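/- **Setting.** A *Richardson quadruple* $R=(\lambda,\mu,k\times(n-k))$ consists of two partitions contained in a $k\times(n-k)$ box such that $\lambda$, placed in the upper left corner, and $\mathrm{rotate}(\mu)$, the rotation of $\mu$ by $180^\circ$ placed in the lower right corner, are disjoint. A row or column of the box is *full* if it is contained in $\lambda\cup\mathrm{rotate}(\mu)$. Deleting a full row (column) from the box, that is, the row (column) of $\lambda$ and the row (column) of $\mu$ that lie in it, is a *row (column) demolition*; the result is again a Richardson quadruple. $R$ is *basic* if it has no full rows and no full columns; a *basic demolition* of $R$ is a basic quadruple obtained from $R$ by successive row and column demolitions. A *filling* of $R$ is a semistandard set-valued tableau $T$ of shape $\mu$ (non-empty finite sets of positive integers in the cells, $\max\le\min$ along rows, $\max<\min$ down columns) such that the word of the tableau of skew shape $\lambda\times\mu$ ($\mu$ directly southwest of $\lambda$, with $\lambda$ filled superstandardly, each cell of row $i$ containing $i$, and $\mu$ filled by $T$), read from right to left and top to bottom with each set in decreasing order, is a reverse lattice word (in every initial string, each $i\ge 1$ occurs at least as often as $i+1$), and such that the content of this tableau, denoted $\mathrm{content}(T)$, is a partition inside the box. The number of *extra letters* of $T$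 is $|T|-|\mu|$, with $|T|$ the sum of the sizes of the sets in $T$. The vertices of $\mathrm{poset}(R)$ are the contents of the fillings, each vertex labelled by all fillings with that content, and $\nu\le\nu'$ iff $\nu\supseteq\nu'$. An isomorphism of such posets is an order isomorphism of the vertices together with a compatible bijection of the labels that keeps the number of extra letters. A pair $\{\lambda,\mu\}$ is a *Stembridge case* if, up to exchanging $\lambda$ and $\mu$: both are rectangles (possibly empty); or $\mu$ is empty or a rectangle with one row or one column ($\lambda$ arbitrary); or $\lambda$ is a rectangle and $\mu$ is a near rectangle (a partition with exactly two part sizes from which a rectangle can be obtained by deleting one row or one column); or $\lambda$ is empty or a rectangle with two rows or two columns and $\mu$ has exactly two part sizes. **Proposition.** Let $R=(\lambda,\mu,k\times(n-k))$ be a Richardson quadruple. 1. (Column demolition) If column $c$ is full and $\widetilde R$ is obtained by demolishing it, then $\mathrm{poset}(\widetilde R)\cong\mathrm{poset}(R)$. 2. (Row demolition) If row $r$ is full and $\widetilde R$ is obtained by demolishing it, then $\mathrm{poset}(\widetilde R)\cong\mathrm{poset}(R)$. 3. If $\widetilde R$ is a basic demolition of $R$, then $\mathrm{poset}(\widetilde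 R)\cong\mathrm{poset}(R)$. 4. Suppose that a basic demolition $(\widetilde\lambda,\widetilde\mu,\widetilde k\times(\widetilde n-\widetilde k))$ of $R$ is a Stembridge case. Let $\kappa$ be any partition inside the $k\times(n-k)$ box that contains the content of at least one filling of $R$. Then there is an involution $I$ on the set of fillings $T$ of $R$ with $\mathrm{content}(T)\subseteq\kappa$ that has exactly one fixed point $M$, where $M$ has no extra letters, and that changes the number of extra letters of every other filling by exactly one. The linear maps which send the generator of the initial $\mathbb C$ to $M$, send $T$ to $I(T)$ if $I(T)$ has one letter more than $T$, and send $T$ to $0$ otherwise, form an exact sequence of vector spaces $$0\to\mathbb C\to\bigoplus_{\substack{T:\ |T|=|\mu|\\ \mathrm{content}(T)\subseteq\kappa}}\mathbb C\to\bigoplus_{\substack{T:\ |T|=|\mu|+1\\ \mathrm{content}(T)\subseteq\kappa}}\mathbb C\to\bigoplus_{\substack{T:\ |T|=|\mu|+2\\ \mathrm{content}(T)\subseteq\kappa}}\mathbb C\to\cdots,$$ and this sequence is a direct sum of exact sequences each of which has exactly two non-zero terms. -/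

import Mathlib

/-! Rows, columns and letters are numbered from `0`: row `i`, column `j` and letter `i` below are
the row `i + 1`, the column `j + 1` and the letter `i + 1` of the usual `1`-based conventions. -/

/-- The increasing enumeration of `ℕ ∖ {r}`. -/
def skipIndex (r i : ℕ) : ℕ := if i < r then i else i + 1

theorem skipIndex_inj {r a b : ℕ} (h : skipIndex r a = skipIndex r b) : a = b := by
  unfold skipIndex at h
  split_ifs at h <;> omega

theorem skipIndex_mono {r a b : ℕ} (h : a ≤ b) : skipIndex r a ≤ skipIndex r b := by
  unfold skipIndex
  split_ifs <;> omega

theorem skipIndex_row_injOn (r : ℕ) (s : Set (ℕ × ℕ)) :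
    Set.InjOn (fun c : ℕ × ℕ => (skipIndex r c.1, c.2)) s := by
  intro x _ y _ h
  exact Prod.ext (skipIndex_inj (Prod.mk.inj h).1) (Prod.mk.inj h).2

theorem skipIndex_col_injOn (r : ℕ) (s : Set (ℕ × ℕ)) :
    Set.InjOn (fun c : ℕ × ℕ => (c.1, skipIndex r c.2)) s := by
  intro x _ y _ h
  exact Prod.ext (Prod.mk.inj h).1 (skipIndex_inj (Prod.mk.inj h).2)

namespace YoungDiagram

/-- Delete row `r` of a partition and close up the gap. -/
noncomputable def removeRow (μ : YoungDiagram) (r : ℕ) : YoungDiagram where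
  cells := μ.cells.preimage (fun c => (skipIndex r c.1, c.2)) (skipIndex_row_injOn r _)
  isLowerSet := by
    rintro ⟨a, b⟩ ⟨c, d⟩ h hm
    rw [Finset.mem_coe, Finset.mem_preimage, mem_cells] at hm ⊢
    exact μ.up_left_mem (skipIndex_mono h.1) h.2 hm

/-- Delete column `s` of a partition and close up the gap. -/
noncomputable def removeCol (μ : YoungDiagram) (s : ℕ) : YoungDiagram where
  cells := μ.cells.preimage (fun c => (c.1, skipIndex s c.2)) (skipIndex_col_injOn s _)
  isLowerSet := by
    rintro ⟨a, b⟩ ⟨c, d⟩ h hm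
    rw [Finset.mem_coe, Finset.mem_preimage, mem_cells] at hm ⊢
    exact μ.up_left_mem h.1 (skipIndex_mono h.2) hm

theorem mem_removeRow {μ : YoungDiagram} {r i j : ℕ} :
    (i, j) ∈ μ.removeRow r ↔ (skipIndex r i, j) ∈ μ := by
  rw [← mem_cells, removeRow, Finset.mem_preimage, mem_cells]

theorem mem_removeCol {μ : YoungDiagram} {s i j : ℕ} :
    (i, j) ∈ μ.removeCol s ↔ (i, skipIndex s j) ∈ μ := by
  rw [← mem_cells, removeCol, Finset.mem_preimage, mem_cells]

/-- `μ` is the rectangle `(c ^ r)`; it is empty when `r = 0` or `c = 0`. -/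
def IsRect (μ : YoungDiagram) (r c : ℕ) : Prop := ∀ i j, (i, j) ∈ μ ↔ i < r ∧ j < c

/-- At most one part size. -/
def IsRectangle (μ : YoungDiagram) : Prop := ∃ r c, μ.IsRect r c

/-- A rectangle with `l` rows or `l` columns (the empty partition is allowed). -/
def IsLineRectangle (l : ℕ) (μ : YoungDiagram) : Prop := ∃ a, μ.IsRect l a ∨ μ.IsRect a l

/-- Exactly two part sizes: `μ = (b ^ r, c ^ s)` with `b > c > 0` and `r, s > 0`. -/
def IsFatHook (μ : YoungDiagram) : Prop :=
  ∃ b r c s, 0 < c ∧ c < b ∧ 0 < r ∧ 0 < s ∧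
    ∀ i j, (i, j) ∈ μ ↔ (i < r ∧ j < b) ∨ (i < r + s ∧ j < c)

/-- A fat hook that becomes a rectangle when one suitable row or column is deleted. -/
def IsNearRectangle (μ : YoungDiagram) : Prop :=
  μ.IsFatHook ∧ ∃ r, (μ.removeRow r).IsRectangle ∨ (μ.removeCol r).IsRectangle

/-- Stembridge's list of pairs, up to exchanging the two partitions. -/
def IsStembridgeOrdered (lam mu : YoungDiagram) : Prop :=
  (lam.IsRectangle ∧ mu.IsRectangle) ∨
  mu.IsLineRectangle 1 ∨
  (lam.IsRectangle ∧ mu.IsNearRectangle) ∨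
  (lam.IsLineRectangle 2 ∧ mu.IsFatHook)

/-- Stembridge's list of pairs of partitions. -/
def IsStembridge (lam mu : YoungDiagram) : Prop :=
  IsStembridgeOrdered lam mu ∨ IsStembridgeOrdered mu lam

end YoungDiagram

/-- A Richardson quadruple `(λ, μ, k × (n - k))`, with `rows = k` and `cols = n - k`: two partitions
that fit in the box, such that `λ` (placed in the upper left corner) and `rotate(μ)` (the rotation
of `μ` by 180 degrees, placed in the lower right corner) are disjoint. -/
@[ext]
structure RichardsonQuadruple where
  lam : YoungDiagram
  mu : YoungDiagram
  rows : ℕ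
  cols : ℕ
  lam_fits : ∀ i j, (i, j) ∈ lam → i < rows ∧ j < cols
  mu_fits : ∀ i j, (i, j) ∈ mu → i < rows ∧ j < cols
  disj : ∀ i j, i < rows → j < cols → (i, j) ∈ lam → (rows - 1 - i, cols - 1 - j) ∉ mu

/-- The cells of `λ ∪ rotate(μ)` inside the box. -/
def RichardsonQuadruple.Covered (R : RichardsonQuadruple) (i j : ℕ) : Prop :=
  (i, j) ∈ R.lam ∨ (R.rows - 1 - i, R.cols - 1 - j) ∈ R.mu

def RichardsonQuadruple.FullRow (R : RichardsonQuadruple) (r : ℕ) : Prop :=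
  r < R.rows ∧ ∀ j < R.cols, R.Covered r j

def RichardsonQuadruple.FullCol (R : RichardsonQuadruple) (c : ℕ) : Prop :=
  c < R.cols ∧ ∀ i < R.rows, R.Covered i c

/-- Row demolition: delete the full row `r` of the box, that is row `r` of `λ` and the row of `μ`
which the rotation places in row `r`. -/
noncomputable def RichardsonQuadruple.demolishRow (R : RichardsonQuadruple) (r : ℕ) (hr : R.FullRow r) :
    RichardsonQuadruple where
  lam := R.lam.removeRow r
  mu := R.mu.removeRow (R.rows - 1 - r)
  rows := R.rows - 1
  cols := R.cols
  lam_fits := by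
    intro i j h
    have hr1 := hr.1
    have h1 := R.lam_fits _ _ (YoungDiagram.mem_removeRow.1 h)
    unfold skipIndex at h1
    split_ifs at h1 <;> omega
  mu_fits := by
    intro i j h
    have hr1 := hr.1
    have h1 := R.mu_fits _ _ (YoungDiagram.mem_removeRow.1 h)
    unfold skipIndex at h1
    split_ifs at h1 <;> omega
  disj := by
    intro i j hi hj h h'
    have hr1 := hr.1
    rw [YoungDiagram.mem_removeRow] at h h'
    have e : skipIndex (R.rows - 1 - r) (R.rows - 1 - 1 - i) = R.rows - 1 - skipIndex r i := by
      unfold skipIndex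
      split_ifs <;> omega
    rw [e] at h'
    exact R.disj _ _ (R.lam_fits _ _ h).1 hj h h'

/-- Column demolition: delete the full column `c` of the box, that is column `c` of `λ` and the
column of `μ` which the rotation places in column `c`. -/
noncomputable def RichardsonQuadruple.demolishCol (R : RichardsonQuadruple) (c : ℕ) (hc : R.FullCol c) :
    RichardsonQuadruple where
  lam := R.lam.removeCol c
  mu := R.mu.removeCol (R.cols - 1 - c)
  rows := R.rows
  cols := R.cols - 1
  lam_fits := by
    intro i j h
    have hc1 := hc.1
    have h1 := R.lam_fits _ _ (YoungDiagram.mem_removeCol.1 h)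
    unfold skipIndex at h1
    split_ifs at h1 <;> omega
  mu_fits := by
    intro i j h
    have hc1 := hc.1
    have h1 := R.mu_fits _ _ (YoungDiagram.mem_removeCol.1 h)
    unfold skipIndex at h1
    split_ifs at h1 <;> omega
  disj := by
    intro i j hi hj h h'
    have hc1 := hc.1
    rw [YoungDiagram.mem_removeCol] at h h'
    have e : skipIndex (R.cols - 1 - c) (R.cols - 1 - 1 - j) = R.cols - 1 - skipIndex c j := by
      unfold skipIndex
      split_ifs <;> omega
    rw [e] at h'
    exact R.disj _ _ hi (R.lam_fits _ _ h).2 h h'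

/-- One row demolition or one column demolition. -/
def RichardsonQuadruple.DemolitionStep (R R' : RichardsonQuadruple) : Prop :=
  (∃ r, ∃ hr : R.FullRow r, R' = R.demolishRow r hr) ∨
  (∃ c, ∃ hc : R.FullCol c, R' = R.demolishCol c hc)

/-- No full rows and no full columns. -/
def RichardsonQuadruple.IsBasic (R : RichardsonQuadruple) : Prop :=
  (∀ r, ¬ R.FullRow r) ∧ ∀ c, ¬ R.FullCol c

/-- `R'` is obtained from `R` by removing all full rows and columns, one after the other. -/
def RichardsonQuadruple.IsBasicDemolition (R R' : RichardsonQuadruple) : Prop :=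
  Relation.ReflTransGen RichardsonQuadruple.DemolitionStep R R' ∧ R'.IsBasic

theorem RichardsonQuadruple.exists_isBasicDemolition (R : RichardsonQuadruple) :
    ∃ R', R.IsBasicDemolition R' := by
  suffices H : ∀ n (R : RichardsonQuadruple), R.rows + R.cols = n →
      ∃ R', R.IsBasicDemolition R' from H _ R rfl
  intro n
  induction n using Nat.strong_induction_on with
  | _ n ih =>
    intro R hn
    by_cases hb : R.IsBasic
    · exact ⟨R, Relation.ReflTransGen.refl, hb⟩
    · have : ∃ R1, R.DemolitionStep R1 ∧ R1.rows + R1.cols < n := by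
        by_cases h1 : ∃ r, R.FullRow r
        · obtain ⟨r, hr⟩ := h1
          have := hr.1
          refine ⟨_, Or.inl ⟨r, hr, rfl⟩, ?_⟩
          simp only [RichardsonQuadruple.demolishRow]
          omega
        · by_cases h2 : ∃ c, R.FullCol c
          · obtain ⟨c, hc⟩ := h2
            have := hc.1
            refine ⟨_, Or.inr ⟨c, hc, rfl⟩, ?_⟩
            simp only [RichardsonQuadruple.demolishCol]
            omega
          · exact absurd ⟨fun r hr => h1 ⟨r, hr⟩, fun c hc => h2 ⟨c, hc⟩⟩ hb
      obtain ⟨R1, hs, hlt⟩ := this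
      obtain ⟨R', hR', hbas⟩ := ih _ hlt R1 rfl
      exact ⟨R', Relation.ReflTransGen.head hs hR', hbas⟩

/-- A semistandard set-valued tableau of shape `μ`: finite non-empty sets of letters in the cells
of `μ`, with `max ≤ min` along rows and `max < min` down columns. -/
@[ext]
structure SetValuedTableau (mu : YoungDiagram) where
  entry : ℕ → ℕ → Finset ℕ
  nonempty_iff : ∀ i j, (entry i j).Nonempty ↔ (i, j) ∈ mu
  row_weak : ∀ i j₁ j₂, j₁ < j₂ → ∀ a ∈ entry i j₁, ∀ b ∈ entry i j₂, a ≤ b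
  col_strict : ∀ i₁ i₂ j, i₁ < i₂ → ∀ a ∈ entry i₁ j, ∀ b ∈ entry i₂ j, a < b

/-- The word of a filling of `mu`: rows from top to bottom, each row from right to left, the letters
of one cell in decreasing order. -/
def readingWord (mu : YoungDiagram) (e : ℕ → ℕ → Finset ℕ) : List ℕ :=
  (List.range (mu.colLen 0)).flatMap fun i =>
    (List.range (mu.rowLen i)).reverse.flatMap fun j => (e i j).sort (· ≥ ·)

/-- The superstandard filling: every cell of row `i` contains the single letter `i`. -/
def superstandardEntry (i _j : ℕ) : Finset ℕ := {i}

/-- In every initial string, each letter occurs at least as often as the next letter. -/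
def IsReverseLatticeWord (w : List ℕ) : Prop :=
  ∀ u, u <+: w → ∀ i, u.count (i + 1) ≤ u.count i

/-- The word of the filling of the skew shape `λ × μ` (`μ` placed directly southwest of `λ`) in which
`λ` is filled superstandardly and `μ` is filled by `T`. -/
def RichardsonQuadruple.word (R : RichardsonQuadruple) (T : SetValuedTableau R.mu) : List ℕ :=
  readingWord R.lam superstandardEntry ++ readingWord R.mu T.entry

/-- The fillings of `μ`: the set-valued tableaux `T` for which the word of the filling of `λ × μ` is
a reverse lattice word and its content is a partition inside the `k × (n - k)` box. -/
def RichardsonQuadruple.Filling (R : RichardsonQuadruple) : Type :=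
  {T : SetValuedTableau R.mu // IsReverseLatticeWord (R.word T) ∧
    ∀ i, (R.word T).count i ≤ R.cols ∧ (R.rows ≤ i → (R.word T).count i = 0)}

/-- The content of the filling of `λ × μ`: the number of occurrences of each letter. -/
def RichardsonQuadruple.content (R : RichardsonQuadruple) (T : R.Filling) : ℕ → ℕ :=
  fun i => (R.word T.1).count i

/-- The number `|T| - |μ|` of extra letters. -/
def RichardsonQuadruple.extra (R : RichardsonQuadruple) (T : R.Filling) : ℕ :=
  (∑ c ∈ R.mu.cells, (T.1.entry c.1 c.2).card) - R.mu.card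

/-- The poset of the quadruple: its vertices are the contents of fillings, and `ν ≤ ν'` if and only
if `ν ⊇ ν'`. -/
abbrev RichardsonQuadruple.Poset (R : RichardsonQuadruple) : Type :=
  (Set.range R.content)ᵒᵈ

/-- The vertex that carries the filling `T` as a label. -/
def RichardsonQuadruple.vertex (R : RichardsonQuadruple) (T : R.Filling) : R.Poset :=
  OrderDual.toDual ⟨R.content T, T, rfl⟩

/-- Isomorphism of the posets of fillings: an order isomorphism of the vertices together with a
compatible bijection of the fillings that label them, which keeps the number of extra letters. -/
def RichardsonQuadruple.PosetIso (R R' : RichardsonQuadruple) : Prop :=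
  ∃ (φ : R.Poset ≃o R'.Poset) (F : R.Filling ≃ R'.Filling),
    ∀ T, φ (R.vertex T) = R'.vertex (F T) ∧ R'.extra (F T) = R.extra T

/-- The fillings whose content is contained in `κ`. -/
def RichardsonQuadruple.Below (R : RichardsonQuadruple) (κ : YoungDiagram) : Type :=
  {T : R.Filling // ∀ i, R.content T i ≤ κ.rowLen i}

/-- Index set of the basis of the `i`-th term of the sequence at `κ`: one vector in degree `0`, and
in degree `i + 1` the fillings with `i` extra letters and content in `κ`. -/
def RichardsonQuadruple.TermIndex (R : RichardsonQuadruple) (κ : YoungDiagram) : ℕ → Type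
  | 0 => Unit
  | i + 1 => {T : R.Below κ // R.extra T.1 = i}

/-- The `i`-th term of the sequence
`0 → ℂ → ⨁_{0 extra letters} ℂ → ⨁_{1 extra letter} ℂ → ⋯` at `κ`. -/
abbrev RichardsonQuadruple.Term (R : RichardsonQuadruple) (κ : YoungDiagram) (i : ℕ) : Type :=
  R.TermIndex κ i →₀ ℂ

/-- The subspaces `W i` form a subsequence of `V 0 → V 1 → ⋯`, and
`0 → W 0 → W 1 → ⋯` is exact. For `W = ⊤` this says that `0 → V 0 → V 1 → ⋯` is exact. -/
def IsExactSubsequence {V : ℕ → Type} [∀ i, AddCommGroup (V i)] [∀ i, Module ℂ (V i)]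
    (f : ∀ i, V i →ₗ[ℂ] V (i + 1)) (W : ∀ i, Submodule ℂ (V i)) : Prop :=
  (∀ i, ∀ x ∈ W i, f i x ∈ W (i + 1)) ∧
  (∀ x ∈ W 0, f 0 x = 0 → x = 0) ∧
  ∀ i, ∀ y ∈ W (i + 1), f (i + 1) y = 0 ↔ ∃ x ∈ W i, f i x = y

/-- The sequence `0 → V 0 → V 1 → ⋯` is the direct sum of exact sequences which have exactly two
non-zero terms each. -/
def IsDirectSumOfTwoTermExact {V : ℕ → Type} [∀ i, AddCommGroup (V i)] [∀ i, Module ℂ (V i)]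
    (f : ∀ i, V i →ₗ[ℂ] V (i + 1)) : Prop :=
  ∃ (ι : Type) (W : ι → ∀ i, Submodule ℂ (V i)),
    (∀ i, iSupIndep (fun a => W a i) ∧ ⨆ a, W a i = ⊤) ∧
    ∀ a, IsExactSubsequence f (W a) ∧ {i | W a i ≠ ⊥}.ncard = 2

open Classical in
/-- The exact sequence at `κ`, constructed from a sign-reversing involution: there is an involution
`I` of the fillings with content in `κ` that has a unique fixed point `M`, where `M` has no extra
letters and `I` changes the number of extra letters of every other filling by exactly one. The maps
that send the generator of `ℂ` to `M`, send `T` to `I T` when `I T` has one letter more than `T`, and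
send all other `T` to `0`, form an exact sequence, and it is a direct sum of exact sequences with
exactly two non-zero terms. -/
def RichardsonQuadruple.HasSequenceAt (R : RichardsonQuadruple) (κ : YoungDiagram) : Prop :=
  ∃ (I : R.Below κ → R.Below κ) (M : R.Below κ) (f : ∀ i, R.Term κ i →ₗ[ℂ] R.Term κ (i + 1)),
    Function.Involutive I ∧
    (∀ T, I T = T ↔ T = M) ∧
    R.extra M.1 = 0 ∧
    (∀ T, T ≠ M → R.extra (I T).1 = R.extra T.1 + 1 ∨ R.extra T.1 = R.extra (I T).1 + 1) ∧
    (∀ T' : R.TermIndex κ 1, f 0 (Finsupp.single () 1) T' = if T'.1 = M then 1 else 0) ∧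
    (∀ i (T : R.TermIndex κ (i + 1)) (T' : R.TermIndex κ (i + 2)),
      f (i + 1) (Finsupp.single T 1) T' = if T'.1 = I T.1 then 1 else 0) ∧
    IsExactSubsequence f (fun _ => ⊤) ∧
    IsDirectSumOfTwoTermExact f

/-- The exact sequence exists at every partition `κ` in the box that contains the content of at
least one filling. -/
def RichardsonQuadruple.HasSequences (R : RichardsonQuadruple) : Prop :=
  ∀ κ : YoungDiagram, (∀ i j, (i, j) ∈ κ → i < R.rows ∧ j < R.cols) →
    Nonempty (R.Below κ) → R.HasSequenceAt κ

section

open Finset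

/-! ### Counting the letters of a tableau row by row and in total. -/

namespace SetValuedTableau

variable {mu : YoungDiagram}

/-! Let c(λ,μ;ν) be the number of fillings of shape μ relative to λ with content ν (`lrCount`). The
box only restricts ν, and the number of extra letters is |ν| − |λ| − |μ|. An isomorphism of posets
therefore only needs a map of contents under which these numbers agree; the bijections between
fillings of corresponding contents may be arbitrary.

Column demolition. If column c of the box is full, the column of μ placed there is the same in every
filling. Let h be the height of column c of λ and k the number of rows. Column strictness and the
bound k on the letters bound the entries of that column from above, the width of the box bounds its
top entry from below, and the two bounds leave only the singletons h, h + 1, …, k − 1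
(`column_forced`). Deleting this column is a bijection of fillings which shortens each of the k rows
of the content by one.

Row demolition is column demolition for the transposed quadruple, once c(λ,μ;ν) = c(λᵗ,μᵗ;νᵗ) is
known (`lrCount_transpose`). This comes from algebra. Let G_μ be the sum of x^weight over all
set-valued tableaux of shape μ, and a_ν the antisymmetrization of ∏ x_b^(ν_b + k − 1 − b) (1 +
x_b)^b, the numerator of the bialternant formula for Grothendieck polynomials. Then G_μ a_λ = ∑
c(λ,μ;ν) a_ν (`gpoly_mul_alternant`): the left side expands into one alternant for each tableau, and
those of the tableaux that violate the lattice condition cancel by Bender–Knuth involutions. Since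
the a_ν are independent, ∑_ν c(λ,μ;ν) c(ν,ρ;τ) is symmetric in μ and ρ, and λ = ∅ gives c(λ,μ;ν) =
c(μ,λ;ν). If μ is a single column, transposition is an explicit bijection between column and row
fillings. For general μ, let μ' be μ without its last column: the product of μ' with that column
contains μ with non-zero coefficient, and all other terms are smaller in a well-founded order, so
the symmetry for μ follows by induction.

Exact sequences. Let P be the sum of X^(extra letters) over the fillings with content in κ. If P = 1
+ (1 + X) Q with Q in ℕ[X], then the fillings can be matched in pairs of adjacent degrees with one
filling left over in degree 0. This is the involution, and the sequence splits into isomorphisms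
between lines. The isomorphisms above transport the truncation at κ, so a basic demolition may be
treated instead. P is unchanged by exchanging λ and μ and by transposing everything. This reduces
Stembridge's list to three families: μ is a row; λ is a rectangle and the rows of μ are equal except
for the last one, or except for those of length at most one; λ has two blocks of equal rows and μ
has two equal rows. In each family, toggling letters that belong to the first rows of λ cancels most
fillings (`exists_blockToggle_sum`), the upper rows of the others are rigid or depend on few
parameters, and the remaining row or column cancels down to its greedy filling (`sum_line`). -/

theorem mem_shape (T : SetValuedTableau mu) {p j l : ℕ} (h : l ∈ T.entry p j) : (p, j) ∈ mu :=
  (T.nonempty_iff p j).1 ⟨l, h⟩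

/-- The number of cells of row `p` which contain the letter `l`. -/
def rowCount (T : SetValuedTableau mu) (p l : ℕ) : ℕ :=
  #{j ∈ range (mu.rowLen p) | l ∈ T.entry p j}

/-- The number of occurrences of `l` above row `p`. -/
def upper (T : SetValuedTableau mu) (p l : ℕ) : ℕ := ∑ q ∈ range p, T.rowCount q l

/-- The number of occurrences of `l`. -/
def weight (T : SetValuedTableau mu) (l : ℕ) : ℕ := #{c ∈ mu.cells | l ∈ T.entry c.1 c.2}

@[simp] theorem upper_zero (T : SetValuedTableau mu) (l : ℕ) : T.upper 0 l = 0 := by simp [upper]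

theorem upper_succ (T : SetValuedTableau mu) (p l : ℕ) :
    T.upper (p + 1) l = T.upper p l + T.rowCount p l := by
  simp [upper, sum_range_succ]

theorem upper_mono (T : SetValuedTableau mu) (l : ℕ) : Monotone fun p => T.upper p l :=
  monotone_nat_of_le_succ fun p => by simp only [T.upper_succ]; omega

theorem upper_eq_card (T : SetValuedTableau mu) (p l : ℕ) :
    T.upper p l = #{c ∈ mu.cells | c.1 < p ∧ l ∈ T.entry c.1 c.2} := by
  induction p with
  | zero => simp
  | succ p ih =>
    have e : {c ∈ mu.cells | c.1 < p + 1 ∧ l ∈ T.entry c.1 c.2} =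
        {c ∈ mu.cells | c.1 < p ∧ l ∈ T.entry c.1 c.2} ∪
          ({j ∈ range (mu.rowLen p) | l ∈ T.entry p j}).image fun j => (p, j) := by
      ext ⟨q, j⟩
      simp only [mem_filter, mem_union, mem_image, mem_range, Prod.mk.injEq,
        YoungDiagram.mem_cells]
      constructor
      · rintro ⟨h1, h2, h3⟩
        rcases Nat.lt_succ_iff_lt_or_eq.1 h2 with h | h
        · exact Or.inl ⟨h1, h, h3⟩
        · subst h
          exact Or.inr ⟨j, ⟨YoungDiagram.mem_iff_lt_rowLen.1 h1, h3⟩, rfl, rfl⟩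
      · rintro (⟨h1, h2, h3⟩ | ⟨a, ⟨h1, h2⟩, rfl, rfl⟩)
        · exact ⟨h1, by omega, h3⟩
        · exact ⟨YoungDiagram.mem_iff_lt_rowLen.2 h1, by omega, h2⟩
    rw [T.upper_succ, ih, e, card_union_of_disjoint,
      card_image_of_injective _ (fun a b h => (Prod.mk.inj h).2), rowCount]
    rw [disjoint_left]
    rintro ⟨q, j⟩ h h'
    simp only [mem_filter, mem_image, Prod.mk.injEq] at h h'
    obtain ⟨_, _, h3, _⟩ := h'
    omega

theorem weight_eq_upper (T : SetValuedTableau mu) {p : ℕ} (hp : mu.colLen 0 ≤ p) (l : ℕ) :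
    T.weight l = T.upper p l := by
  rw [T.upper_eq_card, weight]
  congr 1
  refine filter_congr fun c hc => ?_
  have h0 : (c.1, 0) ∈ mu := mu.up_left_mem le_rfl (Nat.zero_le _) ((mu.mem_cells c).1 hc)
  have := YoungDiagram.mem_iff_lt_colLen.1 h0
  simp only [iff_and_self]
  intro _
  omega

theorem upper_le_weight (T : SetValuedTableau mu) (p l : ℕ) : T.upper p l ≤ T.weight l := by
  rw [T.weight_eq_upper (le_max_left (mu.colLen 0) p)]
  exact T.upper_mono l (le_max_right _ _)

/-- The lattice condition relative to `lam`, in terms of the row counts. -/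
def IsLattice (lam : YoungDiagram) (T : SetValuedTableau mu) : Prop :=
  ∀ p l, lam.rowLen (l + 1) + T.upper (p + 1) (l + 1) ≤ lam.rowLen l + T.upper p l

/-- The content of the filling of `lam × mu` by the superstandard tableau and `T`. -/
def content (lam : YoungDiagram) (T : SetValuedTableau mu) (l : ℕ) : ℕ := lam.rowLen l + T.weight l

/-- The sum of the sizes of the entries. -/
def size (T : SetValuedTableau mu) : ℕ := ∑ c ∈ mu.cells, (T.entry c.1 c.2).card

theorem card_le_size (T : SetValuedTableau mu) : mu.card ≤ T.size := by
  rw [YoungDiagram.card, card_eq_sum_ones]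
  refine sum_le_sum fun c hc => ?_
  exact Finset.card_pos.2 ((T.nonempty_iff c.1 c.2).2 ((mu.mem_cells _).1 hc))

/-- A strict upper bound for the letters. -/
theorem exists_letter_bound (T : SetValuedTableau mu) : ∃ k, ∀ p j, ∀ l ∈ T.entry p j, l < k := by
  refine ⟨(mu.cells.biUnion fun c => T.entry c.1 c.2).sup id + 1, fun p j l hl => ?_⟩
  have : l ∈ mu.cells.biUnion fun c => T.entry c.1 c.2 :=
    mem_biUnion.2 ⟨(p, j), (mu.mem_cells _).2 (T.mem_shape hl), hl⟩
  exact Nat.lt_succ_of_le (le_sup (f := id) this)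

theorem size_eq_sum_weight (T : SetValuedTableau mu) {k : ℕ}
    (hk : ∀ p j, ∀ l ∈ T.entry p j, l < k) : T.size = ∑ l ∈ range k, T.weight l := by
  simp only [size, weight, card_filter]
  rw [sum_comm]
  refine sum_congr rfl fun c _ => ?_
  rw [← card_filter]
  congr 1
  ext l
  simp only [mem_filter, mem_range]
  exact ⟨fun h => ⟨hk _ _ _ h, h⟩, fun h => h.2⟩

theorem weight_eq_zero_iff (T : SetValuedTableau mu) (l : ℕ) :
    T.weight l = 0 ↔ ∀ p j, l ∉ T.entry p j := by
  rw [weight, card_eq_zero, filter_eq_empty_iff]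
  constructor
  · intro h p j hl
    exact h ((mu.mem_cells (p, j)).2 (T.mem_shape hl)) hl
  · intro h c _
    exact h _ _

end SetValuedTableau

/-! ### Words and row counts -/

/-- All prefixes of `u ++ v` that contain `u` satisfy the lattice condition. -/
def LatticeAfter (u v : List ℕ) : Prop :=
  ∀ w, w <+: v → ∀ i, (u ++ w).count (i + 1) ≤ (u ++ w).count i

theorem latticeAfter_append (u v w : List ℕ) :
    LatticeAfter u (v ++ w) ↔ LatticeAfter u v ∧ LatticeAfter (u ++ v) w := by
  constructor
  · intro h
    refine ⟨fun x hx => h x (hx.trans (List.prefix_append _ _)), fun x hx i => ?_⟩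
    rw [List.append_assoc]
    exact h (v ++ x) ((List.prefix_append_right_inj v).2 hx) i
  · rintro ⟨h1, h2⟩ x hx i
    rcases le_total x.length v.length with h | h
    · exact h1 x (List.prefix_of_prefix_length_le hx (List.prefix_append _ _) h) i
    · obtain ⟨y, rfl⟩ := List.prefix_of_prefix_length_le (List.prefix_append v w) hx h
      rw [← List.append_assoc]
      exact h2 y ((List.prefix_append_right_inj v).1 hx) i

/-- All letters `i + 1` of a decreasing word precede all letters `i`. The critical prefix consists
of the letters that are at least `i + 1`; the letters `i` of `v` come too late to help. -/
theorem latticeAfter_of_decreasing {u v : List ℕ} (hv : v.Pairwise (· ≥ ·)) :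
    LatticeAfter u v ↔ (∀ i, u.count (i + 1) ≤ u.count i) ∧
      ∀ i, u.count (i + 1) + v.count (i + 1) ≤ u.count i := by
  constructor
  · intro h
    refine ⟨fun i => by simpa using h [] List.nil_prefix i, fun i => ?_⟩
    have hsplit : v = v.filter (fun x => i + 1 ≤ x) ++ v.filter (fun x => ¬ (i + 1 ≤ x)) := by
      clear h
      induction v with
      | nil => rfl
      | cons a v ih =>
        rw [List.pairwise_cons] at hv
        by_cases ha : i + 1 ≤ a
        · simp only [List.filter_cons, ha, decide_true, if_true, not_true, decide_false,
            Bool.false_eq_true, if_false, List.cons_append]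
          exact congrArg _ (ih hv.2)
        · have h1 : v.filter (fun x => i + 1 ≤ x) = [] := by
            rw [List.filter_eq_nil_iff]
            intro b hb
            have := hv.1 b hb
            simp only [decide_eq_true_eq]
            omega
          have h2 : v.filter (fun x => ¬ (i + 1 ≤ x)) = v := by
            rw [List.filter_eq_self]
            intro b hb
            have := hv.1 b hb
            simp only [decide_eq_true_eq]
            omega
          rw [List.filter_cons_of_neg (by simpa using ha), List.filter_cons_of_pos (by simpa using ha),
            h1, h2]
          rfl
    have h1 := h (v.filter (fun x => i + 1 ≤ x)) ⟨_, hsplit.symm⟩ i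
    rw [List.count_append, List.count_append] at h1
    have h2 : (v.filter (fun x => i + 1 ≤ x)).count (i + 1) = v.count (i + 1) :=
      List.count_filter (by simp)
    have h3 : (v.filter (fun x => i + 1 ≤ x)).count i = 0 :=
      List.count_eq_zero.2 (by simp)
    omega
  · rintro ⟨_, h⟩ w hw i
    have h1 : w.count (i + 1) ≤ v.count (i + 1) := hw.sublist.count_le _
    have := h i
    rw [List.count_append, List.count_append]
    omega

/-- Each row is a decreasing word, so there is only one inequality per row and letter: the letters
`i + 1` up to and including the row against the letters `i` strictly above it. -/
theorem latticeAfter_flatMap_range (u : List ℕ) (r : ℕ → List ℕ)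
    (hr : ∀ p, (r p).Pairwise (· ≥ ·)) (m : ℕ) :
    LatticeAfter u ((List.range m).flatMap r) ↔ (∀ i, u.count (i + 1) ≤ u.count i) ∧
      ∀ p < m, ∀ i, u.count (i + 1) + ∑ q ∈ range (p + 1), (r q).count (i + 1) ≤
        u.count i + ∑ q ∈ range p, (r q).count i := by
  have hcount : ∀ m i, ((List.range m).flatMap r).count i = ∑ q ∈ range m, (r q).count i := by
    intro m i
    induction m with
    | zero => simp
    | succ m ih =>
      rw [List.range_succ, List.flatMap_append, List.count_append, ih, sum_range_succ]
      simp
  induction m with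
  | zero =>
    simp only [List.range_zero, List.flatMap_nil, Nat.not_lt_zero, false_imp_iff, implies_true,
      and_true]
    constructor
    · intro h i
      simpa using h [] List.nil_prefix i
    · intro h w hw i
      rw [List.prefix_nil.1 hw]
      simpa using h i
  | succ m ih =>
    have e : (List.range (m + 1)).flatMap r = (List.range m).flatMap r ++ r m := by
      rw [List.range_succ, List.flatMap_append]
      simp
    rw [e, latticeAfter_append]
    refine (and_congr ih (latticeAfter_of_decreasing (hr m))).trans ?_
    simp only [List.count_append, hcount]
    constructor
    · rintro ⟨⟨h1, h2⟩, h3, h4⟩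
      refine ⟨h1, fun p hp i => ?_⟩
      rcases Nat.lt_succ_iff_lt_or_eq.1 hp with h | rfl
      · exact h2 p h i
      · rw [sum_range_succ, ← add_assoc]
        exact h4 i
    · rintro ⟨h1, h2⟩
      refine ⟨⟨h1, fun p hp => h2 p (by omega)⟩, fun i => ?_, fun i => ?_⟩
      · have := h2 m (by omega) i
        rw [sum_range_succ] at this
        omega
      · have := h2 m (by omega) i
        rw [sum_range_succ, ← add_assoc] at this
        exact this

/-- The word of row `p`. -/
def rowWord (mu : YoungDiagram) (e : ℕ → ℕ → Finset ℕ) (p : ℕ) : List ℕ :=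
  (List.range (mu.rowLen p)).reverse.flatMap fun j => (e p j).sort (· ≥ ·)

theorem count_rowWord (mu : YoungDiagram) (e : ℕ → ℕ → Finset ℕ) (p l : ℕ) :
    (rowWord mu e p).count l = #{j ∈ range (mu.rowLen p) | l ∈ e p j} := by
  rw [rowWord, (List.Perm.flatMap_right _ (List.reverse_perm _)).count_eq]
  generalize mu.rowLen p = n
  induction n with
  | zero => simp
  | succ n ih =>
    rw [List.range_succ, List.flatMap_append, List.count_append, ih, range_add_one, filter_insert]
    split_ifs with h
    · rw [card_insert_of_notMem (by simp)]
      simp [h]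
    · simp [h, List.count_eq_zero]

theorem rowWord_decreasing (mu : YoungDiagram) (e : ℕ → ℕ → Finset ℕ) (p : ℕ)
    (he : ∀ j₁ j₂, j₁ < j₂ → ∀ a ∈ e p j₁, ∀ b ∈ e p j₂, a ≤ b) :
    (rowWord mu e p).Pairwise (· ≥ ·) := by
  rw [rowWord, List.pairwise_flatMap]
  refine ⟨fun j _ => Finset.pairwise_sort _ _, ?_⟩
  rw [List.pairwise_reverse]
  refine List.Pairwise.imp ?_ List.pairwise_lt_range
  intro a b hab x hx y hy
  rw [Finset.mem_sort] at hx hy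
  exact he a b hab y hy x hx

theorem readingWord_eq (mu : YoungDiagram) (e : ℕ → ℕ → Finset ℕ) :
    readingWord mu e = (List.range (mu.colLen 0)).flatMap (rowWord mu e) := rfl

theorem count_readingWord (mu : YoungDiagram) (e : ℕ → ℕ → Finset ℕ) (l : ℕ) :
    (readingWord mu e).count l =
      ∑ p ∈ range (mu.colLen 0), #{j ∈ range (mu.rowLen p) | l ∈ e p j} := by
  rw [readingWord_eq]
  generalize mu.colLen 0 = n
  induction n with
  | zero => simp
  | succ n ih =>
    rw [List.range_succ, List.flatMap_append, List.count_append, ih, sum_range_succ]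
    simp [count_rowWord]

theorem YoungDiagram.rowLen_eq_zero {mu : YoungDiagram} {p : ℕ} (hp : mu.colLen 0 ≤ p) :
    mu.rowLen p = 0 := by
  by_contra h
  have h1 := YoungDiagram.mem_iff_lt_rowLen.2 (Nat.pos_of_ne_zero h)
  have h2 := YoungDiagram.mem_iff_lt_colLen.1 h1
  omega

theorem count_readingWord_superstandard (lam : YoungDiagram) (l : ℕ) :
    (readingWord lam superstandardEntry).count l = lam.rowLen l := by
  rw [count_readingWord]
  have : ∀ p, #{j ∈ range (lam.rowLen p) | l ∈ superstandardEntry p j} =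
      if p = l then lam.rowLen l else 0 := by
    intro p
    simp only [superstandardEntry, mem_singleton]
    split_ifs with h
    · subst h; simp
    · rw [card_eq_zero, filter_eq_empty_iff]
      intro _ _ h'
      exact h h'.symm
  simp only [this]
  rw [sum_ite_eq']
  split_ifs with h
  · rfl
  · rw [YoungDiagram.rowLen_eq_zero]
    simpa using h

theorem latticeAfter_superstandard (lam : YoungDiagram) :
    LatticeAfter [] (readingWord lam superstandardEntry) := by
  rw [readingWord_eq, latticeAfter_flatMap_range]
  · refine ⟨fun i => by simp, fun p hp i => ?_⟩
    have : ∀ q l, (rowWord lam superstandardEntry q).count l = if q = l then lam.rowLen l else 0 := by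
      intro q l
      rw [count_rowWord]
      simp only [superstandardEntry, mem_singleton]
      split_ifs with h
      · subst h; simp
      · rw [card_eq_zero, filter_eq_empty_iff]
        intro _ _ h'
        exact h h'.symm
    simp only [this, sum_ite_eq', mem_range, List.count_nil, zero_add]
    have := lam.rowLen_anti i (i + 1) (by omega)
    split_ifs <;> omega
  · intro p
    refine rowWord_decreasing _ _ _ ?_
    intro j₁ j₂ _ a ha b hb
    simp only [superstandardEntry, mem_singleton] at ha hb
    omega

theorem RichardsonQuadruple.count_word (R : RichardsonQuadruple) (T : SetValuedTableau R.mu)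
    (l : ℕ) : (R.word T).count l = T.content R.lam l := by
  rw [RichardsonQuadruple.word, List.count_append, count_readingWord_superstandard,
    count_readingWord, SetValuedTableau.content, T.weight_eq_upper le_rfl]
  rfl

theorem RichardsonQuadruple.isReverseLatticeWord_iff (R : RichardsonQuadruple)
    (T : SetValuedTableau R.mu) : IsReverseLatticeWord (R.word T) ↔ T.IsLattice R.lam := by
  have h1 : IsReverseLatticeWord (R.word T) ↔ LatticeAfter [] (R.word T) := by
    simp [IsReverseLatticeWord, LatticeAfter]
  rw [h1, RichardsonQuadruple.word, latticeAfter_append, readingWord_eq R.mu,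
    latticeAfter_flatMap_range _ _ (fun p => rowWord_decreasing _ _ _ (T.row_weak p))]
  simp only [List.nil_append, count_readingWord_superstandard, count_rowWord]
  constructor
  · rintro ⟨_, h2, h3⟩ p l
    rcases lt_or_ge p (R.mu.colLen 0) with h | h
    · exact h3 p h l
    -- From the first empty row on `upper` is constant, so the inequality follows from that of the
    -- last row of `mu`, or from `lam` alone if `mu` is empty.
    · have key : ∀ l, T.upper (p + 1) l = T.upper (R.mu.colLen 0) l ∧
          T.upper p l = T.upper (R.mu.colLen 0) l := by
        intro l
        rw [← T.weight_eq_upper h, ← T.weight_eq_upper le_rfl, ← T.weight_eq_upper (by omega)]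
        simp
      rw [(key (l + 1)).1, (key l).2]
      rcases Nat.eq_zero_or_pos (R.mu.colLen 0) with h0 | h0
      · rw [h0]
        simpa using h2 l
      · obtain ⟨m, hm⟩ := Nat.exists_eq_succ_of_ne_zero h0.ne'
        have h4 := h3 m (by omega) l
        have h5 := T.upper_mono l (show m ≤ m + 1 by omega)
        rw [hm]
        exact h4.trans (Nat.add_le_add_left h5 _)
  · intro h
    exact ⟨latticeAfter_superstandard _, fun i => lam_anti R i, fun p _ l => h p l⟩
where
  lam_anti (R : RichardsonQuadruple) (i : ℕ) : R.lam.rowLen (i + 1) ≤ R.lam.rowLen i :=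
    R.lam.rowLen_anti i (i + 1) (by omega)

/-! ### Changing one entry -/

namespace SetValuedTableau

variable {mu : YoungDiagram}

/-- Replace the entry of one cell. -/
def setCell (T : SetValuedTableau mu) (p j : ℕ) (C : Finset ℕ) (hm : (p, j) ∈ mu)
    (hC : C.Nonempty) (hl : ∀ j' < j, ∀ a ∈ T.entry p j', ∀ b ∈ C, a ≤ b)
    (hr : ∀ j', j < j' → ∀ b ∈ C, ∀ a ∈ T.entry p j', b ≤ a)
    (hu : ∀ p' < p, ∀ a ∈ T.entry p' j, ∀ b ∈ C, a < b)
    (hd : ∀ p', p < p' → ∀ b ∈ C, ∀ a ∈ T.entry p' j, b < a) : SetValuedTableau mu where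
  entry q c := if q = p ∧ c = j then C else T.entry q c
  nonempty_iff q c := by
    split_ifs with h
    · obtain ⟨rfl, rfl⟩ := h
      exact iff_of_true hC hm
    · exact T.nonempty_iff q c
  row_weak q c₁ c₂ hc a ha b hb := by
    split_ifs at ha hb with h1 h2 h2
    · omega
    · obtain ⟨rfl, rfl⟩ := h1
      exact hr c₂ hc a ha b hb
    · obtain ⟨rfl, rfl⟩ := h2
      exact hl c₁ hc a ha b hb
    · exact T.row_weak q c₁ c₂ hc a ha b hb
  col_strict q₁ q₂ c hq a ha b hb := by
    split_ifs at ha hb with h1 h2 h2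
    · omega
    · obtain ⟨rfl, rfl⟩ := h1
      exact hd q₂ hq a ha b hb
    · obtain ⟨rfl, rfl⟩ := h2
      exact hu q₁ hq a ha b hb
    · exact T.col_strict q₁ q₂ c hq a ha b hb

section setCell

variable {T : SetValuedTableau mu} {p j : ℕ} {C : Finset ℕ} {hm : (p, j) ∈ mu}
  {hC : C.Nonempty} {hl : ∀ j' < j, ∀ a ∈ T.entry p j', ∀ b ∈ C, a ≤ b}
  {hr : ∀ j', j < j' → ∀ b ∈ C, ∀ a ∈ T.entry p j', b ≤ a}
  {hu : ∀ p' < p, ∀ a ∈ T.entry p' j, ∀ b ∈ C, a < b}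
  {hd : ∀ p', p < p' → ∀ b ∈ C, ∀ a ∈ T.entry p' j, b < a}

theorem setCell_self : (T.setCell p j C hm hC hl hr hu hd).entry p j = C := by
  simp [setCell]

theorem setCell_of_ne {q c : ℕ} (h : ¬ (q = p ∧ c = j)) :
    (T.setCell p j C hm hC hl hr hu hd).entry q c = T.entry q c := by
  simp [setCell, h]

theorem setCell_weight (x : ℕ) :
    (T.setCell p j C hm hC hl hr hu hd).weight x + (if x ∈ T.entry p j then 1 else 0) =
      T.weight x + if x ∈ C then 1 else 0 := by
  have hj : (p, j) ∈ mu.cells := (mu.mem_cells _).2 hm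
  simp only [weight, card_filter]
  rw [← add_sum_erase _ _ hj, ← add_sum_erase _ _ hj, setCell_self]
  have : ∀ i ∈ mu.cells.erase (p, j),
      (if x ∈ (T.setCell p j C hm hC hl hr hu hd).entry i.1 i.2 then 1 else 0) =
        if x ∈ T.entry i.1 i.2 then 1 else 0 := by
    intro i hi
    rw [setCell_of_ne (fun h => (mem_erase.1 hi).1 (Prod.ext h.1 h.2))]
  rw [sum_congr rfl this]
  dsimp only
  omega

end setCell

end SetValuedTableau

/-! ### Bender–Knuth involutions -/

namespace SetValuedTableau

variable {mu : YoungDiagram}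

/-- The cell contains `l` or `l + 1`. -/
def Star (T : SetValuedTableau mu) (l q c : ℕ) : Prop := l ∈ T.entry q c ∨ l + 1 ∈ T.entry q c

/-- A cell left of column `J` which contains `l` or `l + 1` and is the only such cell of its
column. -/
def FreeCell (T : SetValuedTableau mu) (l J q c : ℕ) : Prop :=
  c < J ∧ T.Star l q c ∧ ¬ T.Star l (q + 1) c ∧ ∀ q', q' + 1 = q → ¬ T.Star l q' c

open Classical in
/-- The free cells of row `q`. -/
noncomputable def freeCells (T : SetValuedTableau mu) (l J q : ℕ) : Finset ℕ :=
  {c ∈ range J | T.FreeCell l J q c}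

theorem mem_freeCells {T : SetValuedTableau mu} {l J q c : ℕ} :
    c ∈ T.freeCells l J q ↔ T.FreeCell l J q c := by
  classical
  simp only [freeCells, mem_filter, mem_range, and_iff_right_iff_imp]
  exact fun h => h.1

/-- Reflection of an interval. -/
noncomputable def reflect (s : Finset ℕ) (c : ℕ) : ℕ := sInf (s : Set ℕ) + s.sup id - c

theorem reflect_mem {s : Finset ℕ} (hs : ∀ a ∈ s, ∀ b ∈ s, ∀ c, a ≤ c → c ≤ b → c ∈ s) {c : ℕ}
    (hc : c ∈ s) : reflect s c ∈ s := by
  have h1 : sInf (s : Set ℕ) ∈ s := Nat.sInf_mem (s := (s : Set ℕ)) ⟨c, hc⟩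
  obtain ⟨m, hm, hm'⟩ := exists_mem_eq_sup s ⟨c, hc⟩ id
  have h2 : c ≤ s.sup id := le_sup (f := id) hc
  have h3 : sInf (s : Set ℕ) ≤ c := Nat.sInf_le hc
  rw [hm'] at h2
  refine hs _ h1 m hm _ ?_ ?_ <;> simp only [reflect, hm', id] at * <;> omega

theorem reflect_reflect {s : Finset ℕ} {c : ℕ} (hc : c ∈ s) : reflect s (reflect s c) = c := by
  have h2 : c ≤ s.sup id := le_sup (f := id) hc
  have h3 : sInf (s : Set ℕ) ≤ c := Nat.sInf_le hc
  simp only [reflect]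
  omega

theorem reflect_lt {s : Finset ℕ} {a b : ℕ} (ha : a ∈ s) (hb : b ∈ s) (h : a < b) :
    reflect s b < reflect s a := by
  have h2 : b ≤ s.sup id := le_sup (f := id) hb
  have h3 : sInf (s : Set ℕ) ≤ a := Nat.sInf_le ha
  simp only [reflect]
  omega

theorem star_of_between (T : SetValuedTableau mu) {l q a b c : ℕ} (ha : T.Star l q a)
    (hb : T.Star l q b) (hac : a ≤ c) (hcb : c ≤ b) : T.Star l q c := by
  rcases hac.eq_or_lt with rfl | hac
  · exact ha
  rcases hcb.eq_or_lt with rfl | hcb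
  · exact hb
  obtain ⟨x, hx, hx'⟩ : ∃ x ∈ T.entry q a, l ≤ x := by
    rcases ha with h | h
    exacts [⟨_, h, le_rfl⟩, ⟨_, h, by omega⟩]
  obtain ⟨y, hy, hy'⟩ : ∃ y ∈ T.entry q b, y ≤ l + 1 := by
    rcases hb with h | h
    exacts [⟨_, h, by omega⟩, ⟨_, h, le_rfl⟩]
  obtain ⟨z, hz⟩ := (T.nonempty_iff q c).2
    (mu.up_left_mem le_rfl hcb.le (T.mem_shape hy))
  have h1 := T.row_weak q a c hac x hx z hz
  have h2 := T.row_weak q c b hcb z hz y hy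
  obtain rfl | rfl : z = l ∨ z = l + 1 := by omega
  exacts [Or.inl hz, Or.inr hz]

/-- No integer lies strictly between `l` and `l + 1`, so two starred cells of a column are vertical
neighbours and hold `l` above `l + 1`. -/
theorem star_col (T : SetValuedTableau mu) {l q q' c : ℕ} (h : T.Star l q c) (h' : T.Star l q' c)
    (hq : q < q') : q' = q + 1 ∧ l ∈ T.entry q c ∧ l + 1 ∉ T.entry q c ∧
      l + 1 ∈ T.entry q' c ∧ l ∉ T.entry q' c := by
  have key : ∀ a ∈ T.entry q c, ∀ b ∈ T.entry q' c, a < b := T.col_strict q q' c hq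
  have h1 : l ∈ T.entry q c := by
    rcases h with h | h
    · exact h
    · rcases h' with h' | h'
      · have := key _ h _ h'; omega
      · have := key _ h _ h'; omega
  have h2 : l + 1 ∈ T.entry q' c := by
    rcases h' with h' | h'
    · have := key _ h1 _ h'; omega
    · exact h'
  refine ⟨?_, h1, fun h3 => absurd (key _ h3 _ h2) (by omega), h2,
    fun h3 => absurd (key _ h1 _ h3) (by omega)⟩
  by_contra hne
  obtain ⟨z, hz⟩ := (T.nonempty_iff (q + 1) c).2
    (mu.up_left_mem (show q + 1 ≤ q' by omega) le_rfl (T.mem_shape h2))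
  have h3 := T.col_strict q (q + 1) c (by omega) _ h1 _ hz
  have h4 := T.col_strict (q + 1) q' c (by omega) _ hz _ h2
  omega

/-- Convexity is what allows the free cells of a row to be reflected. If the cell in the middle had
a starred cell below it, monotonicity would force one below the left end; a starred cell above it
would force one above the right end. -/
theorem freeCell_between (T : SetValuedTableau mu) {l J q a b c : ℕ} (ha : T.FreeCell l J q a)
    (hb : T.FreeCell l J q b) (hac : a ≤ c) (hcb : c ≤ b) : T.FreeCell l J q c := by
  have hs := T.star_of_between ha.2.1 hb.2.1 hac hcb
  refine ⟨by have := hb.1; omega, hs, fun h => ?_, fun q' hq' h => ?_⟩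
  · -- below the cell `c` there is a star, hence also below `a`
    obtain ⟨_, h1, _, h2, _⟩ := T.star_col hs h (by omega)
    refine ha.2.2.1 ?_
    rcases hac.eq_or_lt with rfl | hac
    · exact h
    obtain ⟨z, hz⟩ := (T.nonempty_iff (q + 1) a).2
      (mu.up_left_mem le_rfl hac.le (T.mem_shape h2))
    have h3 := T.row_weak (q + 1) a c hac z hz _ h2
    obtain ⟨x, hx, hx'⟩ : ∃ x ∈ T.entry q a, l ≤ x := by
      rcases ha.2.1 with h | h
      exacts [⟨_, h, le_rfl⟩, ⟨_, h, by omega⟩]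
    have h4 := T.col_strict q (q + 1) a (by omega) x hx z hz
    obtain rfl : z = l + 1 := by omega
    exact Or.inr hz
  · subst hq'
    obtain ⟨_, h1, _, h2, _⟩ := T.star_col h hs (by omega)
    refine hb.2.2.2 q' rfl ?_
    rcases hcb.eq_or_lt with rfl | hcb
    · exact h
    obtain ⟨y, hy, hy'⟩ : ∃ y ∈ T.entry (q' + 1) b, y ≤ l + 1 := by
      rcases hb.2.1 with h | h
      exacts [⟨_, h, by omega⟩, ⟨_, h, le_rfl⟩]
    obtain ⟨z, hz⟩ := (T.nonempty_iff q' b).2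
      (mu.up_left_mem (Nat.le_succ _) le_rfl (T.mem_shape hy))
    have h3 := T.row_weak q' c b hcb _ h1 z hz
    have h4 := T.col_strict q' (q' + 1) b (by omega) z hz y hy
    obtain rfl : z = l := by omega
    exact Or.inl hz

theorem reflect_freeCells (T : SetValuedTableau mu) {l J q c : ℕ} (h : T.FreeCell l J q c) :
    T.FreeCell l J q (reflect (T.freeCells l J q) c) := by
  rw [← mem_freeCells] at h ⊢
  refine reflect_mem (fun a ha b hb c hac hcb => ?_) h
  rw [mem_freeCells] at *
  exact T.freeCell_between ha hb hac hcb

open Classical in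
/-- The entries of the Bender–Knuth transform: in every row, the distribution of `l` and `l + 1` on
the free cells is reflected, and `l` and `l + 1` are exchanged. -/
noncomputable def bkEntry (T : SetValuedTableau mu) (l J q c : ℕ) : Finset ℕ :=
  if T.FreeCell l J q c then
    {x ∈ T.entry q c | x ≠ l ∧ x ≠ l + 1} ∪
      ((if l + 1 ∈ T.entry q (reflect (T.freeCells l J q) c) then {l} else ∅) ∪
        (if l ∈ T.entry q (reflect (T.freeCells l J q) c) then {l + 1} else ∅))
  else T.entry q c

theorem mem_bkEntry_of_ne (T : SetValuedTableau mu) {l J q c x : ℕ} (h : x ≠ l) (h' : x ≠ l + 1) :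
    x ∈ T.bkEntry l J q c ↔ x ∈ T.entry q c := by
  classical
  unfold bkEntry
  split_ifs <;> simp [h, h']

theorem mem_bkEntry_left (T : SetValuedTableau mu) {l J q c : ℕ} (h : T.FreeCell l J q c) :
    l ∈ T.bkEntry l J q c ↔ l + 1 ∈ T.entry q (reflect (T.freeCells l J q) c) := by
  classical
  rw [bkEntry, if_pos h]
  split_ifs with h1 h2 <;> simp [h1]

theorem mem_bkEntry_right (T : SetValuedTableau mu) {l J q c : ℕ} (h : T.FreeCell l J q c) :
    l + 1 ∈ T.bkEntry l J q c ↔ l ∈ T.entry q (reflect (T.freeCells l J q) c) := by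
  classical
  rw [bkEntry, if_pos h]
  split_ifs with h1 h2 h2 <;> simp [h2]

theorem bkEntry_of_not_free (T : SetValuedTableau mu) {l J q c : ℕ} (h : ¬ T.FreeCell l J q c) :
    T.bkEntry l J q c = T.entry q c := by
  classical
  rw [bkEntry, if_neg h]

theorem star_bkEntry (T : SetValuedTableau mu) {l J q c : ℕ} :
    (l ∈ T.bkEntry l J q c ∨ l + 1 ∈ T.bkEntry l J q c) ↔ T.Star l q c := by
  by_cases h : T.FreeCell l J q c
  · rw [T.mem_bkEntry_left h, T.mem_bkEntry_right h, or_comm]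
    exact iff_of_true (T.reflect_freeCells h).2.1 h.2.1
  · rw [T.bkEntry_of_not_free h]
    rfl

/-- Changing `l` and `l + 1` in the columns left of `J` does not disturb column `J`. -/
def BKAdmissible (T : SetValuedTableau mu) (l J : ℕ) : Prop :=
  ∀ q c, c + 1 = J → l ∈ T.entry q (c + 1) → ¬ T.Star l q c

/-- Rows can only fail by an `l + 1` to the left of an `l`. Between two free cells the reflection
excludes this. If just one of the cells is free, the other one is paired vertically, and the pairing
would spread along the row to the free cell, or it lies in column `J` or further right, where
`BKAdmissible` applies. -/
theorem bk_row_aux (T : SetValuedTableau mu) {l J : ℕ} (hT : T.BKAdmissible l J) {q c₁ c₂ : ℕ}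
    (hc : c₁ < c₂) (h1 : l + 1 ∈ T.bkEntry l J q c₁) (h2 : l ∈ T.bkEntry l J q c₂) : False := by
  by_cases f1 : T.FreeCell l J q c₁ <;> by_cases f2 : T.FreeCell l J q c₂
  · rw [T.mem_bkEntry_right f1] at h1
    rw [T.mem_bkEntry_left f2] at h2
    have := T.row_weak q _ _ (reflect_lt (mem_freeCells.2 f1) (mem_freeCells.2 f2) hc) _ h2 _ h1
    omega
  · rw [T.bkEntry_of_not_free f2] at h2
    by_cases hJ : c₂ < J
    · have hs : T.Star l q c₂ := Or.inl h2
      by_cases hb : T.Star l (q + 1) c₂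
      · obtain ⟨_, _, _, h3, _⟩ := T.star_col hs hb (by omega)
        refine f1.2.2.1 ?_
        obtain ⟨z, hz⟩ := (T.nonempty_iff (q + 1) c₁).2
          (mu.up_left_mem le_rfl hc.le (T.mem_shape h3))
        have h4 := T.row_weak (q + 1) c₁ c₂ hc z hz _ h3
        obtain ⟨x, hx, hx'⟩ : ∃ x ∈ T.entry q c₁, l ≤ x := by
          rcases f1.2.1 with h | h
          exacts [⟨_, h, le_rfl⟩, ⟨_, h, by omega⟩]
        have h5 := T.col_strict q (q + 1) c₁ (by omega) x hx z hz
        obtain rfl : z = l + 1 := by omega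
        exact Or.inr hz
      · refine f2 ⟨hJ, hs, hb, fun q' hq' h => ?_⟩
        obtain ⟨_, _, _, _, h3⟩ := T.star_col h hs (by omega)
        exact h3 h2
    · obtain ⟨J, rfl⟩ := Nat.exists_eq_succ_of_ne_zero (show J ≠ 0 by have := f1.1; omega)
      have hs2 : T.Star l q c₂ := Or.inl h2
      have f1' := f1.1
      have s1 := T.star_of_between f1.2.1 hs2 (show c₁ ≤ J by omega) (by omega)
      have s2 := T.star_of_between f1.2.1 hs2 (show c₁ ≤ J + 1 by omega) (by omega)
      refine hT q J rfl ?_ s1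
      rcases s2 with s2 | s2
      · exact s2
      · rcases (show J + 1 ≤ c₂ by omega).eq_or_lt with h | h
        · rwa [h]
        · have := T.row_weak q _ _ h _ s2 _ h2
          omega
  · rw [T.bkEntry_of_not_free f1] at h1
    have hs : T.Star l q c₁ := Or.inr h1
    refine f1 ⟨hc.trans f2.1, hs, fun h => ?_, fun q' hq' h => ?_⟩
    · exact (T.star_col hs h (by omega)).2.2.1 h1
    · subst hq'
      obtain ⟨_, h3, _, _, _⟩ := T.star_col h hs (by omega)
      refine f2.2.2.2 q' rfl ?_
      obtain ⟨y, hy, hy'⟩ : ∃ y ∈ T.entry (q' + 1) c₂, y ≤ l + 1 := by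
        rcases f2.2.1 with h | h
        exacts [⟨_, h, by omega⟩, ⟨_, h, le_rfl⟩]
      obtain ⟨z, hz⟩ := (T.nonempty_iff q' c₂).2
        (mu.up_left_mem (Nat.le_succ _) le_rfl (T.mem_shape hy))
      have h4 := T.row_weak q' c₁ c₂ hc _ h3 z hz
      have h5 := T.col_strict q' (q' + 1) c₂ (by omega) z hz y hy
      obtain rfl : z = l := by omega
      exact Or.inl hz
  · rw [T.bkEntry_of_not_free f1] at h1
    rw [T.bkEntry_of_not_free f2] at h2
    have := T.row_weak q _ _ hc _ h1 _ h2
    omega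

theorem exists_star_of_mem_bkEntry (T : SetValuedTableau mu) {l J q c x : ℕ}
    (hx : x ∈ T.bkEntry l J q c) (h : x = l ∨ x = l + 1) :
    ∃ y ∈ T.entry q c, y = l ∨ y = l + 1 := by
  have : T.Star l q c := T.star_bkEntry.1 (by rcases h with rfl | rfl; exacts [Or.inl hx, Or.inr hx])
  rcases this with h | h
  exacts [⟨_, h, Or.inl rfl⟩, ⟨_, h, Or.inr rfl⟩]

/-- The Bender–Knuth transform on the columns left of `J`. -/
noncomputable def bk (T : SetValuedTableau mu) (l J : ℕ) (hT : T.BKAdmissible l J) :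
    SetValuedTableau mu where
  entry := T.bkEntry l J
  nonempty_iff q c := by
    rw [← T.nonempty_iff]
    constructor
    · rintro ⟨x, hx⟩
      by_cases h : x = l ∨ x = l + 1
      · obtain ⟨y, hy, _⟩ := T.exists_star_of_mem_bkEntry hx h
        exact ⟨y, hy⟩
      · push Not at h
        exact ⟨x, (T.mem_bkEntry_of_ne h.1 h.2).1 hx⟩
    · rintro ⟨x, hx⟩
      by_cases h : x = l ∨ x = l + 1
      · have hs : T.Star l q c := by rcases h with rfl | rfl; exacts [Or.inl hx, Or.inr hx]
        rcases (T.star_bkEntry (J := J)).2 hs with h | h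
        exacts [⟨_, h⟩, ⟨_, h⟩]
      · push Not at h
        exact ⟨x, (T.mem_bkEntry_of_ne h.1 h.2).2 hx⟩
  row_weak q c₁ c₂ hc a ha b hb := by
    by_cases h1 : a = l ∨ a = l + 1 <;> by_cases h2 : b = l ∨ b = l + 1
    · rcases h1 with rfl | rfl <;> rcases h2 with rfl | rfl <;> try omega
      exact (T.bk_row_aux hT hc ha hb).elim
    · obtain ⟨y, hy, hy'⟩ := T.exists_star_of_mem_bkEntry ha h1
      push Not at h2
      have := T.row_weak q _ _ hc y hy b ((T.mem_bkEntry_of_ne h2.1 h2.2).1 hb)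
      omega
    · obtain ⟨y, hy, hy'⟩ := T.exists_star_of_mem_bkEntry hb h2
      push Not at h1
      have := T.row_weak q _ _ hc a ((T.mem_bkEntry_of_ne h1.1 h1.2).1 ha) y hy
      omega
    · push Not at h1 h2
      exact T.row_weak q _ _ hc a ((T.mem_bkEntry_of_ne h1.1 h1.2).1 ha) b
        ((T.mem_bkEntry_of_ne h2.1 h2.2).1 hb)
  col_strict q₁ q₂ c hq a ha b hb := by
    by_cases h1 : a = l ∨ a = l + 1 <;> by_cases h2 : b = l ∨ b = l + 1
    · have s1 : T.Star l q₁ c :=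
        T.star_bkEntry.1 (by rcases h1 with rfl | rfl; exacts [Or.inl ha, Or.inr ha])
      have s2 : T.Star l q₂ c :=
        T.star_bkEntry.1 (by rcases h2 with rfl | rfl; exacts [Or.inl hb, Or.inr hb])
      obtain ⟨rfl, _⟩ := T.star_col s1 s2 hq
      rw [T.bkEntry_of_not_free fun h => h.2.2.1 s2] at ha
      rw [T.bkEntry_of_not_free fun h => h.2.2.2 q₁ rfl s1] at hb
      exact T.col_strict _ _ c hq a ha b hb
    · obtain ⟨y, hy, hy'⟩ := T.exists_star_of_mem_bkEntry ha h1
      push Not at h2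
      have := T.col_strict _ _ _ hq y hy b ((T.mem_bkEntry_of_ne h2.1 h2.2).1 hb)
      omega
    · obtain ⟨y, hy, hy'⟩ := T.exists_star_of_mem_bkEntry hb h2
      push Not at h1
      have := T.col_strict _ _ _ hq a ((T.mem_bkEntry_of_ne h1.1 h1.2).1 ha) y hy
      omega
    · push Not at h1 h2
      exact T.col_strict _ _ _ hq a ((T.mem_bkEntry_of_ne h1.1 h1.2).1 ha) b
        ((T.mem_bkEntry_of_ne h2.1 h2.2).1 hb)

variable {T : SetValuedTableau mu} {l J : ℕ} (hT : T.BKAdmissible l J)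

theorem star_bk (q c : ℕ) : (T.bk l J hT).Star l q c ↔ T.Star l q c := T.star_bkEntry

theorem freeCell_bk (q c : ℕ) : (T.bk l J hT).FreeCell l J q c ↔ T.FreeCell l J q c := by
  simp only [FreeCell, star_bk]

theorem freeCells_bk (q : ℕ) : (T.bk l J hT).freeCells l J q = T.freeCells l J q := by
  ext c
  rw [mem_freeCells, mem_freeCells, freeCell_bk]

theorem bk_entry_of_le {q c : ℕ} (hc : J ≤ c) : (T.bk l J hT).entry q c = T.entry q c :=
  T.bkEntry_of_not_free fun h => absurd h.1 (by omega)

theorem mem_bk_of_ne {q c x : ℕ} (h : x ≠ l) (h' : x ≠ l + 1) :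
    x ∈ (T.bk l J hT).entry q c ↔ x ∈ T.entry q c := T.mem_bkEntry_of_ne h h'

theorem bkAdmissible_bk : (T.bk l J hT).BKAdmissible l J := by
  intro q c hc h
  rw [star_bk]
  rw [bk_entry_of_le hT hc.ge] at h
  exact hT q c hc h

theorem bk_bk : (T.bk l J hT).bk l J (bkAdmissible_bk hT) = T := by
  ext q c x
  by_cases h : x = l ∨ x = l + 1
  · change x ∈ (T.bk l J hT).bkEntry l J q c ↔ _
    by_cases f : T.FreeCell l J q c
    · have f' := (freeCell_bk hT q c).2 f
      have g := T.reflect_freeCells f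
      rcases h with rfl | rfl
      · rw [mem_bkEntry_left _ f', freeCells_bk]
        exact (T.mem_bkEntry_right g).trans (by rw [reflect_reflect (mem_freeCells.2 f)])
      · rw [mem_bkEntry_right _ f', freeCells_bk]
        exact (T.mem_bkEntry_left g).trans (by rw [reflect_reflect (mem_freeCells.2 f)])
    · rw [bkEntry_of_not_free _ (fun h => f ((freeCell_bk hT q c).1 h))]
      exact Eq.to_iff (congrArg (x ∈ ·) (T.bkEntry_of_not_free f))
  · push Not at h
    rw [mem_bk_of_ne _ h.1 h.2, mem_bk_of_ne _ h.1 h.2]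

/-- The number of occurrences of `l` in the columns from `j` on. -/
def rightCount (T : SetValuedTableau mu) (j l : ℕ) : ℕ :=
  #{c ∈ mu.cells | j ≤ c.2 ∧ l ∈ T.entry c.1 c.2}

/-- The number of occurrences of `l` in the columns left of `j`. -/
def leftCount (T : SetValuedTableau mu) (j l : ℕ) : ℕ :=
  #{c ∈ mu.cells | c.2 < j ∧ l ∈ T.entry c.1 c.2}

theorem leftCount_add_rightCount (T : SetValuedTableau mu) (j l : ℕ) :
    T.leftCount j l + T.rightCount j l = T.weight l := by
  rw [leftCount, rightCount, weight, ← card_union_of_disjoint]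
  · congr 1
    ext c
    simp only [mem_union, mem_filter]
    constructor
    · rintro (h | h) <;> exact ⟨h.1, h.2.2⟩
    · rintro ⟨h1, h2⟩
      rcases lt_or_ge c.2 j with h | h
      exacts [Or.inl ⟨h1, h, h2⟩, Or.inr ⟨h1, h, h2⟩]
  · rw [disjoint_left]
    intro c h h'
    simp only [mem_filter] at h h'
    omega

/-- An injection from the letters `l` of the transform to the letters `l + 1` of `T`: a free cell
goes to its reflection, any other cell with `l` to the cell directly below, which contains `l + 1`.
The reverse inequality inverts this map. -/
theorem leftCount_bk_le (hT : T.BKAdmissible l J) :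
    (T.bk l J hT).leftCount J l ≤ T.leftCount J (l + 1) := by
  classical
  refine card_le_card_of_injOn
    (fun c => if T.FreeCell l J c.1 c.2 then (c.1, reflect (T.freeCells l J c.1) c.2)
      else (c.1 + 1, c.2)) ?_ ?_
  · rintro ⟨q, c⟩ h
    simp only [coe_filter, Set.mem_ofPred_eq, YoungDiagram.mem_cells] at h ⊢
    obtain ⟨h1, h2, h3⟩ := h
    by_cases f : T.FreeCell l J q c
    · rw [if_pos f]
      have g := (T.mem_bkEntry_left f).1 h3
      exact ⟨T.mem_shape g, (T.reflect_freeCells f).1, g⟩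
    · rw [if_neg f]
      rw [show (T.bk l J hT).entry q c = T.entry q c from T.bkEntry_of_not_free f] at h3
      have hs : T.Star l q c := Or.inl h3
      by_cases hb : T.Star l (q + 1) c
      · obtain ⟨_, _, _, h4, _⟩ := T.star_col hs hb (by omega)
        exact ⟨T.mem_shape h4, h2, h4⟩
      · refine (f ⟨h2, hs, hb, fun q' hq' h => ?_⟩).elim
        exact (T.star_col h hs (by omega)).2.2.2.2 h3
  · rintro ⟨q, c⟩ h ⟨q', c'⟩ h' e
    simp only [coe_filter, Set.mem_ofPred_eq, YoungDiagram.mem_cells] at h h' e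
    have key : ∀ q c, ¬ T.FreeCell l J q c → c < J → l ∈ (T.bk l J hT).entry q c →
        T.Star l q c := by
      intro q c f _ h3
      exact (star_bk hT q c).1 (Or.inl h3)
    by_cases f : T.FreeCell l J q c <;> by_cases f' : T.FreeCell l J q' c'
    · rw [if_pos f, if_pos f', Prod.mk.injEq] at e
      obtain ⟨rfl, e⟩ := e
      rw [← reflect_reflect (mem_freeCells.2 f), e, reflect_reflect (mem_freeCells.2 f')]
    · rw [if_pos f, if_neg f', Prod.mk.injEq] at e
      exact ((T.reflect_freeCells f).2.2.2 q' e.1.symm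
        (e.2 ▸ key _ _ f' h'.2.1 h'.2.2)).elim
    · rw [if_neg f, if_pos f', Prod.mk.injEq] at e
      exact ((T.reflect_freeCells f').2.2.2 q e.1
        (e.2 ▸ key _ _ f h.2.1 h.2.2)).elim
    · rw [if_neg f, if_neg f', Prod.mk.injEq] at e
      exact Prod.ext (by simpa using e.1) e.2

theorem leftCount_le_bk (hT : T.BKAdmissible l J) :
    T.leftCount J (l + 1) ≤ (T.bk l J hT).leftCount J l := by
  classical
  refine card_le_card_of_injOn
    (fun c => if T.FreeCell l J c.1 c.2 then (c.1, reflect (T.freeCells l J c.1) c.2)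
      else (c.1 - 1, c.2)) ?_ ?_
  · rintro ⟨q, c⟩ h
    simp only [coe_filter, Set.mem_ofPred_eq, YoungDiagram.mem_cells] at h ⊢
    obtain ⟨h1, h2, h3⟩ := h
    by_cases f : T.FreeCell l J q c
    · rw [if_pos f]
      have g : l ∈ (T.bk l J hT).entry q (reflect (T.freeCells l J q) c) := by
        refine (T.mem_bkEntry_left (T.reflect_freeCells f)).2 ?_
        rwa [reflect_reflect (mem_freeCells.2 f)]
      exact ⟨mem_shape _ g, (T.reflect_freeCells f).1, g⟩
    · rw [if_neg f]
      have hs : T.Star l q c := Or.inr h3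
      by_cases hb : ∃ q', q' + 1 = q ∧ T.Star l q' c
      · obtain ⟨q', rfl, hb⟩ := hb
        obtain ⟨_, h4, _, _, _⟩ := T.star_col hb hs (by omega)
        have g : l ∈ (T.bk l J hT).entry q' c := by
          rw [show (T.bk l J hT).entry q' c = T.entry q' c from
            T.bkEntry_of_not_free fun h => h.2.2.1 hs]
          exact h4
        exact ⟨mem_shape _ g, h2, g⟩
      · refine (f ⟨h2, hs, fun h => ?_, fun q' hq' h => hb ⟨q', hq', h⟩⟩).elim
        exact (T.star_col hs h (by omega)).2.2.1 h3
  · rintro ⟨q, c⟩ h ⟨q', c'⟩ h' e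
    simp only [coe_filter, Set.mem_ofPred_eq, YoungDiagram.mem_cells] at h h' e
    have key : ∀ q c, ¬ T.FreeCell l J q c → c < J → l + 1 ∈ T.entry q c →
        ∃ q', q = q' + 1 ∧ T.Star l q' c ∧ T.Star l (q' + 1) c := by
      intro q c f h2 h3
      have hs : T.Star l q c := Or.inr h3
      by_contra hb
      refine f ⟨h2, hs, fun h => (T.star_col hs h (by omega)).2.2.1 h3, fun q' hq' h => ?_⟩
      subst hq'
      exact hb ⟨q', rfl, h, hs⟩
    by_cases f : T.FreeCell l J q c <;> by_cases f' : T.FreeCell l J q' c'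
    · rw [if_pos f, if_pos f', Prod.mk.injEq] at e
      obtain ⟨rfl, e⟩ := e
      rw [← reflect_reflect (mem_freeCells.2 f), e, reflect_reflect (mem_freeCells.2 f')]
    · rw [if_pos f, if_neg f', Prod.mk.injEq] at e
      obtain ⟨q'', rfl, _, h4⟩ := key _ _ f' h'.2.1 h'.2.2
      obtain ⟨rfl, e⟩ := e
      exact ((T.reflect_freeCells f).2.2.1 (e ▸ h4)).elim
    · rw [if_neg f, if_pos f', Prod.mk.injEq] at e
      obtain ⟨q'', rfl, _, h4⟩ := key _ _ f h.2.1 h.2.2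
      obtain ⟨rfl, e⟩ := e
      exact ((T.reflect_freeCells f').2.2.1 (e ▸ h4)).elim
    · rw [if_neg f, if_neg f', Prod.mk.injEq] at e
      obtain ⟨q1, rfl, _, _⟩ := key _ _ f h.2.1 h.2.2
      obtain ⟨q2, rfl, _, _⟩ := key _ _ f' h'.2.1 h'.2.2
      exact Prod.ext (by simpa using e.1) e.2

theorem leftCount_bk_left : (T.bk l J hT).leftCount J l = T.leftCount J (l + 1) :=
  (leftCount_bk_le hT).antisymm (leftCount_le_bk hT)

theorem leftCount_bk_right : (T.bk l J hT).leftCount J (l + 1) = T.leftCount J l := by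
  have := leftCount_bk_left (bkAdmissible_bk hT)
  rw [bk_bk] at this
  exact this.symm

theorem rightCount_bk {j x : ℕ} (hj : J ≤ j) :
    (T.bk l J hT).rightCount j x = T.rightCount j x := by
  rw [rightCount, rightCount]
  congr 1
  refine filter_congr fun c _ => and_congr_right fun h => ?_
  rw [bk_entry_of_le hT (hj.trans h)]

theorem weight_bk_of_ne {x : ℕ} (h : x ≠ l) (h' : x ≠ l + 1) :
    (T.bk l J hT).weight x = T.weight x := by
  simp only [weight, mem_bk_of_ne hT h h']

end SetValuedTableau

/-! ### The lattice condition in terms of columns -/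

namespace SetValuedTableau

variable {mu : YoungDiagram}

/-- The column condition at column `j` and letter `l` is violated. -/
def Violation (lam : YoungDiagram) (T : SetValuedTableau mu) (j l : ℕ) : Prop :=
  (∃ p, l + 1 ∈ T.entry p j) ∧
    lam.rowLen l + T.rightCount (j + 1) l ≤ lam.rowLen (l + 1) + T.rightCount (j + 1) (l + 1) ∧
    ¬ ∃ p q, p < q ∧ l ∈ T.entry p j ∧ l + 1 ∈ T.entry q j

theorem col_unique (T : SetValuedTableau mu) {p q j l : ℕ} (h : l ∈ T.entry p j)
    (h' : l ∈ T.entry q j) : p = q := by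
  rcases lt_trichotomy p q with hpq | hpq | hpq
  · exact absurd (T.col_strict _ _ _ hpq _ h _ h') (lt_irrefl _)
  · exact hpq
  · exact absurd (T.col_strict _ _ _ hpq _ h' _ h) (lt_irrefl _)

theorem rightCount_of_mem (T : SetValuedTableau mu) {p j l : ℕ} (h : l ∈ T.entry p j) :
    T.rightCount j l = T.rightCount (j + 1) l + 1 := by
  rw [rightCount, rightCount, ← card_insert_of_notMem (a := (p, j))]
  · congr 1
    ext ⟨q, c⟩
    simp only [mem_filter, mem_insert, Prod.mk.injEq, YoungDiagram.mem_cells]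
    constructor
    · rintro ⟨h1, h2, h3⟩
      rcases h2.eq_or_lt with rfl | h2
      · exact Or.inl ⟨T.col_unique h3 h, rfl⟩
      · exact Or.inr ⟨h1, h2, h3⟩
    · rintro (⟨rfl, rfl⟩ | ⟨h1, h2, h3⟩)
      · exact ⟨T.mem_shape h, le_rfl, h⟩
      · exact ⟨h1, by omega, h3⟩
  · simp

theorem rightCount_of_forall_notMem (T : SetValuedTableau mu) {j l : ℕ}
    (h : ∀ p, l ∉ T.entry p j) : T.rightCount j l = T.rightCount (j + 1) l := by
  rw [rightCount, rightCount]
  congr 1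
  refine filter_congr ?_
  rintro ⟨q, c⟩ _
  constructor
  · rintro ⟨h2, h3⟩
    rcases h2.eq_or_lt with rfl | h2
    · exact (h _ h3).elim
    · exact ⟨h2, h3⟩
  · rintro ⟨h2, h3⟩
    exact ⟨by simp only at *; omega, h3⟩

theorem rightCount_eq_zero (T : SetValuedTableau mu) {j : ℕ} (hj : mu.rowLen 0 ≤ j) (l : ℕ) :
    T.rightCount j l = 0 := by
  rw [rightCount, card_eq_zero, filter_eq_empty_iff]
  rintro ⟨q, c⟩ hc ⟨h1, _⟩
  have h2 : (0, c) ∈ mu := mu.up_left_mem (Nat.zero_le _) le_rfl ((mu.mem_cells _).1 hc)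
  have := YoungDiagram.mem_iff_lt_rowLen.1 h2
  simp only at h1
  omega

theorem rightCount_succ_le (T : SetValuedTableau mu) (j l : ℕ) :
    T.rightCount (j + 1) l ≤ T.rightCount j l ∧ T.rightCount j l ≤ T.rightCount (j + 1) l + 1 := by
  by_cases h : ∃ p, l ∈ T.entry p j
  · obtain ⟨p, h⟩ := h
    rw [T.rightCount_of_mem h]
    omega
  · push Not at h
    rw [T.rightCount_of_forall_notMem h]
    omega

/-- Columns are added from right to left, and each contains every letter at most once. The margin
shrinks only if the column has `l + 1` without `l`; without a violation it was then positive. -/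
theorem partition_of_no_violation (lam : YoungDiagram) (T : SetValuedTableau mu) (j l : ℕ)
    (h : ∀ j' ≥ j, ¬ T.Violation lam j' l) :
    lam.rowLen (l + 1) + T.rightCount j (l + 1) ≤ lam.rowLen l + T.rightCount j l := by
  rcases le_total (mu.rowLen 0) j with hj | hj
  · rw [T.rightCount_eq_zero hj, T.rightCount_eq_zero hj]
    exact Nat.add_le_add_right (lam.rowLen_anti _ _ (Nat.le_succ _)) 0
  · induction hj using Nat.decreasingInduction with
    | self =>
      rw [T.rightCount_eq_zero le_rfl, T.rightCount_eq_zero le_rfl]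
      exact Nat.add_le_add_right (lam.rowLen_anti _ _ (Nat.le_succ _)) 0
    | of_succ j hj ih =>
      have ih := ih fun j' hj' => h j' (by omega)
      have h1 := T.rightCount_succ_le j l
      by_cases hl : ∃ p, l + 1 ∈ T.entry p j
      · have hv := h j le_rfl
        rw [Violation] at hv
        push Not at hv
        obtain ⟨p, hp⟩ := hl
        rw [T.rightCount_of_mem hp]
        by_cases h2 : lam.rowLen l + T.rightCount (j + 1) l ≤
            lam.rowLen (l + 1) + T.rightCount (j + 1) (l + 1)
        · obtain ⟨q, _, _, hq, _⟩ := hv ⟨p, hp⟩ h2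
          rw [T.rightCount_of_mem hq]
          omega
        · omega
      · push Not at hl
        rw [T.rightCount_of_forall_notMem hl]
        omega

theorem row_leftmost (T : SetValuedTableau mu) {p j l : ℕ} (h : l ∈ T.entry p j) :
    ∃ j₀ ≤ j, l ∈ T.entry p j₀ ∧ ∀ c < j₀, l ∉ T.entry p c := by
  classical
  have : ∃ j, l ∈ T.entry p j := ⟨j, h⟩
  exact ⟨Nat.find this, Nat.find_min' this h, Nat.find_spec this, fun c hc => Nat.find_min this hc⟩

theorem mem_row_between (T : SetValuedTableau mu) {p a b c l : ℕ} (ha : l ∈ T.entry p a)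
    (hb : l ∈ T.entry p b) (hac : a ≤ c) (hcb : c ≤ b) : l ∈ T.entry p c := by
  rcases hac.eq_or_lt with rfl | hac
  · exact ha
  rcases hcb.eq_or_lt with rfl | hcb
  · exact hb
  obtain ⟨z, hz⟩ := (T.nonempty_iff p c).2 (mu.up_left_mem le_rfl hcb.le (T.mem_shape hb))
  have h1 := T.row_weak p a c hac _ ha z hz
  have h2 := T.row_weak p c b hcb z hz _ hb
  obtain rfl : z = l := by omega
  exact hz

theorem entry_le_of_mem (T : SetValuedTableau mu) {p q c d a b : ℕ} (ha : a ∈ T.entry p c)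
    (hb : b ∈ T.entry q d) (hpq : p < q) (hcd : c ≤ d) : a < b := by
  obtain ⟨z, hz⟩ := (T.nonempty_iff p d).2 (mu.up_left_mem hpq.le le_rfl (T.mem_shape hb))
  have h2 := T.col_strict p q d hpq z hz b hb
  rcases hcd.eq_or_lt with rfl | hcd
  · exact T.col_strict p q c hpq a ha b hb
  · have h1 := T.row_weak p c d hcd a ha z hz
    omega

/-- The occurrences of `l` in the columns from `j` on which precede the cell `(p, j)`. -/
theorem not_violation_of_isLattice {lam : YoungDiagram} {T : SetValuedTableau mu}
    (hT : T.IsLattice lam) (j l : ℕ) : ¬ T.Violation lam j l := by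
  rintro ⟨⟨p, hp⟩, h1, h2⟩
  -- The lattice condition is used in row `p`. The letters `l + 1` of this row in the columns `j₀,
  -- …, j - 1` are also counted by it; they are offset by the letters `l` above row `p`, at most one
  -- in each of these columns.
  obtain ⟨j₀, hj₀, hp₀, hmin⟩ := T.row_leftmost hp
  have h3 := hT p l
  rw [T.upper_eq_card, T.upper_eq_card] at h3
  -- occurrences of `l + 1`
  have e1 : T.rightCount (j + 1) (l + 1) + 1 + (j - j₀) ≤
      #{c ∈ mu.cells | c.1 < p + 1 ∧ l + 1 ∈ T.entry c.1 c.2} := by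
    rw [← T.rightCount_of_mem hp, rightCount,
      show j - j₀ = #((Ico j₀ j).image fun c => (p, c)) by
        rw [card_image_of_injective _ fun a b h => (Prod.mk.inj h).2, Nat.card_Ico],
      ← card_union_of_disjoint]
    · refine card_le_card ?_
      rintro ⟨q, c⟩ h
      simp only [mem_union, mem_filter, mem_image, mem_Ico, Prod.mk.injEq,
        YoungDiagram.mem_cells] at h ⊢
      rcases h with ⟨h4, h5, h6⟩ | ⟨a, ⟨h4, h5⟩, rfl, rfl⟩
      · refine ⟨h4, ?_, h6⟩
        by_contra hq
        exact absurd (T.entry_le_of_mem hp h6 (by omega) h5) (lt_irrefl _)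
      · have := T.mem_row_between hp₀ hp h4 h5.le
        exact ⟨T.mem_shape this, by omega, this⟩
    · rw [disjoint_left]
      rintro ⟨q, c⟩ h h'
      simp only [mem_filter, mem_image, mem_Ico, Prod.mk.injEq] at h h'
      obtain ⟨a, h4, _, rfl⟩ := h'
      omega
  -- occurrences of `l`
  have e2 : #{c ∈ mu.cells | c.1 < p ∧ l ∈ T.entry c.1 c.2} ≤
      T.rightCount (j + 1) l + (j - j₀) := by
    rw [rightCount, ← Nat.card_Ico, ← card_disjSum]
    refine card_le_card_of_injOn
      (fun c => if j + 1 ≤ c.2 then Sum.inl c else Sum.inr c.2) ?_ ?_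
    · rintro ⟨q, c⟩ h
      simp only [coe_filter, Set.mem_ofPred_eq, YoungDiagram.mem_cells] at h ⊢
      obtain ⟨h4, h5, h6⟩ := h
      split_ifs with h7
      · simp only [mem_coe, inl_mem_disjSum, mem_filter, YoungDiagram.mem_cells]
        exact ⟨h4, h7, h6⟩
      · simp only [mem_coe, inr_mem_disjSum, mem_Ico]
        constructor
        -- A letter `l` above row `p` and left of column `j₀` would force an `l + 1` in row `p` left
        -- of its first occurrence.
        · by_contra h8
          have := T.entry_le_of_mem h6 hp₀ h5 (by omega)
          obtain ⟨z, hz⟩ := (T.nonempty_iff p c).2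
            (mu.up_left_mem le_rfl (show c ≤ j₀ by omega) (T.mem_shape hp₀))
          have h9 := T.row_weak p c j₀ (by omega) z hz _ hp₀
          have h10 := T.col_strict q p c h5 _ h6 z hz
          obtain rfl : z = l + 1 := by omega
          exact hmin c (by omega) hz
        · by_contra h8
          obtain rfl : c = j := by omega
          exact h2 ⟨q, p, h5, h6, hp⟩
    · rintro ⟨q, c⟩ h ⟨q', c'⟩ h' e
      simp only [coe_filter, Set.mem_ofPred_eq] at h h' e
      split_ifs at e with h7 h8 h8
      · exact Sum.inl_injective e
      · have := Sum.inr_injective e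
        subst this
        exact Prod.ext (T.col_unique h.2.2 h'.2.2) rfl
  omega

/-- Rows without `l + 1` inherit the inequality from the row above. In a row `p` with leftmost `l +
1` in column `j`, every `l + 1` in the rows up to `p` lies in a column from `j` on, and every `l` to
the right of column `j` lies above row `p`. So the row condition follows from the column condition
at `j`. -/
theorem isLattice_of_no_violation {lam : YoungDiagram} {T : SetValuedTableau mu}
    (hT : ∀ j l, ¬ T.Violation lam j l) : T.IsLattice lam := by
  intro p l
  induction p with
  | zero =>
    have key : ∀ q, (∃ j, l + 1 ∈ T.entry q j) →
        lam.rowLen (l + 1) + T.upper (q + 1) (l + 1) ≤ lam.rowLen l + T.upper q l :=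
      fun q hq => isLattice_aux hT q l hq
    by_cases h : ∃ j, l + 1 ∈ T.entry 0 j
    · exact key 0 h
    · push Not at h
      have : T.rowCount 0 (l + 1) = 0 := by simp [rowCount, h]
      rw [T.upper_succ, this]
      simpa using lam.rowLen_anti _ _ (Nat.le_succ l)
  | succ p ih =>
    by_cases h : ∃ j, l + 1 ∈ T.entry (p + 1) j
    · exact isLattice_aux hT _ l h
    · push Not at h
      have : T.rowCount (p + 1) (l + 1) = 0 := by simp [rowCount, h]
      rw [T.upper_succ (p + 1), this]
      have := T.upper_succ p l
      omega
where
  isLattice_aux {lam : YoungDiagram} {T : SetValuedTableau mu}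
      (hT : ∀ j l, ¬ T.Violation lam j l) (p l : ℕ) (hp : ∃ j, l + 1 ∈ T.entry p j) :
      lam.rowLen (l + 1) + T.upper (p + 1) (l + 1) ≤ lam.rowLen l + T.upper p l := by
    obtain ⟨j₁, hj₁⟩ := hp
    obtain ⟨j, -, hp, hmin⟩ := T.row_leftmost hj₁
    have h1 := hT j l
    have h0 := T.partition_of_no_violation lam (j + 1) l fun j' _ => hT j' l
    rw [T.upper_eq_card, T.upper_eq_card]
    have e1 : #{c ∈ mu.cells | c.1 < p + 1 ∧ l + 1 ∈ T.entry c.1 c.2} ≤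
        T.rightCount (j + 1) (l + 1) + 1 := by
      rw [← T.rightCount_of_mem hp, rightCount]
      refine card_le_card fun c h => ?_
      simp only [mem_filter] at h ⊢
      refine ⟨h.1, ?_, h.2.2⟩
      by_contra h4
      rcases (show c.1 ≤ p by omega).eq_or_lt with h5 | h5
      · exact hmin c.2 (by omega) (h5 ▸ h.2.2)
      · exact absurd (T.entry_le_of_mem h.2.2 hp h5 (by omega)) (lt_irrefl _)
    have rows : ∀ q c, l ∈ T.entry q c → j < c → q < p := by
      intro q c h hc
      by_contra hq
      rcases (show p ≤ q by omega).eq_or_lt with rfl | h5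
      · have := T.row_weak p _ _ hc _ hp _ h
        omega
      · have := T.entry_le_of_mem hp h h5 hc.le
        omega
    rw [Violation] at h1
    push Not at h1
    by_cases h2 : lam.rowLen l + T.rightCount (j + 1) l ≤
        lam.rowLen (l + 1) + T.rightCount (j + 1) (l + 1)
    · obtain ⟨q, q', hq, hq1, hq2⟩ := h1 ⟨p, hp⟩ h2
      obtain rfl := T.col_unique hp hq2
      have e2 : T.rightCount (j + 1) l + 1 ≤
          #{c ∈ mu.cells | c.1 < p ∧ l ∈ T.entry c.1 c.2} := by
        rw [← T.rightCount_of_mem hq1, rightCount]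
        refine card_le_card fun c h => ?_
        simp only [mem_filter] at h ⊢
        refine ⟨h.1, ?_, h.2.2⟩
        rcases h.2.1.eq_or_lt with h5 | h5
        · have := T.col_unique hq1 (h5 ▸ h.2.2)
          omega
        · exact rows _ _ h.2.2 h5
      omega
    · have e2 : T.rightCount (j + 1) l ≤
          #{c ∈ mu.cells | c.1 < p ∧ l ∈ T.entry c.1 c.2} := by
        rw [rightCount]
        refine card_le_card fun c h => ?_
        simp only [mem_filter] at h ⊢
        exact ⟨h.1, rows _ _ h.2.2 h.2.1, h.2.2⟩
      omega

theorem isLattice_iff_no_violation {lam : YoungDiagram} {T : SetValuedTableau mu} :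
    T.IsLattice lam ↔ ∀ j l, ¬ T.Violation lam j l :=
  ⟨fun h => not_violation_of_isLattice h, isLattice_of_no_violation⟩

end SetValuedTableau

/-! ### Tableaux with bounded letters -/

namespace SetValuedTableau

variable {mu : YoungDiagram}

theorem entry_injective : Function.Injective (entry : SetValuedTableau mu → ℕ → ℕ → Finset ℕ) :=
  fun _ _ h => SetValuedTableau.ext h

/-- All letters are less than `k`. -/
def Bounded (k : ℕ) (T : SetValuedTableau mu) : Prop := ∀ p j, ∀ l ∈ T.entry p j, l < k

theorem finite_bounded (mu : YoungDiagram) (k : ℕ) :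
    {T : SetValuedTableau mu | T.Bounded k}.Finite := by
  refine Set.Finite.of_injOn (f := fun T => {x ∈ mu.cells ×ˢ range k | x.2 ∈ T.entry x.1.1 x.1.2})
    (t := ((mu.cells ×ˢ range k).powerset : Set _)) ?_ ?_ (Finset.finite_toSet _)
  · intro T _
    exact mem_coe.2 (mem_powerset.2 (filter_subset _ _))
  · intro T hT T' hT' e
    ext p j l
    have h := Finset.ext_iff.1 e ((p, j), l)
    simp only [mem_filter, mem_product, mem_range, YoungDiagram.mem_cells] at h
    constructor
    · intro hl
      exact (h.1 ⟨⟨T.mem_shape hl, hT _ _ _ hl⟩, hl⟩).2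
    · intro hl
      exact (h.2 ⟨⟨T'.mem_shape hl, hT' _ _ _ hl⟩, hl⟩).2

/-- The tableaux with letters less than `k`. -/
noncomputable def bounded (mu : YoungDiagram) (k : ℕ) : Finset (SetValuedTableau mu) :=
  (finite_bounded mu k).toFinset

theorem mem_bounded {k : ℕ} {T : SetValuedTableau mu} : T ∈ bounded mu k ↔ T.Bounded k := by
  simp [bounded]

theorem Bounded.bk {k l J : ℕ} {T : SetValuedTableau mu} (h : T.Bounded k) (hl : l + 1 < k)
    (hT : T.BKAdmissible l J) : (T.bk l J hT).Bounded k := by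
  intro q c x hx
  by_cases h1 : x = l
  · omega
  by_cases h2 : x = l + 1
  · omega
  exact h q c x ((mem_bk_of_ne hT h1 h2).1 hx)

theorem rightCount_congr {T T' : SetValuedTableau mu} {j x : ℕ}
    (h : ∀ q c, j ≤ c → (x ∈ T'.entry q c ↔ x ∈ T.entry q c)) :
    T'.rightCount j x = T.rightCount j x := by
  rw [rightCount, rightCount]
  congr 1
  exact filter_congr fun c _ => and_congr_right fun hc => h _ _ hc

theorem violation_congr {lam : YoungDiagram} {T T' : SetValuedTableau mu} {j l : ℕ}
    (h : ∀ q c, j ≤ c → (l ∈ T'.entry q c ↔ l ∈ T.entry q c))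
    (h' : ∀ q c, j ≤ c → (l + 1 ∈ T'.entry q c ↔ l + 1 ∈ T.entry q c)) :
    T'.Violation lam j l ↔ T.Violation lam j l := by
  rw [Violation, Violation, rightCount_congr fun q c hc => h q c (by omega),
    rightCount_congr fun q c hc => h' q c (by omega)]
  simp only [h _ j le_rfl, h' _ j le_rfl]

/-- The conditions on a tableau with rightmost violation at column `j` and largest violated
letter `l` which do not mention the distribution of `l` and `l + 1` in column `j`. -/
structure Critical (lam : YoungDiagram) (j l : ℕ) (T : SetValuedTableau mu) : Prop where
  right : ∀ j' > j, ∀ l', ¬ T.Violation lam j' l'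
  eq : lam.rowLen l + T.rightCount (j + 1) l = lam.rowLen (l + 1) + T.rightCount (j + 1) (l + 1)
  star : ∃ p, T.Star l p j ∧ (∀ q, T.Star l q j → q = p) ∧ l ∉ T.entry p (j + 1) ∧
    ¬ (l + 2 ∈ T.entry p j ∧ lam.rowLen (l + 1) + T.rightCount (j + 1) (l + 1) ≤
      lam.rowLen (l + 2) + T.rightCount (j + 1) (l + 2))
  large : ∀ l' ≥ l + 2, ¬ T.Violation lam j l'

/-- The conditions only see the columns right of `j`, letters other than `l` and `l + 1`, and the
position of the starred cell of column `j`. Hence they survive the Bender–Knuth transforms and the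
insertion or removal of `l + 1` in the starred cell. -/
theorem Critical.congr {lam : YoungDiagram} {j l : ℕ} {T T' : SetValuedTableau mu}
    (hT : T.Critical lam j l) (h1 : ∀ q c, j < c → T'.entry q c = T.entry q c)
    (h2 : ∀ q c x, x ≠ l → x ≠ l + 1 → (x ∈ T'.entry q c ↔ x ∈ T.entry q c))
    (h3 : ∀ q, T'.Star l q j ↔ T.Star l q j) : T'.Critical lam j l := by
  have hrc : ∀ x, T'.rightCount (j + 1) x = T.rightCount (j + 1) x := fun x =>
    rightCount_congr fun q c hc => by rw [h1 q c (by omega)]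
  refine ⟨fun j' hj' l' => ?_, ?_, ?_, fun l' hl' => ?_⟩
  · rw [violation_congr (T := T) (fun q c hc => by rw [h1 q c (by omega)])
      (fun q c hc => by rw [h1 q c (by omega)])]
    exact hT.right j' hj' l'
  · rw [hrc, hrc]
    exact hT.eq
  · obtain ⟨p, h4, h5, h6, h7⟩ := hT.star
    refine ⟨p, (h3 p).2 h4, fun q hq => h5 q ((h3 q).1 hq), ?_, ?_⟩
    · rwa [h1 p (j + 1) (by omega)]
    · rwa [hrc, hrc, h2 p j (l + 2) (by omega) (by omega)]
  · rw [violation_congr (fun q c _ => h2 q c l' (by omega) (by omega))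
      (fun q c _ => h2 q c (l' + 1) (by omega) (by omega))]
    exact hT.large l' hl'

/-- The rightmost column with a violation is `j`, and `l` is its largest violated letter. -/
def Key (lam : YoungDiagram) (j l : ℕ) (T : SetValuedTableau mu) : Prop :=
  T.Violation lam j l ∧ (∀ j' > j, ∀ l', ¬ T.Violation lam j' l') ∧
    ∀ l' > l, ¬ T.Violation lam j l'

theorem Violation.lt {lam : YoungDiagram} {T : SetValuedTableau mu} {j l k : ℕ}
    (h : T.Violation lam j l) (hT : T.Bounded k) : j < mu.rowLen 0 ∧ l + 1 < k := by
  obtain ⟨⟨p, hp⟩, -⟩ := h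
  exact ⟨YoungDiagram.mem_iff_lt_rowLen.1 (mu.up_left_mem (Nat.zero_le _) le_rfl (T.mem_shape hp)),
    hT _ _ _ hp⟩

theorem exists_key {lam : YoungDiagram} {T : SetValuedTableau mu} (hT : ¬ T.IsLattice lam) :
    ∃ j l, T.Key lam j l := by
  classical
  rw [isLattice_iff_no_violation] at hT
  push Not at hT
  obtain ⟨j₀, l₀, h₀⟩ := hT
  obtain ⟨k, hk⟩ := T.exists_letter_bound
  have hb : ∀ j l, T.Violation lam j l → j < mu.rowLen 0 ∧ l + 1 < k := fun j l h => h.lt hk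
  have hj := Nat.findGreatest_spec (P := fun j => ∃ l, T.Violation lam j l) (n := mu.rowLen 0)
    (hb _ _ h₀).1.le ⟨l₀, h₀⟩
  set j := Nat.findGreatest (fun j => ∃ l, T.Violation lam j l) (mu.rowLen 0)
  obtain ⟨l₁, h₁⟩ := hj
  have hl := Nat.findGreatest_spec (P := fun l => T.Violation lam j l) (n := k)
    (by have := hb _ _ h₁; omega) h₁
  refine ⟨j, _, hl, fun j' hj' l' h' => ?_, fun l' hl' h' => ?_⟩
  · exact Nat.findGreatest_is_greatest hj' (hb _ _ h').1.le ⟨l', h'⟩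
  · exact Nat.findGreatest_is_greatest hl' (by have := hb _ _ h'; omega) h'

theorem Key.unique {lam : YoungDiagram} {T : SetValuedTableau mu} {j l j' l' : ℕ}
    (h : T.Key lam j l) (h' : T.Key lam j' l') : j = j' ∧ l = l' := by
  obtain ⟨h1, h2, h3⟩ := h
  obtain ⟨h1', h2', h3'⟩ := h'
  have e : j = j' := by
    rcases lt_trichotomy j j' with h | h | h
    exacts [(h2 _ h _ h1').elim, h, (h2' _ h _ h1).elim]
  subst e
  refine ⟨rfl, ?_⟩
  rcases lt_trichotomy l l' with h | h | h
  exacts [(h3 _ h h1').elim, h, (h3' _ h h1).elim]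

/-- A violation excludes `l` above `l + 1` in column `j`, so the starred cell is unique. The
inequality of the violation is an equality because the columns further right have no violation. The
clause on `l + 2` says that `l + 1` is not violated when it occurs in the starred cell. -/
theorem key_iff {lam : YoungDiagram} {T : SetValuedTableau mu} {j l : ℕ} :
    T.Key lam j l ↔ T.Critical lam j l ∧ ∃ p, l + 1 ∈ T.entry p j := by
  constructor
  · rintro ⟨⟨⟨p, hp⟩, h1, h2⟩, h3, h4⟩
    have hu : ∀ q, T.Star l q j → q = p := by
      rintro q (hq | hq)
      · rcases lt_trichotomy q p with h | h | h
        · exact (h2 ⟨q, p, h, hq, hp⟩).elim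
        · exact h
        · have := T.col_strict _ _ _ h _ hp _ hq
          omega
      · exact T.col_unique hq hp
    refine ⟨⟨h3, le_antisymm h1 ?_, ⟨p, Or.inr hp, hu, ?_, ?_⟩, fun l' hl' => h4 l' (by omega)⟩,
      p, hp⟩
    · exact T.partition_of_no_violation lam (j + 1) l fun j' hj' => h3 j' (by omega) l
    · intro h
      have := T.row_weak p j (j + 1) (by omega) _ hp _ h
      omega
    · rintro ⟨h5, h6⟩
      refine h4 (l + 1) (by omega) ⟨⟨p, h5⟩, h6, ?_⟩
      rintro ⟨a, b, hab, ha, hb⟩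
      have := T.col_unique ha hp
      have := T.col_unique hb h5
      omega
  · rintro ⟨⟨h1, h2, ⟨p, h3, h4, h5, h6⟩, h7⟩, q, hq⟩
    obtain rfl := h4 q (Or.inr hq)
    refine ⟨⟨⟨q, hq⟩, h2.le, ?_⟩, h1, fun l' hl' => ?_⟩
    · rintro ⟨a, b, hab, ha, hb⟩
      have := h4 a (Or.inl ha)
      have := h4 b (Or.inr hb)
      omega
    · rcases (show l + 1 ≤ l' by omega).eq_or_lt with rfl | h
      · rintro ⟨⟨a, ha⟩, h8, h9⟩
        rcases lt_trichotomy a q with h | rfl | h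
        · have := T.col_strict _ _ _ h _ ha _ hq
          omega
        · exact h6 ⟨ha, h8⟩
        · exact h9 ⟨q, a, h, hq, ha⟩
      · exact h7 l' h

theorem Critical.bkAdmissible {lam : YoungDiagram} {T : SetValuedTableau mu} {j l : ℕ}
    (h : T.Critical lam j l) : T.BKAdmissible l (j + 1) := by
  intro q c hc hq hs
  obtain rfl : c = j := by omega
  obtain ⟨p, -, h2, h3, -⟩ := h.star
  rw [h2 q hs] at hq
  exact h3 hq

theorem Critical.bk {lam : YoungDiagram} {T : SetValuedTableau mu} {j l : ℕ}
    (h : T.Critical lam j l) : (T.bk l (j + 1) h.bkAdmissible).Critical lam j l :=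
  h.congr (fun _ _ hc => bk_entry_of_le _ hc) (fun _ _ _ h1 h2 => mem_bk_of_ne _ h1 h2)
    fun q => star_bk _ q j

theorem bkAdmissible_of_notMem {T : SetValuedTableau mu} {j l : ℕ}
    (h : ∀ p, l ∉ T.entry p j) : T.BKAdmissible l j :=
  fun q _ hc hl => (h q (hc ▸ hl)).elim

theorem Critical.bk_of_notMem {lam : YoungDiagram} {T : SetValuedTableau mu} {j l : ℕ}
    (hT : T.Critical lam j l) (h : ∀ p, l ∉ T.entry p j) :
    (T.bk l j (bkAdmissible_of_notMem h)).Critical lam j l :=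
  hT.congr (fun _ _ hc => bk_entry_of_le _ hc.le) (fun _ _ _ h1 h2 => mem_bk_of_ne _ h1 h2)
    fun q => star_bk _ q j

/-- Removal of a letter from a cell which contains another letter. -/
def eraseLetter (T : SetValuedTableau mu) (p j a x : ℕ) (hx : x ∈ T.entry p j) (hxa : x ≠ a) :
    SetValuedTableau mu :=
  T.setCell p j ((T.entry p j).erase a) (T.mem_shape hx)
    (show ((T.entry p j).erase a).Nonempty from ⟨x, mem_erase.2 ⟨hxa, hx⟩⟩)
    (fun j' hj' y hy b hb => T.row_weak p j' j hj' y hy b (mem_of_mem_erase hb))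
    (fun j' hj' b hb y hy => T.row_weak p j j' hj' b (mem_of_mem_erase hb) y hy)
    (fun p' hp' y hy b hb => T.col_strict p' p j hp' y hy b (mem_of_mem_erase hb))
    (fun p' hp' b hb y hy => T.col_strict p p' j hp' b (mem_of_mem_erase hb) y hy)

/-- Insertion of the letter `l + 1` in a cell which contains `l`. -/
def insertSucc (T : SetValuedTableau mu) (p j l : ℕ) (hl : l ∈ T.entry p j)
    (hr : l ∉ T.entry p (j + 1)) (hd : ∀ q, p < q → l + 1 ∉ T.entry q j) : SetValuedTableau mu :=
  T.setCell p j (insert (l + 1) (T.entry p j)) (T.mem_shape hl)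
    (insert_nonempty _ _)
    (by
      intro j' hj' y hy b hb
      rcases mem_insert.1 hb with rfl | hb
      · have := T.row_weak p j' j hj' y hy l hl
        omega
      · exact T.row_weak p j' j hj' y hy b hb)
    (by
      intro j' hj' b hb y hy
      rcases mem_insert.1 hb with rfl | hb
      · obtain ⟨z, hz⟩ := (T.nonempty_iff p (j + 1)).2
          (mu.up_left_mem le_rfl hj' (T.mem_shape hy))
        have h1 := T.row_weak p j (j + 1) (by omega) l hl z hz
        have h2 : z ≠ l := fun h => hr (h ▸ hz)
        rcases (show j + 1 ≤ j' by omega).eq_or_lt with rfl | h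
        · have h3 := T.row_weak p j (j + 1) (by omega) l hl y hy
          have h4 : y ≠ l := fun h => hr (h ▸ hy)
          omega
        · have := T.row_weak p (j + 1) j' h z hz y hy
          omega
      · exact T.row_weak p j j' hj' b hb y hy)
    (by
      intro p' hp' y hy b hb
      rcases mem_insert.1 hb with rfl | hb
      · have := T.col_strict p' p j hp' y hy l hl
        omega
      · exact T.col_strict p' p j hp' y hy b hb)
    (by
      intro p' hp' b hb y hy
      rcases mem_insert.1 hb with rfl | hb
      · have := T.col_strict p p' j hp' l hl y hy
        have h2 : y ≠ l + 1 := fun h => hd p' hp' (h ▸ hy)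
        omega
      · exact T.col_strict p p' j hp' b hb y hy)

section cells

variable {T : SetValuedTableau mu} {p j a x l : ℕ}

theorem mem_eraseLetter {hx : x ∈ T.entry p j} {hxa : x ≠ a} {q c y : ℕ} :
    y ∈ (T.eraseLetter p j a x hx hxa).entry q c ↔
      y ∈ T.entry q c ∧ ¬ (q = p ∧ c = j ∧ y = a) := by
  by_cases h : q = p ∧ c = j
  · obtain ⟨rfl, rfl⟩ := h
    rw [eraseLetter, setCell_self, mem_erase]
    tauto
  · rw [eraseLetter, setCell_of_ne h]
    tauto

theorem mem_insertSucc {hl : l ∈ T.entry p j} {hr : l ∉ T.entry p (j + 1)}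
    {hd : ∀ q, p < q → l + 1 ∉ T.entry q j} {q c y : ℕ} :
    y ∈ (T.insertSucc p j l hl hr hd).entry q c ↔
      y ∈ T.entry q c ∨ (q = p ∧ c = j ∧ y = l + 1) := by
  by_cases h : q = p ∧ c = j
  · obtain ⟨rfl, rfl⟩ := h
    rw [insertSucc, setCell_self, mem_insert]
    tauto
  · rw [insertSucc, setCell_of_ne h]
    tauto

theorem weight_eraseLetter {hx : x ∈ T.entry p j} {hxa : x ≠ a} (ha : a ∈ T.entry p j) (y : ℕ) :
    (T.eraseLetter p j a x hx hxa).weight y + (if y = a then 1 else 0) = T.weight y := by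
  have h := setCell_weight (T := T) (p := p) (j := j) (C := (T.entry p j).erase a)
    (hm := T.mem_shape hx) (hC := ⟨x, mem_erase.2 ⟨hxa, hx⟩⟩)
    (hl := fun j' hj' y hy b hb => T.row_weak p j' j hj' y hy b (mem_of_mem_erase hb))
    (hr := fun j' hj' b hb y hy => T.row_weak p j j' hj' b (mem_of_mem_erase hb) y hy)
    (hu := fun p' hp' y hy b hb => T.col_strict p' p j hp' y hy b (mem_of_mem_erase hb))
    (hd := fun p' hp' b hb y hy => T.col_strict p p' j hp' b (mem_of_mem_erase hb) y hy) y
  change (T.eraseLetter p j a x hx hxa).weight y + _ = _ at h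
  by_cases h1 : y = a
  · subst h1
    simp only [mem_erase, ne_eq, not_true, false_and, if_false, ha, if_true] at h ⊢
    omega
  · simp only [mem_erase, ne_eq, h1, not_false_eq_true, true_and, if_false] at h ⊢
    omega

end cells

theorem Critical.eraseLetter {lam : YoungDiagram} {T : SetValuedTableau mu} {p j l : ℕ}
    (hT : T.Critical lam j l) (h : l ∈ T.entry p j) :
    (T.eraseLetter p j (l + 1) l h (by omega)).Critical lam j l := by
  refine hT.congr ?_ ?_ ?_
  · intro q c hc
    ext y
    rw [mem_eraseLetter]
    constructor
    · exact fun h => h.1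
    · exact fun h => ⟨h, by omega⟩
  · intro q c y _ h2
    rw [mem_eraseLetter]
    tauto
  · intro q
    rw [Star, Star, mem_eraseLetter, mem_eraseLetter]
    constructor
    · tauto
    · by_cases e : q = p
      · subst e
        intro _
        exact Or.inl ⟨h, by omega⟩
      · tauto

theorem Critical.insertSucc {lam : YoungDiagram} {T : SetValuedTableau mu} {p j l : ℕ}
    (hT : T.Critical lam j l) (h : l ∈ T.entry p j) (hr : l ∉ T.entry p (j + 1))
    (hd : ∀ q, p < q → l + 1 ∉ T.entry q j) :
    (T.insertSucc p j l h hr hd).Critical lam j l := by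
  refine hT.congr ?_ ?_ ?_
  · intro q c hc
    ext y
    rw [mem_insertSucc]
    constructor
    · rintro (h | h)
      exacts [h, by omega]
    · exact Or.inl
  · intro q c y _ h2
    rw [mem_insertSucc]
    tauto
  · intro q
    rw [Star, Star, mem_insertSucc, mem_insertSucc]
    constructor
    · rintro ((h1 | h1) | (h1 | h1))
      · tauto
      · omega
      · tauto
      · rw [h1.1]
        tauto
    · tauto

end SetValuedTableau

/-! ### Alternants -/

open MvPolynomial in
/-- The alternating sum of the permutations of a polynomial. -/
noncomputable def alternant (k : ℕ) : MvPolynomial (Fin k) ℤ →+ MvPolynomial (Fin k) ℤ where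
  toFun p := ∑ σ : Equiv.Perm (Fin k), (Equiv.Perm.sign σ : ℤ) • rename σ p
  map_zero' := by simp
  map_add' p q := by simp [sum_add_distrib]

namespace alternant

open MvPolynomial

variable {k : ℕ}

theorem apply (p : MvPolynomial (Fin k) ℤ) :
    alternant k p = ∑ σ : Equiv.Perm (Fin k), (Equiv.Perm.sign σ : ℤ) • rename σ p := rfl

theorem rename_perm (τ : Equiv.Perm (Fin k)) (p : MvPolynomial (Fin k) ℤ) :
    alternant k (rename τ p) = (Equiv.Perm.sign τ : ℤ) • alternant k p := by
  rw [apply, apply, smul_sum, ← Equiv.sum_comp (Equiv.mulRight τ⁻¹)]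
  refine sum_congr rfl fun σ _ => ?_
  rw [rename_rename, smul_smul]
  congr 1
  · simp [Equiv.Perm.sign_mul, mul_comm]
  · congr 2
    ext x
    simp

theorem mul_symmetric {G : MvPolynomial (Fin k) ℤ} (hG : ∀ σ : Equiv.Perm (Fin k), rename σ G = G)
    (p : MvPolynomial (Fin k) ℤ) : alternant k (G * p) = G * alternant k p := by
  simp only [apply, map_mul, hG, mul_sum, mul_smul_comm]

/-- The monomial with exponents `u`. -/
noncomputable def mono (k : ℕ) (u : ℕ → ℕ) : MvPolynomial (Fin k) ℤ := ∏ b : Fin k, X b ^ u b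

/-- The product whose alternant is, up to a common factor, the Grothendieck polynomial of `v`. -/
noncomputable def jterm (k : ℕ) (v : ℕ → ℕ) : MvPolynomial (Fin k) ℤ :=
  ∏ b : Fin k, (X b ^ (v b + (k - 1 - b)) * (1 + X b) ^ (b : ℕ))

/-- A product which is symmetric in the variables `l` and `l + 1` up to the exponents `u`. -/
noncomputable def hterm (k l : ℕ) (u : ℕ → ℕ) : MvPolynomial (Fin k) ℤ :=
  ∏ b : Fin k, (X b ^ u b * (1 + X b) ^ ((b : ℕ) - if (b : ℕ) = l + 1 then 1 else 0))

theorem mono_mul_jterm (u v : ℕ → ℕ) : mono k u * jterm k v = jterm k fun b => v b + u b := by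
  rw [mono, jterm, jterm, ← prod_mul_distrib]
  refine prod_congr rfl fun b _ => ?_
  ring

/-- One factor `1 + X (l + 1)` is multiplied out. The factors `1 + X l` and `1 + X (l + 1)` then
both have exponent `l`, so exchanging these two variables in an `hterm` only permutes the exponents
`u`. -/
theorem jterm_eq_hterm_add {l : ℕ} (hl : l + 1 < k) (v : ℕ → ℕ) :
    jterm k v = hterm k l (fun b => v b + (k - 1 - b)) +
      hterm k l fun b => v b + (k - 1 - b) + if b = l + 1 then 1 else 0 := by
  have h1 : hterm k l (fun b => v b + (k - 1 - b) + if b = l + 1 then 1 else 0) =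
      X ⟨l + 1, hl⟩ * hterm k l fun b => v b + (k - 1 - b) := by
    rw [hterm, hterm, ← mul_prod_erase _ _ (mem_univ (⟨l + 1, hl⟩ : Fin k)),
      ← mul_prod_erase univ _ (mem_univ (⟨l + 1, hl⟩ : Fin k)), ← mul_assoc]
    congr 1
    · simp only [if_true]
      ring
    · refine prod_congr rfl fun b hb => ?_
      have : (b : ℕ) ≠ l + 1 := fun h => (mem_erase.1 hb).1 (Fin.ext h)
      simp [this]
  have h2 : jterm k v = (1 + X ⟨l + 1, hl⟩) * hterm k l fun b => v b + (k - 1 - b) := by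
    rw [hterm, jterm, ← mul_prod_erase _ _ (mem_univ (⟨l + 1, hl⟩ : Fin k)),
      ← mul_prod_erase univ _ (mem_univ (⟨l + 1, hl⟩ : Fin k)), ← mul_assoc]
    congr 1
    · simp only [if_true, Nat.add_sub_cancel]
      ring
    · refine prod_congr rfl fun b hb => ?_
      have : (b : ℕ) ≠ l + 1 := fun h => (mem_erase.1 hb).1 (Fin.ext h)
      simp [this]
  rw [h1, h2]
  ring

theorem rename_swap_prod {l : ℕ} (hl : l + 1 < k) (f : Fin k → MvPolynomial (Fin k) ℤ)
    (g : Fin k → MvPolynomial (Fin k) ℤ)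
    (h : ∀ b, rename (Equiv.swap (⟨l, by omega⟩ : Fin k) ⟨l + 1, hl⟩) (f b) =
      g (Equiv.swap (⟨l, by omega⟩ : Fin k) ⟨l + 1, hl⟩ b)) :
    rename (Equiv.swap (⟨l, by omega⟩ : Fin k) ⟨l + 1, hl⟩) (∏ b, f b) = ∏ b, g b := by
  rw [map_prod, ← Equiv.prod_comp (Equiv.swap (⟨l, by omega⟩ : Fin k) ⟨l + 1, hl⟩) g]
  exact prod_congr rfl fun b _ => h b

theorem swap_cases {l : ℕ} (hl : l + 1 < k) (b : Fin k) :
    (((Equiv.swap (⟨l, by omega⟩ : Fin k) ⟨l + 1, hl⟩ b : Fin k) : ℕ) = l + 1 ∧ (b : ℕ) = l) ∨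
    (((Equiv.swap (⟨l, by omega⟩ : Fin k) ⟨l + 1, hl⟩ b : Fin k) : ℕ) = l ∧ (b : ℕ) = l + 1) ∨
    ((Equiv.swap (⟨l, by omega⟩ : Fin k) ⟨l + 1, hl⟩ b : Fin k) = b ∧ (b : ℕ) ≠ l ∧
      (b : ℕ) ≠ l + 1) := by
  by_cases h1 : b = ⟨l, by omega⟩
  · subst h1
    left
    simp [Equiv.swap_apply_left]
  by_cases h2 : b = ⟨l + 1, hl⟩
  · subst h2
    right; left
    simp [Equiv.swap_apply_right]
  · right; right
    exact ⟨Equiv.swap_apply_of_ne_of_ne h1 h2, fun h => h1 (Fin.ext h), fun h => h2 (Fin.ext h)⟩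

theorem rename_swap_mono {l : ℕ} (hl : l + 1 < k) {u u' : ℕ → ℕ} (h1 : u' l = u (l + 1))
    (h2 : u' (l + 1) = u l) (h3 : ∀ b, b ≠ l → b ≠ l + 1 → u' b = u b) :
    rename (Equiv.swap (⟨l, by omega⟩ : Fin k) ⟨l + 1, hl⟩) (mono k u) = mono k u' := by
  refine rename_swap_prod hl _ _ fun b => ?_
  rw [map_pow, rename_X]
  congr 1
  obtain ⟨h, h'⟩ | ⟨h, h'⟩ | ⟨h, h', h''⟩ := swap_cases hl b
  · rw [h, h', h2]
  · rw [h, h', h1]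
  · rw [h, h3 _ h' h'']

theorem alternant_hterm_swap {l : ℕ} (hl : l + 1 < k) {u u' : ℕ → ℕ} (h1 : u' l = u (l + 1))
    (h2 : u' (l + 1) = u l) (h3 : ∀ b, b ≠ l → b ≠ l + 1 → u' b = u b) :
    alternant k (hterm k l u') = - alternant k (hterm k l u) := by
  have : hterm k l u' =
      rename (Equiv.swap (⟨l, by omega⟩ : Fin k) ⟨l + 1, hl⟩) (hterm k l u) := by
    symm
    refine rename_swap_prod hl _ _ fun b => ?_
    simp only [map_mul, map_pow, map_add, map_one, rename_X]
    obtain ⟨h, h'⟩ | ⟨h, h'⟩ | ⟨h, h', h''⟩ := swap_cases hl b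
    · rw [h, h', h2]
      simp
    · rw [h, h', h1]
      simp
    · rw [h, h3 _ h' h'']
  rw [this, rename_perm, Equiv.Perm.sign_swap]
  · simp
  · simp

/-! ### Linear independence of the alternants -/

theorem coeff_jterm_self (v : ℕ → ℕ) (m : Fin k →₀ ℕ) (h : ∀ b, m b = v b + (k - 1 - b)) :
    coeff m (jterm k v) = 1 := by
  have e : jterm k v = monomial m 1 * ∏ b : Fin k, (1 + X b) ^ (b : ℕ) := by
    rw [jterm, prod_mul_distrib, monomial_eq, Finsupp.prod_fintype _ _ (by simp)]
    simp [h]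
  rw [e, coeff_monomial_mul', if_pos le_rfl, tsub_self, one_mul, ← constantCoeff_eq]
  simp

theorem coeff_jterm_eq_zero (v : ℕ → ℕ) (m : Fin k →₀ ℕ) (h : ∃ b, m b < v b + (k - 1 - b)) :
    coeff m (jterm k v) = 0 := by
  have e : jterm k v = monomial (Finsupp.equivFunOnFinite.symm fun b : Fin k => v b + (k - 1 - b)) 1 *
      ∏ b : Fin k, (1 + X b) ^ (b : ℕ) := by
    rw [jterm, prod_mul_distrib, monomial_eq, Finsupp.prod_fintype _ _ (by simp)]
    simp
  rw [e, coeff_monomial_mul', if_neg]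
  intro h'
  obtain ⟨b, hb⟩ := h
  have := h' b
  simp only [Finsupp.equivFunOnFinite_symm_apply_apply] at this
  omega

theorem perm_eq_one_of_strictAnti {f g : Fin k → ℕ} (hf : StrictAnti f) (hg : StrictAnti g)
    {σ : Equiv.Perm (Fin k)} (h : ∀ b, f (σ b) = g b) : σ = 1 := by
  have hσ : StrictMono σ := by
    intro a b hab
    have := hg hab
    rw [← h, ← h] at this
    exact hf.lt_iff_gt.1 this
  ext b
  have h2 := (OrderIso.refl (Fin k)).toOrderEmbedding.trans (RelIso.refl _).toRelEmbedding
  have : hσ.orderIsoOfSurjective σ σ.surjective = OrderIso.refl _ := Subsingleton.elim _ _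
  exact congrArg Fin.val (DFunLike.congr_fun this b)

/-- `jterm` is the monomial with exponents v + δ times a polynomial with constant term 1. A permuted
version of this monomial can divide x^m, whose degree is not larger, only if it equals x^m; a
permutation that carries one strictly decreasing vector to another is the identity. -/
theorem coeff_alternant_jterm {v w : ℕ → ℕ} (hv : Antitone v) (hw : Antitone w) (m : Fin k →₀ ℕ)
    (hm : ∀ b, m b = w b + (k - 1 - b)) (hs : ∑ b : Fin k, w b ≤ ∑ b : Fin k, v b) :
    coeff m (alternant k (jterm k v)) = if ∀ b : Fin k, v b = w b then 1 else 0 := by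
  have hanti : ∀ {v : ℕ → ℕ}, Antitone v → StrictAnti fun b : Fin k => v b + (k - 1 - b) := by
    intro v hv a b hab
    have := hv (show (a : ℕ) ≤ b from hab.le)
    have : (a : ℕ) < b := hab
    have := b.2
    simp only
    omega
  have key : ∀ σ : Equiv.Perm (Fin k), coeff m (rename σ (jterm k v)) =
      if σ = 1 ∧ ∀ b : Fin k, v b = w b then 1 else 0 := by
    intro σ
    have e : m = Finsupp.mapDomain σ (Finsupp.equivMapDomain σ.symm m) := by
      rw [← Finsupp.equivMapDomain_eq_mapDomain, ← Finsupp.equivMapDomain_trans]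
      simp
    rw [e, coeff_rename_mapDomain _ σ.injective]
    split_ifs with h
    · apply coeff_jterm_self
      intro b
      obtain ⟨rfl, h⟩ := h
      simp [hm, h]
    · apply coeff_jterm_eq_zero
      by_contra hc
      push Not at hc
      have h1 : ∀ b ∈ (univ : Finset (Fin k)), v b + (k - 1 - b) ≤ m (σ b) := by
        intro b _
        simpa using hc b
      have h2 : ∑ b : Fin k, m (σ b) = ∑ b : Fin k, (w b + (k - 1 - b)) := by
        rw [Equiv.sum_comp σ m]
        exact sum_congr rfl fun b _ => hm b
      have h3 : ∑ b : Fin k, m (σ b) = ∑ b : Fin k, (v b + (k - 1 - b)) := by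
        refine le_antisymm ?_ (sum_le_sum h1)
        rw [h2, sum_add_distrib, sum_add_distrib]
        omega
      have h4 := (sum_eq_sum_iff_of_le h1).1 h3.symm
      have h5 : σ = 1 := perm_eq_one_of_strictAnti (hanti hw) (hanti hv) fun b => by
        rw [← hm, h4 b (mem_univ b)]
      refine h ⟨h5, fun b => ?_⟩
      have := h4 b (mem_univ b)
      rw [h5, Equiv.Perm.one_apply, hm] at this
      omega
  rw [apply, coeff_sum]
  simp only [coeff_smul, key]
  rw [sum_eq_single 1]
  · simp
  · intro σ _ h
    simp [h]
  · simp

/-- Triangularity: among the indices with non-zero coefficient one of minimal size is taken; its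
monomial with exponents v + δ occurs in no other alternant of the sum. -/
theorem linear_independent {ι : Type*} (s : Finset ι) (v : ι → ℕ → ℕ) (hv : ∀ i, Antitone (v i))
    (hinj : ∀ i ∈ s, ∀ j ∈ s, (∀ b : Fin k, v i b = v j b) → i = j) (c : ι → ℤ)
    (h : ∑ i ∈ s, c i • alternant k (jterm k (v i)) = 0) : ∀ i ∈ s, c i = 0 := by
  classical
  by_contra hc
  push Not at hc
  have hne : {i ∈ s | c i ≠ 0}.Nonempty := by
    obtain ⟨i, hi, hi'⟩ := hc
    exact ⟨i, mem_filter.2 ⟨hi, hi'⟩⟩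
  obtain ⟨i, hi, hmin⟩ := exists_min_image _ (fun i => ∑ b : Fin k, v i b) hne
  rw [mem_filter] at hi
  set m : Fin k →₀ ℕ := Finsupp.equivFunOnFinite.symm fun b => v i b + (k - 1 - b) with hm
  have h1 := congrArg (coeff m) h
  rw [coeff_sum, coeff_zero, sum_eq_single i] at h1
  · rw [coeff_smul, coeff_alternant_jterm (hv i) (hv i) m (fun b => by simp [hm]) le_rfl] at h1
    simp at h1
    exact hi.2 h1
  · intro j hj hji
    by_cases hj0 : c j = 0
    · simp [hj0]
    · rw [coeff_smul, coeff_alternant_jterm (hv j) (hv i) m (fun b => by simp [hm])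
        (hmin j (mem_filter.2 ⟨hj, hj0⟩)), if_neg, smul_zero]
      exact fun h => hji (hinj j hj i hi.1 h)
  · exact fun h => (h hi.1).elim

end alternant

/-! ### The product of a Grothendieck polynomial with an alternant -/

namespace SetValuedTableau

open MvPolynomial alternant

variable {mu : YoungDiagram}

theorem weight_bk_left {T : SetValuedTableau mu} {l : ℕ} (hT : T.BKAdmissible l (mu.rowLen 0)) :
    (T.bk l _ hT).weight l = T.weight (l + 1) ∧ (T.bk l _ hT).weight (l + 1) = T.weight l := by
  constructor
  · rw [← leftCount_add_rightCount _ (mu.rowLen 0), ← leftCount_add_rightCount _ (mu.rowLen 0),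
      leftCount_bk_left, rightCount_eq_zero _ le_rfl, rightCount_eq_zero _ le_rfl]
  · rw [← leftCount_add_rightCount _ (mu.rowLen 0), ← leftCount_add_rightCount T (mu.rowLen 0),
      leftCount_bk_right, rightCount_eq_zero _ le_rfl, rightCount_eq_zero _ le_rfl]

theorem bkAdmissible_rowLen (T : SetValuedTableau mu) (l : ℕ) :
    T.BKAdmissible l (mu.rowLen 0) := by
  intro q c hc h
  have := YoungDiagram.mem_iff_lt_rowLen.1
    (mu.up_left_mem (Nat.zero_le q) le_rfl (T.mem_shape h))
  omega

/-- The sum over all tableaux of a given shape of the monomials of their weights. -/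
noncomputable def gpoly (k : ℕ) (mu : YoungDiagram) : MvPolynomial (Fin k) ℤ :=
  ∑ T ∈ bounded mu k, mono k T.weight

/-- The Bender–Knuth transform on all columns exchanges the numbers of letters `l` and `l + 1` and
keeps all others. -/
theorem rename_gpoly_swap {k l : ℕ} (hl : l + 1 < k) :
    rename (Equiv.swap (⟨l, by omega⟩ : Fin k) ⟨l + 1, hl⟩) (gpoly k mu) = gpoly k mu := by
  rw [gpoly, map_sum]
  refine sum_nbij' (fun T => T.bk l _ (T.bkAdmissible_rowLen l))
    (fun T => T.bk l _ (T.bkAdmissible_rowLen l)) ?_ ?_ ?_ ?_ ?_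
  · intro T hT
    exact mem_bounded.2 ((mem_bounded.1 hT).bk hl _)
  · intro T hT
    exact mem_bounded.2 ((mem_bounded.1 hT).bk hl _)
  · intro T _
    exact bk_bk _
  · intro T _
    exact bk_bk _
  · intro T _
    obtain ⟨h1, h2⟩ := weight_bk_left (T.bkAdmissible_rowLen l)
    exact rename_swap_mono hl h1 h2 fun b h h' => weight_bk_of_ne _ h h'

theorem rename_gpoly (k : ℕ) (mu : YoungDiagram) (σ : Equiv.Perm (Fin k)) :
    rename σ (gpoly k mu) = gpoly k mu := by
  cases k with
  | zero =>
    rw [Subsingleton.elim σ 1]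
    exact rename_id_apply _
  | succ n =>
    have h : σ ∈ Submonoid.closure (Set.range fun i : Fin n => Equiv.swap i.castSucc i.succ) := by
      rw [Equiv.Perm.mclosure_swap_castSucc_succ]
      trivial
    induction h using Submonoid.closure_induction with
    | mem x hx =>
      obtain ⟨i, rfl⟩ := hx
      exact rename_gpoly_swap (k := n + 1) (l := i) (by omega)
    | one => exact rename_id_apply _
    | mul x y _ _ hx hy =>
      rw [Equiv.Perm.coe_mul, ← rename_rename, hy, hx]

section cancellation

variable {lam : YoungDiagram} {j l k : ℕ}

/-- The exponents of the two summands of `jterm`. -/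
def hexp (lam : YoungDiagram) (k : ℕ) (T : SetValuedTableau mu) (b : ℕ) : ℕ :=
  T.content lam b + (k - 1 - b)

/-- The `+ 1` is the difference between the exponents `k - 1 - l` and `k - 1 - (l + 1)`. With `x =
1`, `y = 0` the exponents themselves are swapped; with `x = y = 0` those with one additional `X (l +
1)` are. -/
theorem hexp_swap (hl : l + 1 < k) {T T' : SetValuedTableau mu} {J x y : ℕ}
    (h1 : lam.rowLen l + T.rightCount J l + x = lam.rowLen (l + 1) + T.rightCount J (l + 1) + y)
    (h2 : T'.leftCount J l = T.leftCount J (l + 1)) (h3 : T'.leftCount J (l + 1) = T.leftCount J l)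
    (h4 : T'.rightCount J l = T.rightCount J l)
    (h5 : T'.rightCount J (l + 1) = T.rightCount J (l + 1)) :
    hexp lam k T' l + x = hexp lam k T (l + 1) + y + 1 ∧
      hexp lam k T' (l + 1) + 1 + y = hexp lam k T l + x := by
  simp only [hexp, content, ← leftCount_add_rightCount _ J]
  omega

theorem sum_eq_zero_of_neg {ι : Type*} (s : Finset ι) (f : ι → MvPolynomial (Fin k) ℤ)
    (i : ∀ a ∈ s, ι) (hi : ∀ a ha, i a ha ∈ s) (hinv : ∀ a ha, i (i a ha) (hi a ha) = a)
    (hf : ∀ a ha, f (i a ha) = - f a) : ∑ a ∈ s, f a = 0 := by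
  have h : ∑ a ∈ s, f a = ∑ a ∈ s, - f a :=
    sum_bij' i i hi hi hinv hinv fun a ha => by rw [hf]; simp
  rw [sum_neg_distrib] at h
  exact self_eq_neg.1 h

open Classical in
-- Of the letters `l` and `l + 1`, the starred cell of column `j` contains only `l + 1` in the
-- critical tableaux of class `A`, both in `B`, and only `l` in `C`; the tableaux to be cancelled
-- form `A ∪ B`. Each alternant splits into two summands. The first summands over `A` cancel by the
-- Bender–Knuth transform left of column `j`. Removing `l + 1` from the starred cell maps `B` onto
-- `C` and turns a first summand into a second one. What remains is the sum of the second summands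
-- over `A ∪ B ∪ C`, which cancels by the transform on the columns up to `j`.
theorem sum_key (hl : l + 1 < k) :
    ∑ T ∈ bounded mu k with T.Key lam j l, alternant k (jterm k (T.content lam)) = 0 := by
  set hp : SetValuedTableau mu → MvPolynomial (Fin k) ℤ := fun T =>
    alternant k (hterm k l fun b => hexp lam k T b + if b = l + 1 then 1 else 0) with hhp
  have split : ∀ T : SetValuedTableau mu, alternant k (jterm k (T.content lam)) =
      alternant k (hterm k l (hexp lam k T)) + hp T := by
    intro T
    rw [jterm_eq_hterm_add hl, map_add]
    rfl
  -- the three kinds of critical tableaux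
  set E : Finset (SetValuedTableau mu) := {T ∈ bounded mu k | T.Critical lam j l}
  set A : Finset (SetValuedTableau mu) := {T ∈ E | ∀ p, l ∉ T.entry p j}
  set B : Finset (SetValuedTableau mu) :=
    {T ∈ E | (∃ p, l ∈ T.entry p j) ∧ ∃ p, l + 1 ∈ T.entry p j}
  set C : Finset (SetValuedTableau mu) :=
    {T ∈ E | (∃ p, l ∈ T.entry p j) ∧ ¬ ∃ p, l + 1 ∈ T.entry p j}
  have hK : ({T ∈ bounded mu k | T.Key lam j l} : Finset _) = A ∪ B := by
    ext T
    simp only [A, B, E, mem_union, mem_filter, key_iff]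
    constructor
    · rintro ⟨h1, h2, h3⟩
      by_cases h : ∃ p, l ∈ T.entry p j
      · exact Or.inr ⟨⟨h1, h2⟩, h, h3⟩
      · push Not at h
        exact Or.inl ⟨⟨h1, h2⟩, h⟩
    · rintro (⟨⟨h1, h2⟩, h3⟩ | ⟨⟨h1, h2⟩, h3, h4⟩)
      · obtain ⟨p, h4, -⟩ := h2.star
        exact ⟨h1, h2, p, h4.resolve_left (h3 p)⟩
      · exact ⟨h1, h2, h4⟩
  have hAB : Disjoint A B := by
    rw [disjoint_left]
    intro T h h'
    simp only [A, B, mem_filter] at h h'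
    obtain ⟨p, hp⟩ := h'.2.1
    exact h.2 p hp
  have hE : E = (A ∪ B) ∪ C := by
    ext T
    simp only [A, B, C, mem_union, mem_filter]
    constructor
    · intro h
      by_cases h1 : ∃ p, l ∈ T.entry p j
      · by_cases h2 : ∃ p, l + 1 ∈ T.entry p j
        · exact Or.inl (Or.inr ⟨h, h1, h2⟩)
        · exact Or.inr ⟨h, h1, h2⟩
      · push Not at h1
        exact Or.inl (Or.inl ⟨h, h1⟩)
    · tauto
  have hABC : Disjoint (A ∪ B) C := by
    rw [disjoint_left]
    intro T h h'
    simp only [A, B, C, mem_union, mem_filter] at h h'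
    rcases h with h | h
    · obtain ⟨p, hp⟩ := h'.2.1
      exact h.2 p hp
    · exact h'.2.2 h.2.2
  have hA : ∑ T ∈ A, alternant k (hterm k l (hexp lam k T)) = 0 := by
    refine sum_eq_zero_of_neg A _
      (fun T hT => T.bk l j (bkAdmissible_of_notMem (mem_filter.1 hT).2)) ?_ ?_ ?_
    · intro T hT
      have hT' := mem_filter.1 hT
      have hT'' := mem_filter.1 hT'.1
      refine mem_filter.2 ⟨mem_filter.2 ⟨mem_bounded.2 ((mem_bounded.1 hT''.1).bk hl _),
        hT''.2.bk_of_notMem hT'.2⟩, fun p => ?_⟩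
      rw [bk_entry_of_le _ le_rfl]
      exact hT'.2 p
    · intro T hT
      exact bk_bk _
    · intro T hT
      have hT' := mem_filter.1 hT
      have hT'' := (mem_filter.1 hT'.1).2
      have had := bkAdmissible_of_notMem hT'.2
      have h1 := T.rightCount_of_forall_notMem hT'.2
      obtain ⟨p, h4, -⟩ := hT''.star
      have h2 := T.rightCount_of_mem (h4.resolve_left (hT'.2 p))
      have h3 := hT''.eq
      -- Column `j` contains `l + 1` but not `l`, so from column `j` on the balance is off by one;
      -- this is `x = 1`.
      have := hexp_swap (k := k) (lam := lam) hl (T := T) (T' := T.bk l j had) (J := j) (x := 1)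
        (y := 0) (by omega)
        (leftCount_bk_left had) (leftCount_bk_right had) (rightCount_bk had le_rfl)
        (rightCount_bk had le_rfl)
      refine alternant_hterm_swap hl (by omega) (by omega) fun b hb hb' => ?_
      simp only [hexp, content, weight_bk_of_ne had hb hb']
  have hEs : ∑ T ∈ E, hp T = 0 := by
    refine sum_eq_zero_of_neg E _
      (fun T hT => T.bk l (j + 1) (mem_filter.1 hT).2.bkAdmissible) ?_ ?_ ?_
    · intro T hT
      have hT' := mem_filter.1 hT
      exact mem_filter.2 ⟨mem_bounded.2 ((mem_bounded.1 hT'.1).bk hl _), hT'.2.bk⟩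
    · intro T hT
      exact bk_bk _
    · intro T hT
      have hT' := (mem_filter.1 hT).2
      have had := hT'.bkAdmissible
      have h3 := hT'.eq
      have := hexp_swap (k := k) (lam := lam) hl (T := T) (T' := T.bk l (j + 1) had) (J := j + 1)
        (x := 0) (y := 0) (by omega)
        (leftCount_bk_left had) (leftCount_bk_right had) (rightCount_bk had le_rfl)
        (rightCount_bk had le_rfl)
      refine alternant_hterm_swap hl ?_ ?_ fun b hb hb' => ?_
      · simp only [if_true, show l ≠ l + 1 by omega, if_false]
        omega
      · simp only [if_true, show l ≠ l + 1 by omega, if_false]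
        omega
      · simp only [hexp, content, weight_bk_of_ne had hb hb']
  have hBC : ∑ T ∈ B, alternant k (hterm k l (hexp lam k T)) = ∑ T ∈ C, hp T := by
    have memB : ∀ T ∈ B, ∃ p, l ∈ T.entry p j ∧ l + 1 ∈ T.entry p j := by
      intro T hT
      obtain ⟨hT', ⟨p, hp⟩, q, hq⟩ := mem_filter.1 hT
      obtain ⟨r, -, h5, -⟩ := (mem_filter.1 hT').2.star
      obtain rfl := h5 p (Or.inl hp)
      obtain rfl := h5 q (Or.inr hq)
      exact ⟨_, hp, hq⟩
    have memC : ∀ T ∈ C, ∃ p, l ∈ T.entry p j ∧ l ∉ T.entry p (j + 1) ∧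
        (∀ q, p < q → l + 1 ∉ T.entry q j) ∧ ∀ q, l + 1 ∉ T.entry q j := by
      intro T hT
      obtain ⟨hT', ⟨p, hp⟩, hq⟩ := mem_filter.1 hT
      obtain ⟨r, -, h5, h6, -⟩ := (mem_filter.1 hT').2.star
      obtain rfl := h5 p (Or.inl hp)
      push Not at hq
      exact ⟨p, hp, h6, fun q _ => hq q, hq⟩
    choose pB hB1 hB2 using memB
    choose pC hC1 hC2 hC3 hC4 using memC
    have eC : ∀ (T : SetValuedTableau mu) (hT : T ∈ B), T.eraseLetter (pB T hT) j (l + 1) l (hB1 T hT) (by omega) ∈ C := by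
      intro T hT
      have hT' := mem_filter.1 (mem_filter.1 hT).1
      refine mem_filter.2 ⟨mem_filter.2 ⟨mem_bounded.2 fun q c y hy => ?_, hT'.2.eraseLetter _⟩,
        ⟨pB T hT, mem_eraseLetter.2 ⟨hB1 T hT, by omega⟩⟩, ?_⟩
      · exact mem_bounded.1 hT'.1 q c y (mem_eraseLetter.1 hy).1
      · rintro ⟨q, hq⟩
        rw [mem_eraseLetter] at hq
        exact hq.2 ⟨T.col_unique hq.1 (hB2 T hT), rfl, rfl⟩
    have iB : ∀ (T : SetValuedTableau mu) (hT : T ∈ C), T.insertSucc (pC T hT) j l (hC1 T hT) (hC2 T hT) (hC3 T hT) ∈ B := by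
      intro T hT
      have hT' := mem_filter.1 (mem_filter.1 hT).1
      refine mem_filter.2 ⟨mem_filter.2 ⟨mem_bounded.2 fun q c y hy => ?_,
        hT'.2.insertSucc _ _ _⟩, ⟨pC T hT, mem_insertSucc.2 (Or.inl (hC1 T hT))⟩,
        pC T hT, mem_insertSucc.2 (Or.inr ⟨rfl, rfl, rfl⟩)⟩
      rcases mem_insertSucc.1 hy with h | ⟨-, -, rfl⟩
      · exact mem_bounded.1 hT'.1 q c y h
      · exact hl
    have peC : ∀ (T : SetValuedTableau mu) (hT : T ∈ B), pC _ (eC T hT) = pB T hT := fun T hT =>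
      T.col_unique (mem_eraseLetter.1 (hC1 _ (eC T hT))).1 (hB1 T hT)
    have piB : ∀ (T : SetValuedTableau mu) (hT : T ∈ C), pB _ (iB T hT) = pC T hT := fun T hT =>
      T.col_unique ((mem_insertSucc.1 (hB1 _ (iB T hT))).resolve_right (by omega)) (hC1 T hT)
    refine sum_bij' (fun T hT => T.eraseLetter (pB T hT) j (l + 1) l (hB1 T hT) (by omega))
      (fun T hT => T.insertSucc (pC T hT) j l (hC1 T hT) (hC2 T hT) (hC3 T hT)) eC iB ?_ ?_ ?_
    · intro T hT
      ext q c y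
      rw [mem_insertSucc, mem_eraseLetter, peC]
      constructor
      · rintro (h | ⟨rfl, rfl, rfl⟩)
        · exact h.1
        · exact hB2 T hT
      · tauto
    · intro T hT
      ext q c y
      rw [mem_eraseLetter, mem_insertSucc, piB]
      constructor
      · rintro ⟨h1 | h1, h2⟩
        · exact h1
        · exact (h2 h1).elim
      · intro h
        refine ⟨Or.inl h, ?_⟩
        rintro ⟨-, rfl, rfl⟩
        exact hC4 T hT _ h
    · intro T hT
      simp only [hhp]
      congr 2
      funext b
      have := weight_eraseLetter (T := T) (hx := hB1 T hT) (hxa := (by omega : l ≠ l + 1))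
        (hB2 T hT) b
      simp only [hexp, content]
      omega
  rw [hK, sum_congr rfl fun T _ => split T, sum_add_distrib, sum_union hAB, hA, hBC, zero_add,
    add_comm, ← sum_union hABC, ← hE, hEs]

end cancellation

open Classical in
-- As `gpoly` is symmetric, it can be moved inside the antisymmetrization, where multiplication by
-- the monomial of `T` turns the exponents `lam` into the content of `T`. The tableaux that are not
-- lattice are sorted by their rightmost violated column and the largest letter violated there, and
-- each class sums to zero.
theorem gpoly_mul_alternant (k : ℕ) (lam mu : YoungDiagram) :
    gpoly k mu * alternant k (jterm k lam.rowLen) =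
      ∑ T ∈ bounded mu k with T.IsLattice lam, alternant k (jterm k (T.content lam)) := by
  rw [← mul_symmetric (rename_gpoly k mu), gpoly, sum_mul, map_sum]
  simp only [mono_mul_jterm]
  change ∑ T ∈ bounded mu k, alternant k (jterm k (T.content lam)) = _
  rw [← sum_filter_add_sum_filter_not _ fun T => T.IsLattice lam, add_eq_left]
  set g : SetValuedTableau mu → ℕ × ℕ := fun T => if h : T.IsLattice lam then (0, 0) else
    ((exists_key h).choose, (exists_key h).choose_spec.choose) with hg
  have hkey : ∀ T : SetValuedTableau mu, ¬ T.IsLattice lam → T.Key lam (g T).1 (g T).2 := by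
    intro T h
    simp only [hg, h, dif_neg, not_false_eq_true]
    exact (exists_key h).choose_spec.choose_spec
  rw [← sum_fiberwise_of_maps_to (g := g) fun T hT => mem_image_of_mem g hT]
  refine sum_eq_zero ?_
  rintro ⟨j, l⟩ _
  have e : ({T ∈ {T ∈ bounded mu k | ¬ T.IsLattice lam} | g T = (j, l)} : Finset _) =
      {T ∈ bounded mu k | T.Key lam j l} := by
    ext T
    simp only [mem_filter]
    constructor
    · rintro ⟨⟨h1, h2⟩, h3⟩
      have := hkey T h2
      rw [h3] at this
      exact ⟨h1, this⟩
    · rintro ⟨h1, h2⟩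
      have h3 : ¬ T.IsLattice lam := fun h => isLattice_iff_no_violation.1 h j l h2.1
      obtain ⟨h4, h5⟩ := (hkey T h3).unique h2
      exact ⟨⟨h1, h3⟩, Prod.ext h4 h5⟩
  rw [e]
  by_cases hl : l + 1 < k
  · exact sum_key hl
  · rw [filter_false_of_mem, sum_empty]
    exact fun T hT h => hl (h.1.lt (mem_bounded.1 hT)).2

end SetValuedTableau

/-! ### Partitions with given parts and partitions in a box. -/

namespace YoungDiagram

/-- The partition with given parts. -/
def ofParts (f : ℕ → ℕ) (hf : Antitone f) (k : ℕ) : YoungDiagram where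
  cells := {c ∈ range k ×ˢ range (f 0) | c.2 < f c.1}
  isLowerSet := by
    rintro ⟨a, b⟩ ⟨c, d⟩ h hm
    have h1 : c ≤ a := h.1
    have h2 : d ≤ b := h.2
    simp only [coe_filter, mem_product, mem_range, Set.mem_ofPred_eq] at hm ⊢
    have := hf h1
    omega

theorem mem_ofParts {f : ℕ → ℕ} {hf : Antitone f} {k : ℕ} (hk : f k = 0) {i j : ℕ} :
    (i, j) ∈ ofParts f hf k ↔ j < f i := by
  rw [← mem_cells, ofParts]
  simp only [mem_filter, mem_product, mem_range, and_iff_right_iff_imp]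
  intro h
  have := hf (Nat.zero_le i)
  refine ⟨?_, by omega⟩
  by_contra hik
  have := hf (show k ≤ i by omega)
  omega

theorem rowLen_ofParts {f : ℕ → ℕ} {hf : Antitone f} {k : ℕ} (hk : f k = 0) (i : ℕ) :
    (ofParts f hf k).rowLen i = f i := by
  refine eq_of_forall_lt_iff fun j => ?_
  rw [← mem_iff_lt_rowLen, mem_ofParts hk]

theorem ext_rowLen {lam mu : YoungDiagram} (h : ∀ i, lam.rowLen i = mu.rowLen i) : lam = mu := by
  ext ⟨i, j⟩
  rw [mem_cells, mem_cells, mem_iff_lt_rowLen, mem_iff_lt_rowLen, h]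

theorem le_iff_rowLen {lam mu : YoungDiagram} : lam ≤ mu ↔ ∀ i, lam.rowLen i ≤ mu.rowLen i := by
  constructor
  · intro h i
    by_contra hc
    push Not at hc
    have h1 := mem_iff_lt_rowLen.1 (h (mem_iff_lt_rowLen.2 hc))
    omega
  · rintro h ⟨i, j⟩ hc
    exact mem_iff_lt_rowLen.2 ((mem_iff_lt_rowLen.1 hc).trans_le (h i))

theorem antitone_rowLen (mu : YoungDiagram) : Antitone mu.rowLen := fun _ _ h => mu.rowLen_anti _ _ h

theorem card_eq_sum_rowLen (mu : YoungDiagram) {k : ℕ} (hk : mu.colLen 0 ≤ k) :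
    mu.card = ∑ i ∈ range k, mu.rowLen i := by
  have : ∀ i, mu.rowLen i = #{c ∈ mu.cells | c.1 = i} := fun i => mu.rowLen_eq_card
  simp only [this]
  rw [YoungDiagram.card, card_eq_sum_card_fiberwise (f := Prod.fst) (t := range k)]
  rintro ⟨i, j⟩ hc
  have := mem_iff_lt_colLen.1 (mu.up_left_mem le_rfl (Nat.zero_le j) ((mu.mem_cells _).1 hc))
  simp only [coe_range, Set.mem_Iio]
  omega

/-- The partitions inside a box. -/
noncomputable def boxed (k m : ℕ) : Finset YoungDiagram :=
  (Set.Finite.of_injOn (f := cells)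
    (s := {mu | ∀ i j, (i, j) ∈ mu → i < k ∧ j < m}) (t := ((range k ×ˢ range m).powerset : Set _))
    (fun mu h => mem_coe.2 (mem_powerset.2 fun c hc => by
      have := h c.1 c.2 ((mu.mem_cells c).1 hc)
      simpa using this))
    (fun _ _ _ _ h => YoungDiagram.ext h) (finite_toSet _)).toFinset

theorem mem_boxed {k m : ℕ} {mu : YoungDiagram} :
    mu ∈ boxed k m ↔ ∀ i j, (i, j) ∈ mu → i < k ∧ j < m := by simp [boxed]

theorem mem_boxed_iff {k m : ℕ} {mu : YoungDiagram} :
    mu ∈ boxed k m ↔ (∀ i ≥ k, mu.rowLen i = 0) ∧ ∀ i, mu.rowLen i ≤ m := by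
  rw [mem_boxed]
  constructor
  · intro h
    refine ⟨fun i hi => ?_, fun i => ?_⟩
    · by_contra hc
      have := (h i 0 (mem_iff_lt_rowLen.2 (Nat.pos_of_ne_zero hc))).1
      omega
    · by_contra hc
      have := (h i m (mem_iff_lt_rowLen.2 (by omega))).2
      omega
  · rintro ⟨h1, h2⟩ i j hc
    rw [mem_iff_lt_rowLen] at hc
    have := h2 i
    refine ⟨?_, by omega⟩
    by_contra hi
    have := h1 i (by omega)
    omega

theorem boxed_mono {k m k' m' : ℕ} (hk : k ≤ k') (hm : m ≤ m') : boxed k m ⊆ boxed k' m' := by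
  intro mu h
  rw [mem_boxed] at h ⊢
  intro i j hc
  have := h i j hc
  omega

theorem mem_boxed_of_le {k m : ℕ} {mu nu : YoungDiagram} (h : nu ∈ boxed k m) (hle : mu ≤ nu) :
    mu ∈ boxed k m := by
  rw [mem_boxed] at h ⊢
  exact fun i j hc => h i j (hle hc)

theorem mem_boxed_self (mu : YoungDiagram) : mu ∈ boxed (mu.colLen 0) (mu.rowLen 0) := by
  rw [mem_boxed_iff]
  exact ⟨fun i hi => rowLen_eq_zero hi, fun i => mu.rowLen_anti _ _ (Nat.zero_le _)⟩

end YoungDiagram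

/-! ### The structure constants as coefficients of products. -/

namespace SetValuedTableau

open YoungDiagram

variable {mu : YoungDiagram}

theorem IsLattice.antitone_content {lam : YoungDiagram} {T : SetValuedTableau mu}
    (hT : T.IsLattice lam) : Antitone (T.content lam) := by
  refine antitone_nat_of_succ_le fun l => ?_
  have h := hT (mu.colLen 0) l
  rw [content, content, T.weight_eq_upper le_rfl l, T.weight_eq_upper (Nat.le_succ _) (l + 1)]
  exact h

theorem content_eq_zero {lam : YoungDiagram} {T : SetValuedTableau mu} {k l : ℕ}
    (hT : T.Bounded k) (hl : k ≤ l) (hlam : lam.rowLen l = 0) : T.content lam l = 0 := by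
  rw [content, hlam, (T.weight_eq_zero_iff l).2 fun p j h => by have := hT p j l h; omega]

theorem IsLattice.exists_diagram {lam : YoungDiagram} {T : SetValuedTableau mu}
    (hT : T.IsLattice lam) : ∃ nu : YoungDiagram, ∀ l, T.content lam l = nu.rowLen l := by
  obtain ⟨k, hk⟩ := T.exists_letter_bound
  refine ⟨ofParts _ hT.antitone_content (max k (lam.colLen 0)), fun l => ?_⟩
  rw [rowLen_ofParts]
  exact content_eq_zero hk (le_max_left _ _) (rowLen_eq_zero (le_max_right _ _))

theorem weight_le_card (T : SetValuedTableau mu) (l : ℕ) : T.weight l ≤ mu.card :=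
  card_filter_le _ _

/-- The fillings of shape `mu` that extend the superstandard tableau of shape `lam` to a filling
of content `nu`. -/
def LR (lam mu nu : YoungDiagram) : Type :=
  {T : SetValuedTableau mu // T.IsLattice lam ∧ ∀ l, T.content lam l = nu.rowLen l}

theorem bounded_of_content {lam nu : YoungDiagram} {T : SetValuedTableau mu} {k : ℕ}
    (h : ∀ l, T.content lam l = nu.rowLen l) (hk : ∀ i ≥ k, nu.rowLen i = 0) : T.Bounded k := by
  intro p j l hl
  by_contra hkl
  have h1 := h l
  rw [hk l (by omega), content] at h1
  exact (T.weight_eq_zero_iff l).1 (by omega) p j hl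

instance (lam mu nu : YoungDiagram) : Finite (LR lam mu nu) :=
  ((finite_bounded mu (nu.colLen 0)).subset fun _ hT =>
    bounded_of_content hT.2 fun _ hi => rowLen_eq_zero hi : Set.Finite
      {T : SetValuedTableau mu | T.IsLattice lam ∧ ∀ l, T.content lam l = nu.rowLen l})

/-- The number of fillings of shape `mu` relative to `lam` with content `nu`. -/
noncomputable def lrCount (lam mu nu : YoungDiagram) : ℕ := Nat.card (LR lam mu nu)

open Classical in
theorem lrCount_eq {lam mu nu : YoungDiagram} {k : ℕ} (hk : ∀ i ≥ k, nu.rowLen i = 0) :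
    lrCount lam mu nu =
      #{T ∈ bounded mu k | T.IsLattice lam ∧ ∀ l, T.content lam l = nu.rowLen l} := by
  rw [lrCount, LR, Nat.subtype_card]
  intro T
  rw [mem_filter, mem_bounded]
  exact ⟨fun h => h.2, fun h => ⟨bounded_of_content h.2 hk, h⟩⟩

theorem LR.le {lam mu nu : YoungDiagram} (T : LR lam mu nu) : lam ≤ nu := by
  rw [le_iff_rowLen]
  intro i
  rw [← T.2.2, content]
  omega

theorem le_of_lrCount_ne_zero {lam mu nu : YoungDiagram} (h : lrCount lam mu nu ≠ 0) :
    lam ≤ nu := by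
  have : Nonempty (LR lam mu nu) := by
    by_contra hc
    rw [not_nonempty_iff] at hc
    exact h Nat.card_of_isEmpty
  exact this.some.le

open alternant in
/-- The alternant of `nu`. -/
noncomputable def alt (k : ℕ) (nu : YoungDiagram) : MvPolynomial (Fin k) ℤ :=
  alternant k (jterm k nu.rowLen)

/-- A letter occurs at most `mu.card` times, so every content fits in width `m'`. -/
theorem gpoly_mul_alt {k m m' : ℕ} {lam : YoungDiagram} (hlam : lam ∈ boxed k m)
    (hm : m + mu.card ≤ m') :
    gpoly k mu * alt k lam = ∑ nu ∈ boxed k m', lrCount lam mu nu • alt k nu := by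
  classical
  rw [mem_boxed_iff] at hlam
  rw [alt, gpoly_mul_alternant]
  choose! D hD using fun (T : SetValuedTableau mu) (hT : T.IsLattice lam) => hT.exists_diagram
  rw [← sum_fiberwise_of_maps_to (g := D) (t := boxed k m')]
  · refine sum_congr rfl fun nu hnu => ?_
    have e : {T ∈ {T ∈ bounded mu k | T.IsLattice lam} | D T = nu} =
        {T ∈ bounded mu k | T.IsLattice lam ∧ ∀ l, T.content lam l = nu.rowLen l} := by
      ext T
      simp only [mem_filter]
      constructor
      · rintro ⟨⟨h1, h2⟩, rfl⟩
        exact ⟨h1, h2, hD T h2⟩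
      · rintro ⟨h1, h2, h3⟩
        exact ⟨⟨h1, h2⟩, ext_rowLen fun i => by rw [← hD T h2, h3]⟩
    rw [e, lrCount_eq (mem_boxed_iff.1 hnu).1, ← sum_const]
    refine sum_congr rfl fun T hT => ?_
    rw [alt, show T.content lam = nu.rowLen from funext (mem_filter.1 hT).2.2]
  · intro T hT
    obtain ⟨h1, h2⟩ := mem_filter.1 hT
    rw [mem_boxed_iff]
    refine ⟨fun i hi => ?_, fun i => ?_⟩
    · rw [← hD T h2]
      exact content_eq_zero (mem_bounded.1 h1) hi (hlam.1 i hi)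
    · rw [← hD T h2, content]
      have := T.weight_le_card i
      have := hlam.2 i
      omega

theorem alt_independent {k m : ℕ} (c c' : YoungDiagram → ℕ)
    (h : ∑ nu ∈ boxed k m, c nu • alt k nu = ∑ nu ∈ boxed k m, c' nu • alt k nu) :
    ∀ nu ∈ boxed k m, c nu = c' nu := by
  intro nu hnu
  have := alternant.linear_independent (k := k) (boxed k m) rowLen antitone_rowLen
    (fun a ha b hb hab => ext_rowLen fun i => by
      rcases lt_or_ge i k with hi | hi
      · exact hab ⟨i, hi⟩
      · rw [(mem_boxed_iff.1 ha).1 i hi, (mem_boxed_iff.1 hb).1 i hi])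
    (fun nu => (c nu : ℤ) - c' nu) (by
      simp only [sub_smul, sum_sub_distrib, natCast_zsmul]
      rw [sub_eq_zero]
      exact h) nu hnu
  omega

theorem sum_lrCount_boxed {k m k' m' : ℕ} (hk : k ≤ k') (hm : m ≤ m') {lam mu rho tau : YoungDiagram}
    (htau : tau ∈ boxed k m) :
    ∑ nu ∈ boxed k m, lrCount lam mu nu * lrCount nu rho tau =
      ∑ nu ∈ boxed k' m', lrCount lam mu nu * lrCount nu rho tau := by
  refine sum_subset (boxed_mono hk hm) fun nu _ h => ?_
  by_contra hc
  exact h (mem_boxed_of_le htau (le_of_lrCount_ne_zero (right_ne_zero_of_mul hc)))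

/-- Both sides are the coefficient of the alternant of `tau` in the product of the alternant of
`lam` with the polynomials of `mu` and `rho`, multiplied in the two possible orders. -/
theorem sum_lrCount_comm {k m : ℕ} (lam mu rho : YoungDiagram) {tau : YoungDiagram}
    (htau : tau ∈ boxed k m) :
    ∑ nu ∈ boxed k m, lrCount lam mu nu * lrCount nu rho tau =
      ∑ nu ∈ boxed k m, lrCount lam rho nu * lrCount nu mu tau := by
  -- The expansions need boxes that contain `lam` and all partitions produced by two
  -- multiplications; partitions outside the given box do not contribute to `tau`.
  set k' := max k (lam.colLen 0)
  set m₁ := max m (lam.rowLen 0)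
  set m₂ := m₁ + mu.card + rho.card
  set m₃ := m₂ + mu.card + rho.card
  have hlam : lam ∈ boxed k' m₁ :=
    boxed_mono (le_max_right _ _) (le_max_right _ _) (mem_boxed_self lam)
  have key : ∀ mu rho : YoungDiagram, m₁ + mu.card ≤ m₂ → m₂ + rho.card ≤ m₃ →
      gpoly k' rho * (gpoly k' mu * alt k' lam) = ∑ tau ∈ boxed k' m₃,
        (∑ nu ∈ boxed k' m₂, lrCount lam mu nu * lrCount nu rho tau) • alt k' tau := by
    intro mu rho h1 h2
    rw [gpoly_mul_alt hlam h1, mul_sum]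
    simp only [sum_smul]
    rw [sum_comm]
    refine sum_congr rfl fun nu hnu => ?_
    rw [mul_smul_comm, gpoly_mul_alt hnu h2, smul_sum]
    simp only [mul_smul]
  have h := (key mu rho (by omega) (by omega)).symm.trans
    ((mul_left_comm _ _ _).trans (key rho mu (by omega) (by omega)))
  rw [sum_lrCount_boxed (le_max_left _ _) (show m ≤ m₂ by omega) htau,
    sum_lrCount_boxed (le_max_left _ _) (show m ≤ m₂ by omega) htau]
  exact alt_independent _ _ h tau (boxed_mono (le_max_left _ _) (show m ≤ m₃ by omega) htau)

/-! ### Symmetry in the two partitions -/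

theorem le_of_mem (T : SetValuedTableau mu) {p j l : ℕ} (h : l ∈ T.entry p j) : p ≤ l := by
  induction p generalizing l with
  | zero => exact Nat.zero_le _
  | succ p ih =>
    obtain ⟨z, hz⟩ := (T.nonempty_iff p j).2 (mu.up_left_mem (Nat.le_succ p) le_rfl (T.mem_shape h))
    have := T.col_strict p (p + 1) j (by omega) z hz l h
    have := ih hz
    omega

/-- The superstandard tableau. -/
noncomputable def superstandard (mu : YoungDiagram) : SetValuedTableau mu where
  entry i j := if (i, j) ∈ mu then {i} else ∅
  nonempty_iff i j := by
    split_ifs with h <;> simp [h]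
  row_weak i j₁ j₂ _ a ha b hb := by
    split_ifs at ha hb <;> simp_all
  col_strict i₁ i₂ j _ a ha b hb := by
    split_ifs at ha hb <;> simp_all

theorem mem_superstandard {p j l : ℕ} : l ∈ (superstandard mu).entry p j ↔ (p, j) ∈ mu ∧ l = p := by
  change l ∈ (if (p, j) ∈ mu then {p} else ∅ : Finset ℕ) ↔ _
  split_ifs with h <;> simp [h]

theorem rowCount_superstandard (p l : ℕ) :
    (superstandard mu).rowCount p l = if p = l then mu.rowLen l else 0 := by
  simp only [rowCount, mem_superstandard]
  split_ifs with h
  · subst h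
    rw [filter_true_of_mem, card_range]
    exact fun j hj => ⟨mem_iff_lt_rowLen.2 (mem_range.1 hj), rfl⟩
  · rw [card_eq_zero, filter_eq_empty_iff]
    rintro j _ ⟨_, h'⟩
    exact h h'.symm

theorem upper_superstandard (p l : ℕ) :
    (superstandard mu).upper p l = if l < p then mu.rowLen l else 0 := by
  simp [upper, rowCount_superstandard]

theorem rowLen_bot (i : ℕ) : (⊥ : YoungDiagram).rowLen i = 0 := by
  rw [rowLen_eq_card]
  simp [YoungDiagram.row]

theorem isLattice_superstandard : (superstandard mu).IsLattice ⊥ := by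
  intro p l
  rw [upper_superstandard, upper_superstandard, rowLen_bot, rowLen_bot]
  have := mu.rowLen_anti l (l + 1) (by omega)
  split_ifs <;> omega

/-- For empty `lam` a letter `l + 1` needs an `l` in a strictly higher row. With the opposite bound
from column strictness, row `p` contains only the letter `p`. -/
theorem IsLattice.le_of_bot {T : SetValuedTableau mu} (hT : T.IsLattice ⊥) {p j l : ℕ}
    (h : l ∈ T.entry p j) : l ≤ p := by
  induction l generalizing p j with
  | zero => exact Nat.zero_le _
  | succ l ih =>
    have h1 := hT p l
    rw [rowLen_bot, rowLen_bot, T.upper_succ] at h1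
    have h2 : 0 < T.rowCount p (l + 1) :=
      card_pos.2 ⟨j, mem_filter.2 ⟨mem_range.2 (mem_iff_lt_rowLen.1 (T.mem_shape h)), h⟩⟩
    have h3 : 0 < T.upper p l := by omega
    rw [T.upper_eq_card, card_pos] at h3
    obtain ⟨c, hc⟩ := h3
    rw [mem_filter] at hc
    have := ih hc.2.2
    omega

theorem IsLattice.eq_superstandard {T : SetValuedTableau mu} (hT : T.IsLattice ⊥) :
    T = superstandard mu := by
  ext p j l
  rw [mem_superstandard]
  constructor
  · exact fun h => ⟨T.mem_shape h, (hT.le_of_bot h).antisymm (T.le_of_mem h)⟩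
  · rintro ⟨h, rfl⟩
    obtain ⟨z, hz⟩ := (T.nonempty_iff l j).2 h
    rwa [(hT.le_of_bot hz).antisymm (T.le_of_mem hz)] at hz

theorem content_superstandard (l : ℕ) : (superstandard mu).content ⊥ l = mu.rowLen l := by
  rw [content, rowLen_bot, zero_add, weight_eq_upper _ (le_max_left (mu.colLen 0) (l + 1)),
    upper_superstandard, if_pos (by omega)]

open Classical in
theorem lrCount_bot (mu nu : YoungDiagram) : lrCount ⊥ mu nu = if nu = mu then 1 else 0 := by
  split_ifs with h
  · subst h
    rw [lrCount, Nat.card_eq_one_iff_unique]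
    refine ⟨⟨fun T T' => Subtype.ext ?_⟩, ⟨superstandard nu, isLattice_superstandard,
      content_superstandard⟩⟩
    rw [T.2.1.eq_superstandard, T'.2.1.eq_superstandard]
  · rw [lrCount, Nat.card_eq_zero]
    left
    refine ⟨fun T => h (ext_rowLen fun i => ?_)⟩
    rw [← T.2.2, T.2.1.eq_superstandard, content_superstandard]

/-- The empty partition is a unit by `lrCount_bot`, so this is the symmetry for three partitions,
the first of them empty. The sums run over partitions in the box of `nu`; hence partitions not
contained in `nu` are treated separately. -/
theorem lrCount_comm (lam mu nu : YoungDiagram) : lrCount lam mu nu = lrCount mu lam nu := by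
  classical
  by_cases h : lam ≤ nu ∧ mu ≤ nu
  · have := sum_lrCount_comm ⊥ lam mu (mem_boxed_self nu)
    simp only [lrCount_bot, ite_mul, one_mul, zero_mul, sum_ite_eq',
      mem_boxed_of_le (mem_boxed_self nu) h.1, mem_boxed_of_le (mem_boxed_self nu) h.2,
      if_true] at this
    exact this
  -- If `mu` is not contained in `nu`, the right side is zero. A non-zero left side would equal a
  -- sum whose only possible term, the one at `mu`, vanishes as well.
  · have key : ∀ lam mu : YoungDiagram, ¬ mu ≤ nu → lrCount lam mu nu = lrCount mu lam nu := by
      intro lam mu h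
      rw [show lrCount mu lam nu = 0 by
        by_contra hc
        exact h (le_of_lrCount_ne_zero hc)]
      by_contra hc
      have hle := le_of_lrCount_ne_zero hc
      have := sum_lrCount_comm ⊥ lam mu (mem_boxed_self nu)
      simp only [lrCount_bot, ite_mul, one_mul, zero_mul, sum_ite_eq',
        mem_boxed_of_le (mem_boxed_self nu) hle, if_true] at this
      rw [this] at hc
      split_ifs at hc with h1
      · exact h (le_of_lrCount_ne_zero hc)
      · exact hc rfl
    rw [not_and_or] at h
    rcases h with h | h
    · exact (key mu lam h).symm
    · exact key lam mu h

end SetValuedTableau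

/-! ### Rows and columns -/

namespace SetValuedTableau

open YoungDiagram

variable {mu lam nu : YoungDiagram}

theorem upper_one (T : SetValuedTableau mu) (l : ℕ) : T.upper 1 l = T.rowCount 0 l := by
  rw [T.upper_succ, upper_zero, zero_add]

theorem weight_of_row (hmu : mu.colLen 0 ≤ 1) (T : SetValuedTableau mu) (l : ℕ) :
    T.weight l = T.rowCount 0 l := by
  rw [T.weight_eq_upper hmu, upper_one]

theorem isLattice_row_iff (hmu : mu.colLen 0 ≤ 1) {T : SetValuedTableau mu} :
    T.IsLattice lam ↔ ∀ l, T.content lam (l + 1) ≤ lam.rowLen l := by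
  constructor
  · intro h l
    have := h 0 l
    rwa [upper_zero, ← T.weight_eq_upper (by omega)] at this
  · intro h p l
    have h1 := h l
    have h2 := T.upper_le_weight (p + 1) (l + 1)
    rw [content] at h1
    omega

/-- A letter occurs in at most one cell of a tableau which consists of one column. -/
theorem weight_of_col (hmu : mu.rowLen 0 ≤ 1) (T : SetValuedTableau mu) (l : ℕ) :
    T.weight l ≤ 1 ∧ (0 < T.weight l ↔ ∃ p, l ∈ T.entry p 0) := by
  have h0 : ∀ p j, (p, j) ∈ mu → j = 0 := fun p j h => by
    have := mem_iff_lt_rowLen.1 (mu.up_left_mem (Nat.zero_le p) le_rfl h)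
    omega
  constructor
  · rw [weight, card_le_one]
    rintro ⟨p, j⟩ h ⟨p', j'⟩ h'
    rw [mem_filter, mem_cells] at h h'
    obtain rfl := h0 _ _ h.1
    obtain rfl := h0 _ _ h'.1
    exact Prod.ext (T.col_unique h.2 h'.2) rfl
  · rw [Nat.pos_iff_ne_zero, Ne, weight_eq_zero_iff]
    push Not
    constructor
    · rintro ⟨p, j, h⟩
      obtain rfl := h0 _ _ (T.mem_shape h)
      exact ⟨p, h⟩
    · rintro ⟨p, h⟩
      exact ⟨p, 0, h⟩

/-- There is nothing to the right of the only column, so a violation just compares two consecutive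
rows of `lam`. -/
theorem isLattice_col_iff (hmu : mu.rowLen 0 ≤ 1) {T : SetValuedTableau mu} :
    T.IsLattice lam ↔ ∀ p l, l + 1 ∈ T.entry p 0 → lam.rowLen (l + 1) = lam.rowLen l →
      ∃ p' < p, l ∈ T.entry p' 0 := by
  rw [isLattice_iff_no_violation]
  have h1 : ∀ l, T.rightCount 1 l = 0 := fun l => T.rightCount_eq_zero hmu l
  constructor
  · intro h p l hl e
    by_contra hc
    refine h 0 l ⟨⟨p, hl⟩, by rw [h1, h1, e], ?_⟩
    rintro ⟨a, b, hab, ha, hb⟩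
    obtain rfl := T.col_unique hb hl
    exact hc ⟨a, hab, ha⟩
  · rintro h j l ⟨⟨p, hp⟩, h2, h3⟩
    have h4 := mem_iff_lt_rowLen.1 (mu.up_left_mem (Nat.zero_le p) le_rfl (T.mem_shape hp))
    obtain rfl : j = 0 := by omega
    rw [zero_add, h1, h1] at h2
    have := lam.rowLen_anti l (l + 1) (by omega)
    obtain ⟨p', h5, h6⟩ := h p l hp (by omega)
    exact h3 ⟨p', p, h5, h6, hp⟩

/-- The position of a letter of a column among the rows of `lam` of the same length. -/
theorem letter_of_col (hmu : mu.rowLen 0 ≤ 1) {T : SetValuedTableau mu} (hT : T.IsLattice lam)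
    {p i c : ℕ} (h : i ∈ T.entry p 0) (hc : lam.rowLen i = c) :
    i = lam.colLen c + #{p' ∈ range p | c ∈ (T.entry p' 0).image lam.rowLen} := by
  rw [isLattice_col_iff hmu] at hT
  induction i generalizing p with
  | zero =>
    have h1 : lam.colLen c = 0 := by
      by_contra h1
      have := mem_iff_lt_rowLen.1 (mem_iff_lt_colLen.2 (Nat.pos_of_ne_zero h1))
      omega
    rw [h1, filter_false_of_mem, card_empty]
    intro p' hp' h2
    obtain ⟨x, hx, -⟩ := mem_image.1 h2
    have := T.col_strict p' p 0 (mem_range.1 hp') x hx 0 h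
    omega
  | succ i ih =>
    -- If row `i` of `lam` also has length `c`, the letter `i` occurs higher up, and between these
    -- two cells there is no further letter whose row has length `c`. Otherwise `i + 1` is the first
    -- row of length `c`.
    by_cases e : lam.rowLen i = c
    · obtain ⟨p', hp', hi⟩ := hT p i h (by omega)
      have h1 := ih hi e
      have h2 : {x ∈ range p | c ∈ (T.entry x 0).image lam.rowLen} =
          insert p' {x ∈ range p' | c ∈ (T.entry x 0).image lam.rowLen} := by
        ext x
        simp only [mem_filter, mem_range, mem_insert]
        constructor
        · rintro ⟨h3, h4⟩
          rcases lt_trichotomy x p' with h5 | h5 | h5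
          · exact Or.inr ⟨h5, h4⟩
          · exact Or.inl h5
          · obtain ⟨y, hy, -⟩ := mem_image.1 h4
            have := T.col_strict p' x 0 h5 _ hi _ hy
            have := T.col_strict x p 0 h3 _ hy _ h
            omega
        · rintro (rfl | ⟨h3, h4⟩)
          · exact ⟨hp', mem_image.2 ⟨i, hi, e⟩⟩
          · exact ⟨by omega, h4⟩
      rw [h2, card_insert_of_notMem (by simp)]
      omega
    · have h1 : lam.colLen c = i + 1 := by
        have := lam.rowLen_anti i (i + 1) (by omega)
        refine le_antisymm ?_ ?_
        · by_contra hh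
          have := mem_iff_lt_rowLen.1 (mem_iff_lt_colLen.2 (show i + 1 < lam.colLen c by omega))
          omega
        · have := mem_iff_lt_colLen.1 (mem_iff_lt_rowLen.2 (show c < lam.rowLen i by omega))
          omega
      rw [h1, filter_false_of_mem, card_empty]
      intro p' hp' h2
      obtain ⟨x, hx, h3⟩ := mem_image.1 h2
      have h4 := T.col_strict p' p 0 (mem_range.1 hp') x hx _ h
      have := lam.rowLen_anti x i (by omega)
      have := lam.rowLen_anti i (i + 1) (by omega)
      have := lam.rowLen_anti x (i + 1) (by omega)
      omega

theorem mem_of_col (hmu : mu.rowLen 0 ≤ 1) {p j : ℕ} : (p, j) ∈ mu ↔ p < mu.colLen 0 ∧ j = 0 := by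
  constructor
  · intro h
    have := mem_iff_lt_rowLen.1 (mu.up_left_mem (Nat.zero_le p) le_rfl h)
    obtain rfl : j = 0 := by omega
    exact ⟨mem_iff_lt_colLen.1 h, rfl⟩
  · rintro ⟨h, rfl⟩
    exact mem_iff_lt_colLen.2 h

theorem mem_transpose_of_col (hmu : mu.rowLen 0 ≤ 1) {p j : ℕ} :
    (p, j) ∈ mu.transpose ↔ j < mu.colLen 0 ∧ p = 0 := by
  rw [mem_transpose]
  exact mem_of_col hmu

theorem exists_card_filter_gt {s : Finset ℕ} {t : ℕ} (ht : t < #s) :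
    ∃ j ∈ s, #{j' ∈ s | j < j'} = t := by
  induction s using Finset.induction_on_min generalizing t with
  | empty => simp at ht
  | insert a s ha ih =>
    have h1 : a ∉ s := fun h => lt_irrefl _ (ha a h)
    rw [card_insert_of_notMem h1] at ht
    rcases (Nat.lt_succ_iff.1 ht).eq_or_lt with rfl | h
    · refine ⟨a, mem_insert_self _ _, ?_⟩
      rw [filter_insert, if_neg (lt_irrefl _), filter_true_of_mem ha]
    · obtain ⟨j, hj, hj'⟩ := ih h
      exact ⟨j, mem_insert_of_mem hj, by rw [filter_insert, if_neg (ha j hj).le.not_gt, hj']⟩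

/-- The row which corresponds to a column filling. -/
noncomputable def colToRow (hmu : mu.rowLen 0 ≤ 1) (lam : YoungDiagram) (T : SetValuedTableau mu) :
    SetValuedTableau mu.transpose where
  entry p j := if p = 0 ∧ j < mu.colLen 0 then
    (T.entry (mu.colLen 0 - 1 - j) 0).image lam.rowLen else ∅
  nonempty_iff p j := by
    rw [mem_transpose_of_col hmu]
    split_ifs with h
    · rw [image_nonempty, T.nonempty_iff, mem_of_col hmu]
      omega
    · simp only [Finset.not_nonempty_empty, false_iff]
      tauto
  row_weak p j₁ j₂ hj a ha b hb := by
    split_ifs at ha hb with h1 h2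
    · obtain ⟨x, hx, rfl⟩ := mem_image.1 ha
      obtain ⟨y, hy, rfl⟩ := mem_image.1 hb
      exact lam.rowLen_anti _ _ (T.col_strict _ _ 0 (by omega) y hy x hx).le
    all_goals simp_all
  col_strict p₁ p₂ j hp a ha b hb := by
    rw [if_neg (by omega)] at hb
    simp at hb

theorem mem_colToRow (hmu : mu.rowLen 0 ≤ 1) (T : SetValuedTableau mu) {p j c : ℕ} :
    c ∈ (colToRow hmu lam T).entry p j ↔
      p = 0 ∧ j < mu.colLen 0 ∧ ∃ i ∈ T.entry (mu.colLen 0 - 1 - j) 0, lam.rowLen i = c := by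
  change c ∈ (if p = 0 ∧ j < mu.colLen 0 then
    (T.entry (mu.colLen 0 - 1 - j) 0).image lam.rowLen else ∅ : Finset ℕ) ↔ _
  split_ifs with h
  · rw [mem_image]
    tauto
  · simp only [notMem_empty, false_iff]
    tauto

theorem colLen_eq_card (mu : YoungDiagram) {k : ℕ} (hk : mu.colLen 0 ≤ k) (c : ℕ) :
    mu.colLen c = #{i ∈ range k | c < mu.rowLen i} := by
  have : {i ∈ range k | c < mu.rowLen i} = range (mu.colLen c) := by
    ext i
    simp only [mem_filter, mem_range, ← mem_iff_lt_rowLen, ← mem_iff_lt_colLen, and_iff_right_iff_imp]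
    intro h
    have := mem_iff_lt_colLen.1 (mu.up_left_mem le_rfl (Nat.zero_le c) h)
    omega
  rw [this, card_range]

/-- The cells that `nu` adds in column `c` of `lam` are those at the end of the rows `i` of length
`c` for which the letter `i` occurs. By `letter_of_col` they correspond to the cells of the new row
that contain `c`. -/
theorem content_colToRow (hmu : mu.rowLen 0 ≤ 1) {T : SetValuedTableau mu} (hT : T.IsLattice lam)
    (h : ∀ l, T.content lam l = nu.rowLen l) (c : ℕ) :
    (colToRow hmu lam T).content lam.transpose c = nu.transpose.rowLen c := by
  classical
  have hw := T.weight_of_col hmu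
  have hle : lam ≤ nu := le_iff_rowLen.2 fun i => by
    rw [← h, content]
    omega
  have hcol : lam.colLen 0 ≤ nu.colLen 0 := by
    by_contra hc
    push Not at hc
    have := mem_iff_lt_colLen.1 (hle (mem_iff_lt_colLen.2 hc))
    omega
  have e1 : nu.colLen c = lam.colLen c +
      #{i ∈ range (nu.colLen 0) | lam.rowLen i = c ∧ ∃ p, i ∈ T.entry p 0} := by
    rw [colLen_eq_card nu le_rfl, colLen_eq_card lam hcol, ← card_union_of_disjoint]
    · congr 1
      ext i
      simp only [mem_union, mem_filter, mem_range, ← (hw _).2, ← h, content]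
      have := (hw i).1
      constructor
      · intro hh
        by_cases h3 : c < lam.rowLen i
        · exact Or.inl ⟨hh.1, h3⟩
        · exact Or.inr ⟨hh.1, by omega, by omega⟩
      · rintro (h3 | h3)
        · exact ⟨h3.1, by omega⟩
        · exact ⟨h3.1, by omega⟩
    · rw [disjoint_left]
      intro i h1 h2
      simp only [mem_filter] at h1 h2
      omega
  have hrow : mu.transpose.rowLen 0 = mu.colLen 0 := by rw [rowLen_transpose]
  rw [rowLen_transpose, e1, content, rowLen_transpose, weight_of_row (by
    rw [colLen_transpose]; exact hmu), rowCount, hrow]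
  congr 1
  refine card_bij' (fun j _ => lam.colLen c +
      #{p' ∈ range (mu.colLen 0 - 1 - j) | c ∈ (T.entry p' 0).image lam.rowLen})
    (fun i hi => mu.colLen 0 - 1 - (mem_filter.1 hi).2.2.choose) ?_ ?_ ?_ ?_
  · intro j hj
    obtain ⟨h1, -, h2, i, hi, hic⟩ := by simpa only [mem_filter, mem_colToRow] using hj
    rw [← letter_of_col hmu hT hi hic, mem_filter]
    refine ⟨mem_range.2 ?_, hic, _, hi⟩
    by_contra hh
    have h3 := h i
    rw [rowLen_eq_zero (mu := nu) (by omega), content] at h3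
    have := (hw i).2.2 ⟨_, hi⟩
    omega
  · intro i hi
    have hs := (mem_filter.1 hi).2.2.choose_spec
    have h1 := (mem_of_col hmu).1 (T.mem_shape hs)
    rw [mem_filter, mem_colToRow, mem_range]
    refine ⟨by omega, rfl, by omega, i, ?_, (mem_filter.1 hi).2.1⟩
    rw [show mu.colLen 0 - 1 - (mu.colLen 0 - 1 - (mem_filter.1 hi).2.2.choose) =
      (mem_filter.1 hi).2.2.choose by omega]
    exact hs
  · intro j hj
    generalize_proofs h0
    have hs := h0.choose_spec
    obtain ⟨h1, -, h2, i, hi, hic⟩ := by simpa only [mem_filter, mem_colToRow] using hj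
    have hl := letter_of_col hmu hT hi hic
    have h3 := T.col_unique hs (hl ▸ hi)
    omega
  · intro i hi
    generalize_proofs h0
    have hs := h0.choose_spec
    have h1 := (mem_of_col hmu).1 (T.mem_shape hs)
    rw [show mu.colLen 0 - 1 - (mu.colLen 0 - 1 - h0.choose) = h0.choose by omega]
    exact (letter_of_col hmu hT hs (mem_filter.1 hi).2.1).symm

theorem isLattice_colToRow (hmu : mu.rowLen 0 ≤ 1) {T : SetValuedTableau mu} (hT : T.IsLattice lam) :
    (colToRow hmu lam T).IsLattice lam.transpose := by
  obtain ⟨nu, h⟩ := hT.exists_diagram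
  rw [isLattice_row_iff (by rw [colLen_transpose]; exact hmu)]
  intro c
  rw [content_colToRow hmu hT h, rowLen_transpose, rowLen_transpose]
  by_contra hc
  push Not at hc
  have h1 := mem_iff_lt_rowLen.1 (mem_iff_lt_colLen.2 hc)
  rw [← h, content] at h1
  have := (T.weight_of_col hmu (lam.colLen c)).1
  have := mem_iff_lt_colLen.1 (mem_iff_lt_rowLen.2 (show c < lam.rowLen (lam.colLen c) by omega))
  omega

theorem colToRow_injective (hmu : mu.rowLen 0 ≤ 1) {T T' : SetValuedTableau mu}
    (hT : T.IsLattice lam) (hT' : T'.IsLattice lam) (e : colToRow hmu lam T = colToRow hmu lam T') :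
    T = T' := by
  have himg : ∀ p < mu.colLen 0, (T.entry p 0).image lam.rowLen = (T'.entry p 0).image lam.rowLen := by
    intro p hp
    ext c
    have := congrArg (fun U : SetValuedTableau mu.transpose =>
      c ∈ U.entry 0 (mu.colLen 0 - 1 - p)) e
    simp only [mem_colToRow, show mu.colLen 0 - 1 - (mu.colLen 0 - 1 - p) = p by omega,
      show mu.colLen 0 - 1 - p < mu.colLen 0 by omega, true_and, ← mem_image] at this
    exact iff_of_eq this
  have key : ∀ {T T' : SetValuedTableau mu}, T.IsLattice lam → T'.IsLattice lam →
      (∀ p < mu.colLen 0, (T.entry p 0).image lam.rowLen = (T'.entry p 0).image lam.rowLen) →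
      ∀ p j x, x ∈ T.entry p j → x ∈ T'.entry p j := by
    intro T T' hT hT' himg p j x hx
    obtain ⟨h1, rfl⟩ := (mem_of_col hmu).1 (T.mem_shape hx)
    have h2 : lam.rowLen x ∈ (T'.entry p 0).image lam.rowLen := by
      rw [← himg p h1]
      exact mem_image_of_mem _ hx
    obtain ⟨y, hy, hyx⟩ := mem_image.1 h2
    rw [letter_of_col hmu hT hx rfl, filter_congr fun p' hp' => by
      rw [himg p' ((mem_range.1 hp').trans h1)], ← letter_of_col hmu hT' hy hyx]
    exact hy
  ext p j x
  exact ⟨key hT hT' himg p j x, key hT' hT (fun p hp => (himg p hp).symm) p j x⟩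

/-- The rows of `lam` of length `c` start at `lam.colLen c`. The lattice condition of the row
filling bounds the number of letters `c` by the number of these rows, so the letter constructed for
`c` stays among them. -/
theorem rowLen_letter_of_row (hmu : mu.rowLen 0 ≤ 1) {T : SetValuedTableau mu.transpose}
    (hT : T.IsLattice lam.transpose) {j c : ℕ} (hc : c ∈ T.entry 0 j) :
    lam.rowLen (lam.colLen c + #{j' ∈ range (mu.colLen 0) | j < j' ∧ c ∈ T.entry 0 j'}) = c := by
  have hmu' : mu.transpose.colLen 0 ≤ 1 := by rwa [colLen_transpose]
  have hj := ((mem_transpose_of_col hmu).1 (T.mem_shape hc)).1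
  set i := lam.colLen c + #{j' ∈ range (mu.colLen 0) | j < j' ∧ c ∈ T.entry 0 j'} with hi
  have h1 : lam.rowLen i ≤ c := by
    by_contra h
    have := mem_iff_lt_colLen.1 (mem_iff_lt_rowLen.2 (show c < lam.rowLen i by omega))
    omega
  refine h1.antisymm ?_
  by_contra h
  obtain ⟨d, rfl⟩ : ∃ d, c = d + 1 := ⟨c - 1, by omega⟩
  have h2 : ¬ i < lam.colLen d := fun h2 => by
    have := mem_iff_lt_rowLen.1 (mem_iff_lt_colLen.2 h2)
    omega
  have h3 := (isLattice_row_iff hmu').1 hT d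
  rw [content, rowLen_transpose, rowLen_transpose, weight_of_row hmu', rowCount,
    rowLen_transpose] at h3
  have h4 : #{j' ∈ range (mu.colLen 0) | j < j' ∧ d + 1 ∈ T.entry 0 j'} <
      #{j' ∈ range (mu.colLen 0) | d + 1 ∈ T.entry 0 j'} := by
    refine card_lt_card ⟨fun x hx => ?_, fun h => ?_⟩
    · rw [mem_filter] at hx ⊢
      exact ⟨hx.1, hx.2.2⟩
    · have := h (mem_filter.2 ⟨mem_range.2 hj, hc⟩)
      rw [mem_filter] at this
      omega
  omega

/-- The column which corresponds to a row filling. -/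
noncomputable def rowToCol (hmu : mu.rowLen 0 ≤ 1) (T : SetValuedTableau mu.transpose)
    (hT : T.IsLattice lam.transpose) : SetValuedTableau mu where
  entry p j := if p < mu.colLen 0 ∧ j = 0 then
    (T.entry 0 (mu.colLen 0 - 1 - p)).image fun c => lam.colLen c +
      #{j' ∈ range (mu.colLen 0) | mu.colLen 0 - 1 - p < j' ∧ c ∈ T.entry 0 j'} else ∅
  nonempty_iff p j := by
    rw [mem_of_col hmu]
    split_ifs with h
    · rw [image_nonempty, T.nonempty_iff, mem_transpose_of_col hmu]
      omega
    · simp only [Finset.not_nonempty_empty, false_iff]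
      exact h
  row_weak p j₁ j₂ hj a ha b hb := by
    rw [if_neg (by omega)] at hb
    simp at hb
  col_strict p₁ p₂ j hp a ha b hb := by
    split_ifs at ha hb with h1 h2
    · obtain ⟨c, hc, rfl⟩ := mem_image.1 ha
      obtain ⟨d, hd, rfl⟩ := mem_image.1 hb
      have h3 := T.row_weak 0 _ _ (show mu.colLen 0 - 1 - p₂ < mu.colLen 0 - 1 - p₁ by omega)
        d hd c hc
      rcases h3.eq_or_lt with rfl | h3
      · rw [add_lt_add_iff_left]
        refine card_lt_card ⟨fun x hx => ?_, fun h => ?_⟩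
        · rw [mem_filter] at hx ⊢
          exact ⟨hx.1, by omega, hx.2.2⟩
        · have := h (mem_filter.2 ⟨mem_range.2 (show mu.colLen 0 - 1 - p₁ < mu.colLen 0 by omega),
            by omega, hc⟩)
          rw [mem_filter] at this
          omega
      · have h4 := rowLen_letter_of_row hmu hT hc
        have h5 := rowLen_letter_of_row hmu hT hd
        by_contra hh
        have := lam.rowLen_anti _ _ (not_lt.1 hh)
        omega
    all_goals simp_all

theorem mem_rowToCol (hmu : mu.rowLen 0 ≤ 1) {T : SetValuedTableau mu.transpose}
    (hT : T.IsLattice lam.transpose) {p l : ℕ} :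
    l ∈ (rowToCol hmu T hT).entry p 0 ↔ p < mu.colLen 0 ∧
      lam.rowLen l ∈ T.entry 0 (mu.colLen 0 - 1 - p) ∧ l = lam.colLen (lam.rowLen l) +
        #{j' ∈ range (mu.colLen 0) | mu.colLen 0 - 1 - p < j' ∧ lam.rowLen l ∈ T.entry 0 j'} := by
  change l ∈ (if p < mu.colLen 0 ∧ 0 = 0 then _ else ∅ : Finset ℕ) ↔ _
  split_ifs with h
  · rw [mem_image]
    constructor
    · rintro ⟨c, hc, rfl⟩
      rw [rowLen_letter_of_row hmu hT hc]
      exact ⟨h.1, hc, rfl⟩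
    · rintro ⟨h1, h2, h3⟩
      exact ⟨_, h2, h3.symm⟩
  · simp only [notMem_empty, false_iff]
    tauto

/-- If the rows `l` and `l + 1` of `lam` have the same length `c`, then `l` is the letter
constructed from the next occurrence of `c` to the right, which becomes a higher cell of the column.
-/
theorem isLattice_rowToCol (hmu : mu.rowLen 0 ≤ 1) {T : SetValuedTableau mu.transpose}
    (hT : T.IsLattice lam.transpose) : (rowToCol hmu T hT).IsLattice lam := by
  rw [isLattice_col_iff hmu]
  intro p l h e
  rw [mem_rowToCol, e] at h
  obtain ⟨h1, h2, h3⟩ := h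
  set c := lam.rowLen l with hc
  have hlen : lam.colLen c ≤ l := by
    by_contra hh
    have := mem_iff_lt_rowLen.1 (mem_iff_lt_colLen.2 (show l < lam.colLen c by omega))
    omega
  have h4 : l - lam.colLen c <
      #{j' ∈ range (mu.colLen 0) | mu.colLen 0 - 1 - p < j' ∧ c ∈ T.entry 0 j'} := by omega
  obtain ⟨j, hj, hj'⟩ := exists_card_filter_gt h4
  rw [mem_filter, mem_range] at hj
  refine ⟨mu.colLen 0 - 1 - j, by omega, ?_⟩
  rw [mem_rowToCol, show mu.colLen 0 - 1 - (mu.colLen 0 - 1 - j) = j by omega, ← hc]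
  refine ⟨by omega, hj.2.2, ?_⟩
  rw [filter_filter] at hj'
  have h5 : {j' ∈ range (mu.colLen 0) | j < j' ∧ c ∈ T.entry 0 j'} =
      {x ∈ range (mu.colLen 0) | (mu.colLen 0 - 1 - p < x ∧ c ∈ T.entry 0 x) ∧ j < x} := by
    refine filter_congr fun x _ => ⟨fun h => ⟨⟨by omega, h.2⟩, h.1⟩, fun h => ⟨h.2, h.1.2⟩⟩
  rw [h5, hj']
  omega

theorem content_rowToCol (hmu : mu.rowLen 0 ≤ 1) {T : SetValuedTableau mu.transpose}
    (hT : T.IsLattice lam.transpose) (h : ∀ l, T.content lam.transpose l = nu.transpose.rowLen l)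
    (l : ℕ) : (rowToCol hmu T hT).content lam l = nu.rowLen l := by
  have hmu' : mu.transpose.colLen 0 ≤ 1 := by rwa [colLen_transpose]
  have hle : lam ≤ nu := by
    rw [← transpose_le_iff, le_iff_rowLen]
    intro i
    rw [← h, content]
    omega
  have hle' := le_iff_rowLen.1 hle l
  set c := lam.rowLen l with hc
  have h1 : nu.rowLen l ≤ c + 1 := by
    by_contra hh
    have h2 := mem_iff_lt_colLen.1 (mem_iff_lt_rowLen.2 (show c + 1 < nu.rowLen l by omega))
    have h3 := (isLattice_row_iff hmu').1 hT c
    rw [h, rowLen_transpose, rowLen_transpose] at h3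
    have := mem_iff_lt_rowLen.1 (mem_iff_lt_colLen.2 (h2.trans_le h3))
    omega
  have hlen : lam.colLen c ≤ l := by
    by_contra hh
    have := mem_iff_lt_rowLen.1 (mem_iff_lt_colLen.2 (show l < lam.colLen c by omega))
    omega
  have hcol : nu.colLen c = lam.colLen c + #{j ∈ range (mu.colLen 0) | c ∈ T.entry 0 j} := by
    rw [← rowLen_transpose, ← h, content, rowLen_transpose, weight_of_row hmu', rowCount,
      rowLen_transpose]
  have key : (∃ p, l ∈ (rowToCol hmu T hT).entry p 0) ↔ c < nu.rowLen l := by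
    rw [← mem_iff_lt_rowLen, mem_iff_lt_colLen, hcol]
    constructor
    · rintro ⟨p, hp⟩
      rw [mem_rowToCol, ← hc] at hp
      obtain ⟨h2, h3, h4⟩ := hp
      have h5 : #{j' ∈ range (mu.colLen 0) | mu.colLen 0 - 1 - p < j' ∧ c ∈ T.entry 0 j'} <
          #{j' ∈ range (mu.colLen 0) | c ∈ T.entry 0 j'} := by
        refine card_lt_card ⟨fun x hx => ?_, fun h => ?_⟩
        · rw [mem_filter] at hx ⊢
          exact ⟨hx.1, hx.2.2⟩
        · have := h (mem_filter.2
            ⟨mem_range.2 (show mu.colLen 0 - 1 - p < mu.colLen 0 by omega), h3⟩)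
          rw [mem_filter] at this
          omega
      omega
    · intro h2
      obtain ⟨j, hj, hj'⟩ := exists_card_filter_gt (show l - lam.colLen c <
        #{j ∈ range (mu.colLen 0) | c ∈ T.entry 0 j} by omega)
      rw [mem_filter, mem_range] at hj
      refine ⟨mu.colLen 0 - 1 - j, ?_⟩
      rw [mem_rowToCol, show mu.colLen 0 - 1 - (mu.colLen 0 - 1 - j) = j by omega, ← hc]
      refine ⟨by omega, hj.2, ?_⟩
      rw [filter_filter] at hj'
      simp only [and_comm] at hj' ⊢
      omega
  obtain ⟨h2, h3⟩ := (rowToCol hmu T hT).weight_of_col hmu l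
  rw [key] at h3
  rw [content]
  omega

theorem rowToCol_injective (hmu : mu.rowLen 0 ≤ 1) {T T' : SetValuedTableau mu.transpose}
    (hT : T.IsLattice lam.transpose) (hT' : T'.IsLattice lam.transpose)
    (e : rowToCol hmu T hT = rowToCol hmu T' hT') : T = T' := by
  have key : ∀ {T T' : SetValuedTableau mu.transpose} (hT : T.IsLattice lam.transpose)
      (hT' : T'.IsLattice lam.transpose), rowToCol hmu T hT = rowToCol hmu T' hT' →
      ∀ p j x, x ∈ T.entry p j → x ∈ T'.entry p j := by
    intro T T' hT hT' e p j x hx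
    obtain ⟨hj, rfl⟩ := (mem_transpose_of_col hmu).1 (T.mem_shape hx)
    have h1 := rowLen_letter_of_row hmu hT hx
    set l := lam.colLen x + #{j' ∈ range (mu.colLen 0) | j < j' ∧ x ∈ T.entry 0 j'} with hl
    have h2 : l ∈ (rowToCol hmu T hT).entry (mu.colLen 0 - 1 - j) 0 := by
      rw [mem_rowToCol, show mu.colLen 0 - 1 - (mu.colLen 0 - 1 - j) = j by omega, h1]
      exact ⟨by omega, hx, hl⟩
    rw [e, mem_rowToCol, show mu.colLen 0 - 1 - (mu.colLen 0 - 1 - j) = j by omega, h1] at h2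
    exact h2.2.1
  ext p j x
  exact ⟨key hT hT' e p j x, key hT' hT e.symm p j x⟩

/-- Transposition symmetry for columns. -/
theorem lrCount_transpose_of_col (hmu : mu.rowLen 0 ≤ 1) (lam nu : YoungDiagram) :
    lrCount lam mu nu = lrCount lam.transpose mu.transpose nu.transpose := by
  apply le_antisymm
  · refine Nat.card_le_card_of_injective (fun T : LR lam mu nu =>
      (⟨colToRow hmu lam T.1, isLattice_colToRow hmu T.2.1, content_colToRow hmu T.2.1 T.2.2⟩ :
        LR lam.transpose mu.transpose nu.transpose)) fun T T' e => Subtype.ext ?_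
    exact colToRow_injective hmu T.2.1 T'.2.1 (congrArg Subtype.val e)
  · refine Nat.card_le_card_of_injective
      (fun T : LR lam.transpose mu.transpose nu.transpose =>
      (⟨rowToCol hmu T.1 T.2.1, isLattice_rowToCol hmu T.2.1, content_rowToCol hmu T.2.1 T.2.2⟩ :
        LR lam mu nu)) fun T T' e => Subtype.ext ?_
    exact rowToCol_injective hmu T.2.1 T'.2.1 (congrArg Subtype.val e)

end SetValuedTableau

/-! ### Transposition -/

namespace YoungDiagram

/-- The partition with one column of length `q`. -/
def colShape (q : ℕ) : YoungDiagram :=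
  ofParts (fun i => if i < q then 1 else 0) (fun a b h => by dsimp only; split_ifs <;> omega) q

theorem rowLen_colShape (q i : ℕ) : (colShape q).rowLen i = if i < q then 1 else 0 :=
  rowLen_ofParts (by simp) i

theorem mem_colShape {q i j : ℕ} : (i, j) ∈ colShape q ↔ i < q ∧ j = 0 := by
  rw [mem_iff_lt_rowLen, rowLen_colShape]
  split_ifs with h <;> omega

theorem rowLen_eq_of_mem_iff {mu : YoungDiagram} {i n : ℕ} (h : ∀ j, (i, j) ∈ mu ↔ j < n) :
    mu.rowLen i = n :=
  eq_of_forall_lt_iff fun j => by rw [← mem_iff_lt_rowLen, h]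

theorem rowLen_removeCol_last (mu : YoungDiagram) (i : ℕ) :
    (mu.removeCol (mu.rowLen 0 - 1)).rowLen i = min (mu.rowLen i) (mu.rowLen 0 - 1) := by
  refine rowLen_eq_of_mem_iff fun j => ?_
  have := mu.rowLen_anti 0 i (Nat.zero_le _)
  rw [mem_removeCol, mem_iff_lt_rowLen, skipIndex]
  split_ifs <;> omega

theorem card_le_of_mem_boxed {k m : ℕ} {mu : YoungDiagram} (h : mu ∈ boxed k m) :
    mu.card ≤ k * m := by
  rw [mem_boxed] at h
  calc mu.card ≤ #(range k ×ˢ range m) := card_le_card fun c hc => by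
        simpa using h c.1 c.2 ((mu.mem_cells c).1 hc)
    _ = k * m := by simp

theorem transpose_mem_boxed {k m : ℕ} {mu : YoungDiagram} :
    mu.transpose ∈ boxed m k ↔ mu ∈ boxed k m := by
  simp only [mem_boxed, mem_transpose, Prod.swap_prod_mk]
  exact ⟨fun h i j hc => (h j i hc).symm, fun h i j hc => (h j i hc).symm⟩

theorem sum_boxed_transpose {k m : ℕ} (f : YoungDiagram → ℕ) :
    ∑ nu ∈ boxed m k, f nu = ∑ nu ∈ boxed k m, f nu.transpose :=
  sum_nbij' transpose transpose (fun _ h => transpose_mem_boxed.2 h)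
    (fun _ h => transpose_mem_boxed.2 h) (fun _ _ => transpose_transpose _)
    (fun _ _ => transpose_transpose _) fun _ _ => by rw [transpose_transpose]

theorem le_colLen_iff {mu : YoungDiagram} {i j : ℕ} : i < mu.colLen j ↔ j < mu.rowLen i := by
  rw [← mem_iff_lt_rowLen, ← mem_iff_lt_colLen]

end YoungDiagram

namespace SetValuedTableau

open YoungDiagram

variable {mu lam nu : YoungDiagram}

/-- The superstandard filling of the column puts the removed cells back at the ends of the top rows.
-/
theorem lrCount_removeCol_ne_zero (hmu : 0 < mu.rowLen 0) :
    lrCount (mu.removeCol (mu.rowLen 0 - 1)) (colShape (mu.colLen (mu.rowLen 0 - 1))) mu ≠ 0 := by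
  set q := mu.colLen (mu.rowLen 0 - 1) with hq
  have hq1 : (colShape q).rowLen 0 ≤ 1 := by rw [rowLen_colShape]; split_ifs <;> omega
  have : Nonempty (LR (mu.removeCol (mu.rowLen 0 - 1)) (colShape q) mu) := by
    refine ⟨superstandard _, ?_, fun l => ?_⟩
    · rw [isLattice_col_iff hq1]
      intro p l h _
      rw [mem_superstandard] at h
      exact ⟨l, by omega, mem_superstandard.2
        ⟨(colShape q).up_left_mem (by omega) le_rfl h.1, rfl⟩⟩
    · have h1 := content_superstandard (mu := colShape q) l
      rw [content, rowLen_bot, zero_add, rowLen_colShape] at h1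
      rw [content, h1, rowLen_removeCol_last]
      have := mu.rowLen_anti 0 l (Nat.zero_le _)
      have h2 : l < q ↔ mu.rowLen 0 - 1 < mu.rowLen l := le_colLen_iff
      split_ifs with h <;> omega
  exact Nat.card_pos.ne'

/-- This is the descent of the induction in `lrCount_transpose_of_boxed`. A column adds at most one
cell to each row, so `nu` is not wider than `mu`. For equal width, the last column of `nu` is not
longer than the added one, and if it has the same length then `nu` contains `mu` properly. Sizes in
a box are bounded, so the order is well founded. -/
theorem measure_of_lrCount_ne_zero (hmu : 0 < mu.rowLen 0) (hne : nu ≠ mu)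
    (h : lrCount (mu.removeCol (mu.rowLen 0 - 1)) (colShape (mu.colLen (mu.rowLen 0 - 1))) nu ≠ 0) :
    nu.rowLen 0 < mu.rowLen 0 ∨ (nu.rowLen 0 = mu.rowLen 0 ∧
      (nu.colLen (nu.rowLen 0 - 1) < mu.colLen (mu.rowLen 0 - 1) ∨
      (nu.colLen (nu.rowLen 0 - 1) = mu.colLen (mu.rowLen 0 - 1) ∧ mu.card < nu.card))) := by
  set q := mu.colLen (mu.rowLen 0 - 1) with hq
  have hq1 : (colShape q).rowLen 0 ≤ 1 := by rw [rowLen_colShape]; split_ifs <;> omega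
  have : Nonempty (LR (mu.removeCol (mu.rowLen 0 - 1)) (colShape q) nu) := by
    by_contra hc
    rw [not_nonempty_iff] at hc
    exact h Nat.card_of_isEmpty
  obtain ⟨T, hT, hcont⟩ := this
  have hw := T.weight_of_col hq1
  simp only [content, rowLen_removeCol_last] at hcont
  have hmq : ∀ l, l < q ↔ mu.rowLen 0 - 1 < mu.rowLen l := fun l => le_colLen_iff
  have h0 := hcont 0
  have hw0 := (hw 0).1
  rcases (show nu.rowLen 0 < mu.rowLen 0 ∨ nu.rowLen 0 = mu.rowLen 0 by omega) with hlt | heq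
  · exact Or.inl hlt
  refine Or.inr ⟨heq, ?_⟩
  rw [heq]
  set h' := nu.colLen (mu.rowLen 0 - 1) with hh'
  have hnu : ∀ l, l < h' ↔ mu.rowLen 0 - 1 < nu.rowLen l := fun l => le_colLen_iff
  -- In the rows that reach the full width of `nu`, the partition without its last column has
  -- constant length. So each letter there needs its predecessor above it, and the letter `l` is at
  -- depth at least `l`.
  have hpos : ∀ l < h', ∀ p, l ∈ T.entry p 0 → l ≤ p := by
    intro l
    induction l with
    | zero => exact fun _ _ _ => Nat.zero_le _
    | succ l ih =>
      intro hl p hp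
      have h1 := (hnu (l + 1)).1 hl
      have h2 := hcont (l + 1)
      have h3 := (hw (l + 1)).1
      have h4 := mu.rowLen_anti l (l + 1) (by omega)
      obtain ⟨p', hp', h5⟩ := (isLattice_col_iff hq1).1 hT p l hp (by
        rw [rowLen_removeCol_last, rowLen_removeCol_last]
        omega)
      have := ih (by omega) p' h5
      omega
  have hle : h' ≤ q := by
    rcases Nat.eq_zero_or_pos h' with h1 | h1
    · omega
    have h2 := (hnu (h' - 1)).1 (by omega)
    have h3 := hcont (h' - 1)
    have h4 := (hw (h' - 1)).1
    obtain ⟨p, hp⟩ := (hw (h' - 1)).2.1 (by omega)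
    have h5 := (mem_colShape.1 (T.mem_shape hp)).1
    have h6 := hpos _ (by omega) p hp
    omega
  rcases hle.eq_or_lt with he | hlt
  · refine Or.inr ⟨he, ?_⟩
    have hmn : mu ≤ nu := by
      rw [le_iff_rowLen]
      intro l
      have h1 := hmq l
      have h2 := hnu l
      have h3 := hcont l
      have h4 := mu.rowLen_anti 0 l (Nat.zero_le _)
      by_cases hl : l < q
      · have := h1.1 hl
        have := h2.1 (by omega)
        omega
      · omega
    exact card_lt_card (cells_ssubset_iff.2 (lt_of_le_of_ne hmn hne.symm))
  · exact Or.inl hlt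

open Classical in
-- Removing the last column gives `mu'`. The symmetry of the triple products of `mu'`, the column
-- and `lam` is used both for the given partitions and for their transposes. On one side all factors
-- belong to `mu'` or to the column, so both versions agree by induction and by the case of a
-- column. On the other side all terms but that of `mu` agree by induction.
theorem lrCount_transpose_of_boxed {k m : ℕ} (mu lam nu : YoungDiagram) (hmu : mu ∈ boxed k m)
    (hnu : nu ∈ boxed k m) :
    lrCount lam mu nu = lrCount lam.transpose mu.transpose nu.transpose := by
  by_cases hcol : mu.rowLen 0 ≤ 1
  · exact lrCount_transpose_of_col hcol lam nu
  set mu' := mu.removeCol (mu.rowLen 0 - 1) with hmu'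
  have hmu0 : mu'.rowLen 0 = mu.rowLen 0 - 1 := by
    rw [rowLen_removeCol_last]
    omega
  have hle' : mu' ≤ mu := by
    rw [le_iff_rowLen]
    intro i
    rw [rowLen_removeCol_last]
    omega
  set q := mu.colLen (mu.rowLen 0 - 1) with hq
  have hq1 : (colShape q).rowLen 0 ≤ 1 := by rw [rowLen_colShape]; split_ifs <;> omega
  have e1 := sum_lrCount_comm mu' (colShape q) lam hnu
  have e2 := sum_lrCount_comm mu'.transpose (colShape q).transpose lam.transpose
    (transpose_mem_boxed.2 hnu)
  rw [sum_boxed_transpose (k := k) (m := m), sum_boxed_transpose (k := k) (m := m)] at e2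
  have e3 : ∑ rho ∈ boxed k m, lrCount mu' lam rho * lrCount rho (colShape q) nu =
      ∑ rho ∈ boxed k m, lrCount mu'.transpose lam.transpose rho.transpose *
        lrCount rho.transpose (colShape q).transpose nu.transpose := by
    refine sum_congr rfl fun rho hrho => ?_
    rw [lrCount_transpose_of_col hq1, lrCount_comm mu' lam rho, lrCount_comm mu'.transpose,
      lrCount_transpose_of_boxed mu' lam rho (mem_boxed_of_le hmu hle') hrho]
  rw [e3, ← e2, ← add_sum_erase _ _ hmu, ← add_sum_erase _ _ hmu] at e1
  have e4 : ∑ rho ∈ (boxed k m).erase mu, lrCount mu' (colShape q) rho * lrCount rho lam nu =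
      ∑ rho ∈ (boxed k m).erase mu,
        lrCount mu'.transpose (colShape q).transpose rho.transpose *
          lrCount rho.transpose lam.transpose nu.transpose := by
    refine sum_congr rfl fun rho hrho => ?_
    rw [← lrCount_transpose_of_col hq1]
    by_cases hz : lrCount mu' (colShape q) rho = 0
    · rw [hz, zero_mul, zero_mul]
    · congr 1
      have hrho' := mem_erase.1 hrho
      have hm := measure_of_lrCount_ne_zero (show 0 < mu.rowLen 0 by omega) hrho'.1 hz
      rw [lrCount_comm rho, lrCount_comm rho.transpose,
        lrCount_transpose_of_boxed rho lam nu hrho'.2 hnu]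
  -- Only the terms of `mu` are left; their common factor is non-zero and cancels.
  rw [e4, add_left_inj, ← lrCount_transpose_of_col hq1] at e1
  have e5 := Nat.eq_of_mul_eq_mul_left
    (Nat.pos_of_ne_zero (lrCount_removeCol_ne_zero (mu := mu) (by omega))) e1
  rw [lrCount_comm lam, e5, lrCount_comm]
termination_by (mu.rowLen 0, mu.colLen (mu.rowLen 0 - 1), k * m - mu.card)
decreasing_by
  · exact Prod.Lex.left _ _ (by rw [rowLen_removeCol_last]; omega)
  · have hcard := card_le_of_mem_boxed hrho'.2
    rcases hm with h | ⟨h, h' | ⟨h', h''⟩⟩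
    · exact Prod.Lex.left _ _ h
    · rw [h] at h' ⊢
      exact Prod.Lex.right _ (Prod.Lex.left _ _ h')
    · rw [h] at h' ⊢
      rw [h']
      exact Prod.Lex.right _ (Prod.Lex.right _ (by omega))

theorem lrCount_eq_zero_of_not_le (h : ¬ mu ≤ nu) : lrCount lam mu nu = 0 := by
  rw [lrCount_comm]
  by_contra hc
  exact h (le_of_lrCount_ne_zero hc)

theorem lrCount_transpose (lam mu nu : YoungDiagram) :
    lrCount lam mu nu = lrCount lam.transpose mu.transpose nu.transpose := by
  by_cases h : mu ≤ nu
  · exact lrCount_transpose_of_boxed mu lam nu (mem_boxed_of_le (mem_boxed_self nu) h)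
      (mem_boxed_self nu)
  · rw [lrCount_eq_zero_of_not_le h, lrCount_eq_zero_of_not_le (by rwa [transpose_le_iff])]

end SetValuedTableau

/-- Turns equal numbers of fillings for corresponding contents into a bijection of fillings, with
arbitrary choices in each fibre. -/
theorem exists_equiv_of_fiber_card {A B C D : Type*} (f : A → C) (g : B → D) (e : C ≃ D)
    [∀ c, Finite {a // f a = c}] [∀ d, Finite {b // g b = d}]
    (h : ∀ c, Nat.card {a // f a = c} = Nat.card {b // g b = e c}) :
    ∃ F : A ≃ B, ∀ a, g (F a) = e (f a) := by
  let k : ∀ c, {a // f a = c} ≃ {b // g b = e c} := fun c =>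
    ((Finite.equivFin _).trans ((finCongr (h c)).trans (Finite.equivFin _).symm))
  refine ⟨(Equiv.sigmaFiberEquiv f).symm.trans
    ((Equiv.sigmaCongr e k).trans (Equiv.sigmaFiberEquiv g)), fun a => ?_⟩
  exact (k (f a) ⟨a, rfl⟩).2

namespace SetValuedTableau

open YoungDiagram

theorem size_add_card {mu lam nu : YoungDiagram} {T : SetValuedTableau mu}
    (h : ∀ l, T.content lam l = nu.rowLen l) : T.size + lam.card = nu.card := by
  obtain ⟨k, hk⟩ := T.exists_letter_bound
  set K := max k (max (lam.colLen 0) (nu.colLen 0))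
  rw [T.size_eq_sum_weight (k := K) fun p j l hl => (hk p j l hl).trans_le (le_max_left _ _),
    lam.card_eq_sum_rowLen (k := K) (by omega), nu.card_eq_sum_rowLen (k := K) (by omega),
    ← sum_add_distrib]
  refine sum_congr rfl fun i _ => ?_
  rw [← h, content, add_comm]

end SetValuedTableau

/-! ### Fillings of a quadruple and their contents. -/

namespace RichardsonQuadruple

open YoungDiagram SetValuedTableau

variable (R : RichardsonQuadruple)

theorem isLattice (T : R.Filling) : T.1.IsLattice R.lam :=
  (R.isReverseLatticeWord_iff T.1).1 T.2.1

theorem content_eq (T : R.Filling) : R.content T = T.1.content R.lam :=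
  funext fun l => R.count_word T.1 l

theorem content_bounds (T : R.Filling) (i : ℕ) :
    T.1.content R.lam i ≤ R.cols ∧ (R.rows ≤ i → T.1.content R.lam i = 0) := by
  have := T.2.2 i
  rwa [R.count_word] at this

/-- A filling, in terms of row counts. -/
def mkFilling (T : SetValuedTableau R.mu) (hT : T.IsLattice R.lam)
    (h : ∀ i, T.content R.lam i ≤ R.cols ∧ (R.rows ≤ i → T.content R.lam i = 0)) : R.Filling :=
  ⟨T, (R.isReverseLatticeWord_iff T).2 hT, fun i => by rw [R.count_word]; exact h i⟩

/-- The content of a filling, as a partition. -/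
noncomputable def diagram (T : R.Filling) : YoungDiagram := (R.isLattice T).exists_diagram.choose

theorem content_diagram (T : R.Filling) (l : ℕ) :
    T.1.content R.lam l = (R.diagram T).rowLen l :=
  (R.isLattice T).exists_diagram.choose_spec l

theorem rowLen_diagram (T : R.Filling) (l : ℕ) : (R.diagram T).rowLen l = R.content T l := by
  rw [R.content_eq]
  exact (R.content_diagram T l).symm

theorem diagram_mem_boxed (T : R.Filling) : R.diagram T ∈ boxed R.rows R.cols := by
  rw [mem_boxed_iff]
  simp only [rowLen_diagram, content_eq]
  exact ⟨fun i hi => (R.content_bounds T i).2 hi, fun i => (R.content_bounds T i).1⟩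

theorem diagram_le_iff {T : R.Filling} {κ : YoungDiagram} :
    R.diagram T ≤ κ ↔ ∀ i, R.content T i ≤ κ.rowLen i := by
  simp only [le_iff_rowLen, rowLen_diagram]

/-- The content determines the number of extra letters, so any bijection of fillings over
transposition of the contents keeps that number. -/
theorem extra_eq (T : R.Filling) : R.extra T + R.lam.card + R.mu.card = (R.diagram T).card := by
  have h := size_add_card (R.content_diagram T)
  have h1 : R.extra T = T.1.size - R.mu.card := rfl
  have := T.1.card_le_size
  omega

/-- The fillings with a given content. -/
noncomputable def fiberEquiv {nu : YoungDiagram} (hnu : nu ∈ boxed R.rows R.cols) :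
    {T : R.Filling // R.diagram T = nu} ≃ LR R.lam R.mu nu where
  toFun T := ⟨T.1.1, R.isLattice T.1, fun l => (R.content_diagram T.1 l).trans (by rw [T.2])⟩
  invFun T := ⟨R.mkFilling T.1 T.2.1 fun i => by
      rw [T.2.2]
      exact ⟨(mem_boxed_iff.1 hnu).2 i, (mem_boxed_iff.1 hnu).1 i⟩, ext_rowLen fun l => by
      rw [R.rowLen_diagram, R.content_eq]
      exact T.2.2 l⟩
  left_inv _ := rfl
  right_inv _ := rfl

instance (nu : YoungDiagram) : Finite {T : R.Filling // R.diagram T = nu} := by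
  by_cases h : nu ∈ boxed R.rows R.cols
  · exact Finite.of_equiv _ (R.fiberEquiv h).symm
  · have : IsEmpty {T : R.Filling // R.diagram T = nu} :=
      ⟨fun T => h (T.2 ▸ R.diagram_mem_boxed T.1)⟩
    infer_instance

theorem card_fiber {nu : YoungDiagram} (hnu : nu ∈ boxed R.rows R.cols) :
    Nat.card {T : R.Filling // R.diagram T = nu} = lrCount R.lam R.mu nu :=
  Nat.card_congr (R.fiberEquiv hnu)

theorem card_fiber_eq_zero {nu : YoungDiagram} (hnu : nu ∉ boxed R.rows R.cols) :
    Nat.card {T : R.Filling // R.diagram T = nu} = 0 := by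
  have : IsEmpty {T : R.Filling // R.diagram T = nu} :=
    ⟨fun T => hnu (T.2 ▸ R.diagram_mem_boxed T.1)⟩
  exact Nat.card_of_isEmpty

/-! ### Isomorphisms -/

/-- A bijection of the fillings which respects contents, numbers of extra letters and the truncated
sets of fillings. -/
def DiagramIso (R R' : RichardsonQuadruple) : Prop :=
  ∃ F : R.Filling ≃ R'.Filling,
    (∀ T U, R'.diagram (F T) ≤ R'.diagram (F U) ↔ R.diagram T ≤ R.diagram U) ∧
    (∀ T, R'.extra (F T) = R.extra T) ∧
    ∀ κ ∈ boxed R.rows R.cols, (∃ T, R.diagram T ≤ κ) →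
      ∃ κ' ∈ boxed R'.rows R'.cols, ∀ T, R'.diagram (F T) ≤ κ' ↔ R.diagram T ≤ κ

variable {R}

theorem DiagramIso.refl (R : RichardsonQuadruple) : R.DiagramIso R :=
  ⟨Equiv.refl _, fun _ _ => Iff.rfl, fun _ => rfl, fun κ hκ _ => ⟨κ, hκ, fun _ => Iff.rfl⟩⟩

theorem DiagramIso.trans {R R' R'' : RichardsonQuadruple} (h : R.DiagramIso R')
    (h' : R'.DiagramIso R'') : R.DiagramIso R'' := by
  obtain ⟨F, h1, h2, h3⟩ := h
  obtain ⟨G, h1', h2', h3'⟩ := h'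
  refine ⟨F.trans G, fun T U => (h1' _ _).trans (h1 _ _), fun T => (h2' _).trans (h2 _),
    fun κ hκ hT => ?_⟩
  obtain ⟨κ', hκ', h4⟩ := h3 κ hκ hT
  obtain ⟨T, hT⟩ := hT
  obtain ⟨κ'', hκ'', h4'⟩ := h3' κ' hκ' ⟨F T, (h4 T).2 hT⟩
  exact ⟨κ'', hκ'', fun T => (h4' _).trans (h4 _)⟩

/-- The bijection respects containment of contents in both directions, hence also equality of
contents, and so it descends to the vertices. -/
theorem DiagramIso.posetIso {R R' : RichardsonQuadruple} (h : R.DiagramIso R') : R'.PosetIso R := by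
  obtain ⟨F, h1, h2, -⟩ := h
  have hle : ∀ T U, R'.content (F T) ≤ R'.content (F U) ↔ R.content T ≤ R.content U := by
    intro T U
    have := h1 T U
    simpa only [diagram_le_iff, rowLen_diagram, ← Pi.le_def] using this
  have heq : ∀ T U, R'.content (F T) = R'.content (F U) ↔ R.content T = R.content U := by
    intro T U
    rw [le_antisymm_iff, hle, hle, ← le_antisymm_iff]
  have hc : ∀ x : Set.range R'.content, ∃ y : Set.range R.content,
      ∀ T, R'.content T = x → R.content (F.symm T) = y := by
    rintro ⟨_, T, rfl⟩
    refine ⟨⟨_, F.symm T, rfl⟩, fun U hU => ?_⟩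
    rw [← heq, F.apply_symm_apply, F.apply_symm_apply]
    exact hU
  have hc' : ∀ x : Set.range R.content, ∃ y : Set.range R'.content,
      ∀ T, R.content T = x → R'.content (F T) = y := by
    rintro ⟨_, T, rfl⟩
    exact ⟨⟨_, F T, rfl⟩, fun U hU => (heq _ _).2 hU⟩
  choose φ hφ using hc
  choose ψ hψ using hc'
  have hφψ : ∀ y, φ (ψ y) = y := by
    rintro ⟨_, T, rfl⟩
    refine Subtype.ext ?_
    rw [← hφ _ (F T) (hψ _ T rfl), F.symm_apply_apply]
  have hψφ : ∀ y, ψ (φ y) = y := by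
    rintro ⟨_, T, rfl⟩
    refine Subtype.ext ?_
    rw [← hψ _ (F.symm T) (hφ _ T rfl), F.apply_symm_apply]
  have hφle : ∀ a b, φ a ≤ φ b ↔ a ≤ b := by
    rintro ⟨_, T, rfl⟩ ⟨_, U, rfl⟩
    rw [← Subtype.coe_le_coe, ← Subtype.coe_le_coe, ← hφ _ T rfl, ← hφ _ U rfl, ← hle,
      F.apply_symm_apply, F.apply_symm_apply]
  let e : Set.range R'.content ≃o Set.range R.content := ⟨⟨φ, ψ, hψφ, hφψ⟩, fun {a b} => hφle a b⟩
  refine ⟨e.dual, F.symm, fun T => ⟨?_, ?_⟩⟩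
  · exact congrArg OrderDual.toDual (Subtype.ext (hφ _ T rfl).symm)
  · rw [← h2, F.apply_symm_apply]

/-! ### Transposition -/

/-- The transposed quadruple. -/
def transpose (R : RichardsonQuadruple) : RichardsonQuadruple where
  lam := R.lam.transpose
  mu := R.mu.transpose
  rows := R.cols
  cols := R.rows
  lam_fits i j h := (R.lam_fits j i (mem_transpose.1 h)).symm
  mu_fits i j h := (R.mu_fits j i (mem_transpose.1 h)).symm
  disj i j hi hj h h' := R.disj j i hj hi (mem_transpose.1 h) (mem_transpose.1 h')

theorem diagramIso_transpose (R : RichardsonQuadruple) : R.DiagramIso R.transpose := by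
  obtain ⟨F, hF⟩ := exists_equiv_of_fiber_card R.diagram R.transpose.diagram
    transposeOrderIso.toEquiv (by
      intro nu
      change _ = Nat.card {b // R.transpose.diagram b = nu.transpose}
      by_cases h : nu ∈ boxed R.rows R.cols
      · rw [R.card_fiber h, R.transpose.card_fiber (transpose_mem_boxed.2 h)]
        exact lrCount_transpose _ _ _
      · rw [R.card_fiber_eq_zero h, R.transpose.card_fiber_eq_zero
          (fun h' => h (transpose_mem_boxed.1 h'))])
  have hF : ∀ T, R.transpose.diagram (F T) = (R.diagram T).transpose := hF
  have hcard : ∀ mu : YoungDiagram, mu.transpose.card = mu.card := fun mu => by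
    simp [YoungDiagram.card, YoungDiagram.transpose]
  refine ⟨F, fun T U => ?_, fun T => ?_, fun κ hκ _ => ⟨κ.transpose, transpose_mem_boxed.2 hκ,
    fun T => ?_⟩⟩
  · rw [hF, hF, transpose_le_iff]
  · have h1 := R.extra_eq T
    have h2 := R.transpose.extra_eq (F T)
    rw [hF, hcard] at h2
    have h3 : R.transpose.lam.card = R.lam.card := hcard _
    have h4 : R.transpose.mu.card = R.mu.card := hcard _
    omega
  · rw [hF, transpose_le_iff]

theorem fullCol_transpose {R : RichardsonQuadruple} {r : ℕ} (h : R.FullRow r) :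
    R.transpose.FullCol r := by
  refine ⟨h.1, fun i hi => ?_⟩
  rcases h.2 i hi with h | h
  · exact Or.inl (mem_transpose.2 h)
  · exact Or.inr (mem_transpose.2 h)

theorem demolishRow_eq {R : RichardsonQuadruple} {r : ℕ} (h : R.FullRow r) :
    R.demolishRow r h = (R.transpose.demolishCol r (fullCol_transpose h)).transpose := by
  ext1
  · ext ⟨i, j⟩
    change (i, j) ∈ R.lam.removeRow r ↔ (i, j) ∈ (R.lam.transpose.removeCol r).transpose
    rw [mem_transpose, Prod.swap_prod_mk, mem_removeCol, mem_transpose, mem_removeRow,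
      Prod.swap_prod_mk]
  · ext ⟨i, j⟩
    change (i, j) ∈ R.mu.removeRow (R.rows - 1 - r) ↔
      (i, j) ∈ (R.mu.transpose.removeCol (R.rows - 1 - r)).transpose
    rw [mem_transpose, Prod.swap_prod_mk, mem_removeCol, mem_transpose, mem_removeRow,
      Prod.swap_prod_mk]
  · rfl
  · rfl

end RichardsonQuadruple

/-! ### Column demolition -/

theorem skipIndex_ne (r i : ℕ) : skipIndex r i ≠ r := by
  unfold skipIndex
  split_ifs <;> omega

theorem skipIndex_strictMono {r a b : ℕ} (h : a < b) : skipIndex r a < skipIndex r b := by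
  unfold skipIndex
  split_ifs <;> omega

theorem exists_skipIndex {r j : ℕ} (h : j ≠ r) : ∃ i, skipIndex r i = j := by
  rcases lt_or_gt_of_ne h with h | h
  · exact ⟨j, by rw [skipIndex, if_pos h]⟩
  · exact ⟨j - 1, by rw [skipIndex, if_neg (by omega)]; omega⟩

theorem YoungDiagram.rowLen_removeCol (mu : YoungDiagram) (s i : ℕ) :
    (mu.removeCol s).rowLen i = if s < mu.rowLen i then mu.rowLen i - 1 else mu.rowLen i := by
  refine rowLen_eq_of_mem_iff fun j => ?_
  rw [mem_removeCol, mem_iff_lt_rowLen, skipIndex]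
  split_ifs <;> omega

theorem card_filter_range_skip (P : ℕ → Prop) [DecidablePred P] (s n : ℕ) :
    #{j ∈ range n | P j} = #{j ∈ range (if s < n then n - 1 else n) | P (skipIndex s j)} +
      if s < n ∧ P s then 1 else 0 := by
  have h1 : #{j ∈ range (if s < n then n - 1 else n) | P (skipIndex s j)} =
      #{j ∈ range n | P j ∧ j ≠ s} := by
    refine card_bij (fun j _ => skipIndex s j) ?_ (fun a _ b _ h => skipIndex_inj h) ?_
    · intro j hj
      rw [mem_filter, mem_range] at hj ⊢
      refine ⟨?_, hj.2, skipIndex_ne _ _⟩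
      unfold skipIndex
      have := hj.1
      split_ifs at this ⊢ <;> omega
    · intro j hj
      rw [mem_filter, mem_range] at hj
      obtain ⟨i, rfl⟩ := exists_skipIndex hj.2.2
      refine ⟨i, ?_, rfl⟩
      rw [mem_filter, mem_range]
      refine ⟨?_, hj.2.1⟩
      have := hj.1
      unfold skipIndex at this
      split_ifs at this ⊢ <;> omega
  rw [h1]
  split_ifs with h
  · have : {j ∈ range n | P j} = insert s {j ∈ range n | P j ∧ j ≠ s} := by
      ext j
      simp only [mem_filter, mem_range, mem_insert]
      constructor
      · intro hj
        by_cases e : j = s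
        · exact Or.inl e
        · exact Or.inr ⟨hj.1, hj.2, e⟩
      · rintro (rfl | hj)
        · exact h
        · exact ⟨hj.1, hj.2.1⟩
    rw [this, card_insert_of_notMem (by simp)]
  · rw [add_zero]
    congr 1
    refine filter_congr fun j hj => ⟨fun h2 => ⟨h2, ?_⟩, fun h2 => h2.1⟩
    rintro rfl
    exact h ⟨mem_range.1 hj, h2⟩

namespace SetValuedTableau

open YoungDiagram

/-- `T'` is obtained from `T` by deleting the column `s`, which consists of the singletons
`{a}, {a + 1}, …`. -/
structure ColumnDeleted {mu : YoungDiagram} (s a : ℕ) (T : SetValuedTableau mu)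
    (T' : SetValuedTableau (mu.removeCol s)) : Prop where
  column : ∀ q l, l ∈ T.entry q s ↔ q < mu.colLen s ∧ l = a + q
  rest : ∀ q j, T'.entry q j = T.entry q (skipIndex s j)

variable {mu : YoungDiagram} {s a : ℕ} {T : SetValuedTableau mu}
  {T' : SetValuedTableau (mu.removeCol s)}

theorem ColumnDeleted.rowCount (h : ColumnDeleted s a T T') (p l : ℕ) :
    T.rowCount p l = T'.rowCount p l + if p < mu.colLen s ∧ l = a + p then 1 else 0 := by
  rw [SetValuedTableau.rowCount, card_filter_range_skip _ s, SetValuedTableau.rowCount,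
    rowLen_removeCol]
  simp only [h.rest, h.column]
  congr 2
  rw [← mem_iff_lt_rowLen, mem_iff_lt_colLen]
  simp

theorem ColumnDeleted.upper (h : ColumnDeleted s a T T') (p l : ℕ) :
    T.upper p l = T'.upper p l + if a ≤ l ∧ l < a + p ∧ l < a + mu.colLen s then 1 else 0 := by
  induction p with
  | zero =>
    rw [upper_zero, upper_zero, if_neg (by omega)]
  | succ p ih =>
    rw [T.upper_succ, T'.upper_succ, ih, h.rowCount]
    split_ifs <;> omega

theorem ColumnDeleted.weight (h : ColumnDeleted s a T T') (l : ℕ) :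
    T.weight l = T'.weight l + if a ≤ l ∧ l < a + mu.colLen s then 1 else 0 := by
  set P := max (max (mu.colLen 0) ((mu.removeCol s).colLen 0)) (mu.colLen s) with hP
  rw [T.weight_eq_upper (p := P) (by omega), T'.weight_eq_upper (p := P) (by omega), h.upper]
  congr 1
  split_ifs <;> omega

theorem ColumnDeleted.size (h : ColumnDeleted s a T T') :
    T.size = T'.size + mu.colLen s := by
  obtain ⟨k, hk⟩ := T.exists_letter_bound
  obtain ⟨k', hk'⟩ := T'.exists_letter_bound
  set K := max (max k k') (a + mu.colLen s) with hK
  rw [T.size_eq_sum_weight (k := K) fun p j l hl => (hk p j l hl).trans_le (by omega),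
    T'.size_eq_sum_weight (k := K) fun p j l hl => (hk' p j l hl).trans_le (by omega)]
  simp only [h.weight, sum_add_distrib]
  congr 1
  rw [← card_filter, show {i ∈ range K | a ≤ i ∧ i < a + mu.colLen s} = Ico a (a + mu.colLen s) by
    ext i
    simp only [mem_filter, mem_range, mem_Ico]
    omega]
  simp

end SetValuedTableau

namespace RichardsonQuadruple

open YoungDiagram SetValuedTableau

variable {R : RichardsonQuadruple} {c : ℕ}

/-- A letter of the first row, its column and its row of `λ` fit in the box. -/
theorem fits_of_mem_first_row {lam mu : YoungDiagram} {cols : ℕ} {T : SetValuedTableau mu}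
    (hT : T.IsLattice lam) (h0 : T.content lam 0 ≤ cols) {x j : ℕ} (hx : x ∈ T.entry 0 j) :
    lam.rowLen x + j + 1 ≤ cols := by
  -- In row `0` the lattice condition says that row `h + 1` of `λ` plus the number of letters `h +
  -- 1` is at most row `h` of `λ`. These inequalities telescope to the content of the letter `0`.
  have key : ∀ h, lam.rowLen h + ∑ l ∈ range (h + 1), T.rowCount 0 l ≤ cols := by
    intro h
    induction h with
    | zero =>
      rw [sum_range_one, ← upper_one]
      have := T.upper_le_weight 1 0
      rw [SetValuedTableau.content] at h0
      omega
    | succ h ih =>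
      have h1 := hT 0 h
      rw [upper_zero, zero_add, upper_one] at h1
      rw [sum_range_succ]
      omega
  -- Each of the cells `0, …, j` of the first row contains a letter that is at most `x`.
  have h1 : j + 1 ≤ ∑ l ∈ range (x + 1), T.rowCount 0 l := by
    simp only [SetValuedTableau.rowCount, card_filter]
    rw [sum_comm]
    have hj := mem_iff_lt_rowLen.1 (T.mem_shape hx)
    calc j + 1 = ∑ _i ∈ range (j + 1), 1 := by simp
      _ ≤ ∑ i ∈ range (j + 1), ∑ l ∈ range (x + 1), if l ∈ T.entry 0 i then 1 else 0 := by
        refine sum_le_sum fun i hi => ?_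
        have hi := mem_range.1 hi
        obtain ⟨z, hz⟩ := (T.nonempty_iff 0 i).2 (mem_iff_lt_rowLen.2 (show i < _ by omega))
        have hzx : ∃ z ∈ T.entry 0 i, z ≤ x := by
          rcases (show i ≤ j by omega).eq_or_lt with rfl | h
          · exact ⟨x, hx, le_rfl⟩
          · exact ⟨z, hz, T.row_weak 0 i j h z hz x hx⟩
        obtain ⟨z, hz, hzx⟩ := hzx
        calc 1 = if z ∈ T.entry 0 i then 1 else 0 := by rw [if_pos hz]
          _ ≤ _ := single_le_sum (f := fun l => if l ∈ T.entry 0 i then 1 else 0)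
            (fun _ _ => Nat.zero_le _) (mem_range.2 (by omega))
      _ ≤ _ := sum_le_sum_of_subset (range_subset_range.2 (by omega))
  have := key x
  omega

theorem FullCol.colLen (hc : R.FullCol c) : R.lam.colLen c ≤ R.rows ∧
    R.mu.colLen (R.cols - 1 - c) = R.rows - R.lam.colLen c := by
  have h1 : R.lam.colLen c ≤ R.rows := by
    by_contra h
    have := R.lam_fits _ _ (mem_iff_lt_colLen.2 (not_le.1 h))
    omega
  refine ⟨h1, ?_⟩
  have h2 : R.mu.colLen (R.cols - 1 - c) ≤ R.rows := by
    by_contra h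
    have := R.mu_fits _ _ (mem_iff_lt_colLen.2 (not_le.1 h))
    omega
  refine le_antisymm ?_ ?_
  · by_contra h
    have h3 := R.disj (R.lam.colLen c - 1) c (by omega) hc.1 (mem_iff_lt_colLen.2 (by omega))
    rw [mem_iff_lt_colLen] at h3
    omega
  · by_contra h
    rcases hc.2 (R.lam.colLen c) (by omega) with h3 | h3
    · exact lt_irrefl _ (mem_iff_lt_colLen.1 h3)
    · have := mem_iff_lt_colLen.1 h3
      omega

theorem lt_rows (T : R.Filling) {p j l : ℕ} (h : l ∈ T.1.entry p j) : l < R.rows := by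
  by_contra hl
  have h1 := (R.content_bounds T l).2 (by omega)
  rw [SetValuedTableau.content] at h1
  exact (T.1.weight_eq_zero_iff l).1 (by omega) p j h

/-- Letters are bounded by the height of their column. -/
theorem letter_add_le {mu : YoungDiagram} {T : SetValuedTableau mu} {k : ℕ} (hk : T.Bounded k)
    {p j l : ℕ} (h : l ∈ T.entry p j) : l + (mu.colLen j - p) ≤ k := by
  have hp := mem_iff_lt_colLen.1 (T.mem_shape h)
  obtain ⟨d, hd⟩ : ∃ d, mu.colLen j = p + 1 + d := ⟨mu.colLen j - (p + 1), by omega⟩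
  have key : ∀ d, ∀ p l, mu.colLen j = p + 1 + d → l ∈ T.entry p j → l + (mu.colLen j - p) ≤ k := by
    intro d
    induction d with
    | zero =>
      intro p l hd h
      have := hk p j l h
      omega
    | succ d ih =>
      intro p l hd h
      obtain ⟨z, hz⟩ := (T.nonempty_iff (p + 1) j).2 (mem_iff_lt_colLen.2 (by omega))
      have h1 := T.col_strict p (p + 1) j (by omega) l h z hz
      have h2 := ih (p + 1) z (by omega) hz
      omega
  exact key d p l hd h

theorem add_le_letter {mu : YoungDiagram} {T : SetValuedTableau mu} {j a : ℕ}
    (ha : ∀ l ∈ T.entry 0 j, a ≤ l) {p l : ℕ} (h : l ∈ T.entry p j) : a + p ≤ l := by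
  induction p generalizing l with
  | zero => exact ha l h
  | succ p ih =>
    obtain ⟨z, hz⟩ := (T.nonempty_iff p j).2 (mu.up_left_mem (Nat.le_succ p) le_rfl (T.mem_shape h))
    have := T.col_strict p (p + 1) j (by omega) z hz l h
    have := ih hz
    omega

/-- Column strictness and the bound `R.rows` on the letters give the upper bound for the entries. In
a full column the heights of `λ` and `μ` add up to `R.rows`, so it matches the lower bound: a top
letter smaller than `R.lam.colLen c` would belong to a row of `λ` longer than `c` and, by
`fits_of_mem_first_row`, leave the box. -/
theorem column_forced (hc : R.FullCol c) (T : R.Filling) (q l : ℕ) :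
    l ∈ T.1.entry q (R.cols - 1 - c) ↔
      q < R.mu.colLen (R.cols - 1 - c) ∧ l = R.lam.colLen c + q := by
  have key : ∀ {q l}, l ∈ T.1.entry q (R.cols - 1 - c) → l = R.lam.colLen c + q := by
    intro q l h
    have h1 := letter_add_le (fun p j l hl => R.lt_rows T hl) h
    have h2 := mem_iff_lt_colLen.1 (T.1.mem_shape h)
    obtain ⟨h3, h4⟩ := hc.colLen
    have h5 : R.lam.colLen c + q ≤ l := by
      refine add_le_letter (fun x hx => ?_) h
      by_contra hh
      have h6 := fits_of_mem_first_row (R.isLattice T) (R.content_bounds T 0).1 hx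
      have h7 := mem_iff_lt_rowLen.1 (mem_iff_lt_colLen.2 (not_le.1 hh))
      have := hc.1
      omega
    omega
  constructor
  · exact fun h => ⟨mem_iff_lt_colLen.1 (T.1.mem_shape h), key h⟩
  · rintro ⟨h, rfl⟩
    obtain ⟨z, hz⟩ := (T.1.nonempty_iff q (R.cols - 1 - c)).2 (mem_iff_lt_colLen.2 h)
    rwa [key hz] at hz

/-- The deleted column of `λ` and the part of the deleted column of `μ` above row `p` together
contain each letter below `R.lam.colLen c + p` and `R.rows` exactly once. So both sides of a lattice
inequality change by the same amount. -/
theorem isLattice_iff_of_columnDeleted (hc : R.FullCol c) {T : SetValuedTableau R.mu}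
    {T' : SetValuedTableau (R.demolishCol c hc).mu} (hT : T.Bounded R.rows)
    (h : ColumnDeleted (R.cols - 1 - c) (R.lam.colLen c) T T') :
    (T.IsLattice R.lam ↔ T'.IsLattice (R.demolishCol c hc).lam) ∧
      ∀ l, T.content R.lam l = T'.content (R.demolishCol c hc).lam l + if l < R.rows then 1 else 0 := by
  obtain ⟨h1, h2⟩ := hc.colLen
  have hlam : ∀ l, R.lam.rowLen l =
      (R.demolishCol c hc).lam.rowLen l + if l < R.lam.colLen c then 1 else 0 := by
    intro l
    change _ = (R.lam.removeCol c).rowLen l + _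
    rw [rowLen_removeCol]
    have := le_colLen_iff (mu := R.lam) (i := l) (j := c)
    split_ifs <;> omega
  have hpart : ∀ p l, R.lam.rowLen l + T.upper p l = (R.demolishCol c hc).lam.rowLen l +
      T'.upper p l + if l < R.lam.colLen c + p ∧ l < R.rows then 1 else 0 := by
    intro p l
    have h3 : T.upper p l = T'.upper p l + if R.lam.colLen c ≤ l ∧ l < R.lam.colLen c + p ∧
      l < R.lam.colLen c + R.mu.colLen (R.cols - 1 - c) then 1 else 0 := h.upper p l
    rw [hlam, h3]
    split_ifs <;> omega
  constructor
  · refine forall_congr' fun p => forall_congr' fun l => ?_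
    rw [hpart, hpart]
    -- Here the letter `l + 1` gets no contribution while `l` may get one; but the letter `R.rows`
    -- does not occur at all, so the inequality is trivial on both sides.
    by_cases hl : l + 1 = R.rows
    · have z1 : R.lam.rowLen (l + 1) + T.upper (p + 1) (l + 1) = 0 := by
        have h4 : R.lam.rowLen (l + 1) = 0 := by
          by_contra hh
          have := R.lam_fits _ _ (mem_iff_lt_rowLen.2 (Nat.pos_of_ne_zero hh))
          omega
        have h5 := T.upper_le_weight (p + 1) (l + 1)
        rw [(T.weight_eq_zero_iff (l + 1)).2 fun q j hq => by have := hT q j _ hq; omega] at h5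
        omega
      rw [← hpart, z1]
      have := hpart (p + 1) (l + 1)
      omega
    · split_ifs <;> omega
  · intro l
    have h3 : T.weight l = T'.weight l + if R.lam.colLen c ≤ l ∧
      l < R.lam.colLen c + R.mu.colLen (R.cols - 1 - c) then 1 else 0 := h.weight l
    rw [SetValuedTableau.content, SetValuedTableau.content, hlam, h3]
    split_ifs <;> omega

/-- Deletion of a column of a tableau. -/
def deleteColumn {mu : YoungDiagram} (s : ℕ) (T : SetValuedTableau mu) :
    SetValuedTableau (mu.removeCol s) where
  entry i j := T.entry i (skipIndex s j)
  nonempty_iff i j := by rw [mem_removeCol, T.nonempty_iff]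
  row_weak i _ _ h := T.row_weak i _ _ (skipIndex_strictMono h)
  col_strict i₁ i₂ j h := T.col_strict i₁ i₂ _ h

/-- Insertion of the column with the entries `{a}, {a + 1}, …`. -/
def insertColumn {mu : YoungDiagram} (s a : ℕ) (T' : SetValuedTableau (mu.removeCol s))
    (hl : ∀ q < mu.colLen s, ∀ j < s, ∀ l ∈ T'.entry q j, l ≤ a + q)
    (hr : ∀ q < mu.colLen s, ∀ j ≥ s, ∀ l ∈ T'.entry q j, a + q ≤ l) : SetValuedTableau mu where
  entry q j := if j = s then if q < mu.colLen s then {a + q} else ∅ else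
    T'.entry q (if j < s then j else j - 1)
  nonempty_iff q j := by
    split_ifs with h1 h2 h3
    · subst h1
      exact iff_of_true (singleton_nonempty _) (mem_iff_lt_colLen.2 h2)
    · subst h1
      exact iff_of_false (by simp) (fun h => h2 (mem_iff_lt_colLen.1 h))
    · rw [T'.nonempty_iff, mem_removeCol, skipIndex, if_pos h3]
    · rw [T'.nonempty_iff, mem_removeCol, skipIndex, if_neg (by omega),
        show j - 1 + 1 = j by omega]
  row_weak q j₁ j₂ hj x hx y hy := by
    by_cases h1 : j₁ = s
    · rw [if_pos h1] at hx
      rw [if_neg (by omega), if_neg (by omega)] at hy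
      split_ifs at hx with h2
      · rw [mem_singleton] at hx
        have := hr q h2 _ (by omega) y hy
        omega
      · simp at hx
    · rw [if_neg h1] at hx
      by_cases h2 : j₂ = s
      · rw [if_pos h2] at hy
        rw [if_pos (by omega)] at hx
        split_ifs at hy with h3
        · rw [mem_singleton] at hy
          have := hl q h3 _ (by omega) x hx
          omega
        · simp at hy
      · rw [if_neg h2] at hy
        refine T'.row_weak q _ _ ?_ x hx y hy
        split_ifs <;> omega
  col_strict p q j hpq x hx y hy := by
    split_ifs at hx hy
    · simp only [mem_singleton] at hx hy
      omega
    all_goals first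
      | exact T'.col_strict p q _ hpq x hx y hy
      | exact absurd hx (notMem_empty _)
      | exact absurd hy (notMem_empty _)

theorem columnDeleted_delete (hc : R.FullCol c) (T : R.Filling) :
    ColumnDeleted (R.cols - 1 - c) (R.lam.colLen c) T.1 (deleteColumn (R.cols - 1 - c) T.1) :=
  ⟨column_forced hc T, fun _ _ => rfl⟩

theorem columnDeleted_insert {mu : YoungDiagram} {s a : ℕ} {T' : SetValuedTableau (mu.removeCol s)}
    {hl : ∀ q < mu.colLen s, ∀ j < s, ∀ l ∈ T'.entry q j, l ≤ a + q}
    {hr : ∀ q < mu.colLen s, ∀ j ≥ s, ∀ l ∈ T'.entry q j, a + q ≤ l} :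
    ColumnDeleted s a (insertColumn s a T' hl hr) T' := by
  constructor
  · intro q l
    change l ∈ (if s = s then if q < mu.colLen s then {a + q} else ∅ else _ : Finset ℕ) ↔ _
    rw [if_pos rfl]
    split_ifs with h <;> simp [h]
  · intro q j
    change _ = (if skipIndex s j = s then _ else T'.entry q (if skipIndex s j < s then
      skipIndex s j else skipIndex s j - 1))
    rw [if_neg (skipIndex_ne _ _)]
    congr 1
    unfold skipIndex
    split_ifs <;> omega

/-- The estimates of `column_forced` for the neighbouring columns: those to the left are at least as
tall as the inserted column, which bounds their letters from above, and those to the right are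
bounded from below by the width of the smaller box. -/
theorem insert_bounds (hc : R.FullCol c) (T' : (R.demolishCol c hc).Filling) :
    (∀ q < R.mu.colLen (R.cols - 1 - c), ∀ j < R.cols - 1 - c, ∀ l ∈ T'.1.entry q j,
      l ≤ R.lam.colLen c + q) ∧
    ∀ q < R.mu.colLen (R.cols - 1 - c), ∀ j ≥ R.cols - 1 - c, ∀ l ∈ T'.1.entry q j,
      R.lam.colLen c + q ≤ l := by
  obtain ⟨h1, h2⟩ := hc.colLen
  constructor
  · intro q hq j hj l hl
    have h3 := letter_add_le (fun p j l hl => lt_rows T' hl) hl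
    have h4 : R.mu.colLen (R.cols - 1 - c) ≤ (R.demolishCol c hc).mu.colLen j := by
      by_contra hh
      have h5 : (R.demolishCol c hc).mu.colLen j < R.mu.colLen (R.cols - 1 - c) := by omega
      refine lt_irrefl _ (mem_iff_lt_colLen.1 (?_ :
        ((R.demolishCol c hc).mu.colLen j, j) ∈ R.mu.removeCol (R.cols - 1 - c)))
      rw [mem_removeCol, skipIndex, if_pos hj]
      exact R.mu.up_left_mem le_rfl hj.le (mem_iff_lt_colLen.2 h5)
    have h5 : (R.demolishCol c hc).rows = R.rows := rfl
    omega
  · intro q _ j hj l hl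
    refine add_le_letter (fun x hx => ?_) hl
    by_contra hh
    have h6 := fits_of_mem_first_row (isLattice _ T') (content_bounds _ T' 0).1 hx
    have h7 := mem_iff_lt_rowLen.1 (mem_iff_lt_colLen.2 (not_le.1 hh))
    change (R.lam.removeCol c).rowLen x + j + 1 ≤ R.cols - 1 at h6
    rw [rowLen_removeCol, if_pos h7] at h6
    have := hc.1
    omega

theorem columnDeleted_unique {mu : YoungDiagram} {s a : ℕ} {T U : SetValuedTableau mu}
    {T' : SetValuedTableau (mu.removeCol s)} (hT : ColumnDeleted s a T T')
    (hU : ColumnDeleted s a U T') : T = U := by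
  ext q j l
  by_cases hj : j = s
  · subst hj
    rw [hT.column, hU.column]
  · obtain ⟨i, rfl⟩ := exists_skipIndex hj
    rw [← hT.rest, ← hU.rest]

/-- Reinsertion of the deleted column in a filling of the demolition. -/
noncomputable def reinsert (hc : R.FullCol c) (T' : (R.demolishCol c hc).Filling) :
    SetValuedTableau R.mu :=
  insertColumn (R.cols - 1 - c) (R.lam.colLen c) T'.1 (insert_bounds hc T').1 (insert_bounds hc T').2

theorem columnDeleted_reinsert (hc : R.FullCol c) (T' : (R.demolishCol c hc).Filling) :
    ColumnDeleted (R.cols - 1 - c) (R.lam.colLen c) (reinsert hc T') T'.1 :=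
  columnDeleted_insert

theorem bounded_reinsert (hc : R.FullCol c) (T' : (R.demolishCol c hc).Filling) :
    (reinsert hc T').Bounded R.rows := by
  intro q j l h
  by_cases hj : j = R.cols - 1 - c
  · subst hj
    rw [(columnDeleted_reinsert hc T').column] at h
    have := hc.colLen
    omega
  · obtain ⟨i, rfl⟩ := exists_skipIndex hj
    rw [← (columnDeleted_reinsert hc T').rest] at h
    exact lt_rows T' h

/-- The bijection between the fillings of a quadruple and those of its column demolition. -/
noncomputable def demolishColEquiv (hc : R.FullCol c) : R.Filling ≃ (R.demolishCol c hc).Filling where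
  toFun T := mkFilling _ (deleteColumn (R.cols - 1 - c) T.1)
    ((isLattice_iff_of_columnDeleted hc (fun _ _ _ h => R.lt_rows T h)
      (columnDeleted_delete hc T)).1.1 (R.isLattice T)) (by
      intro i
      have h := (isLattice_iff_of_columnDeleted hc (fun _ _ _ h => R.lt_rows T h)
        (columnDeleted_delete hc T)).2 i
      have h1 := R.content_bounds T i
      have h2 : (R.demolishCol c hc).cols = R.cols - 1 := rfl
      have h3 : (R.demolishCol c hc).rows = R.rows := rfl
      have := hc.1
      rw [h2, h3]
      split_ifs at h <;> omega)
  invFun T' := mkFilling _ (reinsert hc T')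
    ((isLattice_iff_of_columnDeleted hc (bounded_reinsert hc T')
      (columnDeleted_reinsert hc T')).1.2 (isLattice _ T')) (by
      intro i
      have h := (isLattice_iff_of_columnDeleted hc (bounded_reinsert hc T')
        (columnDeleted_reinsert hc T')).2 i
      have h1 := content_bounds _ T' i
      have h2 : (R.demolishCol c hc).cols = R.cols - 1 := rfl
      have h3 : (R.demolishCol c hc).rows = R.rows := rfl
      have := hc.1
      split_ifs at h <;> omega)
  left_inv T := by
    refine Subtype.ext (columnDeleted_unique (columnDeleted_reinsert hc _) ?_)
    exact columnDeleted_delete hc T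
  right_inv T' := by
    refine Subtype.ext (SetValuedTableau.ext (funext fun q => funext fun j => ?_))
    exact ((columnDeleted_reinsert hc T').rest q j).symm

theorem rowLen_diagram_demolishCol (hc : R.FullCol c) (T : R.Filling) (l : ℕ) :
    (R.diagram T).rowLen l = ((R.demolishCol c hc).diagram (demolishColEquiv hc T)).rowLen l +
      if l < R.rows then 1 else 0 := by
  rw [← content_diagram, ← content_diagram]
  exact (isLattice_iff_of_columnDeleted hc (fun _ _ _ h => R.lt_rows T h)
    (columnDeleted_delete hc T)).2 l

theorem diagramIso_demolishCol (hc : R.FullCol c) : R.DiagramIso (R.demolishCol c hc) := by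
  have hd := rowLen_diagram_demolishCol hc
  refine ⟨demolishColEquiv hc, fun T U => ?_, fun T => ?_, fun κ hκ hT => ?_⟩
  · rw [le_iff_rowLen, le_iff_rowLen]
    refine forall_congr' fun l => ?_
    rw [hd, hd]
    omega
  · have h1 := (columnDeleted_delete hc T).size
    have h2 := T.1.card_le_size
    have h3 := (demolishColEquiv hc T).1.card_le_size
    -- The number of cells is the size of the superstandard tableau, to which the formula for
    -- deleted columns also applies.
    have h4 : R.mu.card = (R.demolishCol c hc).mu.card + R.mu.colLen (R.cols - 1 - c) := by
      have h5 : ∀ mu : YoungDiagram, (superstandard mu).size = mu.card := by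
        intro mu
        simp only [SetValuedTableau.size, YoungDiagram.card, card_eq_sum_ones mu.cells]
        refine sum_congr rfl fun x hx => ?_
        change #(if (x.1, x.2) ∈ mu then {x.1} else ∅ : Finset ℕ) = 1
        rw [if_pos ((mu.mem_cells _).1 hx), card_singleton]
      have h6 : ColumnDeleted (R.cols - 1 - c) 0 (superstandard R.mu)
          (deleteColumn (R.cols - 1 - c) (superstandard R.mu)) := by
        refine ⟨fun q l => ?_, fun _ _ => rfl⟩
        rw [mem_superstandard, mem_iff_lt_colLen, zero_add]
      have h7 : deleteColumn (R.cols - 1 - c) (superstandard R.mu) =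
          superstandard (R.mu.removeCol (R.cols - 1 - c)) := by
        ext q j l
        change l ∈ (superstandard R.mu).entry q (skipIndex _ j) ↔ _
        rw [mem_superstandard, mem_superstandard, mem_removeCol]
      have h8 := h6.size
      rw [h7, h5, h5] at h8
      exact h8
    have h5 : R.extra T = T.1.size - R.mu.card := rfl
    have h6 : (R.demolishCol c hc).extra (demolishColEquiv hc T) =
      (deleteColumn (R.cols - 1 - c) T.1).size - (R.demolishCol c hc).mu.card := rfl
    omega
  · obtain ⟨T, hT⟩ := hT
    have hκ' := mem_boxed_iff.1 hκ
    -- The content of any filling has non-empty rows `0, …, R.rows - 1`. As `κ` contains such a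
    -- content, it has a full first column that can be removed.
    have hfull : ∀ l < R.rows, 0 < κ.rowLen l := by
      intro l hl
      have := le_iff_rowLen.1 hT l
      rw [hd, if_pos hl] at this
      omega
    have hrow : ∀ l, κ.rowLen l = (κ.removeCol 0).rowLen l + if l < R.rows then 1 else 0 := by
      intro l
      rw [rowLen_removeCol]
      by_cases hl : l < R.rows
      · have := hfull l hl
        rw [if_pos this, if_pos hl]
        omega
      · have := hκ'.1 l (by omega)
        rw [if_neg (by omega), if_neg hl, add_zero]
    refine ⟨κ.removeCol 0, mem_boxed_iff.2 ⟨fun i hi => ?_, fun i => ?_⟩, fun U => ?_⟩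
    · have h3 : (R.demolishCol c hc).rows = R.rows := rfl
      have := hκ'.1 i (h3 ▸ hi)
      rw [hrow] at this
      omega
    · change (κ.removeCol 0).rowLen i ≤ R.cols - 1
      have h1 := hκ'.2 i
      have h2 := hκ'.1 i
      have h3 := hrow i
      split_ifs at h3 <;> omega
    · rw [le_iff_rowLen, le_iff_rowLen]
      refine forall_congr' fun l => ?_
      rw [hd, hrow]
      omega

theorem diagramIso_demolishRow {r : ℕ} (hr : R.FullRow r) : R.DiagramIso (R.demolishRow r hr) := by
  rw [demolishRow_eq]
  exact (diagramIso_transpose R).trans ((diagramIso_demolishCol _).trans (diagramIso_transpose _))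

theorem diagramIso_of_isBasicDemolition {R' : RichardsonQuadruple} (h : R.IsBasicDemolition R') :
    R.DiagramIso R' := by
  obtain ⟨h, -⟩ := h
  induction h with
  | refl => exact DiagramIso.refl R
  | tail _ hs ih =>
    refine ih.trans ?_
    obtain ⟨r, hr, rfl⟩ | ⟨c, hc, rfl⟩ := hs
    · exact diagramIso_demolishRow hr
    · exact diagramIso_demolishCol hc

end RichardsonQuadruple

/-! ### Toggles -/

section toggle

open Polynomial

variable {α β : Type*}

open Classical in
theorem exists_sum_toggle (s : Finset α) (deg : α → ℕ) (Tg : α → Set β) (tog : β → α → α)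
    (h1 : ∀ a ∈ s, ∀ b ∈ Tg a, tog b a ∈ s) (h2 : ∀ a ∈ s, ∀ b ∈ Tg a, Tg (tog b a) = Tg a)
    (h3 : ∀ a ∈ s, ∀ b ∈ Tg a, tog b (tog b a) = a)
    (h4 : ∀ a ∈ s, ∀ b ∈ Tg a, deg (tog b a) = deg a + 1 ∨ deg a = deg (tog b a) + 1) :
    ∃ Q : ℕ[X], ∑ a ∈ s, (X : ℕ[X]) ^ deg a =
      ∑ a ∈ s with Tg a = ∅, (X : ℕ[X]) ^ deg a + (1 + X) * Q := by
  -- The chosen toggle depends only on the set `Tg a`, which toggling preserves; therefore `φ` is an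
  -- involution.
  set φ : α → α := fun a => if h : (Tg a).Nonempty then tog h.some a else a with hφ
  have key : ∀ a ∈ s, Tg a ≠ ∅ → φ a ∈ s ∧ Tg (φ a) = Tg a ∧ φ (φ a) = a ∧
      (deg (φ a) = deg a + 1 ∨ deg a = deg (φ a) + 1) := by
    intro a ha hne
    have hn := Set.nonempty_iff_ne_empty.2 hne
    have e : ∀ a' (h : Tg a' = Tg a), φ a' = tog hn.some a' := by
      intro a' h
      simp only [hφ]
      rw [dif_pos (h ▸ hn)]
      congr 1
      simp only [h]
    have e1 := e a rfl
    have h2' := h2 a ha _ hn.some_mem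
    rw [e1]
    refine ⟨h1 a ha _ hn.some_mem, h2', ?_, h4 a ha _ hn.some_mem⟩
    rw [e _ h2', h3 a ha _ hn.some_mem]
  -- The witness collects the member of lower degree of each pair.
  refine ⟨∑ a ∈ {a ∈ s | Tg a ≠ ∅} with deg (φ a) = deg a + 1, X ^ deg a, ?_⟩
  rw [← sum_filter_add_sum_filter_not s fun a => Tg a = ∅]
  congr 1
  rw [← sum_filter_add_sum_filter_not _ fun a => deg (φ a) = deg a + 1, add_mul, one_mul]
  congr 1
  rw [mul_sum]
  symm
  refine sum_nbij' φ φ ?_ ?_ ?_ ?_ ?_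
  · intro a ha
    simp only [mem_filter] at ha ⊢
    obtain ⟨⟨ha, hne⟩, hd⟩ := ha
    obtain ⟨k1, k2, k3, k4⟩ := key a ha hne
    refine ⟨⟨k1, by rwa [k2]⟩, ?_⟩
    rw [k3]
    omega
  · intro a ha
    simp only [mem_filter] at ha ⊢
    obtain ⟨⟨ha, hne⟩, hd⟩ := ha
    obtain ⟨k1, k2, k3, k4⟩ := key a ha hne
    refine ⟨⟨k1, by rwa [k2]⟩, ?_⟩
    rw [k3]
    omega
  · intro a ha
    simp only [mem_filter] at ha
    exact (key a ha.1.1 ha.1.2).2.2.1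
  · intro a ha
    simp only [mem_filter] at ha
    exact (key a ha.1.1 ha.1.2).2.2.1
  · intro a ha
    simp only [mem_filter] at ha
    rw [ha.2, pow_succ, mul_comm]

/-- The sequence of the largest elements. -/
def maxima (v : ℕ → Finset ℕ) (j : ℕ) : ℕ := (v j).sup id

theorem maxima_mem {v : ℕ → Finset ℕ} {j : ℕ} (h : (v j).Nonempty) : maxima v j ∈ v j := by
  obtain ⟨m, hm, e⟩ := exists_mem_eq_sup (v j) h id
  rw [maxima, e]
  exact hm

theorem le_maxima {v : ℕ → Finset ℕ} {j i : ℕ} (h : i ∈ v j) : i ≤ maxima v j :=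
  le_sup (f := id) h

/-- Insert an element in a set, or delete it. -/
def toggleElem (s : Finset ℕ) (i : ℕ) : Finset ℕ := if i ∈ s then s.erase i else insert i s

theorem toggleElem_toggleElem (s : Finset ℕ) (i : ℕ) : toggleElem (toggleElem s i) i = s := by
  unfold toggleElem
  by_cases h : i ∈ s
  · simp [h]
  · simp [h]

theorem mem_toggleElem_of_ne {s : Finset ℕ} {i x : ℕ} (h : x ≠ i) : x ∈ toggleElem s i ↔ x ∈ s := by
  unfold toggleElem
  split_ifs <;> simp [h]

theorem card_toggleElem (s : Finset ℕ) (i : ℕ) : #(toggleElem s i) = #s + 1 ∨ #s = #(toggleElem s i) + 1 := by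
  unfold toggleElem
  split_ifs with h
  · right
    rw [card_erase_of_mem h]
    have := card_pos.2 ⟨i, h⟩
    omega
  · left
    rw [card_insert_of_notMem h]

open Classical in
/-- Sequences of non-empty sets whose elements are subject to conditions which only depend on the
maxima of the preceding sets. -/
theorem sum_line {α : Type*} (s : Finset α) (n d : ℕ) (w : α → ℕ → Finset ℕ) (deg : α → ℕ)
    (Ok : ℕ → (ℕ → ℕ) → ℕ → Prop)
    (hloc : ∀ j M M' i, (∀ k < j, M k = M' k) → Ok j M i → Ok j M' i)
    (hinj : ∀ a ∈ s, ∀ b ∈ s, (∀ j < n, w a j = w b j) → a = b)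
    (hmem : ∀ a ∈ s, ∀ j < n, (w a j).Nonempty ∧ ∀ i ∈ w a j, Ok j (maxima (w a)) i)
    (hsurj : ∀ v : ℕ → Finset ℕ, (∀ j < n, (v j).Nonempty ∧ ∀ i ∈ v j, Ok j (maxima v) i) →
      ∃ a ∈ s, ∀ j < n, w a j = v j)
    (hdeg : ∀ a ∈ s, deg a + n = d + ∑ j ∈ range n, #(w a j))
    (hexch : ∀ M, (∀ j < n, Ok j M (M j)) → ∀ j < n, ∀ i < M j, Ok j M i →
      ∃ M', (∀ j < n, Ok j M' (M' j)) ∧ ∑ j ∈ range n, M' j < ∑ j ∈ range n, M j)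
    (hne : s.Nonempty) :
    ∃ Q : ℕ[X], ∑ a ∈ s, (X : ℕ[X]) ^ deg a = X ^ d + (1 + X) * Q := by
  -- A toggle inserts or deletes an admissible element below the maximum of one set. The maxima stay
  -- the same, and so do all conditions and all other toggles.
  set Tg : α → Set (ℕ × ℕ) := fun a =>
    {x | x.1 < n ∧ x.2 < maxima (w a) x.1 ∧ Ok x.1 (maxima (w a)) x.2} with hTg
  set v : ℕ × ℕ → α → ℕ → Finset ℕ := fun x a k => if k = x.1 then toggleElem (w a k) x.2 else w a k with hv
  set tog : ℕ × ℕ → α → α := fun x a =>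
    if h : ∃ b ∈ s, ∀ j < n, w b j = v x a j then h.choose else a with htog
  have vmax : ∀ a ∈ s, ∀ x ∈ Tg a, ∀ k < n, maxima (v x a) k = maxima (w a) k := by
    intro a ha x hx k hk
    by_cases h : k = x.1
    · subst h
      have hm := maxima_mem (hmem a ha _ hk).1
      refine le_antisymm (Finset.sup_le fun y hy => ?_) (le_maxima ?_)
      · simp only [hv, if_true] at hy
        by_cases e : y = x.2
        · exact e ▸ hx.2.1.le
        · exact le_maxima ((mem_toggleElem_of_ne e).1 hy)
      · simp only [hv, if_true]
        exact (mem_toggleElem_of_ne hx.2.1.ne').2 hm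
    · simp only [maxima, hv, h, if_false]
  have key : ∀ a ∈ s, ∀ x ∈ Tg a, tog x a ∈ s ∧ ∀ j < n, w (tog x a) j = v x a j := by
    intro a ha x hx
    have h : ∃ b ∈ s, ∀ j < n, w b j = v x a j := by
      refine hsurj _ fun j hj => ?_
      have hloc' : ∀ i, Ok j (maxima (w a)) i → Ok j (maxima (v x a)) i := fun i =>
        hloc j _ _ i fun k hk => (vmax a ha x hx k (hk.trans hj)).symm
      by_cases e : j = x.1
      · subst e
        simp only [hv, if_true] at hloc' ⊢
        refine ⟨⟨_, (mem_toggleElem_of_ne hx.2.1.ne').2 (maxima_mem (hmem a ha _ hj).1)⟩,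
          fun i hi => hloc' i ?_⟩
        by_cases e : i = x.2
        · exact e ▸ hx.2.2
        · exact (hmem a ha _ hj).2 i ((mem_toggleElem_of_ne e).1 hi)
      · have e1 : v x a j = w a j := by simp only [hv, e, if_false]
        rw [e1]
        exact ⟨(hmem a ha j hj).1, fun i hi => hloc' i ((hmem a ha j hj).2 i hi)⟩
    simp only [htog]
    rw [dif_pos h]
    exact h.choose_spec
  have tmax : ∀ a ∈ s, ∀ x ∈ Tg a, ∀ k < n, maxima (w (tog x a)) k = maxima (w a) k := by
    intro a ha x hx k hk
    rw [← vmax a ha x hx k hk, maxima, maxima, (key a ha x hx).2 k hk]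
  obtain ⟨Q, hQ⟩ := exists_sum_toggle s deg Tg tog (fun a ha x hx => (key a ha x hx).1) (by
      intro a ha x hx
      ext y
      constructor
      · rintro ⟨h1, h2, h3⟩
        rw [tmax a ha x hx _ h1] at h2
        exact ⟨h1, h2, hloc _ _ _ _ (fun k hk => tmax a ha x hx k (hk.trans h1)) h3⟩
      · rintro ⟨h1, h2, h3⟩
        refine ⟨h1, ?_, hloc _ _ _ _ (fun k hk => (tmax a ha x hx k (hk.trans h1)).symm) h3⟩
        rw [tmax a ha x hx _ h1]
        exact h2) (by
      intro a ha x hx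
      obtain ⟨k1, k2⟩ := key a ha x hx
      have hx' : x ∈ Tg (tog x a) := by
        refine ⟨hx.1, ?_, hloc _ _ _ _ (fun k hk => (tmax a ha x hx k (hk.trans hx.1)).symm) hx.2.2⟩
        rw [tmax a ha x hx _ hx.1]
        exact hx.2.1
      obtain ⟨k3, k4⟩ := key _ k1 x hx'
      refine hinj _ k3 _ ha fun j hj => ?_
      rw [k4 j hj]
      simp only [hv, k2 j hj]
      split_ifs with h
      · exact toggleElem_toggleElem _ _
      · rfl) (by
      intro a ha x hx
      obtain ⟨k1, k2⟩ := key a ha x hx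
      have h1 := hdeg a ha
      have h2 := hdeg _ k1
      have hx1 : x.1 ∈ range n := mem_range.2 hx.1
      rw [← add_sum_erase _ _ hx1] at h1 h2
      have h3 : ∑ j ∈ (range n).erase x.1, #(w (tog x a) j) = ∑ j ∈ (range n).erase x.1, #(w a j) := by
        refine sum_congr rfl fun j hj => ?_
        rw [k2 j (mem_range.1 (mem_of_mem_erase hj))]
        simp only [hv, ne_of_mem_erase hj, if_false]
      have h4 : w (tog x a) x.1 = toggleElem (w a x.1) x.2 := by
        rw [k2 _ hx.1]
        simp only [hv, if_true]
      rw [h3, h4] at h2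
      have := card_toggleElem (w a x.1) x.2
      omega)
  refine ⟨Q, ?_⟩
  rw [hQ]
  congr 1
  -- the tableaux without toggles
  have single : ∀ a ∈ s, Tg a = ∅ → ∀ j < n, w a j = {maxima (w a) j} := by
    intro a ha he j hj
    refine eq_singleton_iff_unique_mem.2 ⟨maxima_mem (hmem a ha j hj).1, fun i hi => ?_⟩
    by_contra hne
    have : (j, i) ∈ Tg a := ⟨hj, lt_of_le_of_ne (le_maxima hi) hne, (hmem a ha j hj).2 i hi⟩
    rw [he] at this
    exact this
  -- Two toggle-free sequences consist of singletons. At the first position where they differ, the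
  -- smaller maximum could be toggled in the other sequence.
  have uniq : ∀ a ∈ s, ∀ b ∈ s, Tg a = ∅ → Tg b = ∅ → a = b := by
    intro a ha b hb hea heb
    have hM : ∀ j < n, maxima (w a) j = maxima (w b) j := by
      intro j
      induction j using Nat.strong_induction_on with
      | _ j ih =>
        intro hj
        rcases lt_trichotomy (maxima (w a) j) (maxima (w b) j) with h | h | h
        · have : (j, maxima (w a) j) ∈ Tg b := ⟨hj, h, hloc _ _ _ _
            (fun k hk => ih k hk (hk.trans hj)) ((hmem a ha j hj).2 _ (maxima_mem (hmem a ha j hj).1))⟩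
          rw [heb] at this
          exact this.elim
        · exact h
        · have : (j, maxima (w b) j) ∈ Tg a := ⟨hj, h, hloc _ _ _ _
            (fun k hk => (ih k hk (hk.trans hj)).symm)
            ((hmem b hb j hj).2 _ (maxima_mem (hmem b hb j hj).1))⟩
          rw [hea] at this
          exact this.elim
    refine hinj a ha b hb fun j hj => ?_
    rw [single a ha hea j hj, single b hb heb j hj, hM j hj]
  -- A valid sequence of maxima with minimal sum is taken; a toggle of the corresponding singletons
  -- would give a smaller sum by `hexch`.
  have exist : ∃ a ∈ s, Tg a = ∅ := by
    have hval : ∃ M : ℕ → ℕ, ∀ j < n, Ok j M (M j) := by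
      obtain ⟨a, ha⟩ := hne
      exact ⟨maxima (w a), fun j hj => (hmem a ha j hj).2 _ (maxima_mem (hmem a ha j hj).1)⟩
    obtain ⟨M, hM, hmin⟩ := exists_min_of_wf (p := fun M : ℕ → ℕ => ∀ j < n, Ok j M (M j))
      (fun M => ∑ j ∈ range n, M j) hval
    have hmx : ∀ j, maxima (fun k => ({M k} : Finset ℕ)) j = M j := fun j => by simp [maxima]
    obtain ⟨a, ha, hw⟩ := hsurj (fun k => {M k}) fun j hj =>
      ⟨singleton_nonempty _, fun i hi => by
        rw [mem_singleton.1 hi]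
        exact hloc _ _ _ _ (fun k _ => (hmx k).symm) (hM j hj)⟩
    have hwM : ∀ j < n, maxima (w a) j = M j := fun j hj => by
      rw [maxima, hw j hj]
      simp
    refine ⟨a, ha, Set.eq_empty_iff_forall_notMem.2 fun x hx => ?_⟩
    obtain ⟨h1, h2, h3⟩ := hx
    obtain ⟨M', hM', hlt⟩ := hexch M hM x.1 h1 x.2 (by rwa [hwM _ h1] at h2)
      (hloc _ _ _ _ (fun k hk => hwM k (hk.trans h1)) h3)
    exact absurd (hmin M' hM') (by omega)
  obtain ⟨a, ha, he⟩ := exist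
  have hs : {a ∈ s | Tg a = ∅} = {a} := by
    ext b
    rw [mem_filter, mem_singleton]
    exact ⟨fun h => uniq b h.1 a ha h.2 he, fun h => h ▸ ⟨ha, he⟩⟩
  rw [hs, sum_singleton]
  congr 1
  have h1 := hdeg a ha
  have h2 : ∑ j ∈ range n, #(w a j) = n := by
    rw [sum_congr rfl fun j hj => by rw [single a ha he j (mem_range.1 hj), card_singleton]]
    simp
  omega
where
  exists_min_of_wf {γ : Type} {p : γ → Prop} (f : γ → ℕ) (h : ∃ a, p a) :
      ∃ a, p a ∧ ∀ b, p b → f a ≤ f b := by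
    obtain ⟨a, ha, hmin⟩ := (measure f).wf.has_min {a | p a} h
    exact ⟨a, ha, fun b hb => not_lt.1 (hmin b hb)⟩

end toggle

/-! ### The generating polynomial of the extra letters below `κ`. -/

namespace SetValuedTableau

open YoungDiagram Polynomial

open Classical in
/-- The tableaux of shape `mu` which extend the superstandard tableau of shape `lam` to a filling
with content in `κ`. -/
noncomputable def below (lam mu κ : YoungDiagram) : Finset (SetValuedTableau mu) :=
  {T ∈ bounded mu (κ.colLen 0) | T.IsLattice lam ∧ ∀ l, T.content lam l ≤ κ.rowLen l}

theorem mem_below {lam mu κ : YoungDiagram} {T : SetValuedTableau mu} :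
    T ∈ below lam mu κ ↔ T.IsLattice lam ∧ ∀ l, T.content lam l ≤ κ.rowLen l := by
  classical
  rw [below, mem_filter, mem_bounded, and_iff_right_iff_imp]
  rintro ⟨_, h⟩ p j l hl
  by_contra hk
  have h1 := h l
  rw [rowLen_eq_zero (not_lt.1 hk), content] at h1
  exact (T.weight_eq_zero_iff l).1 (by omega) p j hl

/-- The polynomial which counts the tableaux of `below lam mu κ` by their extra letters. -/
noncomputable def belowPoly (lam mu κ : YoungDiagram) : ℕ[X] :=
  ∑ T ∈ below lam mu κ, (X : ℕ[X]) ^ (T.size - mu.card)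

theorem belowPoly_ne_zero_iff {lam mu κ : YoungDiagram} :
    belowPoly lam mu κ ≠ 0 ↔ (below lam mu κ).Nonempty := by
  constructor
  · intro h
    by_contra hc
    rw [Finset.not_nonempty_iff_eq_empty] at hc
    exact h (by rw [belowPoly, hc, sum_empty])
  · intro h h0
    have := congrArg (Polynomial.eval 1) h0
    rw [belowPoly, Polynomial.eval_finsetSum] at this
    simp only [eval_pow, eval_X, one_pow, sum_const, smul_eq_mul, mul_one, eval_zero,
      card_eq_zero] at this
    rw [this] at h
    exact Finset.not_nonempty_empty h

open Classical in
-- In this form the polynomial inherits the exchange and transposition symmetries of the structure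
-- constants.
theorem belowPoly_eq (lam mu κ : YoungDiagram) :
    belowPoly lam mu κ = ∑ nu ∈ boxed (κ.colLen 0) (κ.rowLen 0) with nu ≤ κ,
      lrCount lam mu nu • (X : ℕ[X]) ^ (nu.card - lam.card - mu.card) := by
  choose! D hD using fun (T : SetValuedTableau mu) (hT : T.IsLattice lam) => hT.exists_diagram
  have hmap : ∀ T ∈ below lam mu κ,
      D T ∈ {nu ∈ boxed (κ.colLen 0) (κ.rowLen 0) | nu ≤ κ} := by
    intro T hT
    obtain ⟨h1, h2⟩ := mem_below.1 hT
    have hle : D T ≤ κ := le_iff_rowLen.2 fun i => by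
      rw [← hD T h1]
      exact h2 i
    exact mem_filter.2 ⟨mem_boxed_of_le (mem_boxed_self κ) hle, hle⟩
  rw [belowPoly, ← sum_fiberwise_of_maps_to hmap]
  refine sum_congr rfl fun nu hnu => ?_
  obtain ⟨hnu1, hnu⟩ := mem_filter.1 hnu
  rw [lrCount_eq (k := κ.colLen 0) (mem_boxed_iff.1 hnu1).1, ← sum_const]
  refine sum_congr ?_ ?_
  · ext T
    rw [mem_filter, mem_filter, mem_below, mem_bounded]
    constructor
    · rintro ⟨⟨h1, h2⟩, rfl⟩
      exact ⟨bounded_of_content (hD T h1) (mem_boxed_iff.1 hnu1).1, h1, hD T h1⟩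
    · rintro ⟨_, h1, h2⟩
      refine ⟨⟨h1, fun l => ?_⟩, ext_rowLen fun i => ?_⟩
      · rw [h2]
        exact le_iff_rowLen.1 hnu l
      · rw [← hD T h1, h2]
  · intro T hT
    rw [mem_filter] at hT
    have := size_add_card hT.2.2
    congr 1
    omega

/-- The tableaux of `below lam mu κ` cancel in pairs, up to one tableau without extra letters. -/
def Cancels (lam mu : YoungDiagram) : Prop :=
  ∀ κ, (below lam mu κ).Nonempty → ∃ Q : ℕ[X], belowPoly lam mu κ = 1 + (1 + X) * Q

theorem belowPoly_comm (lam mu κ : YoungDiagram) : belowPoly lam mu κ = belowPoly mu lam κ := by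
  classical
  rw [belowPoly_eq, belowPoly_eq]
  refine sum_congr rfl fun nu _ => ?_
  rw [lrCount_comm, Nat.sub_right_comm]

theorem card_transpose (mu : YoungDiagram) : mu.transpose.card = mu.card := by
  simp [YoungDiagram.card, YoungDiagram.transpose]

theorem belowPoly_transpose (lam mu κ : YoungDiagram) :
    belowPoly lam mu κ = belowPoly lam.transpose mu.transpose κ.transpose := by
  classical
  rw [belowPoly_eq, belowPoly_eq]
  refine sum_nbij' transpose transpose ?_ ?_ ?_ ?_ ?_
  · intro nu h
    obtain ⟨h1, h2⟩ := mem_filter.1 h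
    refine mem_filter.2 ⟨?_, transpose_le_iff.2 h2⟩
    rw [colLen_transpose, rowLen_transpose]
    exact transpose_mem_boxed.2 h1
  · intro nu h
    obtain ⟨h1, h2⟩ := mem_filter.1 h
    refine mem_filter.2 ⟨?_, by rw [← transpose_le_iff]; simpa using h2⟩
    rw [colLen_transpose, rowLen_transpose] at h1
    exact transpose_mem_boxed.1 (by simpa using h1)
  · intro nu _
    simp
  · intro nu _
    simp
  · intro nu _
    rw [← lrCount_transpose, card_transpose, card_transpose, card_transpose]

theorem Cancels.comm {lam mu : YoungDiagram} (h : Cancels lam mu) : Cancels mu lam := by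
  intro κ hκ
  rw [← belowPoly_ne_zero_iff, belowPoly_comm, belowPoly_ne_zero_iff] at hκ
  rw [belowPoly_comm]
  exact h κ hκ

theorem Cancels.of_transpose {lam mu : YoungDiagram} (h : Cancels lam.transpose mu.transpose) :
    Cancels lam mu := by
  intro κ hκ
  rw [← belowPoly_ne_zero_iff, belowPoly_transpose, belowPoly_ne_zero_iff] at hκ
  rw [belowPoly_transpose]
  exact h _ hκ

end SetValuedTableau

/-! ### Tableaux with a fixed upper part -/

namespace SetValuedTableau

open YoungDiagram Polynomial

variable {lam mu κ : YoungDiagram}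

/-- The tableaux agree above row `d`. -/
def Agree (d : ℕ) (T T' : SetValuedTableau mu) : Prop := ∀ q < d, ∀ j, T.entry q j = T'.entry q j

theorem Agree.refl (d : ℕ) (T : SetValuedTableau mu) : Agree d T T := fun _ _ _ => rfl

theorem Agree.rowCount {d : ℕ} {T T' : SetValuedTableau mu} (h : Agree d T T') {q : ℕ} (hq : q < d)
    (l : ℕ) : T.rowCount q l = T'.rowCount q l := by
  simp only [SetValuedTableau.rowCount, h q hq]

theorem Agree.upper {d : ℕ} {T T' : SetValuedTableau mu} (h : Agree d T T') {q : ℕ} (hq : q ≤ d)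
    (l : ℕ) : T.upper q l = T'.upper q l :=
  sum_congr rfl fun _ hp => h.rowCount ((mem_range.1 hp).trans_le hq) l

/-- The number of extra letters above row `d`. -/
def upperExtra (T : SetValuedTableau mu) (d : ℕ) : ℕ :=
  ∑ q ∈ range d, ∑ j ∈ range (mu.rowLen q), (#(T.entry q j) - 1)

theorem Agree.upperExtra {d : ℕ} {T T' : SetValuedTableau mu} (h : Agree d T T') :
    T.upperExtra d = T'.upperExtra d := by
  refine sum_congr rfl fun q hq => sum_congr rfl fun j _ => ?_
  rw [h q (mem_range.1 hq)]

theorem sum_cells {M : Type*} [AddCommMonoid M] (mu : YoungDiagram) {d : ℕ}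
    (hd : mu.colLen 0 ≤ d) (F : ℕ → ℕ → M) :
    ∑ c ∈ mu.cells, F c.1 c.2 = ∑ q ∈ range d, ∑ j ∈ range (mu.rowLen q), F q j := by
  rw [sum_sigma']
  refine sum_nbij' (fun c => ⟨c.1, c.2⟩) (fun c => (c.1, c.2)) ?_ ?_ ?_ ?_ ?_
  · rintro ⟨p, j⟩ h
    have h := (mu.mem_cells _).1 h
    have h1 := mem_iff_lt_colLen.1 (mu.up_left_mem le_rfl (Nat.zero_le j) h)
    simp only [mem_sigma, mem_range]
    exact ⟨by omega, mem_iff_lt_rowLen.1 h⟩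
  · rintro ⟨p, j⟩ h
    simp only [mem_sigma, mem_range] at h
    exact (mu.mem_cells _).2 (mem_iff_lt_rowLen.2 h.2)
  · intro _ _; rfl
  · intro _ _; rfl
  · intro _ _; rfl

theorem size_sub_card (T : SetValuedTableau mu) {d : ℕ} (hd : mu.colLen 0 ≤ d) :
    T.size - mu.card = T.upperExtra d := by
  have h : T.size = ∑ c ∈ mu.cells, (#(T.entry c.1 c.2) - 1) + mu.card := by
    rw [YoungDiagram.card, card_eq_sum_ones, ← sum_add_distrib]
    refine sum_congr rfl fun c hc => ?_
    have : 0 < #(T.entry c.1 c.2) :=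
      card_pos.2 ((T.nonempty_iff c.1 c.2).2 ((mu.mem_cells _).1 hc))
    omega
  rw [h, Nat.add_sub_cancel, sum_cells mu hd fun p j => #(T.entry p j) - 1, SetValuedTableau.upperExtra]

theorem upperExtra_succ (T : SetValuedTableau mu) (d : ℕ) : T.upperExtra (d + 1) =
    T.upperExtra d + ∑ j ∈ range (mu.rowLen d), (#(T.entry d j) - 1) := by
  rw [upperExtra, sum_range_succ, ← upperExtra]

theorem entry_nonempty (T : SetValuedTableau mu) {p j : ℕ} (h : j < mu.rowLen p) :
    (T.entry p j).Nonempty := (T.nonempty_iff p j).2 (mem_iff_lt_rowLen.2 h)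

theorem lt_rowLen (T : SetValuedTableau mu) {p j l : ℕ} (h : l ∈ T.entry p j) : j < mu.rowLen p :=
  mem_iff_lt_rowLen.1 (T.mem_shape h)

theorem sum_card_sub_one {v : ℕ → Finset ℕ} {n : ℕ} (h : ∀ j < n, (v j).Nonempty) :
    ∑ j ∈ range n, (#(v j) - 1) + n = ∑ j ∈ range n, #(v j) := by
  have : ∑ j ∈ range n, #(v j) = ∑ j ∈ range n, ((#(v j) - 1) + 1) :=
    sum_congr rfl fun j hj => by
      have := card_pos.2 (h j (mem_range.1 hj))
      omega
  rw [this, sum_add_distrib]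
  simp

/-- Replace the last row. -/
def setRow (T : SetValuedTableau mu) (d : ℕ) (v : ℕ → Finset ℕ) (hd : mu.colLen 0 ≤ d + 1)
    (hv : ∀ j < mu.rowLen d, (v j).Nonempty)
    (hr : ∀ j < mu.rowLen d, ∀ k < j, ∀ a ∈ v k, ∀ b ∈ v j, a ≤ b)
    (hc : ∀ j < mu.rowLen d, ∀ q < d, ∀ a ∈ T.entry q j, ∀ b ∈ v j, a < b) :
    SetValuedTableau mu where
  entry q j := if q = d then if j < mu.rowLen d then v j else ∅ else T.entry q j
  nonempty_iff q j := by
    split_ifs with h1 h2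
    · subst h1
      exact iff_of_true (hv j h2) (mem_iff_lt_rowLen.2 h2)
    · subst h1
      exact iff_of_false (by simp) fun h => h2 (mem_iff_lt_rowLen.1 h)
    · exact T.nonempty_iff q j
  row_weak q j₁ j₂ hj a ha b hb := by
    split_ifs at ha hb with h1 h2 h3 h4
    · exact hr _ h3 _ hj a ha b hb
    · simp at hb
    · simp at ha
    · simp at ha
    · exact T.row_weak q j₁ j₂ hj a ha b hb
  col_strict q₁ q₂ j hq a ha b hb := by
    by_cases h1 : q₁ = d
    · have h2 : (q₂, j) ∉ mu := fun h => by
        have h3 := mem_iff_lt_colLen.1 (mu.up_left_mem le_rfl (Nat.zero_le j) h)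
        omega
      rw [if_neg (by omega)] at hb
      exact absurd (T.mem_shape hb) h2
    · rw [if_neg h1] at ha
      split_ifs at hb with h2 h3
      · subst h2
        exact hc j h3 q₁ hq a ha b hb
      · simp at hb
      · exact T.col_strict q₁ q₂ j hq a ha b hb

theorem mem_below_iff_row {d : ℕ} (hd : mu.colLen 0 ≤ d + 1) {T : SetValuedTableau mu} :
    T ∈ below lam mu κ ↔
      (∀ p < d, ∀ l, lam.rowLen (l + 1) + T.upper (p + 1) (l + 1) ≤ lam.rowLen l + T.upper p l) ∧
      ∀ l, lam.rowLen l + T.upper d l + T.rowCount d l ≤ κ.rowLen l ∧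
        lam.rowLen (l + 1) + T.upper d (l + 1) + T.rowCount d (l + 1) ≤
          lam.rowLen l + T.upper d l := by
  rw [mem_below]
  have hw : ∀ l, T.weight l = T.upper d l + T.rowCount d l := fun l => by
    rw [T.weight_eq_upper hd, T.upper_succ]
  constructor
  · rintro ⟨h1, h2⟩
    refine ⟨fun p _ l => h1 p l, fun l => ?_⟩
    have h3 := h1 d l
    have h4 := h2 l
    rw [T.upper_succ] at h3
    rw [content, hw] at h4
    omega
  · rintro ⟨hT, h'⟩
    refine ⟨fun p l => ?_, fun l => ?_⟩
    · rcases lt_or_ge p d with hp | hp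
      · exact hT p hp l
      · have h1 := (h' l).2
        have h2 := T.upper_le_weight (p + 1) (l + 1)
        have h3 := T.upper_mono l hp
        rw [hw] at h2
        simp only at h3
        omega
    · have := (h' l).1
      rw [content, hw]
      omega

theorem mem_below_iff_of_agree {d : ℕ} (hd : mu.colLen 0 ≤ d + 1) {T T' : SetValuedTableau mu}
    (h : Agree d T' T) (hT : T ∈ below lam mu κ) :
    T' ∈ below lam mu κ ↔ ∀ l, lam.rowLen l + T.upper d l + T'.rowCount d l ≤ κ.rowLen l ∧
      lam.rowLen (l + 1) + T.upper d (l + 1) + T'.rowCount d (l + 1) ≤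
        lam.rowLen l + T.upper d l := by
  rw [mem_below_iff_row hd, and_iff_right]
  · simp only [h.upper le_rfl]
  · intro p hp l
    rw [h.upper hp, h.upper hp.le]
    exact (mem_below.1 hT).1 p l

open Classical in
/-- The tableaux in `below lam mu κ` which differ only in the last row. -/
theorem sum_agree_row {d : ℕ} (hd : mu.colLen 0 ≤ d + 1) {T₀ : SetValuedTableau mu}
    (hT₀ : T₀ ∈ below lam mu κ) :
    ∃ Q : ℕ[X], ∑ T ∈ below lam mu κ with Agree d T T₀, (X : ℕ[X]) ^ (T.size - mu.card) =
      X ^ T₀.upperExtra d + (1 + X) * Q := by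
  -- If `i` occurs in cell `j` and also in an earlier cell, it is the maximum of that cell. Hence
  -- the number of letters `i` so far, which enters the bounds from `κ` and from the lattice
  -- condition, is determined by the earlier maxima.
  set Ok : ℕ → (ℕ → ℕ) → ℕ → Prop := fun j M i => (∀ k < j, M k ≤ i) ∧
    (∀ q < d, ∀ a ∈ T₀.entry q j, a < i) ∧
    lam.rowLen i + T₀.upper d i + #{k ∈ range j | M k = i} + 1 ≤ κ.rowLen i ∧
    ∀ l, l + 1 = i → lam.rowLen i + T₀.upper d i + #{k ∈ range j | M k = i} + 1 ≤
      lam.rowLen l + T₀.upper d l with hOk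
  refine sum_line {T ∈ below lam mu κ | Agree d T T₀} (mu.rowLen d) (T₀.upperExtra d) (fun T => T.entry d)
    (fun T => T.size - mu.card) Ok ?_ ?_ ?_ ?_ ?_ ?_ ⟨T₀, mem_filter.2 ⟨hT₀, Agree.refl d T₀⟩⟩
  · rintro j M M' i h ⟨h1, h2, h3, h4⟩
    have e : ({k ∈ range j | M' k = i} : Finset ℕ) = {k ∈ range j | M k = i} :=
      filter_congr fun k hk => by rw [h k (mem_range.1 hk)]
    refine ⟨fun k hk => h k hk ▸ h1 k hk, h2, ?_, ?_⟩
    · rw [e]; exact h3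
    · rw [e]; exact h4
  · intro T hT T' hT' h
    refine entry_injective (funext fun q => funext fun j => ?_)
    rcases lt_trichotomy q d with hq | rfl | hq
    · rw [(mem_filter.1 hT).2 q hq, (mem_filter.1 hT').2 q hq]
    · by_cases hj : j < mu.rowLen q
      · exact h j hj
      · rw [not_nonempty_iff_eq_empty.1 fun h => hj (mem_iff_lt_rowLen.1 ((T.nonempty_iff q j).1 h)),
          not_nonempty_iff_eq_empty.1 fun h => hj (mem_iff_lt_rowLen.1 ((T'.nonempty_iff q j).1 h))]
    · have hj : ¬ j < mu.rowLen q := by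
        rw [rowLen_eq_zero (by omega)]
        omega
      rw [not_nonempty_iff_eq_empty.1 fun h => hj (mem_iff_lt_rowLen.1 ((T.nonempty_iff q j).1 h)),
          not_nonempty_iff_eq_empty.1 fun h => hj (mem_iff_lt_rowLen.1 ((T'.nonempty_iff q j).1 h))]
  · intro T hT j hj
    obtain ⟨hT1, hT2⟩ := mem_filter.1 hT
    refine ⟨T.entry_nonempty hj, fun i hi => ?_⟩
    have hcount : #{k ∈ range j | maxima (T.entry d) k = i} + 1 ≤ T.rowCount d i := by
      have h1 : j ∉ ({k ∈ range j | maxima (T.entry d) k = i} : Finset ℕ) := by simp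
      rw [← card_insert_of_notMem h1, rowCount]
      refine card_le_card fun k hk => ?_
      rcases mem_insert.1 hk with rfl | hk
      · exact mem_filter.2 ⟨mem_range.2 hj, hi⟩
      · obtain ⟨h2, h3⟩ := mem_filter.1 hk
        have h4 : k < mu.rowLen d := (mem_range.1 h2).trans hj
        exact mem_filter.2 ⟨mem_range.2 h4, h3 ▸ maxima_mem (T.entry_nonempty h4)⟩
    have hb := (mem_below_iff_of_agree hd hT2 hT₀).1 hT1
    refine ⟨fun k hk => ?_, fun q hq a ha => ?_, ?_, ?_⟩
    · exact T.row_weak d k j hk _ (maxima_mem (T.entry_nonempty (hk.trans hj))) i hi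
    · rw [← hT2 q hq] at ha
      exact T.col_strict q d j hq a ha i hi
    · have := (hb i).1
      omega
    · rintro l rfl
      have := (hb l).2
      omega
  · intro v hv
    have hmono : ∀ j < mu.rowLen d, ∀ k < j, ∀ a ∈ v k, ∀ b ∈ v j, a ≤ b := fun j hj k hk a ha b hb =>
      (le_maxima ha).trans (((hv j hj).2 b hb).1 k hk)
    set T' := T₀.setRow d v hd (fun j hj => (hv j hj).1) hmono
      (fun j hj q hq a ha b hb => ((hv j hj).2 b hb).2.1 q hq a ha) with hT'
    have hag : Agree d T' T₀ := fun q hq j => if_neg hq.ne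
    have hrow : ∀ j < mu.rowLen d, T'.entry d j = v j := fun j hj =>
      (if_pos rfl).trans (if_pos hj)
    refine ⟨T', mem_filter.2 ⟨(mem_below_iff_of_agree hd hag hT₀).2 ?_, hag⟩, hrow⟩
    have hrc : ∀ i, 0 < T'.rowCount d i → ∃ j < mu.rowLen d, i ∈ v j ∧
        T'.rowCount d i ≤ #{k ∈ range j | maxima v k = i} + 1 := by
      intro i hi
      obtain ⟨j, hj, hmax⟩ := exists_max_image _ id (card_pos.1 hi)
      obtain ⟨h1, h2⟩ := mem_filter.1 hj
      have hj' := mem_range.1 h1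
      rw [hrow j hj'] at h2
      refine ⟨j, hj', h2, (card_le_card fun k hk => ?_).trans (card_insert_le j _)⟩
      have hkj : k ≤ j := hmax k hk
      rcases hkj.eq_or_lt with rfl | hlt
      · exact mem_insert_self _ _
      · obtain ⟨h3, h4⟩ := mem_filter.1 hk
        rw [hrow k (mem_range.1 h3)] at h4
        exact mem_insert_of_mem (mem_filter.2 ⟨mem_range.2 hlt,
          (((hv j hj').2 i h2).1 k hlt).antisymm (le_maxima h4)⟩)
    intro l
    have hb := (mem_below_iff_of_agree hd (fun _ _ _ => rfl) hT₀).1 hT₀ l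
    constructor
    · rcases Nat.eq_zero_or_pos (T'.rowCount d l) with h0 | h0
      · omega
      · obtain ⟨j, hj, hij, hle⟩ := hrc l h0
        have := ((hv j hj).2 l hij).2.2.1
        omega
    · rcases Nat.eq_zero_or_pos (T'.rowCount d (l + 1)) with h0 | h0
      · omega
      · obtain ⟨j, hj, hij, hle⟩ := hrc _ h0
        have := ((hv j hj).2 _ hij).2.2.2 l rfl
        omega
  · intro T hT
    rw [T.size_sub_card hd, T.upperExtra_succ, (mem_filter.1 hT).2.upperExtra, add_assoc,
      sum_card_sub_one fun j hj => T.entry_nonempty hj]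
  · intro M hM j hj i hi hok
    -- Exchange for a row: only the letter at position `j` is lowered to `i`. Later letters exceed
    -- `i`, so none of the counts that matter for them increases.
    set M' : ℕ → ℕ := fun k => if k = j then i else M k with hM'
    have e : ∀ k, k ≠ j → M' k = M k := fun k hk => if_neg hk
    have ej : M' j = i := if_pos rfl
    have hle : ∀ k, M' k ≤ M k := fun k => by
      by_cases hk : k = j
      · rw [hk, ej]; exact hi.le
      · rw [e k hk]
    refine ⟨M', fun k hk => ?_, sum_lt_sum (fun k _ => hle k) ⟨j, mem_range.2 hj, by rwa [ej]⟩⟩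
    have hcard : ∀ k x, (k ≤ j ∨ i < x) →
        #{k' ∈ range k | M' k' = x} ≤ #{k' ∈ range k | M k' = x} := by
      intro k x hx
      refine card_le_card fun k' hk' => ?_
      obtain ⟨h1, h2⟩ := mem_filter.1 hk'
      refine mem_filter.2 ⟨h1, ?_⟩
      rw [← e k', h2]
      rintro rfl
      rw [ej] at h2
      have := mem_range.1 h1
      omega
    rcases lt_trichotomy k j with h | rfl | h
    · obtain ⟨h1, h2, h3, h4⟩ := hM k hk
      have hc := hcard k (M k) (Or.inl h.le)
      rw [e k h.ne]
      refine ⟨fun k' hk' => (hle k').trans (h1 k' hk'), h2, by omega, fun l hl => ?_⟩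
      have := h4 l hl
      omega
    · obtain ⟨h1, h2, h3, h4⟩ := hok
      have hc := hcard k i (Or.inl le_rfl)
      rw [ej]
      refine ⟨fun k' hk' => (hle k').trans (h1 k' hk'), h2, by omega, fun l hl => ?_⟩
      have := h4 l hl
      omega
    · obtain ⟨h1, h2, h3, h4⟩ := hM k hk
      have hc := hcard k (M k) (Or.inr (hi.trans_le (h1 j h)))
      rw [e k h.ne']
      refine ⟨fun k' hk' => (hle k').trans (h1 k' hk'), h2, by omega, fun l hl => ?_⟩
      have := h4 l hl
      omega

/-- `mu` is a row. -/
theorem cancels_row (lam : YoungDiagram) (hmu : mu.colLen 0 ≤ 1) : Cancels lam mu := by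
  classical
  rintro κ ⟨T₀, hT₀⟩
  obtain ⟨Q, hQ⟩ := sum_agree_row (d := 0) hmu hT₀
  refine ⟨Q, ?_⟩
  rw [filter_true_of_mem fun T _ q hq => absurd hq (Nat.not_lt_zero q)] at hQ
  simpa [upperExtra, belowPoly] using hQ

end SetValuedTableau

namespace SetValuedTableau

open YoungDiagram Polynomial

variable {lam mu κ : YoungDiagram}

theorem rowCount_of_rowLen_le_one (T : SetValuedTableau mu) {p : ℕ} (hp : mu.rowLen p ≤ 1) (l : ℕ)
    [Decidable (l ∈ T.entry p 0)] : T.rowCount p l = if l ∈ T.entry p 0 then 1 else 0 := by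
  rw [rowCount]
  split_ifs with h
  · have := T.lt_rowLen h
    have e : mu.rowLen p = 1 := by omega
    rw [e, range_one, filter_singleton, if_pos h, card_singleton]
  · rw [card_eq_zero, filter_eq_empty_iff]
    intro j hj
    have := mem_range.1 hj
    have e : j = 0 := by omega
    rwa [e]

open Classical in
theorem upper_of_rowLen_le_one (T : SetValuedTableau mu) {r : ℕ} (hr : mu.rowLen r ≤ 1) (t l : ℕ) :
    T.upper (r + t) l = T.upper r l + if ∃ t' < t, l ∈ T.entry (r + t') 0 then 1 else 0 := by
  induction t with
  | zero => simp
  | succ t ih =>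
    have h1 := mu.rowLen_anti r (r + t) (by omega)
    rw [← add_assoc, T.upper_succ, ih, T.rowCount_of_rowLen_le_one (h1.trans hr), add_assoc]
    congr 1
    by_cases h : l ∈ T.entry (r + t) 0
    · rw [if_pos h, if_pos (show ∃ t' < t + 1, l ∈ T.entry (r + t') 0 from ⟨t, by omega, h⟩), if_neg]
      rintro ⟨t', ht', h'⟩
      exact lt_irrefl _ (T.col_strict _ _ 0 (by omega) l h' l h)
    · rw [if_neg h, add_zero]
      congr 1
      refine propext ⟨fun ⟨t', ht', h'⟩ => ⟨t', by omega, h'⟩, fun ⟨t', ht', h'⟩ => ⟨t', ?_, h'⟩⟩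
      rcases Nat.lt_succ_iff_lt_or_eq.1 ht' with h1 | rfl
      · exact h1
      · exact absurd h' h

/-- From row `r` on there is a single column, in which a letter occurs at most once. Such a letter
needs room in `κ`, and either slack against its predecessor from the rows above `r` or the
predecessor higher up in the same column. -/
theorem mem_below_iff_col {r : ℕ} (hr : mu.rowLen r ≤ 1) {T : SetValuedTableau mu}
    (hU : ∀ l, lam.rowLen (l + 1) + T.upper r (l + 1) ≤ lam.rowLen l + T.upper r l)
    (hκ : ∀ l, lam.rowLen l + T.upper r l ≤ κ.rowLen l) :
    T ∈ below lam mu κ ↔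
      (∀ p < r, ∀ l, lam.rowLen (l + 1) + T.upper (p + 1) (l + 1) ≤ lam.rowLen l + T.upper p l) ∧
      ∀ t, ∀ l ∈ T.entry (r + t) 0, lam.rowLen l + T.upper r l + 1 ≤ κ.rowLen l ∧
        ∀ m, m + 1 = l → lam.rowLen l + T.upper r l + 1 ≤ lam.rowLen m + T.upper r m ∨
          ∃ t' < t, m ∈ T.entry (r + t') 0 := by
  classical
  rw [mem_below]
  constructor
  · rintro ⟨h1, h2⟩
    refine ⟨fun p _ l => h1 p l, fun t l hl => ⟨?_, ?_⟩⟩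
    · have h3 := h2 l
      have h4 := T.upper_le_weight (r + (t + 1)) l
      rw [T.upper_of_rowLen_le_one hr, if_pos ⟨t, Nat.lt_succ_self t, hl⟩] at h4
      rw [content] at h3
      omega
    · rintro m rfl
      have h3 := h1 (r + t) m
      rw [add_assoc, T.upper_of_rowLen_le_one hr, T.upper_of_rowLen_le_one hr,
        if_pos ⟨t, Nat.lt_succ_self t, hl⟩] at h3
      by_cases h4 : ∃ t' < t, m ∈ T.entry (r + t') 0
      · exact Or.inr h4
      · rw [if_neg h4] at h3
        exact Or.inl (by omega)
  · rintro ⟨hT, h'⟩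
    refine ⟨fun p l => ?_, fun l => ?_⟩
    · rcases lt_or_ge p r with hp | hp
      · exact hT p hp l
      · obtain ⟨t, rfl⟩ := Nat.exists_eq_add_of_le hp
        rw [add_assoc, T.upper_of_rowLen_le_one hr, T.upper_of_rowLen_le_one hr]
        have h1 := hU l
        by_cases h2 : ∃ t' < t + 1, l + 1 ∈ T.entry (r + t') 0
        · rw [if_pos h2]
          obtain ⟨t', h3, h4⟩ := h2
          rcases (h' t' _ h4).2 l rfl with h5 | ⟨t'', h6, h7⟩
          · omega
          · rw [if_pos ⟨t'', by omega, h7⟩]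
            omega
        · rw [if_neg h2]
          omega
    · rw [content, T.weight_eq_upper (show mu.colLen 0 ≤ r + mu.colLen 0 by omega),
        T.upper_of_rowLen_le_one hr]
      split_ifs with h2
      · obtain ⟨t', h3, h4⟩ := h2
        have := (h' t' _ h4).1
        omega
      · exact hκ l

theorem IsLattice.upper_succ_le {T : SetValuedTableau mu} (hT : T.IsLattice lam) (r l : ℕ) :
    lam.rowLen (l + 1) + T.upper r (l + 1) ≤ lam.rowLen l + T.upper r l := by
  have h1 := hT r l
  have h2 := T.upper_mono (l + 1) (Nat.le_succ r)
  dsimp only [Nat.succ_eq_add_one] at h2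
  omega

theorem upper_le_of_mem_below {T : SetValuedTableau mu} (hT : T ∈ below lam mu κ) (r l : ℕ) :
    lam.rowLen l + T.upper r l ≤ κ.rowLen l := by
  have h1 := (mem_below.1 hT).2 l
  have h2 := T.upper_le_weight r l
  rw [content] at h1
  omega

theorem mem_below_iff_of_agree_col {r : ℕ} (hr : mu.rowLen r ≤ 1) {T T' : SetValuedTableau mu}
    (h : Agree r T' T) (hT : T ∈ below lam mu κ) :
    T' ∈ below lam mu κ ↔ ∀ t, ∀ l ∈ T'.entry (r + t) 0,
      lam.rowLen l + T.upper r l + 1 ≤ κ.rowLen l ∧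
      ∀ m, m + 1 = l → lam.rowLen l + T.upper r l + 1 ≤ lam.rowLen m + T.upper r m ∨
        ∃ t' < t, m ∈ T'.entry (r + t') 0 := by
  have h1 := (mem_below.1 hT).1
  rw [mem_below_iff_col hr, and_iff_right]
  · simp only [h.upper le_rfl]
  · intro p hp l
    rw [h.upper hp, h.upper hp.le]
    exact h1 p l
  · intro l
    rw [h.upper le_rfl, h.upper le_rfl]
    exact h1.upper_succ_le r l
  · intro l
    rw [h.upper le_rfl]
    exact upper_le_of_mem_below hT r l

/-- Replace the rows from row `r` on. -/
def setColumn (T : SetValuedTableau mu) (r : ℕ) (v : ℕ → Finset ℕ) (hr : mu.rowLen r ≤ 1)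
    (hv : ∀ t, (r + t, 0) ∈ mu → (v t).Nonempty)
    (hc : ∀ t t', (r + t', 0) ∈ mu → t < t' → ∀ a ∈ v t, ∀ b ∈ v t', a < b)
    (hu : ∀ t, (r + t, 0) ∈ mu → ∀ q < r, ∀ a ∈ T.entry q 0, ∀ b ∈ v t, a < b) :
    SetValuedTableau mu where
  entry q j := if q < r then T.entry q j else if (q, j) ∈ mu then v (q - r) else ∅
  nonempty_iff q j := by
    split_ifs with h1 h2
    · exact T.nonempty_iff q j
    · refine iff_of_true (hv _ ?_) h2
      rw [Nat.add_sub_cancel' (not_lt.1 h1)]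
      exact mu.up_left_mem le_rfl (Nat.zero_le _) h2
    · exact iff_of_false (by simp) h2
  row_weak q j₁ j₂ hj a ha b hb := by
    by_cases h1 : q < r
    · rw [if_pos h1] at ha hb
      exact T.row_weak q j₁ j₂ hj a ha b hb
    · rw [if_neg h1, if_neg] at hb
      · simp at hb
      · intro h
        have h2 := mem_iff_lt_rowLen.1 h
        have h3 := mu.rowLen_anti r q (by omega)
        omega
  col_strict q₁ q₂ j hq a ha b hb := by
    by_cases h2 : q₂ < r
    · rw [if_pos (by omega)] at ha hb
      exact T.col_strict q₁ q₂ j hq a ha b hb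
    · rw [if_neg h2] at hb
      split_ifs at hb with h3
      · have h4 := mem_iff_lt_rowLen.1 h3
        have h5 := mu.rowLen_anti r q₂ (by omega)
        obtain rfl : j = 0 := by omega
        have h6 : (r + (q₂ - r), 0) ∈ mu := by rwa [Nat.add_sub_cancel' (not_lt.1 h2)]
        split_ifs at ha with h7 h8
        · exact hu _ h6 q₁ h7 a ha b hb
        · exact hc (q₁ - r) (q₂ - r) h6 (by omega) a ha b hb
        · simp at ha
      · simp at hb

open Classical in
/-- The tableaux in `below lam mu κ` which differ only from row `r` on, where the rows from row `r`
on have length at most one. -/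
theorem sum_agree_col {r : ℕ} (hr : mu.rowLen r ≤ 1) {T₀ : SetValuedTableau mu}
    (hT₀ : T₀ ∈ below lam mu κ) :
    ∃ Q : ℕ[X], ∑ T ∈ below lam mu κ with Agree r T T₀, (X : ℕ[X]) ^ (T.size - mu.card) =
      X ^ T₀.upperExtra r + (1 + X) * Q := by
  set n := mu.colLen 0 - r with hn
  have hmem : ∀ t, (r + t, 0) ∈ mu ↔ t < n := fun t => by
    rw [mem_iff_lt_colLen]
    omega
  have hrow : ∀ t < n, mu.rowLen (r + t) = 1 := fun t ht => by
    have h1 := mem_iff_lt_rowLen.1 ((hmem t).2 ht)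
    have h2 := mu.rowLen_anti r (r + t) (by omega)
    omega
  have hne : ∀ (T : SetValuedTableau mu), ∀ t < n, (T.entry (r + t) 0).Nonempty := fun T t ht =>
    (T.nonempty_iff _ _).2 ((hmem t).2 ht)
  -- A predecessor `m` in a cell above a letter `m + 1` is the maximum of that cell, so this
  -- condition is again one on the earlier maxima.
  set Ok : ℕ → (ℕ → ℕ) → ℕ → Prop := fun t M i => (∀ k < t, M k < i) ∧
    (∀ q < r, ∀ a ∈ T₀.entry q 0, a < i) ∧
    lam.rowLen i + T₀.upper r i + 1 ≤ κ.rowLen i ∧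
    ∀ m, m + 1 = i → lam.rowLen i + T₀.upper r i + 1 ≤ lam.rowLen m + T₀.upper r m ∨
      ∃ k < t, M k = m with hOk
  refine sum_line {T ∈ below lam mu κ | Agree r T T₀} n (T₀.upperExtra r)
    (fun T t => T.entry (r + t) 0) (fun T => T.size - mu.card) Ok ?_ ?_ ?_ ?_ ?_ ?_
    ⟨T₀, mem_filter.2 ⟨hT₀, Agree.refl r T₀⟩⟩
  · rintro j M M' i h ⟨h1, h2, h3, h4⟩
    refine ⟨fun k hk => h k hk ▸ h1 k hk, h2, h3, fun m hm => (h4 m hm).imp_right ?_⟩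
    rintro ⟨k, hk, rfl⟩
    exact ⟨k, hk, (h k hk).symm⟩
  · intro T hT T' hT' h
    refine entry_injective (funext fun q => funext fun j => ?_)
    by_cases hq : (q, j) ∈ mu
    · rcases lt_or_ge q r with hqr | hqr
      · rw [(mem_filter.1 hT).2 q hqr, (mem_filter.1 hT').2 q hqr]
      · obtain ⟨t, rfl⟩ := Nat.exists_eq_add_of_le hqr
        have h1 := mem_iff_lt_rowLen.1 hq
        have h2 := mu.rowLen_anti r (r + t) (by omega)
        obtain rfl : j = 0 := by omega
        exact h t ((hmem t).1 hq)
    · rw [not_nonempty_iff_eq_empty.1 fun h => hq ((T.nonempty_iff q j).1 h),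
        not_nonempty_iff_eq_empty.1 fun h => hq ((T'.nonempty_iff q j).1 h)]
  · intro T hT t ht
    obtain ⟨hT1, hT2⟩ := mem_filter.1 hT
    refine ⟨hne T t ht, fun i hi => ?_⟩
    have hb := (mem_below_iff_of_agree_col hr hT2 hT₀).1 hT1 t i hi
    have hlt : ∀ k < t, maxima (fun t => T.entry (r + t) 0) k < i := fun k hk =>
      T.col_strict _ _ 0 (Nat.add_lt_add_left hk r) _
        (maxima_mem (v := fun t => T.entry (r + t) 0) (hne T k (hk.trans ht))) i hi
    refine ⟨hlt, fun q hq a ha => ?_, hb.1, fun m hm => (hb.2 m hm).imp_right ?_⟩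
    · rw [← hT2 q hq] at ha
      exact T.col_strict q (r + t) 0 (by omega) a ha i hi
    · rintro ⟨k, hk, hmk⟩
      refine ⟨k, hk, ?_⟩
      have h1 := hlt k hk
      have h2 := le_maxima (v := fun t => T.entry (r + t) 0) hmk
      omega
  · intro v hv
    set T' := T₀.setColumn r v hr (fun t ht => (hv t ((hmem t).1 ht)).1)
      (fun t t' ht' htt a ha b hb =>
        (le_maxima ha).trans_lt (((hv t' ((hmem t').1 ht')).2 b hb).1 t htt))
      (fun t ht q hq a ha b hb => ((hv t ((hmem t).1 ht)).2 b hb).2.1 q hq a ha) with hT'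
    have hag : Agree r T' T₀ := fun q hq j => if_pos hq
    have hcol : ∀ t < n, T'.entry (r + t) 0 = v t := fun t ht =>
      (if_neg (by omega)).trans ((if_pos ((hmem t).2 ht)).trans (by rw [Nat.add_sub_cancel_left]))
    refine ⟨T', mem_filter.2 ⟨(mem_below_iff_of_agree_col hr hag hT₀).2 fun t l hl => ?_, hag⟩, hcol⟩
    have ht := (hmem t).1 (T'.mem_shape hl)
    rw [hcol t ht] at hl
    obtain ⟨h1, h2, h3, h4⟩ := (hv t ht).2 l hl
    refine ⟨h3, fun m hm => (h4 m hm).imp_right ?_⟩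
    rintro ⟨k, hk, rfl⟩
    refine ⟨k, hk, ?_⟩
    rw [hcol k (hk.trans ht)]
    exact maxima_mem (hv k (hk.trans ht)).1
  · intro T hT
    have h1 : T.size - mu.card = T₀.upperExtra r + ∑ t ∈ range n, (#(T.entry (r + t) 0) - 1) := by
      rw [T.size_sub_card (show mu.colLen 0 ≤ r + n by omega), ← (mem_filter.1 hT).2.upperExtra,
        upperExtra, sum_range_add, ← upperExtra]
      congr 1
      refine sum_congr rfl fun t ht => ?_
      rw [hrow t (mem_range.1 ht), sum_range_one]
    rw [h1, add_assoc, sum_card_sub_one (v := fun t => T.entry (r + t) 0) (hne T)]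
  · intro M hM j hj i hi hok
    -- Exchange for a column: `i` is inserted at position `j`, the following letters move down one
    -- cell and the last one is dropped. Mere replacement could destroy the predecessor that a later
    -- letter needs.
    set M' : ℕ → ℕ := fun k => if k < j then M k else if k = j then i else M (k - 1) with hM'
    have e1 : ∀ k < j, M' k = M k := fun k hk => if_pos hk
    have e2 : M' j = i := by simp [hM']
    have e3 : ∀ k, j ≤ k → M' (k + 1) = M k := fun k hk => by
      simp only [hM']
      rw [if_neg (by omega), if_neg (by omega), Nat.add_sub_cancel]
    refine ⟨M', fun k hk => ?_, ?_⟩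
    · rcases lt_trichotomy k j with h | rfl | h
      · obtain ⟨h1, h2, h3, h4⟩ := hM k hk
        rw [e1 k h]
        refine ⟨fun k' hk' => (e1 k' (hk'.trans h)).symm ▸ h1 k' hk', h2, h3,
          fun m hm => (h4 m hm).imp_right ?_⟩
        rintro ⟨k', hk', rfl⟩
        exact ⟨k', hk', e1 k' (hk'.trans h)⟩
      · obtain ⟨h1, h2, h3, h4⟩ := hok
        rw [e2]
        refine ⟨fun k' hk' => (e1 k' hk').symm ▸ h1 k' hk', h2, h3, fun m hm => (h4 m hm).imp_right ?_⟩
        rintro ⟨k', hk', rfl⟩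
        exact ⟨k', hk', e1 k' hk'⟩
      · obtain ⟨k, rfl⟩ := Nat.exists_eq_succ_of_ne_zero (Nat.ne_of_gt (Nat.zero_le j |>.trans_lt h))
        have hjk : j ≤ k := by omega
        obtain ⟨h1, h2, h3, h4⟩ := hM k (by omega)
        have hik : i < M k := by
          rcases hjk.eq_or_lt with rfl | h
          · exact hi
          · exact hi.trans (h1 j h)
        rw [e3 k hjk]
        refine ⟨fun k' hk' => ?_, h2, h3, fun m hm => (h4 m hm).imp_right ?_⟩
        · rcases lt_trichotomy k' j with h | rfl | h
          · rw [e1 k' h]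
            exact h1 k' (by omega)
          · rwa [e2]
          · obtain ⟨k', rfl⟩ :=
              Nat.exists_eq_succ_of_ne_zero (Nat.ne_of_gt (Nat.zero_le j |>.trans_lt h))
            rw [e3 k' (by omega)]
            exact h1 k' (by omega)
        · rintro ⟨k', hk', rfl⟩
          rcases lt_or_ge k' j with h | h
          · exact ⟨k', by omega, e1 k' h⟩
          · exact ⟨k' + 1, by omega, e3 k' h⟩
    · refine sum_lt_sum (fun k hk => ?_) ⟨j, mem_range.2 hj, by rwa [e2]⟩
      rcases lt_trichotomy k j with h | rfl | h
      · rw [e1 k h]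
      · rw [e2]; exact hi.le
      · obtain ⟨k, rfl⟩ := Nat.exists_eq_succ_of_ne_zero (Nat.ne_of_gt (Nat.zero_le j |>.trans_lt h))
        rw [e3 k (by omega)]
        exact ((hM (k + 1) (mem_range.1 hk)).1 k (Nat.lt_succ_self k)).le

end SetValuedTableau

theorem lt_card_filter_range_iff {n j : ℕ} {P : ℕ → Prop} [DecidablePred P]
    (hP : ∀ i j, i < j → j < n → P j → P i) : j < #{i ∈ range n | P i} ↔ j < n ∧ P j := by
  constructor
  · intro h
    by_contra hc
    have : {i ∈ range n | P i} ⊆ range j := fun i hi => by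
      obtain ⟨h1, h2⟩ := mem_filter.1 hi
      have h1 := mem_range.1 h1
      refine mem_range.2 (not_le.1 fun hji => hc ?_)
      rcases hji.eq_or_lt with rfl | hlt
      · exact ⟨h1, h2⟩
      · exact ⟨by omega, hP j i hlt h1 h2⟩
    have := card_le_card this
    rw [card_range] at this
    omega
  · rintro ⟨h1, h2⟩
    have : range (j + 1) ⊆ {i ∈ range n | P i} := fun i hi => by
      have hi := mem_range.1 hi
      refine mem_filter.2 ⟨mem_range.2 (by omega), ?_⟩
      rcases (Nat.lt_succ_iff.1 hi).eq_or_lt with rfl | hlt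
      · exact h2
      · exact hP i j hlt h1 h2
    have := card_le_card this
    rw [card_range] at this
    omega

/-! ### The first block of rows of `lam` -/

namespace SetValuedTableau

open YoungDiagram Polynomial

variable {lam mu κ : YoungDiagram} {T : SetValuedTableau mu} {e f : ℕ}

theorem rowCount_le_upper (T : SetValuedTableau mu) {p q : ℕ} (h : p < q) (l : ℕ) :
    T.rowCount p l ≤ T.upper q l :=
  single_le_sum (f := fun p => T.rowCount p l) (fun _ _ => Nat.zero_le _) (mem_range.2 h)

theorem rowCount_pos {p j l : ℕ} (h : l ∈ T.entry p j) : 0 < T.rowCount p l :=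
  card_pos.2 ⟨j, mem_filter.2 ⟨mem_range.2 (T.lt_rowLen h), h⟩⟩

theorem rowCount_eq_zero_of_forall {p l : ℕ} (h : ∀ j, l ∉ T.entry p j) : T.rowCount p l = 0 := by
  rw [rowCount, card_eq_zero, filter_eq_empty_iff]
  exact fun j _ => h j

/-- The number of cells of row `p` in which all letters are less than `f`. -/
def low (T : SetValuedTableau mu) (f p : ℕ) : ℕ :=
  #{j ∈ range (mu.rowLen p) | ∀ l ∈ T.entry p j, l < f}

theorem lt_low_iff {p j : ℕ} :
    j < T.low f p ↔ j < mu.rowLen p ∧ ∀ l ∈ T.entry p j, l < f := by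
  refine lt_card_filter_range_iff fun i j hij hj h l hl => ?_
  obtain ⟨a, ha⟩ := T.entry_nonempty hj
  exact (T.row_weak p i j hij l hl a ha).trans_lt (h a ha)

theorem low_le (T : SetValuedTableau mu) (f p : ℕ) : T.low f p ≤ mu.rowLen p :=
  (card_filter_le _ _).trans (card_range _).le

theorem exists_le_of_low_le {p j : ℕ} (hj : j < mu.rowLen p) (h : T.low f p ≤ j) :
    ∃ l ∈ T.entry p j, f ≤ l := by
  by_contra hc
  push Not at hc
  exact absurd (lt_low_iff.2 ⟨hj, hc⟩) (by omega)

theorem lt_low_of_col {p q j l : ℕ} (hpq : p < q) (hl : l ∈ T.entry q j) (hlf : l ≤ f) :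
    j < T.low f p := by
  have h1 := T.lt_rowLen hl
  exact lt_low_iff.2 ⟨h1.trans_le (mu.rowLen_anti p q hpq.le),
    fun a ha => (T.col_strict p q j hpq a ha l hl).trans_le hlf⟩

theorem low_anti (T : SetValuedTableau mu) (f : ℕ) : Antitone (T.low f) := by
  intro p q hpq
  rcases hpq.eq_or_lt with rfl | hlt
  · exact le_rfl
  · by_contra hc
    push Not at hc
    obtain ⟨h1, h2⟩ := lt_low_iff.1 hc
    obtain ⟨l, hl⟩ := T.entry_nonempty h1
    exact lt_irrefl _ (lt_low_of_col hlt hl (h2 l hl).le)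

theorem low_eq_zero {p : ℕ} (h : f ≤ p) : T.low f p = 0 := by
  by_contra hc
  obtain ⟨h1, h2⟩ := lt_low_iff.1 (Nat.pos_of_ne_zero hc)
  obtain ⟨l, hl⟩ := T.entry_nonempty h1
  have := h2 l hl
  have := T.le_of_mem hl
  omega

theorem le_low_of_mem {p j : ℕ} (hp : p < f) (h : p ∈ T.entry p j) : j ≤ T.low f p := by
  by_contra hc
  push Not at hc
  obtain ⟨l, hl, hle⟩ := exists_le_of_low_le (hc.trans (T.lt_rowLen h)) le_rfl
  have := T.row_weak p _ _ hc l hl p h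
  omega

theorem mem_of_lt_low' {p j : ℕ} (h1 : ∀ q c, ∀ l ∈ T.entry q c, l < f → q = l)
    (h : j < T.low f p) : T.entry p j = {p} := by
  obtain ⟨h2, h3⟩ := lt_low_iff.1 h
  exact eq_singleton_iff_nonempty_unique_mem.2
    ⟨T.entry_nonempty h2, fun l hl => (h1 p j l hl (h3 l hl)).symm⟩

theorem low_le_rowCount (h1 : ∀ q c, ∀ l ∈ T.entry q c, l < f → q = l) (p : ℕ) :
    T.low f p ≤ T.rowCount p p := by
  have : range (T.low f p) ⊆ {j ∈ range (mu.rowLen p) | p ∈ T.entry p j} := fun j hj => by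
    have hj := mem_range.1 hj
    refine mem_filter.2 ⟨mem_range.2 (lt_low_iff.1 hj).1, ?_⟩
    rw [mem_of_lt_low' h1 hj]
    exact mem_singleton_self p
  have := card_le_card this
  rwa [card_range] at this

theorem upper_of_row {l : ℕ} (h : ∀ q c, l ∈ T.entry q c → q = l) (q : ℕ) :
    T.upper q l = if l < q then T.rowCount l l else 0 := by
  rw [upper]
  split_ifs with hq
  · refine sum_eq_single l (fun p _ hp => ?_) fun h => absurd (mem_range.2 hq) h
    exact rowCount_eq_zero_of_forall fun j hj => hp (h p j hj)
  · refine sum_eq_zero fun p hp => rowCount_eq_zero_of_forall fun j hj => hq ?_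
    rw [← h p j hj]
    exact mem_range.1 hp

/-- The first `f` rows of `lam` are equal, so a letter `l + 1` in this block needs an `l` in a
higher row. By induction `l` does not occur above row `l`, and column strictness excludes the rows
below. -/
theorem IsLattice.eq_row (hT : T.IsLattice lam) (hlam : ∀ l < f, lam.rowLen l = e) {p j l : ℕ}
    (h : l ∈ T.entry p j) (hl : l < f) : p = l := by
  have key : ∀ l < f, T.upper l l = 0 := by
    intro l
    induction l with
    | zero => intro _; exact T.upper_zero 0
    | succ l ih =>
      intro hl
      have := hT l l
      rw [hlam _ hl, hlam l (by omega), ih (by omega)] at this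
      omega
  refine (T.le_of_mem h).antisymm (not_lt.1 fun hlt => ?_)
  have h1 := T.rowCount_le_upper hlt l
  have h2 := rowCount_pos h
  have := key l hl
  omega

/-- The letters `p + 1` above row `p + 1` are bounded by `lam` alone, and those in row `p + 1` lie
below low cells of row `p`. The bound does not see whether `p` occurs in the first cell that is not
low, which makes `p` there removable. -/
theorem IsLattice.weight_succ_le (hT : T.IsLattice lam) (hlam : ∀ l < f, lam.rowLen l = e) {p : ℕ}
    (hp : p < f) : lam.rowLen (p + 1) + T.weight (p + 1) ≤ lam.rowLen p + T.low f p := by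
  have h1 := hT p p
  rw [T.upper_of_row (l := p) fun q c h => hT.eq_row hlam h hp, if_neg (lt_irrefl p)] at h1
  have h2 : T.weight (p + 1) = T.upper (p + 2) (p + 1) := by
    rw [T.weight_eq_upper (le_max_left (mu.colLen 0) (p + 2)), upper, upper]
    refine (sum_subset (range_subset_range.2 (le_max_right _ _)) fun q _ hq =>
      rowCount_eq_zero_of_forall fun j hj => hq ?_).symm
    have := T.le_of_mem hj
    exact mem_range.2 (by omega)
  have h3 : T.rowCount (p + 1) (p + 1) ≤ T.low f p := by
    have : {j ∈ range (mu.rowLen (p + 1)) | p + 1 ∈ T.entry (p + 1) j} ⊆ range (T.low f p) :=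
      fun j hj => mem_range.2 (lt_low_of_col (Nat.lt_succ_self p) (mem_filter.1 hj).2 hp)
    have := card_le_card this
    rwa [card_range] at this
  rw [h2, T.upper_succ]
  omega

/-- The letters of the first block which can be toggled. -/
def BlockToggle (κ : YoungDiagram) (e f r : ℕ) (T : SetValuedTableau mu) : Set ℕ :=
  {p | p < f ∧ p < r ∧ T.low f p < mu.rowLen p ∧ (∀ p', p' + 1 = p → T.low f p < T.low f p') ∧
    e + T.low f p + 1 ≤ κ.rowLen p}

/-- The toggled cell also contains a letter at least `f`, so it stays non-empty. The row above has
more low cells, which provides for the column and the letter `p - 1`; `weight_succ_le` takes care of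
`p + 1`, and `κ` has room by assumption. -/
theorem exists_blockToggle (hlam : ∀ l < f, lam.rowLen l = e) (hT : T ∈ below lam mu κ) {p r : ℕ}
    (hp : p ∈ BlockToggle κ e f r T) : ∃ T' ∈ below lam mu κ, ∀ q j, T'.entry q j =
      if q = p ∧ j = T.low f p then toggleElem (T.entry q j) p else T.entry q j := by
  obtain ⟨hpf, -, hx, hpred, hκ⟩ := hp
  obtain ⟨hlat, hcont⟩ := mem_below.1 hT
  have hrow : ∀ q c, ∀ l ∈ T.entry q c, l < f → q = l := fun q c l h hl => hlat.eq_row hlam h hl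
  set x := T.low f p with hxdef
  obtain ⟨z, hz, hzf⟩ := exists_le_of_low_le hx le_rfl
  have hmem : ∀ y ∈ toggleElem (T.entry p x) p, y = p ∨ y ∈ T.entry p x := fun y hy => by
    by_cases h : y = p
    · exact Or.inl h
    · exact Or.inr ((mem_toggleElem_of_ne h).1 hy)
  have hge : ∀ y ∈ toggleElem (T.entry p x) p, p ≤ y := fun y hy => by
    rcases hmem y hy with rfl | h
    · exact le_rfl
    · exact T.le_of_mem h
  set T' := T.setCell p x (toggleElem (T.entry p x) p) (mem_iff_lt_rowLen.2 hx)
    (show (toggleElem (T.entry p x) p).Nonempty from ⟨z, (mem_toggleElem_of_ne (by omega)).2 hz⟩)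
    (fun j hj a ha b hb => by
      rw [mem_of_lt_low' hrow hj, mem_singleton] at ha
      exact ha ▸ hge b hb)
    (fun j hj b hb a ha => by
      rcases hmem b hb with rfl | h
      · exact T.le_of_mem ha
      · exact T.row_weak p x j hj b h a ha)
    (fun q hq a ha b hb => by
      obtain ⟨p', rfl⟩ := Nat.exists_eq_succ_of_ne_zero (Nat.ne_of_gt (Nat.zero_le q |>.trans_lt hq))
      have h1 := (hpred p' rfl).trans_le (T.low_anti f (Nat.lt_succ_iff.1 hq))
      rw [mem_of_lt_low' hrow h1, mem_singleton] at ha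
      have := hge b hb
      omega)
    (fun q hq b hb a ha => by
      rcases hmem b hb with rfl | h
      · exact hq.trans_le (T.le_of_mem ha)
      · exact T.col_strict p q x hq b h a ha) with hT'
  have hentry : ∀ q j, T'.entry q j =
      if q = p ∧ j = x then toggleElem (T.entry q j) p else T.entry q j := fun q j => by
    by_cases h : q = p ∧ j = x
    · rw [if_pos h, h.1, h.2]
      exact setCell_self
    · rw [if_neg h]
      exact setCell_of_ne h
  refine ⟨T', ?_, hentry⟩
  have hne : ∀ q j l, l ≠ p → (l ∈ T'.entry q j ↔ l ∈ T.entry q j) := fun q j l hl => by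
    rw [hentry]
    split_ifs
    · exact mem_toggleElem_of_ne hl
    · rfl
  have hrow' : ∀ q c, p ∈ T'.entry q c → q = p := fun q c h => by
    rw [hentry] at h
    split_ifs at h with h1
    · exact h1.1
    · exact hrow q c p h hpf
  have hrc : ∀ q l, l ≠ p → T'.rowCount q l = T.rowCount q l := fun q l hl => by
    simp only [rowCount, hne q _ l hl]
  have hup : ∀ q l, l ≠ p → T'.upper q l = T.upper q l := fun q l hl =>
    sum_congr rfl fun q' _ => hrc q' l hl
  have hxle : x ≤ T'.rowCount p p := by
    have : range x ⊆ {j ∈ range (mu.rowLen p) | p ∈ T'.entry p j} := fun j hj => by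
      have hj := mem_range.1 hj
      refine mem_filter.2 ⟨mem_range.2 (lt_low_iff.1 hj).1, ?_⟩
      rw [hentry, if_neg (by omega), mem_of_lt_low' hrow hj]
      exact mem_singleton_self p
    have := card_le_card this
    rwa [card_range] at this
  have hlex : T'.rowCount p p ≤ x + 1 := by
    have : {j ∈ range (mu.rowLen p) | p ∈ T'.entry p j} ⊆ range (x + 1) := fun j hj => by
      by_cases h : j = x
      · exact mem_range.2 (by omega)
      · have h1 := (mem_filter.1 hj).2
        rw [hentry, if_neg (by omega)] at h1
        exact mem_range.2 (Nat.lt_succ_of_le (le_low_of_mem hpf h1))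
    have := card_le_card this
    rwa [card_range] at this
  have hupp : ∀ q, T'.upper q p = if p < q then T'.rowCount p p else 0 := T'.upper_of_row hrow'
  refine mem_below.2 ⟨fun q l => ?_, fun l => ?_⟩
  · by_cases h1 : l + 1 = p
    · have h2 : l ≠ p := by omega
      rw [hup q l h2, h1, hupp]
      have h3 := lam.rowLen_anti l p (by omega)
      split_ifs with h4
      · have h5 := hpred l h1
        have h6 := low_le_rowCount hrow l
        have h7 := T.rowCount_le_upper (show l < q by omega) l
        omega
      · omega
    · rw [hup (q + 1) (l + 1) h1]
      by_cases h2 : l = p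
      · subst h2
        rw [hupp]
        split_ifs with h4
        · have h5 := hlat.weight_succ_le hlam hpf
          have h6 := T.upper_le_weight (q + 1) (l + 1)
          omega
        · have h5 := hlat q l
          rw [T.upper_of_row (l := l) fun q c h => hrow q c l h hpf, if_neg h4] at h5
          exact h5
      · rw [hup q l h2]
        exact hlat q l
  · rw [content, T'.weight_eq_upper (le_max_left (mu.colLen 0) (p + 1))]
    by_cases h1 : l = p
    · subst h1
      rw [hupp, if_pos (by omega), hlam l hpf]
      omega
    · rw [hup _ _ h1, ← T.weight_eq_upper (le_max_left _ _)]
      exact hcont l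

theorem low_eq_of_toggle {T' : SetValuedTableau mu} {p : ℕ} (hpf : p < f)
    (h : ∀ q j, T'.entry q j =
      if q = p ∧ j = T.low f p then toggleElem (T.entry q j) p else T.entry q j) (q : ℕ) :
    T'.low f q = T.low f q := by
  rw [low, low]
  congr 1
  refine filter_congr fun j hj => ?_
  rw [h]
  split_ifs with h1
  · obtain ⟨rfl, rfl⟩ := h1
    obtain ⟨z, hz, hzf⟩ := exists_le_of_low_le (mem_range.1 hj) le_rfl
    refine iff_of_false (fun h2 => ?_) (fun h2 => ?_)
    · have := h2 z ((mem_toggleElem_of_ne (by omega)).2 hz)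
      omega
    · have := h2 z hz
      omega
  · rfl

/-- The number of low cells never exceeds the minimum. In the first row where it is smaller, the row
above has already reached its minimum and is therefore strictly longer, so the letter can be
toggled. -/
theorem blockToggle_eq_empty_iff {r : ℕ} (hlam : ∀ l < f, lam.rowLen l = e)
    (hT : T ∈ below lam mu κ) : BlockToggle κ e f r T = ∅ ↔
      ∀ p < f, p < r → T.low f p = min (mu.rowLen p) (κ.rowLen p - e) := by
  obtain ⟨hlat, hcont⟩ := mem_below.1 hT
  have hle : ∀ p < f, T.low f p ≤ κ.rowLen p - e := fun p hp => by
    have h1 := low_le_rowCount (fun q c l h hl => hlat.eq_row hlam h hl) p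
    have h2 := T.rowCount_le_upper (Nat.lt_succ_self p) p
    have h3 := upper_le_of_mem_below hT (p + 1) p
    rw [hlam p hp] at h3
    dsimp only [Nat.succ_eq_add_one] at h2
    omega
  constructor
  · intro h p
    induction p with
    | zero =>
      intro hpf hpr
      have h1 : 0 ∉ BlockToggle κ e f r T := h ▸ Set.notMem_empty _
      have h2 := hle 0 hpf
      have h3 := T.low_le f 0
      by_contra hc
      exact h1 ⟨hpf, hpr, by omega, fun p' hp' => absurd hp' (Nat.succ_ne_zero p'), by omega⟩
    | succ p ih =>
      intro hpf hpr
      have h1 : p + 1 ∉ BlockToggle κ e f r T := h ▸ Set.notMem_empty _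
      have h2 := hle (p + 1) hpf
      have h3 := T.low_le f (p + 1)
      have h4 := ih (by omega) (by omega)
      have h5 := mu.rowLen_anti p (p + 1) (by omega)
      have h6 := κ.rowLen_anti p (p + 1) (by omega)
      by_contra hc
      refine h1 ⟨hpf, hpr, by omega, fun p' hp' => ?_, by omega⟩
      obtain rfl : p' = p := by omega
      omega
  · intro h
    refine Set.eq_empty_iff_forall_notMem.2 fun p hp => ?_
    obtain ⟨h1, h2, h3, -, h4⟩ := hp
    have := h p h1 h2
    omega

/-- An occurrence of `p` in the first cell that is not low would give `low + 1` letters `p`, too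
many for the row or for `κ`. -/
theorem lt_low_of_mem (hlam : ∀ l < f, lam.rowLen l = e)
    (hT : T ∈ below lam mu κ) {p j : ℕ} (hp : p < f)
    (h : T.low f p = min (mu.rowLen p) (κ.rowLen p - e)) (hj : p ∈ T.entry p j) : j < T.low f p := by
  obtain ⟨hlat, hcont⟩ := mem_below.1 hT
  have hrow : ∀ q c, ∀ l ∈ T.entry q c, l < f → q = l := fun q c l h hl => hlat.eq_row hlam h hl
  refine lt_of_le_of_ne (le_low_of_mem hp hj) fun hne => ?_
  have h1 := T.lt_rowLen hj
  have : range (T.low f p + 1) ⊆ {j ∈ range (mu.rowLen p) | p ∈ T.entry p j} := fun i hi => by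
    rcases (Nat.lt_succ_iff.1 (mem_range.1 hi)).eq_or_lt with hi | hi
    · subst hi
      rw [← hne]
      exact mem_filter.2 ⟨mem_range.2 h1, hj⟩
    · refine mem_filter.2 ⟨mem_range.2 (lt_low_iff.1 hi).1, ?_⟩
      rw [mem_of_lt_low' hrow hi]
      exact mem_singleton_self p
  have h2 := card_le_card this
  rw [card_range, ← rowCount] at h2
  have h3 := T.rowCount_le_upper (show p < p + 1 by omega) p
  have h4 := upper_le_of_mem_below hT (p + 1) p
  rw [hlam p hp] at h4
  omega

open Classical in
/-- The tableaux in which a letter of the first block can be toggled cancel. -/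
theorem exists_blockToggle_sum (hlam : ∀ l < f, lam.rowLen l = e) (κ : YoungDiagram) (r : ℕ) :
    ∃ Q : ℕ[X], belowPoly lam mu κ =
      ∑ T ∈ below lam mu κ with BlockToggle κ e f r T = ∅, X ^ (T.size - mu.card) + (1 + X) * Q := by
  set tog : ℕ → SetValuedTableau mu → SetValuedTableau mu := fun p T =>
    if h : ∃ T' ∈ below lam mu κ, ∀ q j, T'.entry q j =
      if q = p ∧ j = T.low f p then toggleElem (T.entry q j) p else T.entry q j
    then h.choose else T with htog
  have key : ∀ T ∈ below lam mu κ, ∀ p ∈ BlockToggle κ e f r T, tog p T ∈ below lam mu κ ∧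
      ∀ q j, (tog p T).entry q j =
        if q = p ∧ j = T.low f p then toggleElem (T.entry q j) p else T.entry q j := by
    intro T hT p hp
    have h := exists_blockToggle hlam hT hp
    simp only [htog]
    rw [dif_pos h]
    exact h.choose_spec
  have hlow : ∀ T ∈ below lam mu κ, ∀ p ∈ BlockToggle κ e f r T, (tog p T).low f = T.low f :=
    fun T hT p hp => funext (low_eq_of_toggle hp.1 (key T hT p hp).2)
  -- The set of toggles depends on `T` only through the numbers of low cells, and toggling keeps
  -- these.
  have hTg : ∀ T ∈ below lam mu κ, ∀ p ∈ BlockToggle κ e f r T,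
      BlockToggle κ e f r (tog p T) = BlockToggle κ e f r T := fun T hT p hp => by
    simp only [BlockToggle, hlow T hT p hp]
  refine exists_sum_toggle (below lam mu κ) (fun T => T.size - mu.card) (BlockToggle κ e f r) tog
    (fun T hT p hp => (key T hT p hp).1) hTg (fun T hT p hp => ?_) (fun T hT p hp => ?_)
  · obtain ⟨h1, h2⟩ := key T hT p hp
    obtain ⟨h3, h4⟩ := key _ h1 p ((hTg T hT p hp).symm ▸ hp)
    refine entry_injective (funext fun q => funext fun j => ?_)
    rw [h4, hlow T hT p hp, h2]
    split_ifs
    · exact toggleElem_toggleElem _ _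
    · rfl
  · obtain ⟨h1, h2⟩ := key T hT p hp
    have hx : (p, T.low f p) ∈ mu.cells := (mu.mem_cells _).2 (mem_iff_lt_rowLen.2 hp.2.2.1)
    have e1 : T.size = _ := (add_sum_erase _ _ hx).symm
    have e2 : (tog p T).size = _ := (add_sum_erase _ _ hx).symm
    have e3 : ∑ c ∈ mu.cells.erase (p, T.low f p), #((tog p T).entry c.1 c.2) =
        ∑ c ∈ mu.cells.erase (p, T.low f p), #(T.entry c.1 c.2) :=
      sum_congr rfl fun c hc => by
        rw [h2, if_neg fun h => (mem_erase.1 hc).1 (Prod.ext h.1 h.2)]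
    rw [e3] at e2
    dsimp only at e1 e2
    rw [h2 p, if_pos ⟨rfl, rfl⟩] at e2
    have := card_toggleElem (T.entry p (T.low f p)) p
    have h3 := T.card_le_size
    have h4 := (tog p T).card_le_size
    omega

end SetValuedTableau

/-! ### Rectangular `lam`: the long rows of `mu` -/

namespace SetValuedTableau

open YoungDiagram Polynomial

variable {lam mu κ : YoungDiagram} {T : SetValuedTableau mu} {e f b r : ℕ}

/-- The number of rows above row `r` in which all letters in column `j` are less than `f`. -/
def height (T : SetValuedTableau mu) (f r j : ℕ) : ℕ := #{q ∈ range r | j < T.low f q}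

theorem lt_height_iff {q j : ℕ} : q < T.height f r j ↔ q < r ∧ j < T.low f q :=
  lt_card_filter_range_iff fun _ _ h _ hj => hj.trans_le (T.low_anti f h.le)

theorem height_anti (T : SetValuedTableau mu) (f r : ℕ) : Antitone (T.height f r) := by
  intro j j' h
  exact card_le_card fun q hq => mem_filter.2 ⟨(mem_filter.1 hq).1, h.trans_lt (mem_filter.1 hq).2⟩

theorem height_le (T : SetValuedTableau mu) (f r j : ℕ) : T.height f r j ≤ f := by
  by_contra hc
  push Not at hc
  have := (lt_height_iff.1 hc).2
  rw [low_eq_zero le_rfl] at this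
  omega

theorem card_filter_lt_succ (s : Finset ℕ) (h : ℕ → ℕ) (q : ℕ) :
    #{j ∈ s | h j < q + 1} = #{j ∈ s | h j < q} + #{j ∈ s | h j = q} := by
  have : ({j ∈ s | h j < q + 1} : Finset ℕ) =
      {j ∈ s | h j < q} ∪ {j ∈ s | h j = q} := by
    ext j
    simp only [mem_filter, mem_union]
    constructor
    · rintro ⟨h1, h2⟩
      rcases Nat.lt_succ_iff_lt_or_eq.1 h2 with h3 | h3
      · exact Or.inl ⟨h1, h3⟩
      · exact Or.inr ⟨h1, h3⟩
    · rintro (⟨h1, h2⟩ | ⟨h1, h2⟩)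
      · exact ⟨h1, by omega⟩
      · exact ⟨h1, by omega⟩
  rw [this, card_union_of_disjoint]
  refine disjoint_left.2 fun j h1 h2 => ?_
  have := (mem_filter.1 h1).2
  have := (mem_filter.1 h2).2
  omega

theorem rowCount_of_iff {q l : ℕ} (hrow : mu.rowLen q = b) {P : ℕ → Prop} [DecidablePred P]
    (h : ∀ j < b, l ∈ T.entry q j ↔ P j) : T.rowCount q l = #{j ∈ range b | P j} := by
  rw [rowCount, hrow]
  congr 1
  exact filter_congr fun j hj => h j (mem_range.1 hj)

theorem upper_of_shifted {h : ℕ → ℕ} (hrow : ∀ q < r, mu.rowLen q = b) {q : ℕ} (hq : q ≤ r)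
    (H : ∀ q' < q, ∀ j < b, ∀ m, f + m ∈ T.entry q' j ↔ h j + m = q') (m : ℕ) :
    T.upper q (f + m) = #{j ∈ range b | h j + m < q} := by
  induction q with
  | zero => simp
  | succ q ih =>
    rw [T.upper_succ, ih (by omega) fun q' hq' => H q' (by omega),
      card_filter_lt_succ _ fun j => h j + m,
      rowCount_of_iff (hrow q (by omega)) fun j hj => H q (by omega) j hj m]

/-- If `lam` is a rectangle, then in the upper rows the letters from `f` on are rigid: below the low
cells of a column come exactly f, f + 1, f + 2, … . Strictness bounds these letters from below, and
the lattice condition bounds how often each of them may occur in a row. -/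
theorem IsLattice.mem_iff_height (hT : T.IsLattice lam) (hlam0 : ∀ l ≥ f, lam.rowLen l = 0)
    (hrow : ∀ q < r, mu.rowLen q = b) {q : ℕ} (hq : q < r) {j : ℕ} (hj : j < b) (m : ℕ) :
    f + m ∈ T.entry q j ↔ T.height f r j + m = q := by
  set h := T.height f r with hh
  have hlow : ∀ {q j m}, q < r → f + m ∈ T.entry q j → h j ≤ q := by
    intro q j m hq hm
    by_contra hc
    push Not at hc
    have := (lt_low_iff.1 (lt_height_iff.1 hc).2).2 _ hm
    omega
  have hbig : ∀ {q j}, q < r → j < b → h j ≤ q → ∃ m, f + m ∈ T.entry q j := by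
    intro q j hq hj hle
    obtain ⟨l, hl, hfl⟩ := exists_le_of_low_le (T := T) (f := f) (p := q) (j := j)
      (by rwa [hrow q hq]) (not_lt.1 fun hc => absurd (lt_height_iff.2 ⟨hq, hc⟩) (not_lt.2 hle))
    exact ⟨l - f, by rwa [Nat.add_sub_cancel' hfl]⟩
  -- The letters from `f` on in column `j` start in row `h j` and increase strictly, so `f + m`
  -- cannot occur below row `h j + m`.
  have lower : ∀ m q j, q < r → f + m ∈ T.entry q j → q ≤ h j + m := by
    intro m
    induction m using Nat.strong_induction_on with
    | _ m ih =>
      intro q j hq hm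
      by_contra hc
      push Not at hc
      obtain ⟨p, rfl⟩ := Nat.exists_eq_succ_of_ne_zero (Nat.ne_of_gt (Nat.zero_le _ |>.trans_lt hc))
      have hjb : j < b := by rw [← hrow (p + 1) hq]; exact T.lt_rowLen hm
      obtain ⟨m', hm'⟩ := hbig (show p < r by omega) hjb (by omega)
      have h1 := T.col_strict p (p + 1) j (by omega) _ hm' _ hm
      have h2 := ih m' (by omega) p j (by omega) hm'
      omega
  induction q using Nat.strong_induction_on generalizing j m with
  | _ q ih =>
    have hU := upper_of_shifted (T := T) (h := h) (f := f) hrow hq.le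
      fun q' hq' j hj m => ih q' hq' (by omega) hj m
    -- By induction on the rows, the letters `f + m` above row `q` occupy the columns with `h j + m
    -- < q`. This leaves room for at most the predicted number of letters `f + (m + 1)` in row `q`.
    have cap : ∀ m, T.rowCount q (f + (m + 1)) ≤ #{j ∈ range b | h j + (m + 1) = q} := by
      intro m
      have h1 := hT q (f + m)
      rw [hlam0 _ (by omega), hlam0 _ (by omega), T.upper_succ, add_assoc f, hU, hU] at h1
      have h2 := card_filter_lt_succ (range b) (fun j => h j + (m + 1)) q
      have h3 : #{j ∈ range b | h j + (m + 1) < q + 1} = #{j ∈ range b | h j + m < q} := by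
        congr 1
        refine filter_congr fun j _ => ?_
        omega
      omega
    obtain ⟨k, hk⟩ := T.exists_letter_bound
    -- Downward induction on `m`, starting at a bound for all letters. A cell where `f + m` is
    -- expected contains no larger unexpected letter, so it contains `f + m`; then `cap` excludes
    -- all other positions.
    have claim : ∀ n m, k ≤ m + n → ∀ j, f + m ∈ T.entry q j → h j + m = q := by
      intro n
      induction n with
      | zero =>
        intro m hm j hj
        have := hk _ _ _ hj
        omega
      | succ n ihn =>
        intro m hm j hj
        have h1 := lower m q j hq hj
        have h2 := hlow hq hj
        rcases m with _ | m
        · omega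
        · have hsub : {j ∈ range b | h j + (m + 1) = q} ⊆
              {j ∈ range b | f + (m + 1) ∈ T.entry q j} := fun i hi => by
            obtain ⟨h3, h4⟩ := mem_filter.1 hi
            refine mem_filter.2 ⟨h3, ?_⟩
            obtain ⟨m', hm'⟩ := hbig hq (mem_range.1 h3) (by omega)
            have h5 := lower m' q i hq hm'
            have h6 : m' = m + 1 := by
              by_contra hc
              have := ihn m' (by omega) i hm'
              omega
            rwa [h6] at hm'
          have h3 := cap m
          rw [rowCount, hrow q hq] at h3
          have h4 := eq_of_subset_of_card_le hsub h3
          have h5 : j ∈ {j ∈ range b | f + (m + 1) ∈ T.entry q j} :=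
            mem_filter.2 ⟨mem_range.2 (by rw [← hrow q hq]; exact T.lt_rowLen hj), hj⟩
          rw [← h4] at h5
          exact (mem_filter.1 h5).2
    refine ⟨claim k m (by omega) j, fun hjm => ?_⟩
    obtain ⟨m', hm'⟩ := hbig hq hj (by omega)
    have := claim k m' (by omega) j hm'
    obtain rfl : m = m' := by omega
    exact hm'

section unique

variable (hlam : ∀ l < f, lam.rowLen l = e) (hlam0 : ∀ l ≥ f, lam.rowLen l = 0)
  (hrow : ∀ q < r, mu.rowLen q = b)

include hlam hlam0 hrow

theorem mem_entry_iff_of_blockToggle_eq_empty (hT : T ∈ below lam mu κ)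
    (h : BlockToggle κ e f r T = ∅) {q j l : ℕ} (hq : q < r) (hj : j < b) :
    l ∈ T.entry q j ↔ (l = q ∧ j < T.low f q) ∨ ∃ m, l = f + m ∧ T.height f r j + m = q := by
  have hlat := (mem_below.1 hT).1
  rcases lt_or_ge l f with hl | hl
  · constructor
    · intro h1
      obtain rfl := hlat.eq_row hlam h1 hl
      exact Or.inl ⟨rfl, lt_low_of_mem hlam hT hl
        ((blockToggle_eq_empty_iff hlam hT).1 h q hl hq) h1⟩
    · rintro (⟨rfl, h1⟩ | ⟨m, h1, -⟩)
      · rw [mem_of_lt_low' (fun q c l h hl => hlat.eq_row hlam h hl) h1]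
        exact mem_singleton_self l
      · omega
  · obtain ⟨m, rfl⟩ := Nat.exists_eq_add_of_le hl
    rw [hlat.mem_iff_height hlam0 hrow hq hj]
    constructor
    · exact fun h1 => Or.inr ⟨m, rfl, h1⟩
    · rintro (⟨rfl, h1⟩ | ⟨m', h1, h2⟩)
      · rw [low_eq_zero (by omega)] at h1
        omega
      · omega

theorem agree_of_blockToggle_eq_empty {T' : SetValuedTableau mu} (hT : T ∈ below lam mu κ)
    (hT' : T' ∈ below lam mu κ) (h : BlockToggle κ e f r T = ∅) (h' : BlockToggle κ e f r T' = ∅) :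
    Agree r T T' := by
  have hlow : ∀ q < r, T.low f q = T'.low f q := fun q hq => by
    rcases lt_or_ge q f with hqf | hqf
    · rw [(blockToggle_eq_empty_iff hlam hT).1 h q hqf hq,
        (blockToggle_eq_empty_iff hlam hT').1 h' q hqf hq]
    · rw [low_eq_zero hqf, low_eq_zero hqf]
  have hheight : T.height f r = T'.height f r := funext fun j => by
    rw [height, height]
    congr 1
    exact filter_congr fun q hq => by rw [hlow q (mem_range.1 hq)]
  intro q hq j
  by_cases hj : j < b
  · ext l
    rw [mem_entry_iff_of_blockToggle_eq_empty hlam hlam0 hrow hT h hq hj,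
      mem_entry_iff_of_blockToggle_eq_empty hlam hlam0 hrow hT' h' hq hj, hlow q hq, hheight]
  · have : (q, j) ∉ mu := fun hm => hj (by rw [← hrow q hq]; exact mem_iff_lt_rowLen.1 hm)
    rw [not_nonempty_iff_eq_empty.1 fun h => this ((T.nonempty_iff q j).1 h),
      not_nonempty_iff_eq_empty.1 fun h => this ((T'.nonempty_iff q j).1 h)]

theorem upperExtra_of_blockToggle_eq_empty (hT : T ∈ below lam mu κ)
    (h : BlockToggle κ e f r T = ∅) : T.upperExtra r = 0 := by
  refine sum_eq_zero fun q hq => sum_eq_zero fun j hj => ?_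
  have hq := mem_range.1 hq
  have hj := mem_range.1 hj
  rw [hrow q hq] at hj
  rw [Nat.sub_eq_zero_iff_le, card_le_one]
  intro a ha c hc
  rw [mem_entry_iff_of_blockToggle_eq_empty hlam hlam0 hrow hT h hq hj] at ha hc
  rcases ha with ⟨rfl, ha⟩ | ⟨m, rfl, ha⟩ <;> rcases hc with ⟨hc', hc⟩ | ⟨m', rfl, hc⟩
  · exact hc'.symm
  · have := lt_height_iff.2 ⟨hq, ha⟩
    omega
  · have := lt_height_iff.2 ⟨hq, hc⟩
    omega
  · omega

open Classical in
theorem filter_blockToggle_eq {T₀ : SetValuedTableau mu} (hT₀ : T₀ ∈ below lam mu κ)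
    (h₀ : BlockToggle κ e f r T₀ = ∅) :
    {T ∈ below lam mu κ | BlockToggle κ e f r T = ∅} = {T ∈ below lam mu κ | Agree r T T₀} := by
  refine filter_congr fun T hT => ⟨fun h =>
    agree_of_blockToggle_eq_empty hlam hlam0 hrow hT hT₀ h h₀, fun h => ?_⟩
  rw [blockToggle_eq_empty_iff hlam hT]
  intro p hp hpr
  rw [← (blockToggle_eq_empty_iff hlam hT₀).1 h₀ p hp hpr, low, low]
  congr 1
  exact filter_congr fun j _ => by rw [h p hpr]

/-- The tableaux without toggles agree above row `r` and have no extra letters there, so the sum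
over the last row starts with X^0 = 1. -/
theorem exists_belowPoly_row (hd : mu.colLen 0 ≤ r + 1) {T₀ : SetValuedTableau mu}
    (hT₀ : T₀ ∈ below lam mu κ) (h₀ : BlockToggle κ e f r T₀ = ∅) :
    ∃ Q : ℕ[X], belowPoly lam mu κ = 1 + (1 + X) * Q := by
  classical
  obtain ⟨Q, hQ⟩ := exists_blockToggle_sum (mu := mu) hlam κ r
  obtain ⟨Q', hQ'⟩ := sum_agree_row hd hT₀
  refine ⟨Q + Q', ?_⟩
  rw [hQ, filter_blockToggle_eq hlam hlam0 hrow hT₀ h₀, hQ',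
    upperExtra_of_blockToggle_eq_empty hlam hlam0 hrow hT₀ h₀]
  ring

theorem exists_belowPoly_col (hr : mu.rowLen r ≤ 1) {T₀ : SetValuedTableau mu}
    (hT₀ : T₀ ∈ below lam mu κ) (h₀ : BlockToggle κ e f r T₀ = ∅) :
    ∃ Q : ℕ[X], belowPoly lam mu κ = 1 + (1 + X) * Q := by
  classical
  obtain ⟨Q, hQ⟩ := exists_blockToggle_sum (mu := mu) hlam κ r
  obtain ⟨Q', hQ'⟩ := sum_agree_col hr hT₀
  refine ⟨Q + Q', ?_⟩
  rw [hQ, filter_blockToggle_eq hlam hlam0 hrow hT₀ h₀, hQ',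
    upperExtra_of_blockToggle_eq_empty hlam hlam0 hrow hT₀ h₀]
  ring

end unique

end SetValuedTableau

/-! ### Raising a column: existence of tableaux without toggles. -/

namespace SetValuedTableau

open YoungDiagram Polynomial

variable {lam mu κ : YoungDiagram} {T : SetValuedTableau mu} {e f b r : ℕ}

/-- A tableau with one letter in each cell. -/
def ofLetters (mu : YoungDiagram) (W : ℕ → ℕ → ℕ)
    (hr : ∀ i j j', j < j' → (i, j') ∈ mu → W i j ≤ W i j')
    (hc : ∀ i i' j, i < i' → (i', j) ∈ mu → W i j < W i' j) : SetValuedTableau mu where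
  entry i j := if (i, j) ∈ mu then {W i j} else ∅
  nonempty_iff i j := by
    split_ifs with h <;> simp [h]
  row_weak i j j' hj a ha b hb := by
    split_ifs at ha hb with h1 h2 h2
    · rw [mem_singleton.1 ha, mem_singleton.1 hb]
      exact hr i j j' hj h2
    all_goals simp at ha hb
  col_strict i i' j hi a ha b hb := by
    split_ifs at ha hb with h1 h2 h2
    · rw [mem_singleton.1 ha, mem_singleton.1 hb]
      exact hc i i' j hi h2
    all_goals simp at ha hb

theorem entry_ofLetters {W : ℕ → ℕ → ℕ} {hr hc} {i j : ℕ} (h : (i, j) ∈ mu) :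
    (ofLetters mu W hr hc).entry i j = {W i j} := if_pos h

/-- The letters of a column in which the letters less than `f` occupy `c j` rows. -/
def topLetter (f : ℕ) (c : ℕ → ℕ) (q j : ℕ) : ℕ := if q < c j then q else f + (q - c j)

theorem topLetter_mono {c : ℕ → ℕ} (hc : Antitone c) (hcf : ∀ j, c j ≤ f) (q : ℕ) {j j' : ℕ}
    (h : j ≤ j') : topLetter f c q j ≤ topLetter f c q j' := by
  have h1 := hc h
  have h2 := hcf j
  unfold topLetter
  split_ifs <;> omega

theorem topLetter_strict {c : ℕ → ℕ} (hcf : ∀ j, c j ≤ f) {q q' : ℕ} (h : q < q') (j : ℕ) :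
    topLetter f c q j < topLetter f c q' j := by
  have h2 := hcf j
  unfold topLetter
  split_ifs <;> omega

theorem exists_of_letters {c : ℕ → ℕ} (hc : Antitone c) (hcf : ∀ j, c j ≤ f)
    (hrow : ∀ q < r, mu.rowLen q = b) (V : ℕ → ℕ → ℕ)
    (hV₁ : ∀ i ≥ r, ∀ j j', j < j' → (i, j') ∈ mu → V i j ≤ V i j')
    (hV₂ : ∀ i ≥ r, ∀ i' j, i < i' → (i', j) ∈ mu → V i j < V i' j)
    (hV₃ : ∀ q < r, ∀ i ≥ r, ∀ j, (i, j) ∈ mu → topLetter f c q j < V i j) :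
    ∃ T : SetValuedTableau mu, (∀ q < r, ∀ j < b, T.entry q j = {topLetter f c q j}) ∧
      ∀ q ≥ r, ∀ j, (q, j) ∈ mu → T.entry q j = {V q j} := by
  refine ⟨ofLetters mu (fun q j => if q < r then topLetter f c q j else V q j) ?_ ?_, ?_, ?_⟩
  · intro i j j' hj h
    split_ifs with h1
    · exact topLetter_mono hc hcf i hj.le
    · exact hV₁ i (not_lt.1 h1) j j' hj h
  · intro i i' j hi h
    split_ifs with h1 h2 h2
    · exact topLetter_strict hcf hi j
    · exact hV₃ i h1 i' (not_lt.1 h2) j h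
    · omega
    · exact hV₂ i (not_lt.1 h1) i' j hi h
  · intro q hq j hj
    rw [entry_ofLetters (mem_iff_lt_rowLen.2 (by rwa [hrow q hq])), if_pos hq]
  · intro q hq j hj
    rw [entry_ofLetters hj, if_neg (not_lt.2 hq)]

theorem rowCount_succ_le_low {p l : ℕ} (hl : l ≤ f) : T.rowCount (p + 1) l ≤ T.low f p := by
  have : {j ∈ range (mu.rowLen (p + 1)) | l ∈ T.entry (p + 1) j} ⊆ range (T.low f p) :=
    fun j hj => mem_range.2 (lt_low_of_col (Nat.lt_succ_self p) (mem_filter.1 hj).2 hl)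
  have := card_le_card this
  rwa [card_range] at this

section top

variable {c : ℕ → ℕ} (hcf : ∀ j, c j ≤ f) (hrow : ∀ q < r, mu.rowLen q = b)
  (htop : ∀ q < r, ∀ j < b, T.entry q j = {topLetter f c q j})

include hcf hrow htop

theorem upper_top_add {q : ℕ} (hq : q ≤ r) (m : ℕ) :
    T.upper q (f + m) = #{j ∈ range b | c j + m < q} := by
  refine upper_of_shifted hrow hq (fun q' hq' j hj m => ?_) m
  have := hcf j
  rw [htop q' (by omega) j hj, mem_singleton, topLetter]
  split_ifs <;> omega

theorem upper_top_lt {q l : ℕ} (hq : q ≤ r) (hl : l < f) :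
    T.upper q l = if l < q then #{j ∈ range b | l < c j} else 0 := by
  have key : ∀ q < r, T.rowCount q l = if q = l then #{j ∈ range b | l < c j} else 0 := by
    intro q hq
    rw [rowCount_of_iff (P := fun j => q = l ∧ l < c j) (hrow q hq) fun j hj => ?_]
    · split_ifs with h
      · simp [h]
      · simp [h]
    · have := hcf j
      rw [htop q hq j hj, mem_singleton, topLetter]
      split_ifs <;> omega
  rw [upper, sum_congr rfl fun p hp => key p ((mem_range.1 hp).trans_le hq), sum_ite_eq']
  simp

theorem low_top {q : ℕ} (hq : q < r) : T.low f q = #{j ∈ range b | q < c j} := by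
  rw [low, hrow q hq]
  congr 1
  refine filter_congr fun j hj => ?_
  have := hcf j
  rw [htop q hq j (mem_range.1 hj)]
  simp only [mem_singleton, forall_eq, topLetter]
  split_ifs <;> omega

/-- Within the block and from `f` on, the numbers of letters are nested by construction. Only the
step from `f - 1` to `f` matters: before row `f - 1` is complete, `H` bounds the letters `f` by the
`e` letters `f - 1` of `lam`; afterwards every further column contains its own `f - 1`. -/
theorem lattice_top (hf : 0 < f) (hlam : ∀ l < f, lam.rowLen l = e)
    (hlam0 : ∀ l ≥ f, lam.rowLen l = 0)
    (H : ∀ q < r, q < f → #{j ∈ range b | c j < q + 1} ≤ e) {p : ℕ} (hp : p < r) (l : ℕ) :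
    lam.rowLen (l + 1) + T.upper (p + 1) (l + 1) ≤ lam.rowLen l + T.upper p l := by
  rcases lt_trichotomy (l + 1) f with hl | hl | hl
  · rw [hlam _ hl, hlam l (by omega), upper_top_lt hcf hrow htop hp hl,
      upper_top_lt hcf hrow htop hp.le (show l < f by omega)]
    have : #{j ∈ range b | l + 1 < c j} ≤ #{j ∈ range b | l < c j} :=
      card_le_card (monotone_filter_right _ fun j _ h => by omega)
    split_ifs <;> omega
  · rw [hlam0 _ (by omega), hlam l (by omega), upper_top_lt hcf hrow htop hp.le (show l < f by omega)]
    have h1 := upper_top_add hcf hrow htop (q := p + 1) hp 0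
    simp only [add_zero] at h1
    rw [hl, h1]
    split_ifs with h2
    · have h3 := H (f - 1) (by omega) (by omega)
      have h4 := card_filter_add_card_filter_not (s := range b) fun j => c j < f - 1 + 1
      have h5 : #{j ∈ range b | ¬ c j < f - 1 + 1} ≤ #{j ∈ range b | l < c j} :=
        card_le_card (monotone_filter_right _ fun j _ h => by omega)
      have h6 := card_filter_le (range b) fun j => c j < p + 1
      rw [card_range] at h4 h6
      omega
    · have := H p hp (by omega)
      omega
  · obtain ⟨m, rfl⟩ := Nat.exists_eq_add_of_le (show f ≤ l by omega)
    rw [hlam0 _ (by omega), hlam0 _ (by omega), add_assoc f,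
      upper_top_add hcf hrow htop (show p + 1 ≤ r from hp),
      upper_top_add hcf hrow htop hp.le]
    have : #{j ∈ range b | c j + (m + 1) < p + 1} ≤ #{j ∈ range b | c j + m < p} :=
      card_le_card (monotone_filter_right _ fun j _ h => by omega)
    omega

theorem slack_top (hf : 0 < f) (hlam : ∀ l < f, lam.rowLen l = e)
    (hlam0 : ∀ l ≥ f, lam.rowLen l = 0)
    (H : ∀ q < r, q < f → #{j ∈ range b | c j < q + 1} ≤ e) (l : ℕ) :
    lam.rowLen (l + 1) + T.upper r (l + 1) ≤ lam.rowLen l + T.upper r l := by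
  rcases r with _ | r
  · have := lam.rowLen_anti l (l + 1) (by omega)
    rwa [T.upper_zero, T.upper_zero]
  · have h1 := lattice_top hcf hrow htop hf hlam hlam0 H (Nat.lt_succ_self r) l
    have h2 := T.upper_mono l (Nat.le_succ r)
    dsimp only [Nat.succ_eq_add_one] at h1 h2
    omega

end top

/-- Raise the value at `x` to `p + 1`. -/
def raise (h : ℕ → ℕ) (x p j : ℕ) : ℕ := if j = x then p + 1 else h j

theorem card_raise {h : ℕ → ℕ} {x p : ℕ} (hx : x < b) (hp : h x = p) (P : ℕ → Prop)
    [DecidablePred P] : #{j ∈ range b | P (raise h x p j)} + (if P p then 1 else 0) =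
      #{j ∈ range b | P (h j)} + if P (p + 1) then 1 else 0 := by
  have hx := mem_range.2 hx
  rw [card_filter, card_filter, ← add_sum_erase _ _ hx, ← add_sum_erase (a := x) _ _ hx,
    sum_congr rfl fun j hj => show (if P (raise h x p j) then 1 else 0) = if P (h j) then 1 else 0 by
      rw [raise, if_neg (ne_of_mem_erase hj)]]
  rw [raise, if_pos rfl, hp]
  omega

section improve

variable (hf : 0 < f) (hlam : ∀ l < f, lam.rowLen l = e) (hlam0 : ∀ l ≥ f, lam.rowLen l = 0)
  (hrow : ∀ q < r, mu.rowLen q = b) (hT : T ∈ below lam mu κ) {p : ℕ}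
  (hp : p ∈ BlockToggle κ e f r T)

include hp in
theorem height_low : T.height f r (T.low f p) = p := by
  refine le_antisymm (not_lt.1 fun h => lt_irrefl _ (lt_height_iff.1 h).2) ?_
  rcases p with _ | p
  · exact Nat.zero_le _
  · exact lt_height_iff.2 ⟨by have := hp.2.1; omega, hp.2.2.2.1 p rfl⟩

include hp in
-- Column `T.low f p` is the first column of height `p`; all columns to its left have height at
-- least `p + 1`.
theorem raise_anti : Antitone (raise (T.height f r) (T.low f p) p) := by
  intro j j' hj
  have h1 := height_low hp
  have h2 := T.height_anti f r hj
  unfold raise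
  split_ifs with h3 h4 h4
  · omega
  · exact lt_height_iff.2 ⟨hp.2.1, by omega⟩
  · rw [h4, h1] at h2
    omega
  · exact h2

include hp in
theorem raise_le (j : ℕ) : raise (T.height f r) (T.low f p) p j ≤ f := by
  have h1 := T.height_le f r j
  have h2 := hp.1
  unfold raise
  split_ifs <;> omega

include hp in
theorem le_raise (j : ℕ) : T.height f r j ≤ raise (T.height f r) (T.low f p) p j := by
  have h1 := height_low hp
  unfold raise
  split_ifs with h
  · rw [h]
    omega
  · exact le_rfl

include hrow hp in
theorem low_lt : T.low f p < b := by
  rw [← hrow p hp.2.1]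
  exact hp.2.2.1

include hf hlam hlam0 hrow hT hp in
-- Raising can only decrease the number. For the heights of `T` itself this is the lattice condition
-- for the letter `f`, since `f - 1` does not yet occur above row `q`.
theorem card_raise_lt_le {q : ℕ} (hq : q < r) (hqf : q < f) :
    #{j ∈ range b | raise (T.height f r) (T.low f p) p j < q + 1} ≤ e := by
  have hlat := (mem_below.1 hT).1
  have h1 := hlat q (f - 1)
  rw [Nat.sub_add_cancel hf, hlam0 f le_rfl, hlam _ (by omega),
    T.upper_of_row (l := f - 1) fun q c h => hlat.eq_row hlam h (by omega), if_neg (by omega)] at h1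
  have h2 := upper_of_shifted (T := T) (h := T.height f r) (f := f) hrow (show q + 1 ≤ r from hq)
    (fun q' hq' j hj m => hlat.mem_iff_height hlam0 hrow (by omega) hj m) 0
  simp only [add_zero] at h2
  have h3 : #{j ∈ range b | raise (T.height f r) (T.low f p) p j < q + 1} ≤
      #{j ∈ range b | T.height f r j < q + 1} :=
    card_le_card (monotone_filter_right _ fun j _ h => (le_raise hp j).trans_lt h)
  omega

include hlam0 hrow hT hp in
theorem exists_topLetter_raise_le {q j : ℕ} (hq : q < r) (hj : j < b) :
    ∃ a ∈ T.entry q j, topLetter f (raise (T.height f r) (T.low f p) p) q j ≤ a := by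
  have hle := le_raise hp j
  unfold topLetter
  split_ifs with h
  · obtain ⟨a, ha⟩ := T.entry_nonempty (p := q) (j := j) (by rwa [hrow q hq])
    exact ⟨a, ha, T.le_of_mem ha⟩
  · refine ⟨f + (q - T.height f r j),
      ((mem_below.1 hT).1.mem_iff_height hlam0 hrow hq hj _).2 (by omega), by omega⟩

include hrow hp in
theorem sum_low_lt {T' : SetValuedTableau mu} (htop : ∀ q < r, ∀ j < b, T'.entry q j =
    {topLetter f (raise (T.height f r) (T.low f p) p) q j}) :
    ∑ q ∈ range r, T.low f q < ∑ q ∈ range r, T'.low f q := by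
  have key : ∀ q < r, T.low f q + (if q < p + 1 then 1 else 0) =
      T'.low f q + if q < p then 1 else 0 := by
    intro q hq
    rw [low_top (raise_le hp) hrow htop hq,
      card_raise (low_lt hrow hp) (height_low hp) fun z => q < z]
    congr 1
    have : ({j ∈ range b | q < T.height f r j} : Finset ℕ) = range (T.low f q) := by
      ext j
      rw [mem_filter, mem_range, mem_range, lt_height_iff]
      have := T.low_le f q
      rw [hrow q hq] at this
      omega
    rw [this, card_range]
  refine sum_lt_sum (fun q hq => ?_) ⟨p, mem_range.2 hp.2.1, ?_⟩
  · have := key q (mem_range.1 hq)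
    split_ifs at this <;> omega
  · have := key p hp.2.1
    rw [if_pos (by omega), if_neg (by omega)] at this
    omega

/-- The contents of the upper part after raising. -/
theorem upper_raise_add {T' : SetValuedTableau mu} (hlam0 : ∀ l ≥ f, lam.rowLen l = 0)
    (hrow : ∀ q < r, mu.rowLen q = b) (hT : T ∈ below lam mu κ)
    (hp : p ∈ BlockToggle κ e f r T) (htop : ∀ q < r, ∀ j < b, T'.entry q j =
    {topLetter f (raise (T.height f r) (T.low f p) p) q j}) (m : ℕ) :
    T'.upper r (f + m) + (if p + m < r then 1 else 0) =
      T.upper r (f + m) + if p + 1 + m < r then 1 else 0 := by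
  rw [upper_top_add (raise_le hp) hrow htop le_rfl,
    upper_of_shifted (T := T) (h := T.height f r) (f := f) hrow le_rfl
    fun q' hq' j hj m => (mem_below.1 hT).1.mem_iff_height hlam0 hrow hq' hj m]
  exact card_raise (low_lt hrow hp) (height_low hp) fun z => z + m < r

theorem upper_raise_lt {T' : SetValuedTableau mu} (hlam : ∀ l < f, lam.rowLen l = e)
    (hrow : ∀ q < r, mu.rowLen q = b) (hT : T ∈ below lam mu κ)
    (hp : p ∈ BlockToggle κ e f r T) (htop : ∀ q < r, ∀ j < b, T'.entry q j =
    {topLetter f (raise (T.height f r) (T.low f p) p) q j}) {l : ℕ} (hl : l < f) :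
    T'.upper r l ≤ T.upper r l ∨ l = p ∧ T'.upper r l = T.low f p + 1 := by
  have hlat := (mem_below.1 hT).1
  rw [upper_top_lt (raise_le hp) hrow htop le_rfl hl,
    T.upper_of_row fun q c h => hlat.eq_row hlam h hl]
  split_ifs with hlr
  · have h1 := card_raise (low_lt hrow hp) (height_low hp) fun z => l < z
    have h2 : ({j ∈ range b | l < T.height f r j} : Finset ℕ) = range (T.low f l) := by
      ext j
      rw [mem_filter, mem_range, mem_range, lt_height_iff]
      have := T.low_le f l
      rw [hrow l hlr] at this
      omega
    rw [h2, card_range] at h1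
    have h3 := low_le_rowCount (fun q c l h hl => hlat.eq_row hlam h hl) l
    by_cases hlp : l = p
    · subst hlp
      rw [if_neg (lt_irrefl l), if_pos (Nat.lt_succ_self l)] at h1
      exact Or.inr ⟨rfl, h1⟩
    · left
      split_ifs at h1 <;> omega
  · exact Or.inl le_rfl

end improve

end SetValuedTableau

namespace SetValuedTableau

open YoungDiagram Polynomial

variable {lam mu κ : YoungDiagram} {T : SetValuedTableau mu} {e f b r p : ℕ}

/-- The part of the lattice condition after row `r` which involves the letters up to `f`. -/
theorem rowCount_zero_of_low {l : ℕ} (hr : 0 < r) (hl : l ≤ f) (h : f < r) : T.rowCount r l = 0 := by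
  obtain ⟨q, rfl⟩ := Nat.exists_eq_succ_of_ne_zero hr.ne'
  have h1 := rowCount_succ_le_low (T := T) (p := q) hl
  rw [low_eq_zero (by omega)] at h1
  exact Nat.le_zero.1 h1

/-- The upper rows are rebuilt with one letter per cell and with the toggled column raised. They
lose one letter `f + m₀` and no other letter from `f` on. The last row consists of the old maxima,
one letter `f + (m₀ + 1)` being lowered to `f + m₀` if there is one, which restores the lattice
condition. -/
theorem exists_raise_row (hf : 0 < f) (hlam : ∀ l < f, lam.rowLen l = e)
    (hlam0 : ∀ l ≥ f, lam.rowLen l = 0) (hrow : ∀ q < r, mu.rowLen q = b)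
    (hd : mu.colLen 0 ≤ r + 1) (hT : T ∈ below lam mu κ) (hp : p ∈ BlockToggle κ e f r T) :
    ∃ T' ∈ below lam mu κ, ∑ q ∈ range r, T.low f q < ∑ q ∈ range r, T'.low f q := by
  have hpr := hp.2.1
  have hpf := hp.1
  have hlat := (mem_below.1 hT).1
  set c := raise (T.height f r) (T.low f p) p with hc
  have hca : Antitone c := raise_anti hp
  have hcf : ∀ j, c j ≤ f := raise_le hp
  have hx := low_lt hrow hp
  set x := T.low f p with hxd
  have hcx : ∀ j ≤ x, p + 1 ≤ c j := fun j hj => by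
    refine le_trans ?_ (hca hj)
    rw [hc, raise, if_pos rfl]
  -- In column `x` of `T` the letter in row `r - 1` is `f + m₀`; it is the letter that raising
  -- pushes out of the upper rows.
  set m₀ := r - 1 - p with hm₀
  set w : ℕ → ℕ := maxima (T.entry r) with hw
  have hrb : ∀ j, (r, j) ∈ mu → j < b := fun j hj => by
    have h1 := mem_iff_lt_rowLen.1 (mu.up_left_mem (show p ≤ r by omega) le_rfl hj)
    rwa [hrow p hpr] at h1
  have hwm : ∀ j, (r, j) ∈ mu → w j ∈ T.entry r j := fun j hj =>
    maxima_mem ((T.nonempty_iff r j).2 hj)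
  have honly : ∀ i ≥ r, ∀ j, (i, j) ∈ mu → i = r := fun i hi j hj => by
    have := mem_iff_lt_colLen.1 (mu.up_left_mem le_rfl (Nat.zero_le j) hj)
    omega
  -- the position at which the letter `f + m₀ + 1` is lowered
  obtain ⟨V, hV1, hV2, hV3, hV4⟩ : ∃ V : ℕ → ℕ,
      (∀ j j', j < j' → (r, j') ∈ mu → V j ≤ V j') ∧
      (∀ j, (r, j) ∈ mu → ∀ q < r, topLetter f c q j < V j) ∧
      (∃ s, (∀ j, (r, j) ∈ mu → V j ∈ T.entry r j ∨ j = s ∧ V j = f + m₀)) ∧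
      ((∀ j, (r, j) ∈ mu → V j ≠ f + (m₀ + 1)) ∨
        ∃ s, f + (m₀ + 1) ∈ T.entry r s ∧ V s ≠ f + (m₀ + 1)) := by
    have hold : ∀ j, (r, j) ∈ mu → ∀ q < r, topLetter f c q j < w j := fun j hj q hq => by
      obtain ⟨a, ha, hle⟩ := exists_topLetter_raise_le hlam0 hrow hT hp hq (hrb j hj)
      exact hle.trans_lt (T.col_strict q r j hq a ha _ (hwm j hj))
    have hmono : ∀ j j', j < j' → (r, j') ∈ mu → w j ≤ w j' := fun j j' hj hj' =>
      T.row_weak r j j' hj _ (hwm j (mu.up_left_mem le_rfl hj.le hj')) _ (hwm j' hj')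
    by_cases hex : ∃ s, (r, s) ∈ mu ∧ w s = f + (m₀ + 1)
    · classical
      set s := Nat.find hex with hs
      obtain ⟨hs1, hs2⟩ : (r, s) ∈ mu ∧ w s = f + (m₀ + 1) := Nat.find_spec hex
      -- Below the letter `f + m₀` of column `x` the last row has at least `f + (m₀ + 1)`, so the
      -- leftmost cell with this maximum is not to the right of `x`. The columns up to `x` have new
      -- height at least `p + 1`, so `f + m₀` fits below them.
      have hsx : s ≤ x := by
        by_contra hlt
        push Not at hlt
        have h1 : (r, x) ∈ mu := mu.up_left_mem le_rfl hlt.le hs1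
        have h2 : f + m₀ ∈ T.entry (r - 1) x :=
          (hlat.mem_iff_height hlam0 hrow (by omega) hx _).2 (by rw [height_low hp]; omega)
        have h3 := T.col_strict (r - 1) r x (by omega) _ h2 _ (hwm x h1)
        have h4 := hmono x s hlt hs1
        exact Nat.find_min hex hlt ⟨h1, by omega⟩
      refine ⟨fun j => if j = s then f + m₀ else w j, ?_, ?_, ⟨s, fun j hj => ?_⟩, Or.inr ⟨s, ?_, ?_⟩⟩
      · intro j j' hj hj'
        have h1 := hmono j j' hj hj'
        dsimp only
        split_ifs with h2 h3 h3
        · exact le_rfl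
        · rw [h2, hs2] at h1
          omega
        · have h4 : w j ≠ f + (m₀ + 1) := fun h4 =>
            Nat.find_min hex (show j < s by omega) ⟨mu.up_left_mem le_rfl hj.le hj', h4⟩
          rw [h3, hs2] at h1
          omega
        · exact h1
      · intro j hj q hq
        dsimp only
        split_ifs with h2
        · have h3 := hcx j (by omega)
          have h4 := hcf j
          rw [topLetter]
          split_ifs <;> omega
        · exact hold j hj q hq
      · by_cases h2 : j = s
        · exact Or.inr ⟨h2, if_pos h2⟩
        · exact Or.inl (by dsimp only; rw [if_neg h2]; exact hwm j hj)
      · rw [← hs2]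
        exact hwm s hs1
      · dsimp only
        rw [if_pos rfl]
        omega
    · push Not at hex
      exact ⟨w, hmono, hold, ⟨0, fun j hj => Or.inl (hwm j hj)⟩, Or.inl hex⟩
  obtain ⟨T', htop, htail⟩ := exists_of_letters hca hcf hrow (fun _ => V)
    (fun i hi j j' hj hj' => hV1 j j' hj (honly i hi j' hj' ▸ hj'))
    (fun i hi i' j hii hj => by
      have := honly i' (by omega) j hj
      omega)
    (fun q hq i hi j hj => hV2 j (honly i hi j hj ▸ hj) q hq)
  refine ⟨T', ?_, sum_low_lt hrow hp htop⟩
  have hmem : ∀ j l, l ∈ T'.entry r j → (r, j) ∈ mu ∧ l = V j := fun j l hl => by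
    have h1 := T'.mem_shape hl
    rw [htail r le_rfl j h1] at hl
    exact ⟨h1, mem_singleton.1 hl⟩
  have hrc1 : ∀ l, l ≠ f + m₀ → T'.rowCount r l ≤ T.rowCount r l := by
    intro l hl
    obtain ⟨s, hs⟩ := hV3
    refine card_le_card (monotone_filter_right _ fun j _ h => ?_)
    obtain ⟨h1, rfl⟩ := hmem j l h
    exact (hs j h1).resolve_right fun h2 => hl h2.2
  have hrc2 : T'.rowCount r (f + m₀) ≤ T.rowCount r (f + m₀) + 1 := by
    obtain ⟨s, hs⟩ := hV3
    refine (card_le_card fun j hj => ?_).trans (card_insert_le s _)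
    obtain ⟨h1, h2⟩ := mem_filter.1 hj
    obtain ⟨h3, h4⟩ := hmem j _ h2
    rcases hs j h3 with h5 | h5
    · exact mem_insert_of_mem (mem_filter.2 ⟨h1, h4.symm ▸ h5⟩)
    · exact mem_insert.2 (Or.inl h5.1)
  have hrc3 : T'.rowCount r (f + (m₀ + 1)) = 0 ∨
      T'.rowCount r (f + (m₀ + 1)) + 1 ≤ T.rowCount r (f + (m₀ + 1)) := by
    rcases hV4 with h | ⟨s, h1, h2⟩
    · left
      refine rowCount_eq_zero_of_forall fun j hj => ?_
      obtain ⟨h1, h2⟩ := hmem j _ hj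
      exact h j h1 h2.symm
    · right
      refine Nat.succ_le_of_lt (card_lt_card ((ssubset_iff_of_subset
        (monotone_filter_right _ fun j _ h => ?_)).2 ⟨s, mem_filter.2
        ⟨mem_range.2 (T.lt_rowLen h1), h1⟩, fun h => h2 (hmem s _ (mem_filter.1 h).2).2.symm⟩))
      obtain ⟨h3, h4⟩ := hmem j _ h
      obtain ⟨s', hs'⟩ := hV3
      rw [h4]
      exact (hs' j h3).resolve_right fun h5 => by have := h5.2; omega
  have hH : ∀ q < r, q < f → #{j ∈ range b | c j < q + 1} ≤ e := fun q hq hqf =>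
    card_raise_lt_le hf hlam hlam0 hrow hT hp hq hqf
  have hslack := slack_top hcf hrow htop hf hlam hlam0 hH
  rw [mem_below_iff_row hd] at hT ⊢
  obtain ⟨hT1, hT2⟩ := hT
  have hTb : T ∈ below lam mu κ := (mem_below_iff_row hd).2 ⟨hT1, hT2⟩
  have hUa := upper_raise_add hlam0 hrow hTb hp htop
  refine ⟨fun q hq l => lattice_top hcf hrow htop hf hlam hlam0 hH hq l, fun l => ⟨?_, ?_⟩⟩
  · have h1 := (hT2 l).1
    rcases lt_or_ge l f with hl | hl
    · have h2 := hrc1 l (by omega)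
      rcases upper_raise_lt hlam hrow hTb hp htop hl with h3 | ⟨rfl, h3⟩
      · omega
      · have h4 : T'.rowCount r l = 0 := rowCount_eq_zero_of_forall fun j hj => by
          have := T'.le_of_mem hj
          omega
        have h5 := hp.2.2.2.2
        rw [hlam l hl]
        omega
    · obtain ⟨m, rfl⟩ := Nat.exists_eq_add_of_le hl
      have h2 := hUa m
      by_cases hm : m = m₀
      · subst hm
        rw [if_pos (by omega), if_neg (by omega)] at h2
        omega
      · have h3 := hrc1 (f + m) (by omega)
        split_ifs at h2 <;> omega
  · have h1 := (hT2 l).2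
    have h0 := hslack l
    rcases lt_trichotomy (l + 1) f with hl | hl | hl
    · have h2 := hrc1 (l + 1) (by omega)
      by_cases h3 : l + 1 = r
      · have h4 := rowCount_succ_le_low (T := T') (p := l) (f := f) (l := l + 1) hl.le
        rw [h3] at h4 h2
        rw [hlam _ hl, hlam l (by omega), upper_top_lt hcf hrow htop le_rfl hl,
          upper_top_lt hcf hrow htop le_rfl (show l < f by omega), if_neg (by omega),
          if_pos (by omega), h3]
        rw [low_top hcf hrow htop (by omega)] at h4
        omega
      · have h4 : T.rowCount r (l + 1) = 0 := rowCount_eq_zero_of_forall fun j hj =>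
          h3 (hlat.eq_row hlam hj hl).symm
        omega
    · rcases lt_trichotomy r f with h2 | h2 | h2
      · have h3 := hUa 0
        simp only [add_zero] at h3
        rw [hlam0 _ (by omega), hlam l (by omega),
          T.upper_of_row (l := l) fun q c h => hlat.eq_row hlam h (by omega), if_neg (by omega)] at h1
        rw [hlam0 _ (by omega), hlam l (by omega),
          upper_top_lt hcf hrow htop le_rfl (show l < f by omega), if_neg (by omega)]
        rw [hl] at h1 ⊢
        rw [if_pos hpr] at h3
        by_cases h4 : m₀ = 0
        · rw [if_neg (by omega)] at h3
          rw [h4, add_zero] at hrc2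
          omega
        · rw [if_pos (by omega)] at h3
          have h5 := hrc1 f (by omega)
          omega
      · have h3 := rowCount_succ_le_low (T := T') (p := l) (f := f) (l := l + 1) hl.le
        have h4 : T'.upper r (f + 0) = #{j ∈ range b | c j + 0 < r} :=
          upper_top_add hcf hrow htop le_rfl 0
        have h5 := hH l (by omega) (by omega)
        rw [low_top hcf hrow htop (by omega)] at h3
        simp only [add_zero] at h4
        rw [hlam0 _ (by omega), hlam l (by omega),
          upper_top_lt hcf hrow htop le_rfl (show l < f by omega), if_pos (by omega)]
        have h6 : l + 1 = r := by omega
        rw [h6] at h3 h5 ⊢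
        rw [h2] at h3 h5 ⊢
        rw [h2] at h4
        omega
      · rw [hl, rowCount_zero_of_low (by omega) le_rfl h2, ← hl]
        omega
    · obtain ⟨m, rfl⟩ := Nat.exists_eq_add_of_le (show f ≤ l by omega)
      have h2 := hUa m
      have h3 := hUa (m + 1)
      rw [add_assoc f] at h0 h1 ⊢
      rw [hlam0 _ (by omega), hlam0 _ (by omega)] at h0 h1 ⊢
      by_cases h4 : m = m₀
      · subst h4
        rw [if_pos (by omega), if_neg (by omega)] at h2
        rw [if_neg (by omega), if_neg (by omega)] at h3
        omega
      · by_cases h5 : m + 1 = m₀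
        · rw [if_pos (by omega), if_pos (by omega)] at h2
          rw [if_pos (by omega), if_neg (by omega)] at h3
          rw [← h5] at hrc2
          omega
        · have h6 := hrc1 (f + (m + 1)) (by omega)
          split_ifs at h2 h3 <;> omega

end SetValuedTableau

namespace SetValuedTableau

open YoungDiagram Polynomial

variable {lam mu κ : YoungDiagram} {T : SetValuedTableau mu} {e f b r p : ℕ}

/-- As for a last row, the upper rows lose one letter `f + m₀`. A letter `f + (m₀ + 1)` in the
column below row `r` may depend on it; then `f + m₀` has to occur in that column before it. -/
theorem exists_raise_col (hf : 0 < f) (hlam : ∀ l < f, lam.rowLen l = e)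
    (hlam0 : ∀ l ≥ f, lam.rowLen l = 0) (hrow : ∀ q < r, mu.rowLen q = b)
    (hr : mu.rowLen r ≤ 1) (hT : T ∈ below lam mu κ) (hp : p ∈ BlockToggle κ e f r T) :
    ∃ T' ∈ below lam mu κ, ∑ q ∈ range r, T.low f q < ∑ q ∈ range r, T'.low f q := by
  have hpr := hp.2.1
  have hpf := hp.1
  have hlat := (mem_below.1 hT).1
  have hTc := ((mem_below_iff_col hr (hlat.upper_succ_le r) (upper_le_of_mem_below hT r)).1 hT).2
  set c := raise (T.height f r) (T.low f p) p with hc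
  have hca : Antitone c := raise_anti hp
  have hcf : ∀ j, c j ≤ f := raise_le hp
  have hx := low_lt hrow hp
  set x := T.low f p with hxd
  have hcx : c x = p + 1 := by rw [hc, raise, if_pos rfl]
  have hc0 : p + 1 ≤ c 0 := hcx ▸ hca (Nat.zero_le x)
  set m₀ := r - 1 - p with hm₀
  set n := mu.colLen 0 - r with hn
  have hcell : ∀ {t}, (r + t, 0) ∈ mu ↔ t < n := fun {t} => by
    rw [mem_iff_lt_colLen]
    omega
  set w : ℕ → ℕ := maxima fun t => T.entry (r + t) 0 with hw
  have hwm : ∀ t < n, w t ∈ T.entry (r + t) 0 := fun t ht =>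
    maxima_mem (v := fun t => T.entry (r + t) 0) ((T.nonempty_iff _ _).2 (hcell.2 ht))
  have hws : ∀ t t', t < t' → t' < n → w t < w t' := fun t t' h ht' =>
    T.col_strict _ _ 0 (by omega) _ (hwm t (h.trans ht')) _ (hwm t' ht')
  have hold : ∀ t < n, ∀ q < r, topLetter f c q 0 < w t := fun t ht q hq => by
    obtain ⟨a, ha, hle⟩ := exists_topLetter_raise_le hlam0 hrow hT hp hq
      (show 0 < b by omega)
    exact hle.trans_lt (T.col_strict q _ 0 (by omega) a ha _ (hwm t ht))
  -- the letters below row `r`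
  obtain ⟨V, hV1, hV2, hV3, hV4⟩ : ∃ V : ℕ → ℕ,
      (∀ t t', t < t' → t' < n → V t < V t') ∧
      (∀ t < n, ∀ q < r, topLetter f c q 0 < V t) ∧
      (∀ t < n, V t = f + m₀ ∨ ∃ k < n, V t = w k ∧ ∀ k' < k, ∃ s < t, V s = w k') ∧
      (∀ t < n, V t = f + (m₀ + 1) → ∃ s < t, V s = f + m₀) := by
    -- If `f + (m₀ + 1)` occurs among the maxima of the lower column but `f + m₀` does not, `f + m₀`
    -- is inserted just before it, the rest moves down and the last letter is dropped. Otherwise the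
    -- old maxima can be kept.
    by_cases hex : (∃ s < n, w s = f + (m₀ + 1)) ∧ ∀ t < n, w t ≠ f + m₀
    · obtain ⟨⟨s, hs, hws'⟩, hno⟩ := hex
      set V : ℕ → ℕ := fun k => if k < s then w k else if k = s then f + m₀ else w (k - 1) with hV
      have e1 : ∀ k < s, V k = w k := fun k hk => if_pos hk
      have e2 : V s = f + m₀ := by simp [hV]
      have e3 : ∀ k, s ≤ k → V (k + 1) = w k := fun k hk => by
        simp only [hV]
        rw [if_neg (by omega), if_neg (by omega), Nat.add_sub_cancel]
      have hlt : ∀ k < s, w k < f + m₀ := fun k hk => by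
        have h1 := hws k s hk hs
        have h2 := hno k (by omega)
        omega
      have hgt : ∀ k, s ≤ k → k < n → f + m₀ < w k := fun k hk hkn => by
        rcases hk.eq_or_lt with rfl | h
        · omega
        · have := hws s k h hkn
          omega
      have cases : ∀ k, k < s ∨ k = s ∨ ∃ k', k = k' + 1 ∧ s ≤ k' := fun k => by
        rcases lt_trichotomy k s with h | h | h
        · exact Or.inl h
        · exact Or.inr (Or.inl h)
        · exact Or.inr (Or.inr ⟨k - 1, by omega, by omega⟩)
      refine ⟨V, ?_, ?_, ?_, ?_⟩
      · intro t t' htt ht'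
        rcases cases t with h | rfl | ⟨k, rfl, h⟩ <;> rcases cases t' with h' | rfl | ⟨k', rfl, h'⟩
        · rw [e1 t h, e1 t' h']
          exact hws t t' htt ht'
        · rw [e1 t h, e2]
          exact hlt t h
        · rw [e1 t h, e3 k' h']
          exact hws t k' (by omega) (by omega)
        · omega
        · omega
        · rw [e2, e3 k' h']
          exact hgt k' h' (by omega)
        · omega
        · omega
        · rw [e3 k h, e3 k' h']
          exact hws k k' (by omega) (by omega)
      · intro t ht q hq
        rcases cases t with h | rfl | ⟨k, rfl, h⟩
        · rw [e1 t h]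
          exact hold t ht q hq
        · have h4 := hcf 0
          rw [e2, topLetter]
          split_ifs <;> omega
        · rw [e3 k h]
          exact hold k (by omega) q hq
      · intro t ht
        rcases cases t with h | rfl | ⟨k, rfl, h⟩
        · exact Or.inr ⟨t, ht, e1 t h, fun k' hk' => ⟨k', hk', e1 k' (by omega)⟩⟩
        · exact Or.inl e2
        · refine Or.inr ⟨k, by omega, e3 k h, fun k' hk' => ?_⟩
          rcases lt_or_ge k' s with h' | h'
          · exact ⟨k', by omega, e1 k' h'⟩
          · exact ⟨k' + 1, by omega, e3 k' h'⟩
      · intro t ht hVt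
        rcases cases t with h | rfl | ⟨k, rfl, h⟩
        · have := hlt t h
          rw [e1 t h] at hVt
          omega
        · omega
        · exact ⟨s, by omega, e2⟩
    · refine ⟨w, hws, hold, fun t ht => Or.inr ⟨t, ht, rfl, fun k' hk' => ⟨k', hk', rfl⟩⟩,
        fun t ht hwt => ?_⟩
      by_contra hc
      push Not at hc
      refine hex ⟨⟨t, ht, hwt⟩, fun t' ht' h => ?_⟩
      rcases lt_trichotomy t' t with h' | rfl | h'
      · exact hc t' h' h
      · omega
      · have := hws t t' h' ht'
        omega
  have hone : ∀ i ≥ r, ∀ j, (i, j) ∈ mu → j = 0 := fun i hi j hj => by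
    have h1 := mem_iff_lt_rowLen.1 hj
    have h2 := mu.rowLen_anti r i hi
    omega
  obtain ⟨T', htop, htail⟩ := exists_of_letters hca hcf hrow (fun i _ => V (i - r))
    (fun i hi j j' hj hj' => by
      have := hone i hi j' hj'
      omega)
    (fun i hi i' j hii hj => hV1 _ _ (by omega) (by
      have := hone i' (by omega) j hj
      subst this
      have := mem_iff_lt_colLen.1 hj
      omega))
    (fun q hq i hi j hj => by
      have := hone i hi j hj
      subst this
      have := mem_iff_lt_colLen.1 hj
      exact hV2 _ (by omega) q hq)
  refine ⟨T', ?_, sum_low_lt hrow hp htop⟩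
  have hmem : ∀ t < n, T'.entry (r + t) 0 = {V t} := fun t ht => by
    have := htail (r + t) (by omega) 0 (hcell.2 ht)
    rwa [Nat.add_sub_cancel_left] at this
  have hH : ∀ q < r, q < f → #{j ∈ range b | c j < q + 1} ≤ e := fun q hq hqf =>
    card_raise_lt_le hf hlam hlam0 hrow hT hp hq hqf
  have hslack := slack_top hcf hrow htop hf hlam hlam0 hH
  have hUa := upper_raise_add hlam0 hrow hT hp htop
  have hUle : ∀ m, T'.upper r (f + m) ≤ T.upper r (f + m) := fun m => by
    have := hUa m
    split_ifs at this <;> omega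
  have hUl := fun l (hl : l < f) => upper_raise_lt hlam hrow hT hp htop hl
  have hz : ∀ l < f, r ≤ l → T.upper r l = 0 ∧ T'.upper r l = 0 := fun l hl hrl => by
    rw [upper_top_lt hcf hrow htop le_rfl hl, T.upper_of_row fun q c h => hlat.eq_row hlam h hl,
      if_neg (by omega), if_neg (by omega)]
    exact ⟨rfl, rfl⟩
  have hκ : ∀ l, lam.rowLen l + T'.upper r l ≤ κ.rowLen l := fun l => by
    have h1 := upper_le_of_mem_below hT r l
    rcases lt_or_ge l f with hl | hl
    · rcases hUl l hl with h2 | ⟨rfl, h2⟩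
      · omega
      · have := hp.2.2.2.2
        rw [hlam l hl]
        omega
    · obtain ⟨m, rfl⟩ := Nat.exists_eq_add_of_le hl
      have := hUle m
      omega
  have hlowpos : ∀ q < r, q < f → 0 < T.low f q → 0 < T'.upper r q := fun q hq hqf h => by
    rw [upper_top_lt hcf hrow htop le_rfl hqf, if_pos hq]
    refine card_pos.2 ⟨0, mem_filter.2 ⟨mem_range.2 (by omega), ?_⟩⟩
    exact (lt_height_iff.2 ⟨hq, h⟩).trans_le (le_raise hp 0)
  have hUf : r = f → T'.upper r f ≤ e := fun h => by
    have h1 : T'.upper r (f + 0) = #{j ∈ range b | c j + 0 < r} :=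
      upper_top_add hcf hrow htop le_rfl 0
    have h2 := hH (f - 1) (by omega) (by omega)
    rw [Nat.sub_add_cancel hf] at h2
    simp only [add_zero] at h1
    rw [h1, h]
    exact h2
  refine (mem_below_iff_col hr hslack hκ).2 ⟨fun q hq l =>
    lattice_top hcf hrow htop hf hlam hlam0 hH hq l, fun t l hl => ?_⟩
  have ht := hcell.1 (T'.mem_shape hl)
  rw [hmem t ht, mem_singleton] at hl
  have hpred : ∀ m, (∃ t' < t, m ∈ T'.entry (r + t') 0) ↔ ∃ t' < t, V t' = m := fun m => by
    constructor
    · rintro ⟨t', ht', h⟩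
      rw [hmem t' (ht'.trans ht), mem_singleton] at h
      exact ⟨t', ht', h.symm⟩
    · rintro ⟨t', ht', rfl⟩
      refine ⟨t', ht', ?_⟩
      rw [hmem t' (ht'.trans ht)]
      exact mem_singleton_self _
  simp only [hpred]
  rcases hV3 t ht with h | ⟨k, hk, hVk, htrans⟩
  · rw [h] at hl
    subst hl
    have h1 := hUa m₀
    rw [if_pos (by omega), if_neg (by omega)] at h1
    refine ⟨by have := upper_le_of_mem_below hT r (f + m₀); omega, fun m hm => Or.inl ?_⟩
    rcases Nat.eq_zero_or_pos m₀ with h0 | h0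
    · have hm' : m = f - 1 := by omega
      subst hm'
      rw [h0, add_zero] at h1 ⊢
      rcases lt_or_ge r f with h2 | h2
      · obtain ⟨h3, h4⟩ := hz (f - 1) (by omega) (by omega)
        have h5 := hlat.upper_succ_le r (f - 1)
        rw [Nat.sub_add_cancel hf] at h5
        omega
      · have h3 : r = f := by omega
        have h4 := hUf h3
        have h5 : 0 < T'.upper r (f - 1) := by
          rw [upper_top_lt hcf hrow htop le_rfl (show f - 1 < f by omega), if_pos (by omega)]
          exact card_pos.2 ⟨x, mem_filter.2 ⟨mem_range.2 hx, by omega⟩⟩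
        rw [hlam0 f le_rfl, hlam (f - 1) (by omega)]
        omega
    · obtain ⟨m', hm'⟩ := Nat.exists_eq_succ_of_ne_zero h0.ne'
      have hm'' : m = f + m' := by omega
      subst hm''
      have h2 := hUa m'
      rw [if_pos (by omega), if_pos (by omega)] at h2
      have h3 := hlat.upper_succ_le r (f + m')
      rw [hm] at h3
      omega
  · have hlk : l ∈ T.entry (r + k) 0 := by
      rw [hl, hVk]
      exact hwm k hk
    obtain ⟨h1, h2⟩ := hTc k l hlk
    have hlr := T.le_of_mem hlk
    refine ⟨?_, fun m hm => ?_⟩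
    · rcases lt_or_ge l f with hlf | hlf
      · rcases hUl l hlf with h3 | ⟨rfl, h3⟩ <;> omega
      · obtain ⟨m, rfl⟩ := Nat.exists_eq_add_of_le hlf
        have := hUle m
        omega
    · have hpr' : (∃ t' < k, m ∈ T.entry (r + t') 0) → ∃ t' < t, V t' = m := by
        rintro ⟨k', hk', hmk⟩
        obtain ⟨s, hs, hVs⟩ := htrans k' hk'
        refine ⟨s, hs, ?_⟩
        have h3 := le_maxima (v := fun t => T.entry (r + t) 0) hmk
        have h4 := hws k' k hk' hk
        rw [hVs]
        simp only [hw] at h4 hVk ⊢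
        omega
      rcases lt_trichotomy l f with hlf | hlf | hlf
      · have h3 := hlat.eq_row hlam hlk hlf
        obtain ⟨-, h4⟩ := hz l hlf (by omega)
        rcases Nat.eq_zero_or_pos k with h5 | h5
        · left
          have h6 := lt_low_of_col (T := T) (f := f) (p := m) (q := r + k) (by omega) hlk hlf.le
          have h7 := hlowpos m (by omega) (by omega) h6
          rw [hlam l hlf, hlam m (by omega)]
          omega
        · right
          obtain ⟨h6, -⟩ := hz m (by omega) (by omega)
          refine hpr' ((h2 m hm).resolve_left fun h7 => ?_)
          rw [hlam l hlf, hlam m (by omega)] at h7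
          omega
      · rcases lt_or_ge r f with hrf | hrf
        · refine (h2 m hm).imp (fun h3 => ?_) hpr'
          obtain ⟨h4, h5⟩ := hz m (by omega) (by omega)
          have h6 := hUle 0
          rw [add_zero] at h6
          rw [hlf] at h3 ⊢
          omega
        · left
          have h3 := lt_low_of_col (T := T) (f := f) (p := r + k - 1) (q := r + k) (by omega) hlk
            hlf.le
          have h4 : r + k - 1 < f := not_le.1 fun h => by
            rw [low_eq_zero h] at h3
            omega
          have h5 : r + k - 1 = m := by omega
          rw [h5] at h3
          have h6 := hlowpos m (by omega) (by omega) h3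
          have h7 := hUf (by omega)
          rw [hlf, hlam0 f le_rfl, hlam m (by omega)]
          omega
      · obtain ⟨m', hm'⟩ := Nat.exists_eq_add_of_le (show f ≤ m by omega)
        by_cases h3 : m' = m₀
        · right
          obtain ⟨s, hs, hVs⟩ := hV4 t ht (by omega)
          exact ⟨s, hs, by omega⟩
        · refine (h2 m hm).imp (fun h4 => ?_) hpr'
          have h5 := hUa m'
          have h6 := hUa (m' + 1)
          rw [← add_assoc f, ← hm', hm] at h6
          rw [← hm'] at h5
          split_ifs at h5 h6 <;> omega

/-- A tableau with the largest possible number of low cells has no toggle, since otherwise a column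
could be raised. -/
theorem exists_blockToggle_eq_empty
    (H : ∀ T ∈ below lam mu κ, ∀ p ∈ BlockToggle κ e f r T, ∃ T' ∈ below lam mu κ,
      ∑ q ∈ range r, T.low f q < ∑ q ∈ range r, T'.low f q)
    (hne : (below lam mu κ).Nonempty) : ∃ T ∈ below lam mu κ, BlockToggle κ e f r T = ∅ := by
  obtain ⟨T, hT, hmax⟩ := exists_max_image _ (fun T => ∑ q ∈ range r, T.low f q) hne
  refine ⟨T, hT, Set.eq_empty_iff_forall_notMem.2 fun p hp => ?_⟩
  obtain ⟨T', hT', hlt⟩ := H T hT p hp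
  exact absurd (hmax T' hT') (not_le.2 hlt)

/-- `lam` is a rectangle, and all rows of `mu` except for the last one have the same length. -/
theorem cancels_rect_row (hf : 0 < f) (hlam : ∀ l < f, lam.rowLen l = e)
    (hlam0 : ∀ l ≥ f, lam.rowLen l = 0) (hrow : ∀ q < r, mu.rowLen q = b)
    (hd : mu.colLen 0 ≤ r + 1) : Cancels lam mu := by
  intro κ hne
  obtain ⟨T, hT, h⟩ := exists_blockToggle_eq_empty
    (fun T hT p hp => exists_raise_row hf hlam hlam0 hrow hd hT hp) hne
  exact exists_belowPoly_row hlam hlam0 hrow hd hT h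

/-- `lam` is a rectangle, and all rows of `mu` except for those of length at most one have the same
length. -/
theorem cancels_rect_col (hf : 0 < f) (hlam : ∀ l < f, lam.rowLen l = e)
    (hlam0 : ∀ l ≥ f, lam.rowLen l = 0) (hrow : ∀ q < r, mu.rowLen q = b)
    (hr : mu.rowLen r ≤ 1) : Cancels lam mu := by
  intro κ hne
  obtain ⟨T, hT, h⟩ := exists_blockToggle_eq_empty
    (fun T hT p hp => exists_raise_col hf hlam hlam0 hrow hr hT hp) hne
  exact exists_belowPoly_col hlam hlam0 hrow hr hT h

end SetValuedTableau

theorem card_filter_range_interval {n x y : ℕ} (h : y ≤ n) :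
    #{j ∈ range n | x ≤ j ∧ j < y} = y - x := by
  have : {j ∈ range n | x ≤ j ∧ j < y} = Ico x y := by
    ext j
    simp only [mem_filter, mem_range, mem_Ico]
    omega
  rw [this, Nat.card_Ico]

/-! ### Two long rows -/

namespace SetValuedTableau

open YoungDiagram Polynomial

variable {lam mu κ : YoungDiagram} {T : SetValuedTableau mu} {A B c r s : ℕ}

theorem rowCount_of_interval {q l x y : ℕ} (hrow : mu.rowLen q = c) (hy : y ≤ c)
    (h : ∀ j < c, l ∈ T.entry q j ↔ x ≤ j ∧ j < y) : T.rowCount q l = y - x := by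
  rw [rowCount_of_iff hrow h, card_filter_range_interval hy]

/-- `lam` has at most two part sizes: `A` in the first `r` rows and `B` in the next `s` rows. -/
structure TwoBlocks (lam : YoungDiagram) (A B r s : ℕ) : Prop where
  first : ∀ l < r, lam.rowLen l = A
  second : ∀ l, r ≤ l → l < r + s → lam.rowLen l = B
  third : ∀ l ≥ r + s, lam.rowLen l = 0

/-- `mu` has two rows of length `c`. -/
structure TwoRows (mu : YoungDiagram) (c : ℕ) : Prop where
  zero : mu.rowLen 0 = c
  one : mu.rowLen 1 = c
  colLen : mu.colLen 0 ≤ 2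

/-- The conditions under which a first row with `a` letters `0`, `b + e - a` letters `r` and `c - b`
letters `r + s` extends to two rows. -/
def Extendable (N M K₁ K₂ K₃ c a b e : ℕ) : Prop :=
  a ≤ b ∧ b + e ≤ c ∧ b + e ≤ a + N ∧ c ≤ b + M ∧ c ≤ b + K₃ ∧ c ≤ a + K₂ + M ∧
    c ≤ min a K₁ + N + M ∧ c + b + e ≤ a + min a K₁ + N + M + K₂

/-- `1` if the first cell of the first row with a letter at least `t` also contains `r`, otherwise
`0`. -/
noncomputable def doubleBit (T : SetValuedTableau mu) (r t : ℕ) : ℕ :=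
  open Classical in if r ∈ T.entry 0 (T.low t 0) then 1 else 0

theorem doubleBit_le (T : SetValuedTableau mu) (r t : ℕ) : T.doubleBit r t ≤ 1 := by
  unfold doubleBit
  split_ifs <;> omega

section

variable (hl : TwoBlocks lam A B r s) (hm : TwoRows mu c) (hr : 2 ≤ r) (hs : 2 ≤ s)
  (hT : T ∈ below lam mu κ)

include hl in
theorem TwoBlocks.rowLen (l : ℕ) : (l < r ∧ lam.rowLen l = A) ∨
    (r ≤ l ∧ l < r + s ∧ lam.rowLen l = B) ∨ r + s ≤ l ∧ lam.rowLen l = 0 := by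
  rcases lt_or_ge l r with h | h
  · exact Or.inl ⟨h, hl.first l h⟩
  · rcases lt_or_ge l (r + s) with h' | h'
    · exact Or.inr (Or.inl ⟨h, h', hl.second l h h'⟩)
    · exact Or.inr (Or.inr ⟨h', hl.third l h'⟩)

theorem upper_one' (T : SetValuedTableau mu) (l : ℕ) : T.upper 1 l = T.rowCount 0 l := by
  rw [T.upper_succ, T.upper_zero, zero_add]

include hl hs hT in
-- A positive letter of the first row needs a row of `lam` shorter than the one before it, that is
-- the first row after a block.
theorem letter_row_zero {j l : ℕ} (h : l ∈ T.entry 0 j) : l = 0 ∨ l = r ∨ l = r + s := by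
  rcases l with _ | l
  · exact Or.inl rfl
  · have h1 := (mem_below.1 hT).1 0 l
    rw [upper_one', T.upper_zero] at h1
    have h2 := rowCount_pos h
    have h3 := hl.rowLen l
    have h4 := hl.rowLen (l + 1)
    omega

theorem low_row_zero_le (T : SetValuedTableau mu) (r s : ℕ) : T.low r 0 ≤ T.low (r + s) 0 :=
  card_le_card (monotone_filter_right _ fun _ _ h l hl => (h l hl).trans_le (Nat.le_add_right r s))

include hm in
theorem add_doubleBit_le (T : SetValuedTableau mu) (r s : ℕ) : T.low (r + s) 0 + T.doubleBit r (r + s) ≤ c := by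
  have h1 := T.low_le (r + s) 0
  rw [hm.zero] at h1
  unfold doubleBit
  split_ifs with h
  · have := T.lt_rowLen h
    rw [hm.zero] at this
    omega
  · omega

include hl hm hr hs hT

theorem mem_row_zero_mid {j : ℕ} :
    r ∈ T.entry 0 j ↔ T.low r 0 ≤ j ∧ j < T.low (r + s) 0 + T.doubleBit r (r + s) := by
  have hc := add_doubleBit_le hm T r s
  constructor
  · intro h
    have h1 := T.lt_rowLen h
    refine ⟨not_lt.1 fun h2 => absurd ((lt_low_iff.1 h2).2 r h) (lt_irrefl r), ?_⟩
    rcases lt_trichotomy j (T.low (r + s) 0) with h2 | h2 | h2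
    · omega
    · rw [h2] at h
      rw [doubleBit, if_pos h]
      omega
    · obtain ⟨l, h3, h4⟩ := exists_le_of_low_le (h2.trans h1) le_rfl
      have := T.row_weak 0 _ _ h2 l h3 r h
      omega
  · rintro ⟨h1, h2⟩
    rcases lt_or_ge j (T.low (r + s) 0) with h3 | h3
    · obtain ⟨l, h4, h5⟩ := exists_le_of_low_le (f := r) (lt_low_iff.1 h3).1 h1
      have h6 := (lt_low_iff.1 h3).2 l h4
      rcases letter_row_zero hl hs hT h4 with h7 | rfl | h7
      · omega
      · exact h4
      · omega
    · unfold doubleBit at h2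
      split_ifs at h2 with h4
      · obtain rfl : j = T.low (r + s) 0 := by omega
        exact h4
      · omega

theorem mem_row_zero_top {j : ℕ} (hj : j < c) : r + s ∈ T.entry 0 j ↔ T.low (r + s) 0 ≤ j := by
  constructor
  · exact fun h => not_lt.1 fun h2 => absurd ((lt_low_iff.1 h2).2 _ h) (lt_irrefl _)
  · intro h
    obtain ⟨l, h1, h2⟩ := exists_le_of_low_le (by rwa [hm.zero]) h
    rcases letter_row_zero hl hs hT h1 with h3 | h3 | rfl
    · omega
    · omega
    · exact h1

theorem rowCount_zero_mid :
    T.rowCount 0 r = T.low (r + s) 0 + T.doubleBit r (r + s) - T.low r 0 :=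
  rowCount_of_interval hm.zero (add_doubleBit_le hm T r s) fun _ _ =>
    mem_row_zero_mid hl hm hr hs hT

theorem rowCount_zero_top : T.rowCount 0 (r + s) = c - T.low (r + s) 0 :=
  rowCount_of_interval hm.zero le_rfl fun _ hj =>
    (mem_row_zero_top hl hm hr hs hT hj).trans (iff_self_and.2 fun _ => hj)

omit hm in
-- Besides the first rows after the blocks, the successors of letters of the first row are possible.
theorem letter_row_one {j l : ℕ} (h : l ∈ T.entry 1 j) :
    l = 1 ∨ l = r ∨ l = r + 1 ∨ l = r + s ∨ l = r + s + 1 := by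
  have h0 := T.le_of_mem h
  obtain ⟨l, rfl⟩ := Nat.exists_eq_succ_of_ne_zero (show l ≠ 0 by omega)
  by_contra hc
  have h1 := (mem_below.1 hT).1 1 l
  rw [T.upper_succ, upper_one', upper_one'] at h1
  have h2 := rowCount_pos h
  have h3 := hl.rowLen l
  have h4 := hl.rowLen (l + 1)
  have h5 : T.rowCount 0 l = 0 := rowCount_eq_zero_of_forall fun j hj => by
    have := letter_row_zero hl hs hT hj
    omega
  dsimp only [Nat.succ_eq_add_one] at h2 hc
  omega

/-- Necessity of the counting conditions. The five bounds are the capacities, given by `lam` and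
`κ`, for the letters `r`, `r + s`, `1`, `r + 1` and `r + s + 1`; the inequalities say that the
second row can be covered within them. -/
theorem extendable_of_mem_below : Extendable (min (A - B) (κ.rowLen r - B)) (min B (κ.rowLen (r + s)))
    (κ.rowLen 1 - A) (κ.rowLen (r + 1) - B) (κ.rowLen (r + s + 1)) c (T.low r 0)
    (T.low (r + s) 0) (T.doubleBit r (r + s)) := by
  have hc := add_doubleBit_le hm T r s
  have hab := T.low_row_zero_le r s
  have e1 := rowCount_zero_mid hl hm hr hs hT
  have e2 := rowCount_zero_top hl hm hr hs hT
  set a := T.low r 0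
  set b := T.low (r + s) 0
  have hlat := (mem_below.1 hT).1
  have hB : lam.rowLen r = B := hl.second r le_rfl (by omega)
  have hB1 : lam.rowLen (r + 1) = B := hl.second _ (by omega) (by omega)
  have hA1 : lam.rowLen 1 = A := hl.first _ (by omega)
  have h0 : lam.rowLen (r + s) = 0 := hl.third _ le_rfl
  have h01 : lam.rowLen (r + s + 1) = 0 := hl.third _ (by omega)
  have hAr : lam.rowLen (r - 1) = A := hl.first _ (by omega)
  have hBs : lam.rowLen (r + s - 1) = B := hl.second _ (by omega) (by omega)
  have hU : ∀ l, T.upper 2 l = T.rowCount 0 l + T.rowCount 1 l := fun l => by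
    rw [T.upper_succ, upper_one']
  have hκ : ∀ l, lam.rowLen l + T.rowCount 0 l + T.rowCount 1 l ≤ κ.rowLen l := fun l => by
    have := upper_le_of_mem_below hT 2 l
    rw [hU] at this
    omega
  have hL : ∀ l, lam.rowLen (l + 1) + T.rowCount 0 (l + 1) + T.rowCount 1 (l + 1) ≤
      lam.rowLen l + T.rowCount 0 l := fun l => by
    have := hlat 1 l
    rw [hU, upper_one'] at this
    omega
  have z : ∀ l, l ≠ 0 → l ≠ r → l ≠ r + s → T.rowCount 0 l = 0 := fun l h1 h2 h3 =>
    rowCount_eq_zero_of_forall fun j hj => by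
      have := letter_row_zero hl hs hT hj
      omega
  -- the second row
  have g1 : ∀ j < c, b ≤ j → r + s + 1 ∈ T.entry 1 j := by
    intro j hj hbj
    obtain ⟨l, hl'⟩ := T.entry_nonempty (p := 1) (j := j) (by rwa [hm.one])
    have h1 := T.col_strict 0 1 j (by omega) _ ((mem_row_zero_top hl hm hr hs hT hj).2 hbj) l hl'
    rcases letter_row_one hl hr hs hT hl' with h | h | h | h | h
    all_goals first | omega | (rw [← h]; exact hl')
  -- Below each `r + s` only `r + s + 1` is possible. The lattice condition allows no more of these,
  -- so they fill exactly the columns from `b` on.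
  have g2 : {j ∈ range c | r + s + 1 ∈ T.entry 1 j} = {j ∈ range c | b ≤ j ∧ j < c} := by
    refine (eq_of_subset_of_card_le (fun j hj => ?_) ?_).symm
    · obtain ⟨h1, h2, h3⟩ := mem_filter.1 hj
      exact mem_filter.2 ⟨h1, g1 j h3 h2⟩
    · have h1 := hL (r + s)
      rw [h0, h01, z _ (by omega) (by omega) (by omega), e2] at h1
      have h2 : #{j ∈ range c | r + s + 1 ∈ T.entry 1 j} = T.rowCount 1 (r + s + 1) := by
        rw [rowCount, hm.one]
      rw [h2, card_filter_range_interval le_rfl]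
      omega
  have g3 : T.rowCount 1 (r + s + 1) = c - b := by
    rw [rowCount, hm.one, g2, card_filter_range_interval le_rfl]
  -- The letters `1` and `r` of the second row lie below low cells, that is in the first `a`
  -- columns. The remaining columns before `b` must be covered by `r + 1` and `r + s`.
  set D : Finset ℕ := {j ∈ range c | 1 ∈ T.entry 1 j ∨ r ∈ T.entry 1 j} with hD
  have g4 : #D ≤ a := by
    have : D ⊆ range a := fun j hj => by
      rcases (mem_filter.1 hj).2 with h | h
      · exact mem_range.2 (lt_low_of_col (by omega) h (by omega))
      · exact mem_range.2 (lt_low_of_col (by omega) h le_rfl)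
    have := card_le_card this
    rwa [card_range] at this
  have g5 : #D ≤ T.rowCount 1 1 + T.rowCount 1 r := by
    rw [hD, filter_or, rowCount, rowCount, hm.one]
    exact card_union_le _ _
  have g6 : T.rowCount 1 1 ≤ a := by
    have := rowCount_succ_le_low (T := T) (p := 0) (l := 1) (f := r) (by omega)
    exact this
  have g7 : b ≤ #D + T.rowCount 1 (r + 1) + T.rowCount 1 (r + s) := by
    have : range b ⊆ D ∪ {j ∈ range c | r + 1 ∈ T.entry 1 j} ∪
        {j ∈ range c | r + s ∈ T.entry 1 j} := by
      intro j hj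
      have hj := mem_range.1 hj
      have hjc : j ∈ range c := mem_range.2 (by omega)
      obtain ⟨l, hl'⟩ := T.entry_nonempty (p := 1) (j := j) (by rw [hm.one]; omega)
      rw [mem_union, mem_union]
      rcases letter_row_one hl hr hs hT hl' with rfl | rfl | rfl | rfl | rfl
      · exact Or.inl (Or.inl (mem_filter.2 ⟨hjc, Or.inl hl'⟩))
      · exact Or.inl (Or.inl (mem_filter.2 ⟨hjc, Or.inr hl'⟩))
      · exact Or.inl (Or.inr (mem_filter.2 ⟨hjc, hl'⟩))
      · exact Or.inr (mem_filter.2 ⟨hjc, hl'⟩)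
      · have h1 : j ∈ {j ∈ range c | r + s + 1 ∈ T.entry 1 j} := mem_filter.2 ⟨hjc, hl'⟩
        rw [g2] at h1
        have := (mem_filter.1 h1).2
        omega
    have h1 := (card_le_card this).trans ((card_union_le _ _).trans
      (Nat.add_le_add_right (card_union_le _ _) _))
    rw [card_range] at h1
    rw [rowCount, rowCount, hm.one]
    exact h1
  have k1 := hκ r
  have k2 := hκ (r + s)
  have k3 := hκ 1
  have k4 := hκ (r + 1)
  have k5 := hκ (r + s + 1)
  have l3 := hL r
  have l1 : B + T.rowCount 0 r + T.rowCount 1 r ≤ A := by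
    have := hL (r - 1)
    rw [show r - 1 + 1 = r by omega] at this
    rw [z (r - 1) (by omega) (by omega) (by omega)] at this
    omega
  have l2 : T.rowCount 0 (r + s) + T.rowCount 1 (r + s) ≤ B := by
    have := hL (r + s - 1)
    rw [show r + s - 1 + 1 = r + s by omega, z (r + s - 1) (by omega) (by omega) (by omega)] at this
    omega
  rw [z (r + 1) (by omega) (by omega) (by omega)] at l3 k4
  unfold Extendable
  refine ⟨hab, hc, ?_, ?_, ?_, ?_, ?_, ?_⟩ <;> omega

end

end SetValuedTableau

namespace SetValuedTableau

open YoungDiagram Polynomial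

variable {lam mu κ : YoungDiagram} {T : SetValuedTableau mu} {A B c r s : ℕ}

theorem TwoRows.mem_iff (hm : TwoRows mu c) {q j : ℕ} : (q, j) ∈ mu ↔ q < 2 ∧ j < c := by
  rw [mem_iff_lt_rowLen]
  rcases q with _ | _ | q
  · rw [hm.zero]; omega
  · rw [zero_add, hm.one]; omega
  · rw [rowLen_eq_zero (by have := hm.colLen; omega)]; omega

/-- A tableau with two rows. -/
def ofTwoRows (hm : TwoRows mu c) (Z W : ℕ → Finset ℕ)
    (hZ : ∀ j < c, (Z j).Nonempty) (hW : ∀ j < c, (W j).Nonempty)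
    (hZr : ∀ j j', j < j' → j' < c → ∀ x ∈ Z j, ∀ y ∈ Z j', x ≤ y)
    (hWr : ∀ j j', j < j' → j' < c → ∀ x ∈ W j, ∀ y ∈ W j', x ≤ y)
    (hc : ∀ j < c, ∀ x ∈ Z j, ∀ y ∈ W j, x < y) : SetValuedTableau mu where
  entry q j := if q < 2 ∧ j < c then if q = 0 then Z j else W j else ∅
  nonempty_iff q j := by
    rw [hm.mem_iff]
    split_ifs with h h'
    · exact iff_of_true (hZ j h.2) h
    · exact iff_of_true (hW j h.2) h
    · exact iff_of_false (by simp) h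
  row_weak q j j' hj x hx y hy := by
    split_ifs at hx hy with h1 h2 h3
    · exact hZr j j' hj h3.2 x hx y hy
    · simp at hy
    · exact hWr j j' hj (by omega) x hx y hy
    all_goals first | (simp at hx) | (simp at hy)
  col_strict q q' j hq x hx y hy := by
    split_ifs at hx hy with h1 h2 h3 h4
    · omega
    · exact hc j h1.2 x hx y hy
    all_goals first | omega | (simp at hx) | (simp at hy)

theorem entry_zero_ofTwoRows {hm : TwoRows mu c} {Z W : ℕ → Finset ℕ} {hZ hW hZr hWr hc} {j : ℕ}
    (hj : j < c) : (ofTwoRows hm Z W hZ hW hZr hWr hc).entry 0 j = Z j :=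
  (if_pos ⟨by omega, hj⟩).trans (if_pos rfl)

theorem entry_one_ofTwoRows {hm : TwoRows mu c} {Z W : ℕ → Finset ℕ} {hZ hW hZr hWr hc} {j : ℕ}
    (hj : j < c) : (ofTwoRows hm Z W hZ hW hZr hWr hc).entry 1 j = W j :=
  (if_pos ⟨by omega, hj⟩).trans (if_neg (by omega))

theorem exists_of_letters_two (hm : TwoRows mu c) (hr : 2 ≤ r) (hs : 2 ≤ s) {a b e x u v : ℕ}
    (hab : a ≤ b) (he : e ≤ 1) (hx : x ≤ u) (hu : u ≤ a) (hv : u + v ≤ b) :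
    ∃ T : SetValuedTableau mu,
      (∀ j < c, ∀ l, l ∈ T.entry 0 j ↔
        (l = 0 ∧ j < a) ∨ (l = r ∧ a ≤ j ∧ j < b + e) ∨ (l = r + s ∧ b ≤ j)) ∧
      ∀ j < c, ∀ l, l ∈ T.entry 1 j ↔ (l = 1 ∧ j < x) ∨ (l = r ∧ x ≤ j ∧ j < u) ∨
        (l = r + 1 ∧ u ≤ j ∧ j < u + v) ∨ (l = r + s ∧ u + v ≤ j ∧ j < b) ∨
        (l = r + s + 1 ∧ b ≤ j) := by
  set Z : ℕ → Finset ℕ := fun j => {l ∈ range (r + s + 1) |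
    (l = 0 ∧ j < a) ∨ (l = r ∧ a ≤ j ∧ j < b + e) ∨ (l = r + s ∧ b ≤ j)} with hZ
  set W : ℕ → Finset ℕ := fun j => {l ∈ range (r + s + 2) | (l = 1 ∧ j < x) ∨
    (l = r ∧ x ≤ j ∧ j < u) ∨ (l = r + 1 ∧ u ≤ j ∧ j < u + v) ∨ (l = r + s ∧ u + v ≤ j ∧ j < b) ∨
    (l = r + s + 1 ∧ b ≤ j)} with hW
  have mZ : ∀ j l, l ∈ Z j ↔
      (l = 0 ∧ j < a) ∨ (l = r ∧ a ≤ j ∧ j < b + e) ∨ (l = r + s ∧ b ≤ j) := fun j l => by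
    rw [hZ, mem_filter, mem_range]
    omega
  have mW : ∀ j l, l ∈ W j ↔ (l = 1 ∧ j < x) ∨
      (l = r ∧ x ≤ j ∧ j < u) ∨ (l = r + 1 ∧ u ≤ j ∧ j < u + v) ∨
      (l = r + s ∧ u + v ≤ j ∧ j < b) ∨ (l = r + s + 1 ∧ b ≤ j) := fun j l => by
    rw [hW, mem_filter, mem_range]
    omega
  have nZ : ∀ j < c, (Z j).Nonempty := fun j _ => by
    by_cases h1 : j < a
    · exact ⟨0, (mZ _ _).2 (by omega)⟩
    · by_cases h2 : j < b
      · exact ⟨r, (mZ _ _).2 (by omega)⟩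
      · exact ⟨r + s, (mZ _ _).2 (by omega)⟩
  have nW : ∀ j < c, (W j).Nonempty := fun j _ => by
    by_cases h1 : j < x
    · exact ⟨1, (mW _ _).2 (by omega)⟩
    by_cases h2 : j < u
    · exact ⟨r, (mW _ _).2 (by omega)⟩
    by_cases h3 : j < u + v
    · exact ⟨r + 1, (mW _ _).2 (by omega)⟩
    by_cases h4 : j < b
    · exact ⟨r + s, (mW _ _).2 (by omega)⟩
    · exact ⟨r + s + 1, (mW _ _).2 (by omega)⟩
  refine ⟨ofTwoRows hm Z W nZ nW ?_ ?_ ?_, ?_, ?_⟩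
  · intro j j' hj _ y hy z hz
    rw [mZ] at hy hz
    omega
  · intro j j' hj _ y hy z hz
    rw [mW] at hy hz
    omega
  · intro j hj y hy z hz
    rw [mZ] at hy
    rw [mW] at hz
    omega
  · intro j hj l
    rw [entry_zero_ofTwoRows hj]
    exact mZ j l
  · intro j hj l
    rw [entry_one_ofTwoRows hj]
    exact mW j l

section letters

variable {a b e x u v : ℕ} (hm : TwoRows mu c) (hr : 2 ≤ r) (hs : 2 ≤ s) (hab : a ≤ b) (hbc : b + e ≤ c)
  (t0 : ∀ j < c, ∀ l, l ∈ T.entry 0 j ↔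
      (l = 0 ∧ j < a) ∨ (l = r ∧ a ≤ j ∧ j < b + e) ∨ (l = r + s ∧ b ≤ j))

include hm hr hs hab hbc t0

theorem low_of_letters : T.low r 0 = a := by
  rw [low, hm.zero]
  have : {j ∈ range c | ∀ l ∈ T.entry 0 j, l < r} = {j ∈ range c | 0 ≤ j ∧ j < a} := by
    refine filter_congr fun j hj => ?_
    have hj := mem_range.1 hj
    constructor
    · intro h'
      refine ⟨Nat.zero_le _, not_le.1 fun haj => ?_⟩
      by_cases hjb : j < b
      · exact absurd (h' r ((t0 j hj r).2 (by omega))) (lt_irrefl r)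
      · have := h' (r + s) ((t0 j hj _).2 (by omega))
        omega
    · intro h' l hl'
      have := (t0 j hj l).1 hl'
      omega
  rw [this, card_filter_range_interval (by omega), Nat.sub_zero]

omit hab in
theorem low_top_of_letters : T.low (r + s) 0 = b := by
  rw [low, hm.zero]
  have : {j ∈ range c | ∀ l ∈ T.entry 0 j, l < r + s} = {j ∈ range c | 0 ≤ j ∧ j < b} := by
    refine filter_congr fun j hj => ?_
    have hj := mem_range.1 hj
    constructor
    · intro h'
      refine ⟨Nat.zero_le _, not_le.1 fun haj => ?_⟩
      have := h' (r + s) ((t0 j hj _).2 (by omega))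
      omega
    · intro h' l hl'
      have := (t0 j hj l).1 hl'
      omega
  rw [this, card_filter_range_interval (by omega), Nat.sub_zero]

theorem doubleBit_of_letters (he : e ≤ 1) : T.doubleBit r (r + s) = e := by
  have low1 := low_top_of_letters hm hr hs hbc t0
  rw [doubleBit, low1]
  split_ifs with h'
  · have h'' := T.lt_rowLen h'
    rw [hm.zero] at h''
    have := (t0 b h'' r).1 h'
    omega
  · by_contra hne
    exact h' ((t0 b (by omega) r).2 (by omega))

theorem rowCount_zero_of_letters (l : ℕ) : (l = 0 ∧ T.rowCount 0 l = a) ∨ (l = r ∧ T.rowCount 0 l = b + e - a) ∨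
      (l = r + s ∧ T.rowCount 0 l = c - b) ∨
      (l ≠ 0 ∧ l ≠ r ∧ l ≠ r + s ∧ T.rowCount 0 l = 0) := by
  by_cases e1 : l = 0
  · refine Or.inl ⟨e1, ?_⟩
    rw [rowCount_of_interval (x := 0) (y := a) hm.zero (by omega) fun j hj => by rw [t0 j hj]; omega]
    omega
  by_cases e2 : l = r
  · exact Or.inr (Or.inl ⟨e2, rowCount_of_interval hm.zero (by omega) fun j hj => by
      rw [t0 j hj]; omega⟩)
  by_cases e3 : l = r + s
  · exact Or.inr (Or.inr (Or.inl ⟨e3, rowCount_of_interval hm.zero le_rfl fun j hj => by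
      rw [t0 j hj]; omega⟩))
  · refine Or.inr (Or.inr (Or.inr ⟨e1, e2, e3, rowCount_eq_zero_of_forall fun j hj => ?_⟩))
    have hj' := T.lt_rowLen hj
    rw [hm.zero] at hj'
    have := (t0 j hj' l).1 hj
    omega

end letters

theorem rowCount_one_of_letters {b x u v : ℕ} (hm : TwoRows mu c) (hr : 2 ≤ r) (hs : 2 ≤ s)
    (hbc : b ≤ c) (hx : x ≤ u) (hv : u + v ≤ b)
    (t1 : ∀ j < c, ∀ l, l ∈ T.entry 1 j ↔ (l = 1 ∧ j < x) ∨ (l = r ∧ x ≤ j ∧ j < u) ∨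
      (l = r + 1 ∧ u ≤ j ∧ j < u + v) ∨ (l = r + s ∧ u + v ≤ j ∧ j < b) ∨
      (l = r + s + 1 ∧ b ≤ j)) (l : ℕ) :
    (l = 1 ∧ T.rowCount 1 l = x) ∨ (l = r ∧ T.rowCount 1 l = u - x) ∨
      (l = r + 1 ∧ T.rowCount 1 l = v) ∨ (l = r + s ∧ T.rowCount 1 l = b - u - v) ∨
      (l = r + s + 1 ∧ T.rowCount 1 l = c - b) ∨
      (l ≠ 1 ∧ l ≠ r ∧ l ≠ r + 1 ∧ l ≠ r + s ∧ l ≠ r + s + 1 ∧ T.rowCount 1 l = 0) := by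
  by_cases e1 : l = 1
  · refine Or.inl ⟨e1, ?_⟩
    rw [rowCount_of_interval (x := 0) (y := x) hm.one (by omega) fun j hj => by rw [t1 j hj]; omega]
    omega
  by_cases e2 : l = r
  · exact Or.inr (Or.inl ⟨e2, rowCount_of_interval hm.one (by omega) fun j hj => by
      rw [t1 j hj]; omega⟩)
  by_cases e3 : l = r + 1
  · refine Or.inr (Or.inr (Or.inl ⟨e3, ?_⟩))
    rw [rowCount_of_interval (x := u) (y := u + v) hm.one (by omega) fun j hj => by
      rw [t1 j hj]; omega]
    omega
  by_cases e4 : l = r + s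
  · refine Or.inr (Or.inr (Or.inr (Or.inl ⟨e4, ?_⟩)))
    rw [rowCount_of_interval (x := u + v) (y := b) hm.one (by omega) fun j hj => by
      rw [t1 j hj]; omega]
    omega
  by_cases e5 : l = r + s + 1
  · exact Or.inr (Or.inr (Or.inr (Or.inr (Or.inl ⟨e5, rowCount_of_interval hm.one le_rfl
      fun j hj => by rw [t1 j hj]; omega⟩))))
  · refine Or.inr (Or.inr (Or.inr (Or.inr (Or.inr ⟨e1, e2, e3, e4, e5,
      rowCount_eq_zero_of_forall fun j hj => ?_⟩))))
    have hj' := T.lt_rowLen hj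
    rw [hm.one] at hj'
    have := (t1 j hj' l).1 hj
    omega

/-- Sufficiency: a second row with blocks of letters `1`, `r`, `r + 1`, `r + s`, `r + s + 1`, in
which the smaller letters are used as often as their capacities permit. -/
theorem exists_of_extendable (hl : TwoBlocks lam A B r s) (hm : TwoRows mu c) (hr : 2 ≤ r)
    (hs : 2 ≤ s) (hκ : ∀ l, lam.rowLen l ≤ κ.rowLen l) {a b e : ℕ} (ha : a + A ≤ κ.rowLen 0)
    (he : e ≤ 1) (h : Extendable (min (A - B) (κ.rowLen r - B)) (min B (κ.rowLen (r + s)))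
      (κ.rowLen 1 - A) (κ.rowLen (r + 1) - B) (κ.rowLen (r + s + 1)) c a b e) :
    ∃ T ∈ below lam mu κ, T.low r 0 = a ∧ T.low (r + s) 0 = b ∧ T.doubleBit r (r + s) = e := by
  have hB : lam.rowLen r = B := hl.second r le_rfl (by omega)
  have hB1 : lam.rowLen (r + 1) = B := hl.second _ (by omega) (by omega)
  have hA0 : lam.rowLen 0 = A := hl.first _ (by omega)
  have hA1 : lam.rowLen 1 = A := hl.first _ (by omega)
  have hAB : B ≤ A := hB ▸ hA0 ▸ lam.rowLen_anti 0 r (by omega)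
  have k1 := hκ r
  have k2 := hκ 1
  have k3 := hκ (r + 1)
  rw [hB] at k1
  rw [hA1] at k2
  rw [hB1] at k3
  unfold Extendable at h
  have hab := h.1
  have hbc := h.2.1
  obtain ⟨x, u, v, h1, h2, h3, h4, h5, h6, h7, h8, h9, h10, h11⟩ : ∃ x u v, x ≤ u ∧ u ≤ a ∧
      x + A ≤ κ.rowLen 1 ∧ u - x + (b + e - a) + B ≤ A ∧ u - x + (b + e - a) + B ≤ κ.rowLen r ∧
      v ≤ b + e - a ∧ v + B ≤ κ.rowLen (r + 1) ∧ u + v ≤ b ∧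
      (b - u - v) + (c - b) ≤ B ∧ (b - u - v) + (c - b) ≤ κ.rowLen (r + s) ∧ x ≤ a := by
    -- The letters `1` and `r` extend as far as the first `a` columns and their capacities allow;
    -- then the same for `r + 1`. The inequalities of `Extendable` ensure that the rest fits into
    -- the capacity of `r + s`.
    set u := min b (min a (min a (κ.rowLen 1 - A) +
      (min (A - B) (κ.rowLen r - B) - (b + e - a)))) with hu
    set v := min (b - u) (min (b + e - a) (κ.rowLen (r + 1) - B)) with hv
    refine ⟨min u (min a (κ.rowLen 1 - A)), u, v, ?_⟩
    refine ⟨by omega, by omega, by omega, by omega, by omega, by omega, by omega, by omega,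
      by omega, by omega, by omega⟩
  have hK₃ := h.2.2.2.2.1
  clear h
  obtain ⟨T, t0, t1⟩ := exists_of_letters_two hm hr hs hab he h1 h2 h8
  have c0 := rowCount_zero_of_letters hm hr hs hab hbc t0
  have c1 := rowCount_one_of_letters hm hr hs (by omega) h1 h8 t1
  refine ⟨T, ?_, low_of_letters hm hr hs hab hbc t0, low_top_of_letters hm hr hs hbc t0,
    doubleBit_of_letters hm hr hs hab hbc t0 he⟩
  rw [mem_below_iff_row hm.colLen]
  refine ⟨fun p hp l => ?_, fun l => ⟨?_, ?_⟩⟩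
  · obtain rfl : p = 0 := by omega
    rw [upper_one', T.upper_zero]
    have d1 := c0 (l + 1)
    have d2 := hl.rowLen l
    have d3 := hl.rowLen (l + 1)
    omega
  · rw [upper_one']
    have d0 := hκ l
    have d1 := hl.rowLen l
    rcases c1 l with ⟨rfl, d2⟩ | ⟨rfl, d2⟩ | ⟨rfl, d2⟩ | ⟨rfl, d2⟩ | ⟨rfl, d2⟩ | ⟨n1, n2, n3, n4, n5, d2⟩
    · have d3 := c0 1
      omega
    · have d3 := c0 l
      omega
    · have d3 := c0 (r + 1)
      omega
    · have d3 := c0 (r + s)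
      omega
    · have d3 := c0 (r + s + 1)
      omega
    · rcases c0 l with ⟨rfl, d3⟩ | d3
      · omega
      · omega
  · rw [upper_one', upper_one']
    have d1 := c0 l
    have d2 := c0 (l + 1)
    have d3 := c1 (l + 1)
    have d4 := hl.rowLen l
    have d5 := hl.rowLen (l + 1)
    rcases d3 with d3 | d3 | d3 | d3 | d3 | d3 <;> omega

end SetValuedTableau

namespace SetValuedTableau

open YoungDiagram Polynomial

variable {lam mu κ : YoungDiagram} {T T' : SetValuedTableau mu} {A B c r s a : ℕ}

theorem Agree.low {d : ℕ} (h : Agree d T T') {q : ℕ} (hq : q < d) (f : ℕ) :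
    T.low f q = T'.low f q := by
  simp only [SetValuedTableau.low, h q hq]

theorem Agree.doubleBit {d : ℕ} (h : Agree d T T') (hd : 0 < d) (r t : ℕ) :
    T.doubleBit r t = T'.doubleBit r t := by
  simp only [SetValuedTableau.doubleBit, h.low hd, h 0 hd]

/-- The inequalities without `b` carry over from the smaller value `a₀`; the others confine `b` from
below and `b + e` from above. -/
theorem extendable_iff {N M K₁ K₂ K₃ a₀ b₀ e₀ : ℕ} (h : Extendable N M K₁ K₂ K₃ c a₀ b₀ e₀)
    (ha : a₀ ≤ a) (b e : ℕ) : Extendable N M K₁ K₂ K₃ c a b e ↔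
      max a (max (c - M) (c - K₃)) ≤ b ∧ b + e ≤ min c (min (a + N) (a + min a K₁ + N + M + K₂ - c)) := by
  obtain ⟨-, -, -, -, -, h6, h7, -⟩ := h
  have hmin : min a₀ K₁ ≤ min a K₁ := min_le_min_right _ ha
  unfold Extendable
  generalize min a₀ K₁ = m₀ at h7 hmin
  generalize min a K₁ = m at hmin ⊢
  rw [max_le_iff, max_le_iff, le_min_iff, le_min_iff]
  constructor
  · rintro ⟨g1, g2, g3, g4, g5, g6, g7, g8⟩
    refine ⟨⟨g1, ?_, ?_⟩, g2, g3, ?_⟩ <;> omega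
  · rintro ⟨⟨g1, g2, g3⟩, g4, g5, g6⟩
    refine ⟨g1, g4, g5, ?_, ?_, ?_, ?_, ?_⟩ <;> omega

/-- Shows that the interval of possible values of `b` is not empty for the largest `a`. -/
theorem Extendable.le {N M K₁ K₂ K₃ a₀ b₀ e₀ : ℕ} (h : Extendable N M K₁ K₂ K₃ c a₀ b₀ e₀)
    (ha : a₀ ≤ a) (hac : a ≤ c) : Extendable N M K₁ K₂ K₃ c a (max a b₀) 0 := by
  obtain ⟨h1, h2, h3, h4, h5, h6, h7, h8⟩ := h
  have hmin : min a₀ K₁ ≤ min a K₁ := min_le_min_right _ ha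
  unfold Extendable
  generalize min a₀ K₁ = m₀ at h7 h8 hmin
  generalize min a K₁ = m at hmin ⊢
  rcases le_total a b₀ with g | g
  · rw [max_eq_right g]
    refine ⟨g, ?_, ?_, ?_, ?_, ?_, ?_, ?_⟩ <;> omega
  · rw [max_eq_left g]
    refine ⟨le_rfl, ?_, ?_, ?_, ?_, ?_, ?_, ?_⟩ <;> omega

section

variable (hl : TwoBlocks lam A B r s) (hm : TwoRows mu c) (hr : 2 ≤ r) (hs : 2 ≤ s)

theorem low_blockToggle_iff (hl : TwoBlocks lam A B r s) (hm : TwoRows mu c) (hr : 2 ≤ r)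
    (hT : T ∈ below lam mu κ) :
    BlockToggle κ A r 1 T = ∅ ↔ T.low r 0 = min c (κ.rowLen 0 - A) := by
  rw [blockToggle_eq_empty_iff hl.first hT, ← hm.zero]
  constructor
  · exact fun h => h 0 (by omega) one_pos
  · intro h p _ hp
    obtain rfl : p = 0 := by omega
    exact h

theorem mem_row_zero_bot (hl : TwoBlocks lam A B r s) (hm : TwoRows mu c) (hr : 2 ≤ r)
    (hT : T ∈ below lam mu κ) (ha : T.low r 0 = min c (κ.rowLen 0 - A)) {j : ℕ} :
    0 ∈ T.entry 0 j ↔ j < T.low r 0 := by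
  constructor
  · exact lt_low_of_mem hl.first hT (by omega) (by rwa [hm.zero])
  · intro h
    rw [mem_of_lt_low' (fun q c l h h' => (mem_below.1 hT).1.eq_row hl.first h h') h]
    exact mem_singleton_self 0

include hl hm hr hs

theorem agree_one_of (hT : T ∈ below lam mu κ) (hT' : T' ∈ below lam mu κ)
    (ha : T.low r 0 = min c (κ.rowLen 0 - A)) (ha' : T'.low r 0 = min c (κ.rowLen 0 - A))
    (hb : T.low (r + s) 0 = T'.low (r + s) 0)
    (he : T.doubleBit r (r + s) = T'.doubleBit r (r + s)) : Agree 1 T T' := by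
  have key : ∀ T ∈ below lam mu κ, ∀ T' ∈ below lam mu κ, T.low r 0 = min c (κ.rowLen 0 - A) →
      T'.low r 0 = min c (κ.rowLen 0 - A) → T.low (r + s) 0 = T'.low (r + s) 0 →
      T.doubleBit r (r + s) = T'.doubleBit r (r + s) → ∀ j, T.entry 0 j ⊆ T'.entry 0 j := by
    intro T hT T' hT' ha ha' hb he j l h
    have hj := T.lt_rowLen h
    rw [hm.zero] at hj
    rcases letter_row_zero hl hs hT h with rfl | rfl | rfl
    · rw [mem_row_zero_bot hl hm hr hT ha] at h
      rw [mem_row_zero_bot hl hm hr hT' ha']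
      omega
    · rw [mem_row_zero_mid hl hm hr hs hT] at h
      rw [mem_row_zero_mid hl hm hr hs hT']
      omega
    · rw [mem_row_zero_top hl hm hr hs hT hj] at h
      rw [mem_row_zero_top hl hm hr hs hT' hj]
      omega
  intro q hq j
  obtain rfl : q = 0 := by omega
  exact (key T hT T' hT' ha ha' hb he j).antisymm (key T' hT' T hT ha' ha hb.symm he.symm j)

theorem upperExtra_one (hT : T ∈ below lam mu κ) (ha : T.low r 0 = min c (κ.rowLen 0 - A)) :
    T.upperExtra 1 = T.doubleBit r (r + s) := by
  have h0 : T.rowCount 0 0 = T.low r 0 := by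
    have h1 := T.low_le r 0
    rw [hm.zero] at h1
    have := rowCount_of_interval (T := T) (x := 0) (y := T.low r 0) (l := 0) hm.zero h1
      fun j _ => by rw [mem_row_zero_bot hl hm hr hT ha]; omega
    omega
  have e1 := rowCount_zero_mid hl hm hr hs hT
  have e2 := rowCount_zero_top hl hm hr hs hT
  have h1 := add_doubleBit_le hm T r s
  have h2 := T.low_row_zero_le r s
  have h3 : ∑ j ∈ range (mu.rowLen 0), #(T.entry 0 j) =
      T.rowCount 0 0 + (T.rowCount 0 r + T.rowCount 0 (r + s)) := by
    have h4 : ∀ j, T.entry 0 j = {l ∈ ({0, r, r + s} : Finset ℕ) | l ∈ T.entry 0 j} := fun j => by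
      ext l
      rw [mem_filter, and_comm, iff_self_and]
      intro h
      simpa using letter_row_zero hl hs hT h
    rw [sum_congr rfl fun j _ => congrArg card (h4 j)]
    have := sum_card_bipartiteAbove_eq_sum_card_bipartiteBelow (s := range (mu.rowLen 0))
      (t := ({0, r, r + s} : Finset ℕ)) fun j l => l ∈ T.entry 0 j
    simp only [bipartiteAbove, bipartiteBelow] at this
    rw [this, sum_insert, sum_insert, sum_singleton]
    · rfl
    · simp; omega
    · simp; omega
  have h5 := sum_card_sub_one (v := T.entry 0) fun j hj => T.entry_nonempty hj
  have h6 : T.upperExtra 1 = ∑ j ∈ range (mu.rowLen 0), (#(T.entry 0 j) - 1) := by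
    rw [upperExtra, sum_range_one]
  rw [hm.zero] at *
  omega

/-- Toggling `0` in the first row leaves the tableaux with the largest possible `a`. Their first row
is determined by `b` and the bit `e`, and those with the same first row cancel up to X^e. The
admissible pairs are given by `L ≤ b` and `b + e ≤ U`, so the pairs with `e = 1` cancel all pairs
with `e = 0` but one. -/
theorem cancels_two_rows : Cancels lam mu := by
  classical
  rintro κ ⟨T₁, hT₁⟩
  have hκ : ∀ l, lam.rowLen l ≤ κ.rowLen l := fun l => by
    have := upper_le_of_mem_below hT₁ 0 l
    omega
  set a := min c (κ.rowLen 0 - A) with ha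
  set N := min (A - B) (κ.rowLen r - B)
  set M := min B (κ.rowLen (r + s))
  set K₁ := κ.rowLen 1 - A
  set K₂ := κ.rowLen (r + 1) - B
  set K₃ := κ.rowLen (r + s + 1)
  set L := max a (max (c - M) (c - K₃)) with hL
  set U := min c (min (a + N) (a + min a K₁ + N + M + K₂ - c)) with hU
  have hA : A ≤ κ.rowLen 0 := by
    have := hκ 0
    rwa [hl.first 0 (by omega)] at this
  have hfeas := extendable_of_mem_below hl hm hr hs hT₁
  have haa : T₁.low r 0 ≤ a := by
    have h1 := T₁.low_le r 0
    have h2 := low_le_rowCount (T := T₁) (f := r)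
      (fun q c l h h' => (mem_below.1 hT₁).1.eq_row hl.first h h') 0
    have h3 := upper_le_of_mem_below hT₁ 1 0
    rw [upper_one', hl.first 0 (by omega)] at h3
    rw [hm.zero] at h1
    exact le_min h1 (by clear hL hU; omega)
  have hac : a + A ≤ κ.rowLen 0 := by
    have : a ≤ κ.rowLen 0 - A := min_le_right _ _
    clear hL hU
    omega
  have hext : ∀ b e, Extendable N M K₁ K₂ K₃ c a b e ↔ L ≤ b ∧ b + e ≤ U :=
    extendable_iff hfeas haa
  have hLU : L ≤ U := by
    obtain ⟨h1, h2⟩ := (hext _ _).1 (hfeas.le haa (min_le_left _ _))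
    exact h1.trans h2
  clear_value L U a
  clear hL hU
  set Y : Finset (SetValuedTableau mu) := {T ∈ below lam mu κ | BlockToggle κ A r 1 T = ∅} with hY
  have hYm : ∀ T, T ∈ Y ↔ T ∈ below lam mu κ ∧ T.low r 0 = a := fun T => by
    rw [hY, mem_filter, and_congr_right_iff]
    exact fun h => (low_blockToggle_iff hl hm hr h).trans (by rw [← ha])
  set g : SetValuedTableau mu → ℕ × ℕ := fun T => (T.low (r + s) 0, T.doubleBit r (r + s)) with hg
  set S : Finset (ℕ × ℕ) := Icc L U ×ˢ {0} ∪ Ico L U ×ˢ {1} with hS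
  have hSm : ∀ b e, (b, e) ∈ S ↔ e ≤ 1 ∧ L ≤ b ∧ b + e ≤ U := fun b e => by
    simp only [hS, mem_union, mem_product, mem_Icc, mem_Ico, mem_singleton]
    omega
  have hmaps : ∀ T ∈ Y, g T ∈ S := fun T hT => by
    obtain ⟨h1, h2⟩ := (hYm T).1 hT
    have he := T.doubleBit_le r (r + s)
    have h3 := extendable_of_mem_below hl hm hr hs h1
    rw [h2] at h3
    exact (hSm _ _).2 ⟨he, (hext _ _).1 h3⟩
  have hfib : ∀ p ∈ S, ∃ Q : ℕ[X],
      ∑ T ∈ Y with g T = p, (X : ℕ[X]) ^ (T.size - mu.card) = X ^ p.2 + (1 + X) * Q := by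
    rintro ⟨b, e⟩ hp
    obtain ⟨he, hp⟩ := (hSm _ _).1 hp
    obtain ⟨T₀, hT₀, h1, h2, h3⟩ := exists_of_extendable hl hm hr hs hκ hac he
      ((hext b e).2 hp)
    obtain ⟨Q, hQ⟩ := sum_agree_row (d := 1) hm.colLen hT₀
    refine ⟨Q, ?_⟩
    rw [upperExtra_one hl hm hr hs hT₀ (h1.trans ha), h3] at hQ
    rw [← hQ]
    refine sum_congr ?_ fun _ _ => rfl
    ext T
    rw [mem_filter, hYm, mem_filter, hg, Prod.mk.injEq]
    constructor
    · rintro ⟨⟨h4, h5⟩, h6, h7⟩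
      exact ⟨h4, agree_one_of hl hm hr hs h4 hT₀ (h5.trans ha) (h1.trans ha) (h6.trans h2.symm)
        (h7.trans h3.symm)⟩
    · rintro ⟨h4, h5⟩
      exact ⟨⟨h4, (h5.low one_pos r).trans h1⟩, (h5.low one_pos _).trans h2,
        (h5.doubleBit one_pos _ _).trans h3⟩
  choose! Q hQ using hfib
  obtain ⟨Q₀, hQ₀⟩ := exists_blockToggle_sum (mu := mu) hl.first κ 1
  -- There are `U - L + 1` pairs with `e = 0` and `U - L` pairs with `e = 1`.
  have hsum : ∑ p ∈ S, (X : ℕ[X]) ^ p.2 = 1 + (1 + X) * ((U - L : ℕ) : ℕ[X]) := by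
    rw [hS, sum_union, sum_product, sum_product]
    · simp only [sum_singleton, pow_zero, pow_one, sum_const, Nat.card_Icc, Nat.card_Ico, nsmul_eq_mul]
      rw [Nat.succ_sub hLU]
      push_cast
      ring
    · rw [disjoint_left]
      rintro ⟨b, e⟩ h1 h2
      have h1 := mem_singleton.1 (mem_product.1 h1).2
      have h2 := mem_singleton.1 (mem_product.1 h2).2
      omega
  refine ⟨((U - L : ℕ) : ℕ[X]) + ∑ p ∈ S, Q p + Q₀, ?_⟩
  rw [hQ₀, ← hY, ← sum_fiberwise_of_maps_to hmaps, sum_congr rfl hQ, sum_add_distrib, hsum,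
    ← mul_sum]
  ring

end

end SetValuedTableau

/-! ### Shapes with at most two part sizes and Stembridge's list. -/

namespace YoungDiagram

open SetValuedTableau

variable {lam mu : YoungDiagram} {b r c s e f : ℕ}

/-- `mu` has rows of length `b` up to row `r`, and then rows of length `c` up to row `r + s`. -/
def IsHook (mu : YoungDiagram) (b r c s : ℕ) : Prop :=
  ∀ i j, (i, j) ∈ mu ↔ (i < r ∧ j < b) ∨ (i < r + s ∧ j < c)

theorem IsRect.transpose (h : mu.IsRect r c) : mu.transpose.IsRect c r := fun i j => by
  rw [mem_transpose, Prod.swap_prod_mk, h, and_comm]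

theorem IsHook.transpose (h : mu.IsHook b r c s) (hcb : c ≤ b) :
    mu.transpose.IsHook (r + s) c r (b - c) := fun i j => by
  rw [mem_transpose, Prod.swap_prod_mk, h]
  omega

theorem IsRect.isHook (h : mu.IsRect r c) : mu.IsHook c r 0 0 := fun i j => by
  rw [h]
  omega

theorem IsHook.rowLen_first (h : mu.IsHook b r c s) (hcb : c ≤ b) {i : ℕ} (hi : i < r) :
    mu.rowLen i = b :=
  rowLen_eq_of_mem_iff fun j => by rw [h]; omega

theorem IsHook.rowLen_second (h : mu.IsHook b r c s) {i : ℕ} (hi : r ≤ i) (hi' : i < r + s) :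
    mu.rowLen i = c :=
  rowLen_eq_of_mem_iff fun j => by rw [h]; omega

theorem IsHook.rowLen_third (h : mu.IsHook b r c s) {i : ℕ} (hi : r + s ≤ i) :
    mu.rowLen i = 0 :=
  rowLen_eq_of_mem_iff fun j => by rw [h]; omega

theorem IsHook.colLen_le (h : mu.IsHook b r c s) : mu.colLen 0 ≤ r + s := by
  by_contra hc
  have := mem_iff_lt_colLen.2 (not_le.1 hc)
  rw [h] at this
  omega

theorem cancels_of_colLen_le (h : lam.colLen 0 ≤ 1) : Cancels lam mu := (cancels_row mu h).comm

theorem IsHook.cancels_row (h : mu.IsHook b r c s) (hcb : c ≤ b) (hs : s ≤ 1)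
    (hl : lam.IsRect f e) : Cancels lam mu := by
  rcases Nat.eq_zero_or_pos f with rfl | hf
  · exact cancels_of_colLen_le (hl.isHook.colLen_le.trans (by omega))
  · exact cancels_rect_row hf (fun l h => hl.isHook.rowLen_first (Nat.zero_le _) h)
      (fun l h => hl.isHook.rowLen_third h) (fun q h' => h.rowLen_first hcb h')
      (h.colLen_le.trans (by omega))

theorem IsHook.cancels_col (h : mu.IsHook b r c s) (hcb : c ≤ b) (hc : c ≤ 1)
    (hl : lam.IsRect f e) : Cancels lam mu := by
  rcases Nat.eq_zero_or_pos f with rfl | hf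
  · exact cancels_of_colLen_le (hl.isHook.colLen_le.trans (by omega))
  · refine cancels_rect_col hf (fun l h => hl.isHook.rowLen_first (Nat.zero_le _) h)
      (fun l h => hl.isHook.rowLen_third h) (fun q h' => h.rowLen_first hcb h') ?_
    rcases Nat.eq_zero_or_pos s with rfl | hs
    · rw [h.rowLen_third (i := r) le_rfl]
      omega
    · rwa [h.rowLen_second le_rfl (by omega)]

/-- Transposition exchanges `r` with `c` and `s` with `b - c`, so two of the four cases reduce to a
single short row or to rows of length at most one. -/
theorem IsHook.cancels (h : mu.IsHook b r c s) (hcb : c ≤ b)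
    (hthin : r ≤ 1 ∨ s ≤ 1 ∨ c ≤ 1 ∨ b - c ≤ 1) (hl : lam.IsRect f e) : Cancels lam mu := by
  rcases hthin with h' | h' | h' | h'
  · exact ((h.transpose hcb).cancels_col (by omega) h' hl.transpose).of_transpose
  · exact h.cancels_row hcb h' hl
  · exact h.cancels_col hcb h' hl
  · exact ((h.transpose hcb).cancels_row (by omega) h' hl.transpose).of_transpose

/-- If both blocks of rows have height at least two, this is the case of two equal rows with the
roles of the partitions exchanged; otherwise the hook is thin. -/
theorem IsHook.cancels_two (h : mu.IsHook b r c s) (hcb : c ≤ b) (hl : lam.IsRect 2 e) :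
    Cancels lam mu := by
  by_cases hthin : r ≤ 1 ∨ s ≤ 1
  · exact h.cancels hcb (by omega) hl
  · push Not at hthin
    refine (cancels_two_rows (mu := lam) (c := e)
      ⟨fun l h' => h.rowLen_first hcb h', fun l h' h'' => h.rowLen_second h' h'',
        fun l h' => h.rowLen_third h'⟩
      ⟨hl.isHook.rowLen_first (Nat.zero_le _) two_pos,
        hl.isHook.rowLen_first (Nat.zero_le _) one_lt_two, hl.isHook.colLen_le⟩
      hthin.1 hthin.2).comm

/-- If both blocks have at least two rows, deleting one row keeps the inner corner: the top right
and the bottom left corner cells remain in the shape while the opposite corner of their rectangle is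
missing. -/
theorem IsHook.thin_of_removeRow (h : mu.IsHook b r c s) (hc : 0 < c) (hcb : c < b) {q : ℕ}
    (hq : (mu.removeRow q).IsRectangle) : r ≤ 1 ∨ s ≤ 1 := by
  obtain ⟨x, y, hxy⟩ := hq
  by_contra! hthin
  have h1 := hxy 0 (b - 1)
  have h2 := hxy (r + s - 2) (c - 1)
  have h3 := hxy (r + s - 2) (b - 1)
  rw [mem_removeRow, h] at h1 h2 h3
  unfold skipIndex at h1 h2 h3
  split_ifs at h1 h2 h3 <;> omega

theorem IsHook.thin_of_removeCol (h : mu.IsHook b r c s) (hr : 0 < r) (hs : 0 < s) {q : ℕ}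
    (hq : (mu.removeCol q).IsRectangle) : c ≤ 1 ∨ b - c ≤ 1 := by
  obtain ⟨x, y, hxy⟩ := hq
  by_contra! hthin
  have h1 := hxy (r + s - 1) 0
  have h2 := hxy 0 (b - 2)
  have h3 := hxy (r + s - 1) (b - 2)
  rw [mem_removeCol, h] at h1 h2 h3
  unfold skipIndex at h1 h2 h3
  split_ifs at h1 h2 h3 <;> omega

theorem cancels_of_isStembridgeOrdered (h : IsStembridgeOrdered lam mu) : Cancels lam mu := by
  rcases h with ⟨⟨f, e, hl⟩, r, c, hm⟩ | ⟨a, hm | hm⟩ | ⟨⟨f, e, hl⟩, hf, q, hq⟩ |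
    ⟨⟨a, hl⟩, b, r, c, s, -, hcb, -, -, hm⟩
  · exact hm.isHook.cancels (Nat.zero_le _) (by omega) hl
  · exact SetValuedTableau.cancels_row lam hm.isHook.colLen_le
  · exact (SetValuedTableau.cancels_row _ hm.transpose.isHook.colLen_le).of_transpose
  · obtain ⟨b, r, c, s, hc, hcb, hr, hs, hm⟩ := hf
    have hm : mu.IsHook b r c s := hm
    refine hm.cancels hcb.le ?_ hl
    rcases hq with hq | hq
    · have := hm.thin_of_removeRow hc hcb hq
      tauto
    · have := hm.thin_of_removeCol hr hs hq
      tauto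
  · have hm : mu.IsHook b r c s := hm
    rcases hl with hl | hl
    · exact hm.cancels_two hcb.le hl
    · exact ((hm.transpose hcb.le).cancels_two (by omega) hl.transpose).of_transpose

theorem cancels_of_isStembridge (h : IsStembridge lam mu) : Cancels lam mu :=
  h.elim cancels_of_isStembridgeOrdered fun h => (cancels_of_isStembridgeOrdered h).comm

end YoungDiagram

/-! ### Sequences of vector spaces given by partial matchings of bases -/

section

variable {J : ℕ → Type} (φ : ∀ i, J i → Option (J (i + 1)))

/-- The linear maps which send a basis vector to its partner, or to `0` if it has no partner. -/
noncomputable def matchingMap (i : ℕ) : (J i →₀ ℂ) →ₗ[ℂ] (J (i + 1) →₀ ℂ) :=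
  Finsupp.linearCombination ℂ fun t => (φ i t).elim 0 fun u => Finsupp.single u 1

/-- Every basis vector is matched to exactly one basis vector, in the next or the previous term. -/
structure IsPerfectMatching : Prop where
  inj : ∀ {i t t' u}, φ i t = some u → φ i t' = some u → t = t'
  none_of_some : ∀ {i t u}, φ i t = some u → φ (i + 1) u = none
  zero : ∀ t, φ 0 t ≠ none
  exists_of_none : ∀ {i u}, φ (i + 1) u = none → ∃ t, φ i t = some u

variable {φ}

theorem matchingMap_single_some {i : ℕ} {t : J i} {u : J (i + 1)} (h : φ i t = some u) :
    matchingMap φ i (Finsupp.single t 1) = Finsupp.single u 1 := by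
  rw [matchingMap, Finsupp.linearCombination_single, one_smul, h, Option.elim_some]

theorem matchingMap_single_none {i : ℕ} {t : J i} (h : φ i t = none) :
    matchingMap φ i (Finsupp.single t 1) = 0 := by
  rw [matchingMap, Finsupp.linearCombination_single, one_smul, h, Option.elim_none]

theorem matchingMap_apply (hφ : IsPerfectMatching φ) {i : ℕ} {t : J i} {u : J (i + 1)}
    (h : φ i t = some u) (x : J i →₀ ℂ) : matchingMap φ i x u = x t := by
  have : Finsupp.lapply u ∘ₗ matchingMap φ i = Finsupp.lapply (R := ℂ) (M := ℂ) t := by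
    refine Finsupp.lhom_ext' fun t' => LinearMap.ext_ring ?_
    change matchingMap φ i (Finsupp.single t' 1) u = Finsupp.single t' (1 : ℂ) t
    rcases h' : φ i t' with _ | u'
    · rw [matchingMap_single_none h', Finsupp.single_eq_of_ne, Finsupp.zero_apply]
      rintro rfl
      rw [h] at h'
      cases h'
    · rw [matchingMap_single_some h']
      by_cases htt : t = t'
      · subst htt
        rw [h] at h'
        cases h'
        rw [Finsupp.single_eq_same, Finsupp.single_eq_same]
      · rw [Finsupp.single_eq_of_ne htt, Finsupp.single_eq_of_ne]
        rintro rfl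
        exact htt (hφ.inj h h')
  exact LinearMap.congr_fun this x

theorem matchingMap_matchingMap (hφ : IsPerfectMatching φ) (i : ℕ) (x : J i →₀ ℂ) :
    matchingMap φ (i + 1) (matchingMap φ i x) = 0 := by
  have : matchingMap φ (i + 1) ∘ₗ matchingMap φ i = 0 := by
    refine Finsupp.lhom_ext' fun t => LinearMap.ext_ring ?_
    change matchingMap φ (i + 1) (matchingMap φ i (Finsupp.single t 1)) = 0
    rcases h : φ i t with _ | u
    · rw [matchingMap_single_none h, map_zero]
    · rw [matchingMap_single_some h, matchingMap_single_none (hφ.none_of_some h)]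
  exact LinearMap.congr_fun this x

/-- Coefficients of matched basis vectors reappear at their partners, so a vector in the kernel only
involves basis vectors without partner in the next term. Each of these is the image of its partner
in the previous term. As `P` contains both members or none of each pair, everything restricts to the
subspaces. -/
theorem isExactSubsequence_matchingMap (hφ : IsPerfectMatching φ) {P : ∀ i, Set (J i)}
    (hP : ∀ i t u, φ i t = some u → (t ∈ P i ↔ u ∈ P (i + 1))) :
    IsExactSubsequence (matchingMap φ) fun i => Finsupp.supported ℂ ℂ (P i) := by
  have hmem : ∀ i, ∀ x ∈ Finsupp.supported ℂ ℂ (P i),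
      matchingMap φ i x ∈ Finsupp.supported ℂ ℂ (P (i + 1)) := by
    intro i x hx
    refine Submodule.sum_mem _ fun t ht => Submodule.smul_mem _ _ ?_
    rcases h : φ i t with _ | u
    · simp only [h, Option.elim_none]
      exact Submodule.zero_mem _
    · simp only [h, Option.elim_some]
      exact Finsupp.single_mem_supported ℂ 1 ((hP i t u h).1 (hx ht))
  refine ⟨hmem, fun x _ hx => Finsupp.ext fun t => ?_, fun i y hy => ⟨fun h => ?_, ?_⟩⟩
  · obtain ⟨u, hu⟩ := Option.ne_none_iff_exists'.1 (hφ.zero t)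
    rw [← matchingMap_apply hφ hu, hx]
    rfl
  · have hy' : y ∈ Finsupp.supported ℂ ℂ {u ∈ P (i + 1) | φ (i + 1) u = none} := by
      intro u hu
      refine ⟨hy hu, ?_⟩
      by_contra hne
      obtain ⟨v, hv⟩ := Option.ne_none_iff_exists'.1 hne
      have := matchingMap_apply hφ hv y
      rw [h] at this
      exact Finsupp.mem_support_iff.1 hu this.symm
    have hle : Finsupp.supported ℂ ℂ {u ∈ P (i + 1) | φ (i + 1) u = none} ≤
        (Finsupp.supported ℂ ℂ (P i)).map (matchingMap φ i) := by
      rw [Finsupp.supported_eq_span_single, Submodule.span_le]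
      rintro _ ⟨u, ⟨hu, hu'⟩, rfl⟩
      obtain ⟨t, ht⟩ := hφ.exists_of_none hu'
      exact ⟨_, Finsupp.single_mem_supported ℂ 1 ((hP i t u ht).2 hu), matchingMap_single_some ht⟩
    exact hle hy'
  · rintro ⟨x, -, rfl⟩
    exact matchingMap_matchingMap hφ i x

theorem isExactSubsequence_matchingMap_top (hφ : IsPerfectMatching φ) :
    IsExactSubsequence (matchingMap φ) fun _ => ⊤ := by
  simpa only [Finsupp.supported_univ] using
    isExactSubsequence_matchingMap hφ (P := fun _ => Set.univ) fun _ _ _ _ => Iff.rfl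

theorem supported_ne_bot_iff {α : Type*} {s : Set α} :
    Finsupp.supported ℂ ℂ s ≠ ⊥ ↔ s.Nonempty := by
  constructor
  · intro h
    rw [Set.nonempty_iff_ne_empty]
    rintro rfl
    exact h Finsupp.supported_empty
  · rintro ⟨t, ht⟩ h
    have := h ▸ Finsupp.single_mem_supported ℂ (1 : ℂ) ht
    rw [Submodule.mem_bot, Finsupp.single_eq_zero] at this
    exact one_ne_zero this

/-- The basis is decomposed by `col`, which is constant on matched pairs; the summands are spanned
by its classes. -/
theorem isDirectSumOfTwoTermExact_matchingMap (hφ : IsPerfectMatching φ) {ι : Type}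
    (col : ∀ i, J i → ι) (hcol : ∀ i t u, φ i t = some u → col i t = col (i + 1) u)
    (hι : ∀ a, {i | ∃ t, col i t = a}.ncard = 2) : IsDirectSumOfTwoTermExact (matchingMap φ) := by
  refine ⟨ι, fun a i => Finsupp.supported ℂ ℂ {t | col i t = a}, fun i => ⟨fun a => ?_, ?_⟩,
    fun a => ⟨isExactSubsequence_matchingMap hφ fun i t u h => ?_, ?_⟩⟩
  · refine Disjoint.mono_right (iSup₂_le fun b hb => Finsupp.supported_mono
      (t := {t | col i t ≠ a}) fun t ht h => hb (Eq.trans (Eq.symm ht) h)) ?_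
    exact Finsupp.disjoint_supported_supported (Set.disjoint_left.2 fun t ht ht' => ht' ht)
  · rw [← Finsupp.supported_iUnion, ← Finsupp.supported_univ]
    congr 1
    exact Set.eq_univ_of_forall fun t => Set.mem_iUnion.2 ⟨col i t, rfl⟩
  · rw [Set.mem_ofPred_eq, Set.mem_ofPred_eq, hcol i t u h]
  · simp only [supported_ne_bot_iff]
    exact hι a

end

/-! ### An involution from a polynomial identity -/

section

open Polynomial

theorem card_fiber_eq_coeff {α : Type*} [Fintype α] (d : α → ℕ) (k : ℕ) :
    Nat.card {a // d a = k} = (∑ a, (X : ℕ[X]) ^ d a).coeff k := by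
  classical
  rw [finsetSum_coeff, Nat.card_eq_fintype_card, Fintype.card_subtype, card_filter]
  refine sum_congr rfl fun a _ => ?_
  rw [coeff_X_pow]
  simp only [eq_comm]

/-- The right side is the generating polynomial of a model set: one point in degree 0 and, for each
unit of a coefficient of `Q`, a pair of points in adjacent degrees. Equal generating polynomials
give a bijection that keeps degrees, along which the exchange of the pairs is transported. It
matters that the coefficients of `Q` are natural numbers. -/
theorem exists_involution_of_sum_eq {α : Type*} [Fintype α] (d : α → ℕ) {Q : ℕ[X]}
    (h : ∑ a, (X : ℕ[X]) ^ d a = 1 + (1 + X) * Q) :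
    ∃ (I : α → α) (M : α), Function.Involutive I ∧ (∀ a, I a = a ↔ a = M) ∧ d M = 0 ∧
      ∀ a, a ≠ M → d (I a) = d a + 1 ∨ d a = d (I a) + 1 := by
  classical
  set N := Q.natDegree + 1
  set g : Option ((Σ n : Fin N, Fin (Q.coeff n)) × Bool) → ℕ := fun b =>
    b.elim 0 fun p => p.1.1 + p.2.toNat with hg
  have hsum : ∑ b, (X : ℕ[X]) ^ g b = 1 + (1 + X) * Q := by
    rw [Fintype.sum_option, Fintype.sum_prod_type]
    simp only [hg, Option.elim_none, Option.elim_some, Fintype.sum_bool, Fintype.sum_sigma,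
      sum_const, card_univ, Fintype.card_fin, pow_zero, Bool.toNat_true, Bool.toNat_false]
    rw [Fin.sum_univ_eq_sum_range fun n => Q.coeff n • ((X : ℕ[X]) ^ (n + 1) + X ^ (n + 0))]
    conv_rhs => rw [Q.as_sum_range_C_mul_X_pow, mul_sum]
    congr 1
    refine sum_congr rfl fun n _ => ?_
    rw [nsmul_eq_mul, ← C_eq_natCast]
    simp only [add_zero, Nat.cast_id]
    ring
  obtain ⟨F, hF⟩ := exists_equiv_of_fiber_card d g (Equiv.refl ℕ) fun k => by
    rw [Equiv.refl_apply, card_fiber_eq_coeff, card_fiber_eq_coeff, h, hsum]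
  have hd : ∀ b, d (F.symm b) = g b := fun b => by
    have := hF (F.symm b)
    rw [F.apply_symm_apply] at this
    exact this.symm
  set I' : Option ((Σ n : Fin N, Fin (Q.coeff n)) × Bool) → _ :=
    Option.map (Prod.map id not) with hI'
  refine ⟨fun a => F.symm (I' (F a)), F.symm none, fun a => ?_, fun a => ?_, hd none,
    fun a ha => ?_⟩
  · dsimp only
    rw [F.apply_symm_apply, F.symm_apply_eq]
    rcases F a with _ | ⟨p, b⟩
    · rfl
    · simp [hI']
  · rw [F.symm_apply_eq, F.eq_symm_apply]
    rcases F a with _ | ⟨p, b⟩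
    · simp [hI']
    · simp [hI']
  · dsimp only
    rw [Ne, F.eq_symm_apply] at ha
    rw [hd, show d a = g (F a) from (hF a).symm]
    generalize F a = x at ha
    rcases x with _ | ⟨p, b⟩
    · exact absurd rfl ha
    · cases b <;> simp [hI', hg]

end

/-! ### From the involution to the exact sequence of a quadruple. -/

namespace RichardsonQuadruple

open YoungDiagram SetValuedTableau Polynomial

variable {R : RichardsonQuadruple} {κ : YoungDiagram}

section

variable (I : R.Below κ → R.Below κ) (M : R.Below κ)

open Classical in
/-- The partial matching of the basis vectors given by an involution with a fixed point. -/
noncomputable def termMatching (hM : R.extra M.1 = 0) :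
    ∀ i, R.TermIndex κ i → Option (R.TermIndex κ (i + 1))
  | 0 => fun _ => some ⟨M, hM⟩
  | i + 1 => fun T => if h : R.extra (I T.1).1 = i + 1 then some ⟨I T.1, h⟩ else none

variable {I M} (hI : Function.Involutive I) (hfix : ∀ T, I T = T ↔ T = M)
  (hM : R.extra M.1 = 0)
  (hstep : ∀ T, T ≠ M → R.extra (I T).1 = R.extra T.1 + 1 ∨ R.extra T.1 = R.extra (I T).1 + 1)

theorem termMatching_succ_eq_some {i : ℕ} {T : R.TermIndex κ (i + 1)}
    {U : R.TermIndex κ (i + 2)} : termMatching I M hM (i + 1) T = some U ↔ U.1 = I T.1 := by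
  have hU := U.2
  rw [termMatching]
  dsimp only
  split_ifs with h
  · refine Option.some_inj.trans ⟨fun h => ?_, fun h => Subtype.ext h.symm⟩
    rw [← h]
  · refine iff_of_false (by simp) fun h' => h ?_
    rw [← h', hU]

theorem termMatching_succ_eq_none {i : ℕ} {T : R.TermIndex κ (i + 1)} :
    termMatching I M hM (i + 1) T = none ↔ R.extra (I T.1).1 ≠ i + 1 := by
  rw [termMatching]
  dsimp only
  split_ifs with h
  · exact iff_of_false (by simp) (not_not.2 h)
  · exact iff_of_true rfl h

include hI hfix hM hstep

theorem isPerfectMatching_termMatching : IsPerfectMatching (termMatching I M hM) where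
  inj {i t t' u} h h' := by
    rcases i with _ | i
    · rfl
    · rw [termMatching_succ_eq_some] at h h'
      exact Subtype.ext (hI.injective (h.symm.trans h'))
  none_of_some {i t u} h := by
    rw [termMatching_succ_eq_none]
    rcases i with _ | i
    · obtain rfl : (⟨M, hM⟩ : R.TermIndex κ 1) = u := Option.some_inj.1 h
      change R.extra (I M).1 ≠ 1
      rw [(hfix M).2 rfl, hM]
      exact zero_ne_one
    · rw [termMatching_succ_eq_some] at h
      rw [h, hI, t.2]
      omega
  zero t := by simp [termMatching]
  exists_of_none {i u} h := by
    rw [termMatching_succ_eq_none] at h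
    have hu := u.2
    by_cases huM : u.1 = M
    · rw [huM, hM] at hu
      subst hu
      exact ⟨(), congrArg some (Subtype.ext huM.symm)⟩
    · have h1 : R.extra u.1.1 = R.extra (I u.1).1 + 1 :=
        (hstep u.1 huM).resolve_left fun h' => h (by rw [h', hu])
      rcases i with _ | i
      · omega
      · exact ⟨⟨I u.1, by omega⟩, (termMatching_succ_eq_some hM).2 (hI u.1).symm⟩

theorem isDirectSumOfTwoTermExact_termMatching :
    IsDirectSumOfTwoTermExact (matchingMap (termMatching I M hM)) := by
  classical
  -- `L` selects the lower member of each pair, together with `M`, whose partner is the generator of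
  -- the initial term. These elements index the summands.
  set L : R.Below κ → Prop := fun T => T = M ∨ R.extra (I T).1 = R.extra T.1 + 1 with hL
  have hLI : ∀ T, ¬ L T → L (I T) := fun T hT => by
    simp only [hL, not_or] at hT ⊢
    right
    rw [hI]
    exact (hstep T hT.1).resolve_left hT.2
  have hLI' : ∀ T, T ≠ M → L T → ¬ L (I T) := fun T hT h h' => by
    have h1 := h.resolve_left hT
    rcases h' with h' | h'
    · rw [h', hM] at h1
      omega
    · rw [hI] at h'
      omega
  let low : R.Below κ → {T // L T} := fun T => if h : L T then ⟨T, h⟩ else ⟨I T, hLI T h⟩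
  have hlow : ∀ T, L T → (low T).1 = T := fun T h => by simp only [low, dif_pos h]
  have hlow' : ∀ T, ¬ L T → (low T).1 = I T := fun T h => by simp only [low, dif_neg h]
  have hLM : L M := Or.inl rfl
  let col : ∀ i, R.TermIndex κ i → {T // L T} := fun i =>
    match i with
    | 0 => fun _ => ⟨M, hLM⟩
    | _ + 1 => fun T => low T.1
  refine isDirectSumOfTwoTermExact_matchingMap (isPerfectMatching_termMatching hI hfix hM hstep)
    col ?_ ?_
  · intro i t u h
    rcases i with _ | i
    · obtain rfl : (⟨M, hM⟩ : R.TermIndex κ 1) = u := Option.some_inj.1 h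
      exact Subtype.ext (hlow M hLM).symm
    · rw [termMatching_succ_eq_some] at h
      have hu := u.2
      have ht := t.2
      have h1 : L t.1 := Or.inr (by rw [← h, hu, ht])
      have h2 : t.1 ≠ M := by
        intro h2
        rw [h, h2, (hfix M).2 rfl, hM] at hu
        omega
      refine Subtype.ext ?_
      change (low t.1).1 = (low u.1).1
      rw [h, hlow _ h1, hlow' _ (hLI' _ h2 h1), hI]
  · rintro ⟨T, hT⟩
    have key : ∀ k, (∃ t : R.TermIndex κ (k + 1), col (k + 1) t = ⟨T, hT⟩) ↔
        ∃ U, R.extra U.1 = k ∧ (low U).1 = T := fun k =>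
      ⟨fun ⟨t, ht⟩ => ⟨t.1, t.2, congrArg Subtype.val ht⟩,
        fun ⟨U, hU, h⟩ => ⟨⟨U, hU⟩, Subtype.ext h⟩⟩
    by_cases hTM : T = M
    · have : {i | ∃ t, col i t = ⟨T, hT⟩} = {0, 1} := by
        ext i
        rw [Set.mem_ofPred_eq, Set.mem_insert_iff, Set.mem_singleton_iff]
        rcases i with _ | k
        · exact iff_of_true ⟨(), Subtype.ext hTM.symm⟩ (Or.inl rfl)
        · rw [key]
          constructor
          · rintro ⟨U, hU, h⟩
            by_cases hLU : L U
            · rw [hlow U hLU] at h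
              rw [h, hTM, hM] at hU
              omega
            · rw [hlow' U hLU, hTM, ← (hfix M).2 rfl] at h
              exact absurd (Or.inl (hI.injective h)) hLU
          · intro h
            obtain rfl : k = 0 := by omega
            exact ⟨M, hM, (hlow M hLM).trans hTM.symm⟩
      rw [this, Set.ncard_pair zero_ne_one]
    · have h1 : R.extra (I T).1 = R.extra T.1 + 1 := hT.resolve_left hTM
      have : {i | ∃ t, col i t = ⟨T, hT⟩} = {R.extra T.1 + 1, R.extra T.1 + 2} := by
        ext i
        rw [Set.mem_ofPred_eq, Set.mem_insert_iff, Set.mem_singleton_iff]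
        rcases i with _ | k
        · refine iff_of_false ?_ (by omega)
          rintro ⟨t, ht⟩
          exact hTM (congrArg Subtype.val ht).symm
        · rw [key]
          constructor
          · rintro ⟨U, hU, h⟩
            by_cases hLU : L U
            · rw [hlow U hLU] at h
              subst h
              omega
            · rw [hlow' U hLU] at h
              subst h
              rw [hI] at h1
              omega
          · rintro (h | h)
            · exact ⟨T, by omega, hlow T hT⟩
            · exact ⟨I T, by omega, (hlow' _ (hLI' T hTM hT)).trans (hI T)⟩
      rw [this, Set.ncard_pair (by omega)]

theorem hasSequenceAt_of_involution : R.HasSequenceAt κ := by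
  classical
  have hφ := isPerfectMatching_termMatching hI hfix hM hstep
  refine ⟨I, M, matchingMap (termMatching I M hM), hI, hfix, hM, hstep, fun T' => ?_,
    fun i T T' => ?_, isExactSubsequence_matchingMap_top hφ,
    isDirectSumOfTwoTermExact_termMatching hI hfix hM hstep⟩
  · refine (DFunLike.congr_fun (matchingMap_single_some (φ := termMatching I M hM) (i := 0)
      (t := ()) (u := (⟨M, hM⟩ : R.TermIndex κ 1)) rfl) T').trans ?_
    refine Finsupp.single_apply.trans ?_
    exact if_congr ⟨fun h => by rw [← h], fun h => Subtype.ext h.symm⟩ rfl rfl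
  · split_ifs with h
    · rw [matchingMap_single_some ((termMatching_succ_eq_some hM).2 h), Finsupp.single_eq_same]
    · rcases h' : termMatching I M hM (i + 1) T with _ | U
      · rw [matchingMap_single_none h', Finsupp.zero_apply]
      · rw [matchingMap_single_some h', Finsupp.single_eq_of_ne]
        rintro rfl
        exact h ((termMatching_succ_eq_some hM).1 h')

end

/-- The fillings with content in `κ`, as a finite set of tableaux. -/
def belowEquiv (hκ : κ ∈ boxed R.rows R.cols) : R.Below κ ≃ below R.lam R.mu κ where
  toFun T := ⟨T.1.1, mem_below.2 ⟨R.isLattice T.1, fun l => by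
    have := T.2 l
    rwa [R.content_eq] at this⟩⟩
  invFun T := ⟨R.mkFilling T.1 (mem_below.1 T.2).1 fun i => by
      have h := (mem_below.1 T.2).2 i
      refine ⟨h.trans ((mem_boxed_iff.1 hκ).2 i), fun hi => ?_⟩
      rw [(mem_boxed_iff.1 hκ).1 i hi] at h
      exact Nat.le_zero.1 h, fun i => by
      rw [R.content_eq]
      exact (mem_below.1 T.2).2 i⟩
  left_inv _ := rfl
  right_inv _ := rfl

/-- The polynomial identity is available at the partition `κ'` that corresponds to `κ` in the other
quadruple; the bijection of fillings carries it back to `κ`. -/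
theorem DiagramIso.hasSequences {R' : RichardsonQuadruple} (h : R.DiagramIso R')
    (hc : Cancels R'.lam R'.mu) : R.HasSequences := by
  classical
  rintro κ hκ ⟨T₀⟩
  obtain ⟨F, -, hextra, hbelow⟩ := h
  obtain ⟨κ', hκ', hF⟩ := hbelow κ (mem_boxed.2 hκ) ⟨T₀.1, (R.diagram_le_iff).2 T₀.2⟩
  let e : R.Below κ ≃ below R'.lam R'.mu κ' := (F.subtypeEquiv fun T => by
    rw [← diagram_le_iff, ← diagram_le_iff, hF]).trans (R'.belowEquiv hκ')
  have he : ∀ T, (e T).1.size - R'.mu.card = R.extra T.1 := fun T => hextra T.1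
  let _ : Fintype (R.Below κ) := Fintype.ofEquiv _ e.symm
  obtain ⟨Q, hQ⟩ := hc κ' ⟨_, (e T₀).2⟩
  have hsum : ∑ T : R.Below κ, (X : ℕ[X]) ^ R.extra T.1 = 1 + (1 + X) * Q := by
    rw [← hQ, belowPoly, ← sum_coe_sort (below R'.lam R'.mu κ')]
    exact Fintype.sum_equiv e _ (fun T => X ^ (T.1.size - R'.mu.card)) fun T => by rw [he]
  obtain ⟨I, M, hI, hfix, hM, hstep⟩ := exists_involution_of_sum_eq _ hsum
  exact hasSequenceAt_of_involution hI hfix hM hstep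

end RichardsonQuadruple

end

theorem mainTheorem4 (R : RichardsonQuadruple) :
    (∀ (c : ℕ) (hc : R.FullCol c), (R.demolishCol c hc).PosetIso R) ∧
    (∀ (r : ℕ) (hr : R.FullRow r), (R.demolishRow r hr).PosetIso R) ∧
    (∀ R' : RichardsonQuadruple, R.IsBasicDemolition R' → R'.PosetIso R) ∧
    (∀ R' : RichardsonQuadruple, R.IsBasicDemolition R' →
      YoungDiagram.IsStembridge R'.lam R'.mu → R.HasSequences) := by
  refine ⟨fun c hc => (RichardsonQuadruple.diagramIso_demolishCol hc).posetIso,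
    fun r hr => (RichardsonQuadruple.diagramIso_demolishRow hr).posetIso,
    fun R' h => (RichardsonQuadruple.diagramIso_of_isBasicDemolition h).posetIso,
    fun R' h hS => (RichardsonQuadruple.diagramIso_of_isBasicDemolition h).hasSequences
      (YoungDiagram.cancels_of_isStembridge hS)⟩
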